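/- **Setup.** For $t>1$ write $r_i=\log|w_i|/\log t$, $\theta_i=\arg w_i$ on $(\mathbb C^*)^2$, and let $m_0,\dots,m_4$ be the monomials $1,\ t^{-1}w_1,\ t^{-1}w_2,\ t^{-1}w_1^{-1},\ t^{-1}w_2^{-1}$ of $h_t=1+t^{-1}(w_1+w_2+w_1^{-1}+w_2^{-1})$. Fix smooth functions $\kappa,\psi:\mathbb R\to[0,1]$ equal to $1$ on $(-\infty,1]$ and to $0$ on $[2,\infty)$, and constants $0<\eta,\delta\le\frac14$. Let $$h_{t,1}=\sum_i(1-\varphi_i)\,m_i,\qquad 1-\varphi_i=\prod_j\kappa\Big(\tfrac{2}{\eta}\,\tfrac{\log|m_j|-\log|m_i|}{\log t}\Big)$$ be the tropical localization of $h_t$ (each monomial is cut off where it is much smaller than another one), $Z_{t,1}=\{h_{t,1}=0\}$, and let $\chi=\psi\big(|h_{t,1}|^2/(\delta^2\sum_i|m_i|^2)\big)$, a cutoff function equal to $1$ near $Z_{t,1}$ and $0$ away from it. The conic bundle is $$X_t=\{(u,v,w)\in\mathbb C^2\times(\mathbb C^*)^2 : uv=h_{t,1}(w)\}.$$ For $\epsilon>0$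 it carries the one-form (with $\phi_u=\arg u$, $\phi_v=\arg v$) $$\theta_\epsilon=r_1d\theta_1+r_2d\theta_2+\tfrac{|u|^2}{2}d\phi_u+\epsilon\Big(\chi\tfrac{|v|^2}{1+|v|^2}\,d\phi_v-(1-\chi)\,d\phi_u\Big),\qquad \omega_\epsilon=d\theta_\epsilon,$$ and the moment map $\mu=\tfrac{|u|^2}{2}+\tfrac{\epsilon\chi}{1+|v|^2}$ of the circle action $(e^{i\alpha}u,e^{-i\alpha}v,w)$, which equals $\epsilon$ at the fixed points $u=v=0$. Let $\ell_1=\{|w_1|=1,\ \theta_2=\pi,\ |r_2|\le1\}$ and $\ell_2=\{|w_2|=1,\ \theta_1=\pi,\ |r_1|\le1\}$, annuli which meet in the single point $(-1,-1)$, and let $C_3\subset(\mathbb C^*)^2$ be the surface obtained from $\ell_1\cup\ell_2$ by a Polterovich surgery of size $R\le\frac14$ at this point: in the coordinates $a=(\theta_1-\pi,r_2)$, $b=(-r_1,\theta_2-\pi)$ the discs of radius $R$ of the planes $b=0$ and $a=0$ are replaced by $\{(a,b)=(p(s)\xi,\ \sigma q(s)\xi):\xi\in S^1,\ |s|<R\}$,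 where $\sigma\in\{1,-1\}$ and $s\mapsto(p(s),q(s))$ is a smooth embedded curve in the closed first quadrant minus the origin which equals $(s,0)$ for $s\ge R$ and $(0,-s)$ for $s\le-R$, and lies in the open disc of radius $R$ for $|s|<R$. Put $Q=\{x\in X_t:\ w(x)\in C_3,\ \mu(x)=\epsilon\}$. For $k\ge1$ let $X_t^{(k)}=\{uv=h_{t,1}(z_1^k,z_2)\}\subset\mathbb C^2\times(\mathbb C^*)^2$ be the $k$-fold cover of $X_t$ by $(u,v,z_1,z_2)\mapsto(u,v,z_1^k,z_2)$, with the pulled back one-form $\theta_\epsilon^{(k)}$, and let $Q^{(k)}$ be the preimage of $Q$. (So $X_t^{(1)}=X_t$ and $Q^{(1)}=Q$.) **Lemma.** There is $t_0>1$ such that for every $t\ge t_0$ there is $\epsilon_0>0$ such that for all $0<\epsilon<\epsilon_0$ and all $k\ge1$: $X_t^{(k)}$ is a smooth submanifold of real dimension $6$, $\theta^{(k)}_\epsilon$ is smooth on it and $d\theta_\epsilon^{(k)}$ is a symplectic form on it; and, for every choice of the surgery, $Q^{(k)}$ is the image of a smooth embedding $j$ of a manifold diffeomorphic to $\#_{2k+1}\,S^1\times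 S^2$ which is an exact Lagrangian embedding, i.e. $j^*d\theta^{(k)}_\epsilon=0$ and $j^*\theta^{(k)}_\epsilon=df$ for a smooth function $f$. In particular ($k=1$) $Q\cong\#_3\,S^1\times S^2$ is an exact Lagrangian in $X_t$, and every odd $n=2k+1\ge3$ occurs for a cover. -/

import Mathlib

open scoped Manifold ContDiff

noncomputable section

namespace ConicBundle

/-! ### Connected sums -/

/-- `M` is a connected sum of the `d`-manifolds `M₁` and `M₂`: there are embedded open discs
`e₁ : ℝᵈ → M₁`, `e₂ : ℝᵈ → M₂` such that `M` is the union of open copies (under `f₁`, `f₂`) of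
`M₁ ∖ {e₁ 0}` and `M₂ ∖ {e₂ 0}`, glued exactly along `e₁ v ∼ e₂ (v / ‖v‖²)` for `v ≠ 0`. -/
def IsConnectedSum {d : ℕ}
    {E₁ H₁ E₂ H₂ E H : Type} [NormedAddCommGroup E₁] [NormedSpace ℝ E₁] [TopologicalSpace H₁]
    [NormedAddCommGroup E₂] [NormedSpace ℝ E₂] [TopologicalSpace H₂]
    [NormedAddCommGroup E] [NormedSpace ℝ E] [TopologicalSpace H]
    (I₁ : ModelWithCorners ℝ E₁ H₁) (I₂ : ModelWithCorners ℝ E₂ H₂) (I : ModelWithCorners ℝ E H)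
    (M₁ : Type) [TopologicalSpace M₁] [ChartedSpace H₁ M₁]
    (M₂ : Type) [TopologicalSpace M₂] [ChartedSpace H₂ M₂]
    (M : Type) [TopologicalSpace M] [ChartedSpace H M] : Prop :=
  ∃ (e₁ : EuclideanSpace ℝ (Fin d) → M₁) (e₂ : EuclideanSpace ℝ (Fin d) → M₂)
    (f₁ : M₁ → M) (f₂ : M₂ → M),
    IsLocalDiffeomorph (𝓡 d) I₁ ∞ e₁ ∧ Function.Injective e₁ ∧
    IsLocalDiffeomorph (𝓡 d) I₂ ∞ e₂ ∧ Function.Injective e₂ ∧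
    IsLocalDiffeomorphOn I₁ I ∞ f₁ {e₁ 0}ᶜ ∧ Set.InjOn f₁ {e₁ 0}ᶜ ∧
    IsLocalDiffeomorphOn I₂ I ∞ f₂ {e₂ 0}ᶜ ∧ Set.InjOn f₂ {e₂ 0}ᶜ ∧
    f₁ '' {e₁ 0}ᶜ ∪ f₂ '' {e₂ 0}ᶜ = Set.univ ∧
    ∀ x ∈ ({e₁ 0}ᶜ : Set M₁), ∀ y ∈ ({e₂ 0}ᶜ : Set M₂),
      f₁ x = f₂ y ↔ ∃ v : EuclideanSpace ℝ (Fin d), v ≠ 0 ∧ x = e₁ v ∧ y = e₂ ((‖v‖ ^ 2)⁻¹ • v)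

/-- The standard sphere `Sᵈ`. -/
abbrev Sph (d : ℕ) : Type := Metric.sphere (0 : EuclideanSpace ℝ (Fin (d + 1))) 1

/-- The (Hausdorff, smooth) 3-manifold `M` is diffeomorphic to `#ₙ S¹ × S²`:
`#₀ = S³` and `#ₙ₊₁ = (#ₙ S¹ × S²) # (S¹ × S²)`.  Since `S¹ × S²` has an orientation reversing
diffeomorphism, no orientation has to be recorded. -/
def IsSumS1S2 : ℕ → ∀ (M : Type) [TopologicalSpace M] [ChartedSpace (EuclideanSpace ℝ (Fin 3)) M],
    Prop
  | 0, M, _, _ => IsManifold (𝓡 3) ∞ M ∧ Nonempty (M ≃ₘ⟮𝓡 3, 𝓡 3⟯ Sph 3)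
  | n + 1, M, _, _ => T2Space M ∧ IsManifold (𝓡 3) ∞ M ∧
      ∃ (N : Type) (_ : TopologicalSpace N) (_ : ChartedSpace (EuclideanSpace ℝ (Fin 3)) N),
        IsSumS1S2 n N ∧
        IsConnectedSum (d := 3) (𝓡 3) ((𝓡 1).prod (𝓡 2)) (𝓡 3) N (Sph 1 × Sph 2) M

/-! ### The Laurent polynomials and their tropical localization -/

/-- A smooth cutoff function, equal to `1` on `(-∞, 1]` and to `0` on `[2, ∞)`. -/
structure IsCutoff (κ : ℝ → ℝ) : Prop where
  smooth : ContDiff ℝ ∞ κ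
  mem_Icc : ∀ s, κ s ∈ Set.Icc (0 : ℝ) 1
  eq_one : ∀ s ≤ 1, κ s = 1
  eq_zero : ∀ s, 2 ≤ s → κ s = 0

/-- The auxiliary choices: cutoff functions `κ` (tropical localization) and `ψ` (symplectic form),
and the sizes `η`, `δ` of the regions in which they interpolate. -/
structure Choices where
  κ : ℝ → ℝ
  ψ : ℝ → ℝ
  η : ℝ
  δ : ℝ
  hκ : IsCutoff κ
  hψ : IsCutoff ψ
  hη : 0 < η ∧ η ≤ 1 / 4
  hδ : 0 < δ ∧ δ ≤ 1 / 4

/-- The five monomials `1, t⁻¹w₁, t⁻¹w₂, t⁻¹w₁⁻¹, t⁻¹w₂⁻¹`. -/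
def mono (t : ℝ) (w₁ w₂ : ℂ) : Fin 5 → ℂ :=
  ![1, (t : ℂ)⁻¹ * w₁, (t : ℂ)⁻¹ * w₂, (t : ℂ)⁻¹ * w₁⁻¹, (t : ℂ)⁻¹ * w₂⁻¹]

/-- The coordinate `log |w| / log t`. -/
def logT (t : ℝ) (w : ℂ) : ℝ := Real.log ‖w‖ / Real.log t

/-- The localizing function `φ_i : (ℂ*)² → [0, 1]` of the `i`-th monomial.  Each
`logT t (mono t w₁ w₂ i)` is an affine function of the point `(log |w₁|, log |w₂|) / log t` of
`ℝ²`; `φ_i` is `0` where the `i`-th of them is within `η / 2` of the largest one, and `1` where it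
is smaller than the largest one by at least `η`. -/
def Choices.φ (c : Choices) (t : ℝ) (w₁ w₂ : ℂ) (i : Fin 5) : ℝ :=
  1 - ∏ j, c.κ (2 * (logT t (mono t w₁ w₂ j) - logT t (mono t w₁ w₂ i)) / c.η)

/-- The family `h_{t,s} = ∑_i (1 - s φ_i) m_i`, from `h_{t,0} = h_t` to the tropical localization
`h_{t,1}`. -/
def Choices.family (c : Choices) (t s : ℝ) (w₁ w₂ : ℂ) : ℂ :=
  ∑ i, ((1 - s * c.φ t w₁ w₂ i : ℝ) : ℂ) * mono t w₁ w₂ i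

theorem Choices.family_zero (c : Choices) (t : ℝ) (w₁ w₂ : ℂ) :
    c.family t 0 w₁ w₂ =
      1 + (t : ℂ)⁻¹ * w₁ + (t : ℂ)⁻¹ * w₂ + (t : ℂ)⁻¹ * w₁⁻¹ + (t : ℂ)⁻¹ * w₂⁻¹ := by
  simp [Choices.family, mono, Fin.sum_univ_five]

/-- The tropical localization `h_{t,1}`. -/
def Choices.h (c : Choices) (t : ℝ) (w₁ w₂ : ℂ) : ℂ := c.family t 1 w₁ w₂

/-- The cutoff function on `(ℂ*)²`, equal to `1` near the discriminant `Z_{t,1} = {h_{t,1} = 0}`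
and to `0` away from it; `|h_{t,1}|` is measured relative to the size of the monomials. -/
def Choices.χ (c : Choices) (t : ℝ) (w₁ w₂ : ℂ) : ℝ :=
  c.ψ (‖c.h t w₁ w₂‖ ^ 2 / (c.δ ^ 2 * ∑ i, ‖mono t w₁ w₂ i‖ ^ 2))

/-! ### The conic bundle, its primitive and its moment map -/

/-- The ambient space `ℂ⁴`, with coordinates `(u, v, w₁, w₂)`. -/
abbrev Amb : Type := ℂ × ℂ × ℂ × ℂ

def dU : Amb →L[ℝ] ℂ := ContinuousLinearMap.fst ℝ ℂ (ℂ × ℂ × ℂ)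
def dV : Amb →L[ℝ] ℂ :=
  (ContinuousLinearMap.fst ℝ ℂ (ℂ × ℂ)).comp (ContinuousLinearMap.snd ℝ ℂ (ℂ × ℂ × ℂ))
def dW₁ : Amb →L[ℝ] ℂ :=
  (ContinuousLinearMap.fst ℝ ℂ ℂ).comp
    ((ContinuousLinearMap.snd ℝ ℂ (ℂ × ℂ)).comp (ContinuousLinearMap.snd ℝ ℂ (ℂ × ℂ × ℂ)))
def dW₂ : Amb →L[ℝ] ℂ :=
  (ContinuousLinearMap.snd ℝ ℂ ℂ).comp
    ((ContinuousLinearMap.snd ℝ ℂ (ℂ × ℂ)).comp (ContinuousLinearMap.snd ℝ ℂ (ℂ × ℂ × ℂ)))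

/-- The real linear functional `ξ ↦ Im (a ξ)` on `ℂ`.  So `imMul z⁻¹` is `d arg` at `z ≠ 0`, and
`imMul (conj z)` is `|z|² d arg` at `z`. -/
def imMul (a : ℂ) : ℂ →L[ℝ] ℝ := Complex.imCLM.comp (ContinuousLinearMap.mul ℝ ℂ a)

/-- The primitive `θ_ε`.  With polar angles `φ_u`, `φ_v`, `θ₁`, `θ₂` of `u`, `v`, `w₁`, `w₂` and
`r_i = log |w_i| / log t` it is
`r₁ dθ₁ + r₂ dθ₂ + |u|²/2 dφ_u + ε (χ |v|²/(1+|v|²) dφ_v - (1 - χ) dφ_u)`.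
(On the conic bundle, `χ = 1` near `u = 0`.) -/
def Choices.θ (c : Choices) (t ε : ℝ) (x : Amb) : Amb →L[ℝ] ℝ :=
  match x with
  | (u, v, w₁, w₂) =>
    logT t w₁ • (imMul w₁⁻¹).comp dW₁ + logT t w₂ • (imMul w₂⁻¹).comp dW₂
      + (1 / 2 : ℝ) • (imMul (starRingEnd ℂ u)).comp dU
      + ε • ((c.χ t w₁ w₂ / (1 + ‖v‖ ^ 2)) • (imMul (starRingEnd ℂ v)).comp dV
              - (1 - c.χ t w₁ w₂) • (imMul u⁻¹).comp dU)

/-- The moment map of the circle action `(e^{iα} u, e^{-iα} v, w₁, w₂)`, normalized so that it is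
`ε` at the fixed points `u = v = 0`; note that
`1 / (1 + |v|²) = |u|² / (|u|² + |h|²)` where `uv = h` and `u ≠ 0`. -/
def Choices.μ (c : Choices) (t ε : ℝ) (x : Amb) : ℝ :=
  match x with
  | (u, v, w₁, w₂) => ‖u‖ ^ 2 / 2 + ε * c.χ t w₁ w₂ / (1 + ‖v‖ ^ 2)

/-- The covering map `(u, v, z₁, z₂) ↦ (u, v, z₁ᵏ, z₂)` (`k`-fold over `z₁ ≠ 0`; the identity if
`k = 1`). -/
def coverMap (k : ℕ) (x : Amb) : Amb :=
  match x with
  | (u, v, z₁, z₂) => (u, v, z₁ ^ k, z₂)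

/-- The function `uv - h_{t,1}(w₁, w₂)`. -/
def Choices.eqn (c : Choices) (t : ℝ) (x : Amb) : ℂ :=
  match x with
  | (u, v, w₁, w₂) => u * v - c.h t w₁ w₂

/-- The `k`-fold cover `{uv = h_{t,1}(z₁ᵏ, z₂)} ⊆ ℂ² × (ℂ*)²` of the conic bundle
`{uv = h_{t,1}(w₁, w₂)}`, which is the case `k = 1`. -/
def Choices.X (c : Choices) (t : ℝ) (k : ℕ) : Set Amb :=
  {x | x.2.2.1 ≠ 0 ∧ x.2.2.2 ≠ 0 ∧ c.eqn t (coverMap k x) = 0}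

/-- The pull back of `θ_ε` to the `k`-fold cover. -/
def Choices.coverθ (c : Choices) (t ε : ℝ) (k : ℕ) (x : Amb) : Amb →L[ℝ] ℝ :=
  (c.θ t ε (coverMap k x)).comp (fderiv ℝ (coverMap k) x)

/-! ### Exact symplectic submanifolds of `ℂ⁴` and exact Lagrangian embeddings -/

/-- The exterior derivative `ω = dθ` of a 1-form on the ambient space. -/
def omega (θ : Amb → Amb →L[ℝ] ℝ) (x : Amb) : Amb [⋀^Fin 2]→L[ℝ] ℝ :=
  extDeriv (fun y => ContinuousAlternatingMap.ofSubsingleton ℝ Amb ℝ (0 : Fin 1) (θ y)) x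

/-- The set `X`, cut out near each of its points by `F = 0`, is a smooth submanifold of real
dimension six with tangent spaces `ker dF`, and the restriction to `X` of `dθ` is a symplectic
form. -/
structure IsExactSymplectic (F : Amb → ℂ) (X : Set Amb) (θ : Amb → Amb →L[ℝ] ℝ) : Prop where
  locally_eq : ∀ x ∈ X, ∀ᶠ y in nhds x, y ∈ X ↔ F y = 0
  smooth_eqn : ∀ x ∈ X, ContDiffAt ℝ ∞ F x
  regular : ∀ x ∈ X, Function.Surjective (fderiv ℝ F x)
  smooth_form : ∀ x ∈ X, ContDiffAt ℝ ∞ θ x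
  nondegenerate : ∀ x ∈ X, ∀ ξ, fderiv ℝ F x ξ = 0 →
    (∀ ζ, fderiv ℝ F x ζ = 0 → omega θ x ![ξ, ζ] = 0) → ξ = 0

/-- `j : M → X` is a smooth embedding of a (three-dimensional) manifold, `j^* dθ = 0`, and
`j^* θ = df` for a smooth function `f` on `M`. -/
structure IsExactLagrangianEmbedding (X : Set Amb) (θ : Amb → Amb →L[ℝ] ℝ) {M : Type}
    [TopologicalSpace M] [ChartedSpace (EuclideanSpace ℝ (Fin 3)) M] (j : M → Amb) : Prop where
  mapsTo : ∀ m, j m ∈ X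
  smooth : ContMDiff (𝓡 3) 𝓘(ℝ, Amb) ∞ j
  embedding : Topology.IsEmbedding j
  immersion : ∀ m, Function.Injective (mfderiv (𝓡 3) 𝓘(ℝ, Amb) j m)
  lagrangian : ∀ m (a b : TangentSpace (𝓡 3) m),
    omega θ (j m) ![mfderiv (𝓡 3) 𝓘(ℝ, Amb) j m a, mfderiv (𝓡 3) 𝓘(ℝ, Amb) j m b] = 0
  exact_form : ∃ f : M → ℝ, ContMDiff (𝓡 3) 𝓘(ℝ, ℝ) ∞ f ∧ ∀ m (a : TangentSpace (𝓡 3) m),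
    mfderiv (𝓡 3) 𝓘(ℝ, ℝ) f m a = θ (j m) (mfderiv (𝓡 3) 𝓘(ℝ, Amb) j m a)

/-! ### The surgered surface and the Lagrangian -/

/-- The profile of a Polterovich surgery of size `R`: an embedded smooth curve `(p, q)` in the
closed first quadrant minus the origin which is the positive `p`-axis for `s ≥ R`, the positive
`q`-axis for `s ≤ -R`, and stays in the disc of radius `R` in between; the sign `σ` selects one of
the two possible surgeries. -/
structure SurgeryProfile where
  R : ℝ
  p : ℝ → ℝ
  q : ℝ → ℝ
  σ : ℝ
  hR : 0 < R ∧ R ≤ 1 / 4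
  smooth_p : ContDiff ℝ ∞ p
  smooth_q : ContDiff ℝ ∞ q
  right : ∀ s, R ≤ s → p s = s ∧ q s = 0
  left : ∀ s, s ≤ -R → p s = 0 ∧ q s = -s
  nonneg : ∀ s, 0 ≤ p s ∧ 0 ≤ q s
  mem_disc : ∀ s, |s| < R → 0 < p s ^ 2 + q s ^ 2 ∧ p s ^ 2 + q s ^ 2 < R ^ 2
  injective : Function.Injective fun s => (p s, q s)
  regular : ∀ s, deriv p s ≠ 0 ∨ deriv q s ≠ 0
  hσ : σ = 1 ∨ σ = -1

/-- The annulus `|w₁| = 1`, `θ₂ = π` in `Log_t⁻¹([-1, 1]²)`. -/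
def annulus₁ (t : ℝ) : Set (ℂ × ℂ) :=
  {w | ‖w.1‖ = 1 ∧ w.2 ≠ 0 ∧ w.2.arg = Real.pi ∧ |logT t w.1| ≤ 1 ∧ |logT t w.2| ≤ 1}

/-- The annulus `|w₂| = 1`, `θ₁ = π` in `Log_t⁻¹([-1, 1]²)`. -/
def annulus₂ (t : ℝ) : Set (ℂ × ℂ) :=
  {w | ‖w.2‖ = 1 ∧ w.1 ≠ 0 ∧ w.1.arg = Real.pi ∧ |logT t w.1| ≤ 1 ∧ |logT t w.2| ≤ 1}

/-- The point near `(-1, -1)` with `log |w_i| / log t = r_i` and angles `π + y_i`. -/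
def nearPt (t r₁ y₁ r₂ y₂ : ℝ) : ℂ × ℂ :=
  (-Complex.exp ((r₁ * Real.log t : ℝ) + y₁ * Complex.I),
   -Complex.exp ((r₂ * Real.log t : ℝ) + y₂ * Complex.I))

/-- The Polterovich surgery of the two annuli at their intersection point `(-1, -1)`.  In the
Darboux coordinates `a = (y₁, r₂)`, `b = (-r₁, y₂)` the annuli are the planes `b = 0` and `a = 0`;
their discs of radius `R` are replaced by the handle
`{(a, b) = (p(s) (cos α, sin α), ± q(s) (cos α, sin α))}`. -/
def surgered (t : ℝ) (S : SurgeryProfile) : Set (ℂ × ℂ) :=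
  {w | w ∈ annulus₁ t ∧ S.R ^ 2 ≤ (-w.1).arg ^ 2 + logT t w.2 ^ 2} ∪
  {w | w ∈ annulus₂ t ∧ S.R ^ 2 ≤ logT t w.1 ^ 2 + (-w.2).arg ^ 2} ∪
  {w | ∃ s α : ℝ, |s| < S.R ∧
    w = nearPt t (-(S.σ * S.q s * Real.cos α)) (S.p s * Real.cos α)
          (S.p s * Real.sin α) (S.σ * S.q s * Real.sin α)}

/-- The part of `{μ = ε}` over the surgered surface, lifted to the `k`-fold cover. -/
def Choices.Q (c : Choices) (t ε : ℝ) (S : SurgeryProfile) (k : ℕ) : Set Amb :=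
  {x | x ∈ c.X t k ∧ (coverMap k x).2.2 ∈ surgered t S ∧ c.μ t ε (coverMap k x) = ε}

end ConicBundle

end

/-!
The proof has a topological half, which recognises the connected sum, and a geometric half, which
finds it inside `X_t` and controls the forms.

*Topology.* If `g` has regular zero set, then `{(Z, U) | |U|² = g Z}` is a closed three-manifold,
a circle fibration over the planar domain `{g ≥ 0}` with the circles over the boundary collapsed
(`RegDomain`). Over a disc it is `S³`. Punching a hole multiplies `g` by a function which is `1`
away from a neighbourhood of an arc from the hole to an old boundary circle, and it is a connected
sum with the manifold of an annulus, which is `S¹ × S²` (`isConnectedSum_punch`). So an annulus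
with `2k` holes gives `#_{2k+1} S¹ × S²` (`exists_planarDomain`).

*The Lagrangian.* The first annulus has the coordinate `a`. The handle is a neighbourhood of the
circle `|a|² = k₀`, and across it `a` becomes, by the inversion `k₀ / conj a`, a logarithmic
coordinate on the second annulus; the latter is a Möbius image of a neighbourhood of `0` in which
its two boundary circles are round circles. Hence the surgered surface is an annulus with two
holes, and its `k`-fold cover, on which `a` is `k`-to-one, an annulus with `2k` holes
(`Model.surf`). On this domain `h` is real, and it vanishes only on the boundary, to first order;
so `h = g H` with `H` positive (`exists_factorization`). In each fibre over it, `μ = ε` fixes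
`|u|² / h` as a smooth function of `h` and `χ` (`levelRatio`), so that `Q^{(k)}` is the image of
`{|U|² = g Z}` under an embedding with `u` a positive multiple of `U` (`Param.j`).

*Exactness.* On `μ = ε` the part of the one-form in the directions `u` and `v` pulls back to `0`
(`fibre_form_eq_zero`), and `r₁ dθ₁ + r₂ dθ₂`, which vanishes on the two annuli, has on the handle
a primitive which is constant at each of the ends (`primitive_spec`). The pull back of `dθ` then
vanishes because exact forms are closed (`isotropic_of_exact`).

*The symplectic form.* In logarithmic coordinates the derivatives of the cutoff coefficients of `h`
only see monomials which are small compared with the largest one. So `dh` is nearly complex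
linear, and not small near the zero set (`exists_fderiv_hl`), which makes `X_t` a submanifold. The
tangent vectors to it are perturbed to a vector which pairs positively with a given one: for small
`ε` the terms coming from `χ` are dominated by the other ones (`nondegenerate_aux`).
-/

open scoped Manifold ContDiff

noncomputable section

namespace ConicBundle

open Set Topology ComplexConjugate
open Complex (I I_im I_ne_zero I_re abs_im_le_norm abs_re_le_norm add_im add_re arg arg_exp
  arg_mem_Ioc arg_real_mul conjCLE conj_conj conj_im conj_ofReal contDiff_exp equivRealProdCLM exp
  exp_add exp_log exp_nat_mul exp_ne_zero im imCLM im_ofReal_mul log_im log_re mem_slitPlane_iff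
  mem_slitPlane_iff_arg mul_I_im mul_conj mul_im mul_re neg_re normSq_apply normSq_eq_norm_sq
  norm_I norm_conj norm_exp norm_exp_ofReal_mul_I norm_mul_exp_arg_mul_I norm_real ofRealCLM
  ofReal_exp ofReal_im ofReal_inv ofReal_mul ofReal_re ofReal_zero re reCLM re_add_im
  re_ofReal_mul real_smul slitPlane slitPlane_ne_zero sq_norm sub_im sub_re zero_im)
open Real (abs_exp cos exp_pos log log_div log_exp log_mul log_one log_pos norm_eq_abs
  pi_gt_three sin smoothTransition sq_sqrt sqrt_pos sqrt_sq two_pi_pos)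

local notation "SmoothAt" => ContDiffAt ℝ ∞

local notation "Smooth" => ContDiff ℝ ∞

local notation "𝔼[" n "]" => EuclideanSpace ℝ (Fin n)

local notation "Iπ" => Set.Ioc (-Real.pi) Real.pi

variable {E : Type*} [NormedAddCommGroup E] [NormedSpace ℝ E]

lemma norm_coe (r : ℝ) : ‖(r : ℂ)‖ = |r| := by rw [norm_real, norm_eq_abs]

/-! ### Smooth inverses and local diffeomorphisms -/

section General

/-- The inverse function theorem with a smooth inverse, in the form that provides charts: the
inverse exists and is smooth on the whole target. -/
lemma exists_openPartialHomeomorph_contDiffOn {E F : Type*} [NormedAddCommGroup E]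
    [NormedSpace ℝ E] [CompleteSpace E] [NormedAddCommGroup F] [NormedSpace ℝ F]
    {Φ : E → F} {U : Set E} (hU : IsOpen U)
    (hΦ : ContDiffOn ℝ ∞ Φ U) {a : E} (ha : a ∈ U) {A : E ≃L[ℝ] F}
    (hA : HasFDerivAt Φ (A : E →L[ℝ] F) a) :
    ∃ e : OpenPartialHomeomorph E F, a ∈ e.source ∧ e.source ⊆ U ∧ (e : E → F) = Φ ∧
      ContDiffOn ℝ ∞ e.symm e.target := by
  have hcd := hΦ.contDiffAt (hU.mem_nhds ha)
  let e₀ := hcd.toOpenPartialHomeomorph Φ hA (by simp)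
  have he₀ := hcd.toOpenPartialHomeomorph_coe hA (by simp)
  have hfd := hΦ.continuousOn_fderiv_of_isOpen hU (by simp)
  let V : Set E := U ∩ (fderiv ℝ Φ) ⁻¹' (range ((↑) : (E ≃L[ℝ] F) → (E →L[ℝ] F)))
  have hV := hfd.isOpen_inter_preimage hU ContinuousLinearEquiv.isOpen
  have haV : a ∈ V := ⟨ha, A, by rw [hA.fderiv]⟩
  refine ⟨e₀.restrOpen V hV, ?_, ?_, ?_, ?_⟩
  · rw [OpenPartialHomeomorph.restrOpen_source]
    exact ⟨hcd.mem_toOpenPartialHomeomorph_source hA (by simp), haV⟩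
  · rw [OpenPartialHomeomorph.restrOpen_source]
    exact fun x hx => hx.2.1
  · exact he₀
  · intro y hy
    set e := e₀.restrOpen V hV with he
    have hx := e.map_target hy
    have hx' : e.symm y ∈ V := by
      rw [OpenPartialHomeomorph.restrOpen_source] at hx
      exact hx.2
    obtain ⟨B, hB⟩ := hx'.2
    have hd : HasFDerivAt Φ (B : E →L[ℝ] F) (e.symm y) := by
      rw [hB]
      exact ((hΦ.contDiffAt (hU.mem_nhds hx'.1)).differentiableAt (by simp)).hasFDerivAt
    have hee : e = Φ := he₀
    exact (e.contDiffAt_symm hy (by rw [hee]; exact hd)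
      (by rw [hee]; exact hΦ.contDiffAt (hU.mem_nhds hx'.1))).contDiffWithinAt

/-- An injective smooth map with invertible derivatives on an open set is an open partial
homeomorphism with smooth inverse on that set. -/
lemma exists_openPartialHomeomorph_of_injOn {E F : Type*} [NormedAddCommGroup E]
    [NormedSpace ℝ E] [CompleteSpace E] [NormedAddCommGroup F] [NormedSpace ℝ F]
    {Φ : E → F} {U : Set E} (hU : IsOpen U)
    (hΦ : ContDiffOn ℝ ∞ Φ U) (hinj : InjOn Φ U)
    (hA : ∀ a ∈ U, ∃ A : E ≃L[ℝ] F, HasFDerivAt Φ (A : E →L[ℝ] F) a) :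
    ∃ e : OpenPartialHomeomorph E F, e.source = U ∧ (e : E → F) = Φ ∧
      ContDiffOn ℝ ∞ e.symm e.target := by
  have hopen : ∀ s ⊆ U, IsOpen s → IsOpen (Φ '' s) := by
    intro s hs hso
    rw [isOpen_iff_mem_nhds]
    rintro _ ⟨a, ha, rfl⟩
    obtain ⟨A, hA⟩ := hA a (hs ha)
    have hcd := hΦ.contDiffAt (hU.mem_nhds (hs ha))
    rw [← ((hcd.hasStrictFDerivAt' hA (by simp)).map_nhds_eq_of_equiv)]
    exact Filter.image_mem_map (hso.mem_nhds ha)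
  let pe : PartialEquiv E F := hinj.toPartialEquiv
  let e : OpenPartialHomeomorph E F :=
    { toPartialEquiv := pe
      open_source := hU
      open_target := hopen U le_rfl hU
      continuousOn_toFun := hΦ.continuousOn
      continuousOn_invFun := by
        change ContinuousOn pe.symm (Φ '' U)
        rintro _ ⟨a, ha, rfl⟩
        refine ContinuousAt.continuousWithinAt ?_
        have hs : pe.symm (Φ a) = a := pe.left_inv ha
        rw [ContinuousAt, hs]
        intro s hs'
        obtain ⟨s', hs's, hs'o, has'⟩ := mem_nhds_iff.1 hs'
        have := (hopen _ inter_subset_right (hs'o.inter hU)).mem_nhds ⟨a, ⟨has', ha⟩, rfl⟩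
        refine Filter.mem_map.2 (Filter.mem_of_superset this ?_)
        rintro _ ⟨b, hb, rfl⟩
        have : pe.symm (Φ b) = b := pe.left_inv hb.2
        rw [mem_preimage, this]
        exact hs's hb.1 }
  refine ⟨e, rfl, rfl, ?_⟩
  intro y hy
  have hx := e.map_target hy
  obtain ⟨A, hA⟩ := hA _ hx
  exact (e.contDiffAt_symm hy hA (hΦ.contDiffAt (hU.mem_nhds hx))).contDiffWithinAt

variable {E H E' H' : Type*} [NormedAddCommGroup E] [NormedSpace ℝ E] [TopologicalSpace H]
    [NormedAddCommGroup E'] [NormedSpace ℝ E'] [TopologicalSpace H']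
    {I : ModelWithCorners ℝ E H} {I' : ModelWithCorners ℝ E' H'}
    {M : Type*} [TopologicalSpace M] [ChartedSpace H M]
    {N : Type*} [TopologicalSpace N] [ChartedSpace H' N]

/-- Two mutually inverse smooth maps between open sets are local diffeomorphisms. -/
lemma isLocalDiffeomorphOn_of_inverse {f : M → N} {g : N → M} {U : Set M} {V : Set N}
    (hU : IsOpen U) (hV : IsOpen V) (hf : ContMDiffOn I I' ∞ f U) (hg : ContMDiffOn I' I ∞ g V)
    (hfU : MapsTo f U V) (hgV : MapsTo g V U) (hgf : ∀ x ∈ U, g (f x) = x)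
    (hfg : ∀ y ∈ V, f (g y) = y) : IsLocalDiffeomorphOn I I' ∞ f U := by
  intro x
  let Φ : PartialDiffeomorph I I' M N ∞ :=
    { toFun := f
      invFun := g
      source := U
      target := V
      map_source' := hfU
      map_target' := hgV
      left_inv' := hgf
      right_inv' := hfg
      open_source := hU
      open_target := hV
      contMDiffOn_toFun := hf
      contMDiffOn_invFun := hg }
  exact Φ.isLocalDiffeomorphAt I I' ∞ x.2

lemma isLocalDiffeomorphAt_congr {f g : M → N} {x : M} (hf : IsLocalDiffeomorphAt I I' ∞ f x)
    (h : g =ᶠ[𝓝 x] f) : IsLocalDiffeomorphAt I I' ∞ g x := by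
  obtain ⟨Φ, hx, he⟩ := hf
  obtain ⟨s, hs, hso, hxs⟩ := mem_nhds_iff.1 h
  let Ψ : PartialDiffeomorph I I' M N ∞ :=
    { toPartialEquiv := (Φ.toOpenPartialHomeomorph.restrOpen s hso).toPartialEquiv
      open_source := (Φ.toOpenPartialHomeomorph.restrOpen s hso).open_source
      open_target := (Φ.toOpenPartialHomeomorph.restrOpen s hso).open_target
      contMDiffOn_toFun := Φ.contMDiffOn_toFun.mono fun y hy => by
        have h1 := (OpenPartialHomeomorph.restrOpen_source
          Φ.toOpenPartialHomeomorph s hso) ▸ hy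
        exact h1.1
      contMDiffOn_invFun := Φ.contMDiffOn_invFun.mono fun y hy => hy.1 }
  refine ⟨Ψ, ?_, ?_⟩
  · change x ∈ (Φ.toOpenPartialHomeomorph.restrOpen s hso).source
    rw [OpenPartialHomeomorph.restrOpen_source]
    exact ⟨hx, hxs⟩
  · intro y hy
    rw [OpenPartialHomeomorph.restrOpen_source] at hy
    exact (hs hy.2).trans (he hy.1)

lemma isLocalDiffeomorphAt_comp {E'' H'' P : Type*} [NormedAddCommGroup E''] [NormedSpace ℝ E'']
    [TopologicalSpace H''] {I'' : ModelWithCorners ℝ E'' H''} [TopologicalSpace P]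
    [ChartedSpace H'' P] {g : N → P} {f : M → N} {x : M} {y : N}
    (hg : IsLocalDiffeomorphAt I' I'' ∞ g y) (hf : IsLocalDiffeomorphAt I I' ∞ f x)
    (hy : f x = y) : IsLocalDiffeomorphAt I I'' ∞ (g ∘ f) x := by
  subst hy
  exact IsLocalDiffeomorphAt.comp I'' P hf hg

end General

/-! ### Circle fibrations over planar domains, collapsed over the boundary -/

/-- The model space of three-manifolds. -/
abbrev E3 : Type := 𝔼[3]

/-- A smooth function on the plane with regular zero set.  It stands for the planar domain
`{g ≥ 0}` with smooth boundary `{g = 0}`. -/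
structure RegDomain where
  g : ℂ → ℝ
  smooth : Smooth g
  regular : ∀ z, g z = 0 → fderiv ℝ g z ≠ 0

namespace RegDomain

variable (D : RegDomain)

/-- The hypersurface `{|U|² = g(Z)}` of `ℂ²`.  It fibres over `{g ≥ 0}`, with circles as fibres
over the interior, which are collapsed to points over the boundary. -/
def Mfd : Type := {p : ℂ × ℂ // ‖p.2‖ ^ 2 = D.g p.1}

instance : TopologicalSpace D.Mfd := instTopologicalSpaceSubtype

instance : T2Space D.Mfd := inferInstanceAs (T2Space {p : ℂ × ℂ // ‖p.2‖ ^ 2 = D.g p.1})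

/-- The inclusion into `ℂ²`. -/
def val (x : D.Mfd) : ℂ × ℂ := x.1

variable {D}

/-- A point of the hypersurface, from its coordinates. -/
def ofCoord (z u : ℂ) (h : ‖u‖ ^ 2 = D.g z) : D.Mfd := ⟨(z, u), h⟩

@[simp] theorem val_ofCoord (z u : ℂ) (h : ‖u‖ ^ 2 = D.g z) : D.val (ofCoord z u h) = (z, u) := rfl

variable (D)

lemma val_prop x : ‖(D.val x).2‖ ^ 2 = D.g (D.val x).1 := x.2

lemma g_nonneg x : 0 ≤ D.g (D.val x).1 := by rw [← D.val_prop]; positivity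

lemma val_injective : Function.Injective D.val := Subtype.val_injective

lemma isInducing_val : Topology.IsInducing D.val := Topology.IsInducing.subtypeVal

lemma continuous_val : Continuous D.val := continuous_subtype_val

variable {D} in
@[ext] theorem mfd_ext {x y : D.Mfd} (h₁ : (D.val x).1 = (D.val y).1)
    (h₂ : (D.val x).2 = (D.val y).2) : x = y :=
  D.val_injective (Prod.ext h₁ h₂)

/-- The defining function of the hypersurface. -/
def defFn (p : ℂ × ℂ) : ℝ := ‖p.2‖ ^ 2 - D.g p.1

lemma contDiff_defFn : Smooth D.defFn :=
  ((contDiff_norm_sq ℝ).comp contDiff_snd).sub (D.smooth.comp contDiff_fst)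

lemma fderiv_defFn_ne_zero {p : ℂ × ℂ} (hp : D.defFn p = 0) : fderiv ℝ D.defFn p ≠ 0 := by
  have hg := (D.smooth.differentiable (by simp) p.1).hasFDerivAt
  have h1 : HasFDerivAt D.defFn
      ((2 • (innerSL ℝ p.2)).comp (ContinuousLinearMap.snd ℝ ℂ ℂ)
        - (fderiv ℝ D.g p.1).comp (ContinuousLinearMap.fst ℝ ℂ ℂ)) p := by
    have h2 := ((hasStrictFDerivAt_norm_sq p.2).hasFDerivAt).comp p
        (ContinuousLinearMap.snd ℝ ℂ ℂ).hasFDerivAt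
    exact h2.sub (HasFDerivAt.comp p hg (ContinuousLinearMap.fst ℝ ℂ ℂ).hasFDerivAt)
  rw [h1.fderiv]
  intro h0
  have hv : ∀ v : ℂ × ℂ, 2 * inner ℝ p.2 v.2 - fderiv ℝ D.g p.1 v.1 = 0 := by
    intro v
    simpa [two_smul, two_mul] using (congrArg (fun A : (ℂ × ℂ) →L[ℝ] ℝ => A v) h0)
  by_cases hu : p.2 = 0
  · have hz : D.g p.1 = 0 := by
      have : ‖p.2‖ ^ 2 - D.g p.1 = 0 := hp
      rw [hu] at this; simpa using this
    apply D.regular _ hz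
    refine ContinuousLinearMap.ext fun v => ?_
    simpa using hv (v, 0)
  · have := hv (0, p.2)
    simp at this
    exact hu this

/-- A nonzero functional on `ℂ²` is a coordinate of a linear isomorphism with `ℝ × ℝ³`. -/
lemma exists_equiv_fst_eq {A : (ℂ × ℂ) →L[ℝ] ℝ} (hA : A ≠ 0) :
    ∃ B : (ℂ × ℂ) ≃L[ℝ] (ℝ × E3), ∀ v, (B v).1 = A v := by
  obtain ⟨v₀, hv₀⟩ : ∃ v, A v ≠ 0 := by
    by_contra! h
    exact hA (ContinuousLinearMap.ext h)
  have hsurj : Function.Surjective (A : (ℂ × ℂ) →ₗ[ℝ] ℝ) := by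
    exact fun c => ⟨(c / A v₀) • v₀, by simp [hv₀]⟩
  let K : Submodule ℝ (ℂ × ℂ) := LinearMap.ker (A : (ℂ × ℂ) →ₗ[ℝ] ℝ)
  have hfr : Module.finrank ℝ K = 3 := by
    have h1 := LinearMap.finrank_range_add_finrank_ker (A : (ℂ × ℂ) →ₗ[ℝ] ℝ)
    rw [LinearMap.range_eq_top.2 hsurj, finrank_top, Module.finrank_prod,
      Complex.finrank_real_complex, Module.finrank_self] at h1
    change Module.finrank ℝ (LinearMap.ker (A : (ℂ × ℂ) →ₗ[ℝ] ℝ)) = 3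
    omega
  let e : K ≃ₗ[ℝ] E3 := LinearEquiv.ofFinrankEq K E3 (by rw [hfr]; simp)
  let f : (ℂ × ℂ) →ₗ[ℝ] (ℝ × E3) :=
    LinearMap.prod (A : (ℂ × ℂ) →ₗ[ℝ] ℝ)
      (e.comp (LinearMap.codRestrict K
        (LinearMap.id - ((A v₀)⁻¹ • (A : (ℂ × ℂ) →ₗ[ℝ] ℝ)).smulRight v₀)
        (fun x => by simp [K]; field_simp; ring)))
  have hinj : Function.Injective f := by
    rw [← LinearMap.ker_eq_bot, LinearMap.ker_eq_bot']
    intro x hx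
    have h1 : A x = 0 := congrArg Prod.fst hx
    have h2 : e _ = 0 := congrArg Prod.snd hx
    rw [LinearEquiv.map_eq_zero_iff] at h2
    simpa [h1] using (congrArg Subtype.val h2)
  have hdim : Module.finrank ℝ (ℂ × ℂ) = Module.finrank ℝ (ℝ × E3) := by
    simp [Complex.finrank_real_complex]
  let g := LinearEquiv.ofInjectiveOfFinrankEq f hinj hdim
  exact ⟨g.toContinuousLinearEquiv, fun v => rfl⟩

lemma exists_slice (p : D.Mfd) : ∃ e : OpenPartialHomeomorph (ℂ × ℂ) (ℝ × E3),
    D.val p ∈ e.source ∧ (∀ x, (e x).1 = D.defFn x) ∧ Smooth e ∧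
      ContDiffOn ℝ ∞ e.symm e.target := by
  obtain ⟨B, hB⟩ := exists_equiv_fst_eq (D.fderiv_defFn_ne_zero (sub_eq_zero.2 (D.val_prop p)))
  let Φ : ℂ × ℂ → ℝ × E3 := fun x => (D.defFn x, (B x).2)
  have hΦ := D.contDiff_defFn.prodMk (contDiff_snd.comp B.contDiff)
  have hd : HasFDerivAt Φ (B : (ℂ × ℂ) →L[ℝ] (ℝ × E3)) (D.val p) := by
    have h1 : HasFDerivAt D.defFn (fderiv ℝ D.defFn (D.val p)) (D.val p) :=
      (D.contDiff_defFn.differentiable (by simp) _).hasFDerivAt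
    have h2 : HasFDerivAt (fun x => (B x).2)
        ((ContinuousLinearMap.snd ℝ ℝ E3).comp (B : (ℂ × ℂ) →L[ℝ] (ℝ × E3))) (D.val p) :=
      ((ContinuousLinearMap.snd ℝ ℝ E3).comp (B : (ℂ × ℂ) →L[ℝ] (ℝ × E3))).hasFDerivAt
    have heq : (B : (ℂ × ℂ) →L[ℝ] (ℝ × E3)) = (fderiv ℝ D.defFn (D.val p)).prod
        ((ContinuousLinearMap.snd ℝ ℝ E3).comp (B : (ℂ × ℂ) →L[ℝ] (ℝ × E3))) :=
      ContinuousLinearMap.ext fun v => Prod.ext (hB v) rfl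
    rw [heq]
    exact h1.prodMk h2
  obtain ⟨e, h1, -, h2, h3⟩ := exists_openPartialHomeomorph_contDiffOn isOpen_univ
    hΦ.contDiffOn (mem_univ (D.val p)) hd
  exact ⟨e, h1, fun _ => by rw [h2], by rw [h2]; exact hΦ, h3⟩

/-- A local straightening of the hypersurface near `p`. -/
def slice (p : D.Mfd) : OpenPartialHomeomorph (ℂ × ℂ) (ℝ × E3) := (D.exists_slice p).choose

lemma mem_slice_source p : D.val p ∈ (D.slice p).source :=
  (D.exists_slice p).choose_spec.1

lemma slice_fst p (x : ℂ × ℂ) : (D.slice p x).1 = D.defFn x :=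
  (D.exists_slice p).choose_spec.2.1 x

lemma contDiff_slice p : Smooth (D.slice p) :=
  (D.exists_slice p).choose_spec.2.2.1

lemma contDiffOn_slice_symm p : ContDiffOn ℝ ∞ (D.slice p).symm (D.slice p).target :=
  (D.exists_slice p).choose_spec.2.2.2

lemma slice_val (p x : D.Mfd) : D.slice p (D.val x) = (0, (D.slice p (D.val x)).2) := by
  refine Prod.ext ?_ rfl
  rw [slice_fst]
  exact sub_eq_zero.2 (D.val_prop x)

lemma slice_symm_prop (p : D.Mfd) {y : E3} (hy : ((0 : ℝ), y) ∈ (D.slice p).target) :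
    ‖((D.slice p).symm (0, y)).2‖ ^ 2 = D.g ((D.slice p).symm (0, y)).1 := by
  have h := D.slice_fst p ((D.slice p).symm (0, y))
  rw [(D.slice p).right_inv hy] at h
  exact sub_eq_zero.1 h.symm

open Classical in
/-- The inverse of the chart at `p`. -/
def chartInv (p : D.Mfd) (y : E3) : D.Mfd :=
  if h : ((0 : ℝ), y) ∈ (D.slice p).target then ofCoord _ _ (D.slice_symm_prop p h)
  else p

lemma val_chartInv (p : D.Mfd) {y : E3} (hy : ((0 : ℝ), y) ∈ (D.slice p).target) :
    D.val (D.chartInv p y) = (D.slice p).symm (0, y) := by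
  rw [chartInv, dif_pos hy, val_ofCoord]

/-- The chart at `p` cut out by a straightening of the hypersurface. -/
def chart (p : D.Mfd) : OpenPartialHomeomorph D.Mfd E3 where
  toFun x := (D.slice p (D.val x)).2
  invFun := D.chartInv p
  source := D.val ⁻¹' (D.slice p).source
  target := {y | ((0 : ℝ), y) ∈ (D.slice p).target}
  map_source' x hx := by
    change ((0 : ℝ), (D.slice p (D.val x)).2) ∈ (D.slice p).target
    rw [← slice_val]
    exact (D.slice p).map_source hx
  map_target' y hy := by
    rw [mem_preimage, D.val_chartInv p hy]
    exact (D.slice p).map_target hy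
  left_inv' x hx := by
    have hy : ((0 : ℝ), (D.slice p (D.val x)).2) ∈ (D.slice p).target := by
      rw [← slice_val]
      exact (D.slice p).map_source hx
    apply D.val_injective
    rw [D.val_chartInv p hy, ← slice_val, (D.slice p).left_inv hx]
  right_inv' y hy := by
    rw [D.val_chartInv p hy, (D.slice p).right_inv hy]
  open_source := (D.slice p).open_source.preimage D.continuous_val
  open_target := (D.slice p).open_target.preimage (by fun_prop)
  continuousOn_toFun :=
    (continuous_snd.comp ((D.contDiff_slice p).continuous.comp D.continuous_val)).continuousOn
  continuousOn_invFun := by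
    rw [D.isInducing_val.continuousOn_iff]
    have : ContinuousOn (fun y : E3 => (D.slice p).symm ((0 : ℝ), y))
        {y | ((0 : ℝ), y) ∈ (D.slice p).target} :=
      (D.slice p).continuousOn_symm.comp (by fun_prop) (fun y hy => hy)
    exact this.congr fun y hy => D.val_chartInv p hy

instance : ChartedSpace E3 D.Mfd where
  atlas := range D.chart
  chartAt := D.chart
  mem_chart_source := D.mem_slice_source
  chart_mem_atlas p := mem_range_self p

lemma contDiffOn_val_chartInv (p : D.Mfd) :
    ContDiffOn ℝ ∞ (fun y => D.val (D.chartInv p y)) (D.chart p).target := by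
  have : ContDiffOn ℝ ∞ (fun y : E3 => (D.slice p).symm (0, y)) (D.chart p).target :=
    (D.contDiffOn_slice_symm p).comp (by fun_prop) (fun y hy => hy)
  exact this.congr fun y hy => D.val_chartInv p hy

instance : IsManifold (𝓡 3) ∞ D.Mfd := by
  apply isManifold_of_contDiffOn
  rintro _ _ ⟨p, rfl⟩ ⟨q, rfl⟩
  simp only [modelWithCornersSelf_coe, modelWithCornersSelf_coe_symm, Function.comp_id,
    Function.id_comp, preimage_id, range_id, inter_univ]
  have h1 : ContDiffOn ℝ ∞ (fun y => D.val (D.chartInv p y))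
      ((D.chart p).symm.trans (D.chart q)).source :=
    (D.contDiffOn_val_chartInv p).mono fun y hy => hy.1
  exact contDiff_snd.comp_contDiffOn ((D.contDiff_slice q).comp_contDiffOn h1)

lemma contMDiff_val : ContMDiff (𝓡 3) 𝓘(ℝ, ℂ × ℂ) ∞ D.val := by
  intro p
  rw [contMDiffAt_iff_source]
  have hmem : extChartAt (𝓡 3) p p ∈ (D.chart p).target := by
    exact (D.chart p).map_source (D.mem_slice_source p)
  have h1 := (D.contDiffOn_val_chartInv p).contDiffAt ((D.chart p).open_target.mem_nhds hmem)
  exact h1.contMDiffAt.contMDiffWithinAt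

variable {E H N : Type*} [NormedAddCommGroup E] [NormedSpace ℝ E] [TopologicalSpace H]
    {I : ModelWithCorners ℝ E H} [TopologicalSpace N] [ChartedSpace H N]

variable {D} in
/-- A map into the hypersurface is smooth if it is smooth as a map into `ℂ²`. -/
lemma contMDiffAt_of_val {f : N → D.Mfd} {x : N}
    (h : ContMDiffAt I 𝓘(ℝ, ℂ × ℂ) ∞ (fun y => D.val (f y)) x) :
    ContMDiffAt I (𝓡 3) ∞ f x := by
  rw [contMDiffAt_iff_target]
  refine ⟨(D.isInducing_val.continuousAt_iff).2 h.continuousAt, ?_⟩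
  exact (contDiff_snd.comp (D.contDiff_slice (f x))).contMDiff.contMDiffAt.comp x h

variable {D} in
lemma contMDiffOn_of_val {f : N → D.Mfd} {s : Set N} (hs : IsOpen s)
    (h : ContMDiffOn I 𝓘(ℝ, ℂ × ℂ) ∞ (fun y => D.val (f y)) s) :
    ContMDiffOn I (𝓡 3) ∞ f s := fun _ hx =>
  (contMDiffAt_of_val (h.contMDiffAt (hs.mem_nhds hx))).contMDiffWithinAt

/-- A smooth function of the coordinates is smooth on the hypersurface. -/
lemma contMDiffAt_comp_val {F : Type*} [NormedAddCommGroup F] [NormedSpace ℝ F]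
    {f : ℂ × ℂ → F} {x : D.Mfd} (hf : SmoothAt f (D.val x)) :
    ContMDiffAt (𝓡 3) 𝓘(ℝ, F) ∞ (fun y => f (D.val y)) x :=
  hf.contMDiffAt.comp x (D.contMDiff_val x)

lemma mfderiv_val_injective (p : D.Mfd) :
    Function.Injective (mfderiv (𝓡 3) 𝓘(ℝ, ℂ × ℂ) D.val p) := by
  let f : ℂ × ℂ → E3 := fun q => (D.slice p q).2
  have h1 := (D.contMDiff_val p).mdifferentiableAt (by simp)
  have h2 : MDifferentiableAt 𝓘(ℝ, ℂ × ℂ) 𝓘(ℝ, E3) f (D.val p) :=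
    (contDiff_snd.comp (D.contDiff_slice p)).contMDiff.contMDiffAt.mdifferentiableAt (by simp)
  have h3 := mfderiv_comp p h2 h1
  have h4 : f ∘ D.val = extChartAt (𝓡 3) p := by
    ext x : 1
    rfl
  rw [h4] at h3
  have h5 : (mfderiv (𝓡 3) 𝓘(ℝ, E3) (extChartAt (𝓡 3) p) p).IsInvertible :=
    isInvertible_mfderiv_extChartAt (mem_extChartAt_source p)
  intro a b hab
  apply h5.injective
  rw [h3]
  exact congrArg (mfderiv 𝓘(ℝ, ℂ × ℂ) 𝓘(ℝ, E3) f (D.val p)) hab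

end RegDomain

/-! ### Connected sums from a common collar -/

section ConnectedSum

/-- The inversion `v ↦ v / |v|²`. -/
def inv3 (v : E3) : E3 := (‖v‖ ^ 2)⁻¹ • v

lemma inv3_ne_zero {v : E3} (hv : v ≠ 0) : inv3 v ≠ 0 := by
  simp [inv3, hv]

lemma norm_inv3 v : ‖inv3 v‖ = ‖v‖⁻¹ := by
  by_cases hv : v = 0
  · simp [inv3, hv]
  rw [inv3, norm_smul, norm_inv, norm_pow, norm_norm]
  field_simp

lemma inv3_inv3 v : inv3 (inv3 v) = v := by
  by_cases hv : v = 0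
  · simp [inv3, hv]
  rw [inv3, norm_inv3, inv3, smul_smul]
  have : (‖v‖⁻¹ ^ 2)⁻¹ * (‖v‖ ^ 2)⁻¹ = 1 := by field_simp
  rw [this, one_smul]

lemma contDiffOn_inv3 : ContDiffOn ℝ ∞ inv3 {0}ᶜ := by
  intro v hv
  have h1 : SmoothAt (fun v => ‖v‖ ^ 2) v := (contDiff_norm_sq ℝ).contDiffAt
  have h2 : ‖v‖ ^ 2 ≠ 0 := pow_ne_zero _ (norm_ne_zero_iff.2 hv)
  exact ((h1.inv h2).smul contDiffAt_id).contDiffWithinAt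

lemma isLocalDiffeomorphOn_inv3 : IsLocalDiffeomorphOn (𝓡 3) (𝓡 3) ∞ inv3 {0}ᶜ :=
  isLocalDiffeomorphOn_of_inverse (g := inv3) isOpen_compl_singleton
    isOpen_compl_singleton contDiffOn_inv3.contMDiffOn contDiffOn_inv3.contMDiffOn
    (fun _ hv => inv3_ne_zero hv) (fun _ hv => inv3_ne_zero hv) (fun v _ => inv3_inv3 v)
    (fun v _ => inv3_inv3 v)

variable {F₁ H₁ F₂ H₂ F H : Type} [NormedAddCommGroup F₁] [NormedSpace ℝ F₁] [TopologicalSpace H₁]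
    [NormedAddCommGroup F₂] [NormedSpace ℝ F₂] [TopologicalSpace H₂]
    [NormedAddCommGroup F] [NormedSpace ℝ F] [TopologicalSpace H]
    {I₁ : ModelWithCorners ℝ F₁ H₁} {I₂ : ModelWithCorners ℝ F₂ H₂} {I : ModelWithCorners ℝ F H}
    {M₁ : Type} [TopologicalSpace M₁] [ChartedSpace H₁ M₁] [T2Space M₁]
    {M₂ : Type} [TopologicalSpace M₂] [ChartedSpace H₂ M₂]
    {M : Type} [TopologicalSpace M] [ChartedSpace H M]

/-- `M` is a connected sum of `M₁` and `M₂` if it is covered by a copy of `M₂` minus the centre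
of a disc `e₂` and a copy of `M₁` minus the unit ball of a disc `e₁`, and the collars of the
two discs are glued by inversion.  The copy of `M₁` minus the unit ball is extended
to a copy of `M₁` minus the centre by running through the disc `e₂`. -/
lemma isConnectedSum_of_collar {e₁ : E3 → M₁} {e₂ : E3 → M₂} {ι : M₁ → M} {f₂ : M₂ → M}
    (he₁ : IsLocalDiffeomorph (𝓡 3) I₁ ∞ e₁) (he₁i : Function.Injective e₁)
    (he₂ : IsLocalDiffeomorph (𝓡 3) I₂ ∞ e₂) (he₂i : Function.Injective e₂)
    (hf₂ : IsLocalDiffeomorphOn I₂ I ∞ f₂ {e₂ 0}ᶜ) (hf₂i : InjOn f₂ {e₂ 0}ᶜ)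
    (hι : IsLocalDiffeomorphOn I₁ I ∞ ι (e₁ '' Metric.closedBall 0 1)ᶜ)
    (hιi : InjOn ι (range e₁)ᶜ)
    (hcollar : ∀ v, 1 < ‖v‖ → ι (e₁ v) = f₂ (e₂ (inv3 v)))
    (hsep : ∀ x ∉ range e₁, ∀ y ≠ e₂ 0, ι x ≠ f₂ y)
    (hcov : ∀ z, (∃ x ∉ range e₁, ι x = z) ∨ ∃ y ≠ e₂ 0, f₂ y = z) :
    IsConnectedSum (d := 3) I₁ I₂ I M₁ M₂ M := by
  classical
  let d : M₁ → E3 := Function.invFun e₁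
  have hd : ∀ v, d (e₁ v) = v := Function.leftInverse_invFun he₁i
  let f₁ : M₁ → M := fun x => if x ∈ range e₁ then f₂ (e₂ (inv3 (d x))) else ι x
  have hf₁e : ∀ v, f₁ (e₁ v) = f₂ (e₂ (inv3 v)) := fun v => by
    simp only [f₁, mem_range_self, if_true, hd]
  have hf₁n : ∀ x ∉ range e₁, f₁ x = ι x := fun x hx => by simp only [f₁, hx, if_false]
  have hne : ∀ v : E3, v ≠ 0 → e₂ (inv3 v) ≠ e₂ 0 := fun v hv h =>
    inv3_ne_zero hv (he₂i h)
  have hclosed : IsClosed (e₁ '' Metric.closedBall 0 1) :=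
    ((isCompact_closedBall _ _).image he₁.contMDiff.continuous).isClosed
  have hf₁ι : ∀ x ∈ (e₁ '' Metric.closedBall 0 1)ᶜ, f₁ x = ι x := by
    intro x hx
    by_cases hxr : x ∈ range e₁
    · obtain ⟨v, rfl⟩ := hxr
      have hv : 1 < ‖v‖ := by
        by_contra! h
        exact hx ⟨v, by simpa using h, rfl⟩
      rw [hf₁e, hcollar v hv]
    · exact hf₁n x hxr
  refine ⟨e₁, e₂, f₁, f₂, he₁, he₁i, he₂, he₂i, ?_, ?_, hf₂, hf₂i, ?_, ?_⟩
  · rintro ⟨x, hx⟩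
    by_cases hxr : x ∈ range e₁
    · obtain ⟨v, rfl⟩ := hxr
      have hv : v ≠ 0 := fun h => hx (by rw [h]; rfl)
      have h1 := (he₁ v).localInverse_isLocalDiffeomorphAt
      have h1v := (he₁ v).localInverse_left_inv (he₁ v).localInverse_mem_target
      have h2 := isLocalDiffeomorphAt_comp (isLocalDiffeomorphOn_inv3 ⟨v, hv⟩) h1 h1v
      have h3 := isLocalDiffeomorphAt_comp (he₂ (inv3 v)) h2 (congrArg inv3 h1v)
      have h4 :=
          isLocalDiffeomorphAt_comp (hf₂ ⟨_, hne v hv⟩) h3 (congrArg (fun w => e₂ (inv3 w)) h1v)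
      refine isLocalDiffeomorphAt_congr h4 ?_
      filter_upwards [(he₁ v).localInverse_open_source.mem_nhds (he₁ v).localInverse_mem_source]
        with y hy
      have hy2 := (he₁ v).localInverse_right_inv hy
      conv_lhs => rw [← hy2, hf₁e]
      rfl
    · refine isLocalDiffeomorphAt_congr (hι ⟨x, fun h => hxr (image_subset_range _ _ h)⟩) ?_
      filter_upwards [hclosed.isOpen_compl.mem_nhds
        (fun h => hxr (image_subset_range _ _ h) : x ∈ (e₁ '' Metric.closedBall 0 1)ᶜ)] with y hy
      exact hf₁ι y hy
  · intro x hx x' hx' h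
    by_cases hxr : x ∈ range e₁ <;> by_cases hxr' : x' ∈ range e₁
    · obtain ⟨v, rfl⟩ := hxr
      obtain ⟨v', rfl⟩ := hxr'
      have hv : v ≠ 0 := fun h => hx (by rw [h]; rfl)
      have hv' : v' ≠ 0 := fun h => hx' (by rw [h]; rfl)
      rw [hf₁e, hf₁e] at h
      have h1 := he₂i (hf₂i (hne v hv) (hne v' hv') h)
      rw [← inv3_inv3 v, h1, inv3_inv3]
    · obtain ⟨v, rfl⟩ := hxr
      have hv : v ≠ 0 := fun h => hx (by rw [h]; rfl)
      rw [hf₁e, hf₁n _ hxr'] at h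
      exact absurd h.symm (hsep _ hxr' _ (hne v hv))
    · obtain ⟨v, rfl⟩ := hxr'
      have hv : v ≠ 0 := fun h => hx' (by rw [h]; rfl)
      rw [hf₁e, hf₁n _ hxr] at h
      exact absurd h (hsep _ hxr _ (hne v hv))
    · rw [hf₁n _ hxr, hf₁n _ hxr'] at h
      exact hιi hxr hxr' h
  · rw [eq_univ_iff_forall]
    intro z
    rcases hcov z with ⟨x, hx, rfl⟩ | ⟨y, hy, rfl⟩
    · left
      exact ⟨x, fun h => hx ⟨0, h.symm⟩, hf₁n x hx⟩
    · right
      exact ⟨y, hy, rfl⟩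
  · intro x hx y hy
    constructor
    · intro h
      by_cases hxr : x ∈ range e₁
      · obtain ⟨v, rfl⟩ := hxr
        have hv : v ≠ 0 := fun h => hx (by rw [h]; rfl)
        rw [hf₁e] at h
        exact ⟨v, hv, rfl, (hf₂i (hne v hv) hy h).symm⟩
      · rw [hf₁n _ hxr] at h
        exact absurd h (hsep _ hxr _ hy)
    · rintro ⟨v, hv, rfl, rfl⟩
      exact hf₁e v

end ConnectedSum

/-! ### A radial compression of space -/

section Radial

/-- The factor `k` of the compression `v ↦ k(|v|²) v`: equal to `1` for `s ≤ 1`, and to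
`2 / √(1 + s)` for `s ≥ 2`. -/
def radialFactor (s : ℝ) : ℝ :=
  (1 - smoothTransition (s - 1)) + smoothTransition (s - 1) * (2 / √(1 + s))

lemma contDiffAt_radialFactor {s : ℝ} (hs : 0 ≤ s) : SmoothAt radialFactor s := by
  have h1 : SmoothAt (fun s => smoothTransition (s - 1)) s :=
    smoothTransition.contDiff.contDiffAt.comp s (by fun_prop)
  have h2 : SmoothAt (fun s => √(1 + s)) s :=
    (Real.contDiffAt_sqrt (by positivity)).comp s (by fun_prop)
  have h3 : √(1 + s) ≠ 0 := by positivity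
  exact (contDiffAt_const.sub h1).add (h1.mul (contDiffAt_const.div h2 h3))

lemma radialFactor_of_le {s : ℝ} (hs : s ≤ 1) : radialFactor s = 1 := by
  simp [radialFactor, smoothTransition.zero_of_nonpos (by linarith : s - 1 ≤ 0)]

lemma radialFactor_pos {s : ℝ} (hs : 0 ≤ s) : 0 < radialFactor s := by
  have h0 := smoothTransition.nonneg (s - 1)
  have h1 := smoothTransition.le_one (s - 1)
  have h2 : 0 < 2 / √(1 + s) := by positivity
  rcases h0.eq_or_lt with h | h
  · rw [radialFactor, ← h]; norm_num
  · rw [radialFactor]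
    have := mul_pos h h2
    linarith

/-- The compression `v ↦ k(|v|²) v` of space onto a ball of radius `2`. -/
def compress (v : E3) : E3 := radialFactor (‖v‖ ^ 2) • v

lemma compress_of_le {v : E3} (hv : ‖v‖ ≤ 1) : compress v = v := by
  rw [compress, radialFactor_of_le (by nlinarith [norm_nonneg v]), one_smul]

lemma contDiff_compress : Smooth compress := by
  rw [contDiff_iff_contDiffAt]
  intro v
  exact ((contDiffAt_radialFactor (sq_nonneg ‖v‖)).comp v
    (contDiff_norm_sq ℝ).contDiffAt).smul contDiffAt_id

lemma hasDerivAt_radial {r : ℝ} :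
    ∃ d : ℝ, 0 < d ∧ HasDerivAt (fun r => r * radialFactor (r ^ 2)) d r := by
  set s := r ^ 2 with hs
  set T := smoothTransition (s - 1) with hT
  set T' := deriv smoothTransition (s - 1) with hT'
  have hq : 0 < √(1 + s) := by positivity
  have hqq : √(1 + s) ^ 2 = 1 + s := sq_sqrt (by positivity)
  have hT0 : 0 ≤ T := smoothTransition.nonneg _
  have hT1 : T ≤ 1 := smoothTransition.le_one _
  have hT'0 : 0 ≤ T' := smoothTransition.monotone.deriv_nonneg
  have h1 : HasDerivAt (fun s => smoothTransition (s - 1)) T' s := by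
    have : HasDerivAt smoothTransition T' (s - 1) :=
      (smoothTransition.contDiff (n := 1)).differentiable (by simp) _ |>.hasDerivAt
    simpa [Function.comp_def] using this.comp s ((hasDerivAt_id s).sub_const 1)
  have h2 : HasDerivAt (fun s => 2 / √(1 + s)) (-(1 / √(1 + s) ^ 3)) s := by
    have h3 : HasDerivAt (fun s => √(1 + s)) (1 / (2 * √(1 + s))) s :=
      ((hasDerivAt_id s).const_add 1).sqrt (by simp; positivity)
    convert! (hasDerivAt_const s 2).div h3 hq.ne' using 1
    ring
  have h4 : HasDerivAt radialFactor (T' * (2 / √(1 + s) - 1) - T * (1 / √(1 + s) ^ 3)) s := by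
    convert! (h1.const_sub 1).add (h1.mul h2) using 1
    ring
  have h5 : HasDerivAt (fun r => r * radialFactor (r ^ 2))
      (radialFactor s + 2 * s * (T' * (2 / √(1 + s) - 1) - T * (1 / √(1 + s) ^ 3))) r := by
    have h6 : HasDerivAt (fun r => r ^ 2) (2 * r) r := by simpa using hasDerivAt_pow 2 r
    have h7 : HasDerivAt (fun r => radialFactor (r ^ 2)) (_ * (2 * r)) r :=
      HasDerivAt.comp (h₂ := radialFactor) r h4 h6
    convert! (hasDerivAt_id r).mul h7 using 1
    simp only [id]; ring
  refine ⟨_, ?_, h5⟩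
  have h6 : radialFactor s + 2 * s * (T' * (2 / √(1 + s) - 1) - T * (1 / √(1 + s) ^ 3))
      = (1 - T) + 2 * T / √(1 + s) ^ 3 + 2 * s * (T' * (2 / √(1 + s) - 1)) := by
    have : 2 / √(1 + s) = 2 * (1 + s) / √(1 + s) ^ 3 := by field_simp; exact hqq
    rw [radialFactor, this]; ring
  rw [h6]
  have h7 : 0 ≤ T' * (2 / √(1 + s) - 1) := by
    rcases le_or_gt s 2 with h | h
    · refine mul_nonneg hT'0 ?_
      have : √(1 + s) ≤ 2 := by rw [Real.sqrt_le_left (by norm_num)]; linarith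
      rw [sub_nonneg, le_div_iff₀ hq]; linarith
    · have : T' = 0 := by
        have h8 : smoothTransition =ᶠ[𝓝 (s - 1)] fun _ => 1 := by
          filter_upwards [lt_mem_nhds (by linarith : 1 < s - 1)] with x hx
          exact smoothTransition.one_of_one_le hx.le
        rw [hT', h8.deriv_eq]; simp
      rw [this, zero_mul]
  have h8 : 0 ≤ 2 * s * (T' * (2 / √(1 + s) - 1)) := by positivity
  rcases hT1.eq_or_lt with h | h
  · rw [h]; have : 0 < 2 * 1 / √(1 + s) ^ 3 := by positivity
    linarith
  · have : 0 ≤ 2 * T / √(1 + s) ^ 3 := by positivity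
    linarith

lemma norm_compress (v : E3) : ‖compress v‖ = ‖v‖ * radialFactor (‖v‖ ^ 2) := by
  rw [compress, norm_smul, Real.norm_of_nonneg (radialFactor_pos (sq_nonneg _)).le, mul_comm]

lemma strictMono_radial : StrictMono (fun r => r * radialFactor (r ^ 2)) := by
  apply strictMono_of_deriv_pos
  intro r
  obtain ⟨d, hd, h⟩ := hasDerivAt_radial
  rwa [h.deriv]

lemma compress_injective : Function.Injective compress := by
  intro v w h
  have h1 : ‖v‖ = ‖w‖ := by
    apply strictMono_radial.injective
    simp only
    rw [← norm_compress, ← norm_compress, h]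
  rw [compress, h1] at h
  exact smul_right_injective E3 (radialFactor_pos (sq_nonneg ‖w‖)).ne' h

lemma norm_compress_lt v : ‖compress v‖ < 2 := by
  rw [norm_compress]
  set r := ‖v‖ with hr
  set T := smoothTransition (r ^ 2 - 1) with hT
  have hT0 : 0 ≤ T := smoothTransition.nonneg _
  have hT1 : T ≤ 1 := smoothTransition.le_one _
  have h1 : r * (2 / √(1 + r ^ 2)) < 2 := by
    have : r < √(1 + r ^ 2) := Real.lt_sqrt_of_sq_lt (by linarith)
    rw [← mul_div_assoc, div_lt_iff₀ (by positivity)]; linarith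
  have h2 : r * radialFactor (r ^ 2) = (1 - T) * r + T * (r * (2 / √(1 + r ^ 2))) := by
    rw [radialFactor]; ring
  rw [h2]
  rcases hT1.eq_or_lt with h | h
  · rw [h]; linarith
  · have h3 : r ^ 2 - 1 < 1 := by
      by_contra! h4
      exact h.ne (smoothTransition.one_of_one_le h4)
    have h4 : r < 2 := by nlinarith
    nlinarith

lemma exists_equiv_compress (v : E3) :
    ∃ A : E3 ≃L[ℝ] E3, HasFDerivAt compress (A : E3 →L[ℝ] E3) v := by
  have hd := (contDiff_compress.differentiable (by simp) v).hasFDerivAt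
  have hk : DifferentiableAt ℝ radialFactor (‖v‖ ^ 2) :=
    (contDiffAt_radialFactor (sq_nonneg _)).differentiableAt (by simp)
  have hf : HasFDerivAt compress
      (radialFactor (‖v‖ ^ 2) • ContinuousLinearMap.id ℝ E3 +
        ((deriv radialFactor (‖v‖ ^ 2)) • (2 • innerSL ℝ v)).smulRight v) v :=
    HasFDerivAt.smul
      (HasDerivAt.comp_hasFDerivAt (h₂ := radialFactor) v hk.hasDerivAt
        (hasStrictFDerivAt_norm_sq v).hasFDerivAt) (hasFDerivAt_id v)
  have hk0 := radialFactor_pos (sq_nonneg ‖v‖)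
  have hinj : Function.Injective (fderiv ℝ compress v) := by
    rw [injective_iff_map_eq_zero]
    intro w hw
    rw [hf.fderiv] at hw
    have h1 : radialFactor (‖v‖ ^ 2) • w +
        (deriv radialFactor (‖v‖ ^ 2) * (2 * inner ℝ v w)) • v = 0 := by
      simpa [two_mul, mul_add] using hw
    obtain ⟨d, hd0, hd1⟩ := hasDerivAt_radial (r := ‖v‖)
    have hd2 : d = radialFactor (‖v‖ ^ 2) + deriv radialFactor (‖v‖ ^ 2) * 2 * ‖v‖ ^ 2 := by
      refine hd1.unique ?_
      have h6 : HasDerivAt (fun r => r ^ 2) (2 * ‖v‖) ‖v‖ := by simpa using hasDerivAt_pow 2 ‖v‖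
      have h7 : HasDerivAt (fun r => radialFactor (r ^ 2)) (_ * (2 * ‖v‖)) ‖v‖ :=
        HasDerivAt.comp (h₂ := radialFactor) ‖v‖ hk.hasDerivAt h6
      convert! (hasDerivAt_id ‖v‖).mul h7 using 1
      simp only [id]; ring
    have h2 : d * inner ℝ v w = 0 := by
      have := congrArg (fun x => inner ℝ v x) h1
      simp only [inner_add_right, inner_smul_right, real_inner_self_eq_norm_sq,
        inner_zero_right] at this
      rw [hd2]; linarith
    have h3 := (mul_eq_zero.1 h2).resolve_left hd0.ne'
    rw [h3] at h1
    simpa [hk0.ne'] using h1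
  let A := LinearEquiv.ofInjectiveEndo (fderiv ℝ compress v : E3 →ₗ[ℝ] E3) hinj
  refine ⟨A.toContinuousLinearEquiv, ?_⟩
  have : (A.toContinuousLinearEquiv : E3 →L[ℝ] E3) = fderiv ℝ compress v :=
    ContinuousLinearMap.ext fun _ => rfl
  rwa [this]

lemma exists_compress_homeomorph : ∃ e : OpenPartialHomeomorph E3 E3, e.source = univ ∧
    (e : E3 → E3) = compress ∧ ContDiffOn ℝ ∞ e.symm e.target :=
  exists_openPartialHomeomorph_of_injOn isOpen_univ contDiff_compress.contDiffOn
    compress_injective.injOn (fun v _ => exists_equiv_compress v)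

end Radial

/-! ### Coordinates on spheres -/

section Coordinates

/-- The second and third coordinates of a vector, as a complex number. -/
def cplx (v : E3) : ℂ := ⟨v 1, v 2⟩

/-- The vector with first coordinate `x` and remaining coordinates `u`. -/
def vec (x : ℝ) (u : ℂ) : E3 := !₂[x, u.re, u.im]

@[simp] theorem vec_zero (x : ℝ) (u : ℂ) : vec x u 0 = x := rfl

@[simp] theorem cplx_vec (x : ℝ) (u : ℂ) : cplx (vec x u) = u := rfl

@[simp] theorem vec_cplx (v : E3) : vec (v 0) (cplx v) = v := by
  ext i; fin_cases i <;> rfl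

lemma norm_sq_E3 (v : E3) : ‖v‖ ^ 2 = v 0 ^ 2 + ‖cplx v‖ ^ 2 := by
  rw [EuclideanSpace.norm_sq_eq, Fin.sum_univ_three, cplx, sq_norm, Complex.normSq_mk]
  simp only [norm_eq_abs, sq_abs]; ring

lemma norm_sq_vec (x : ℝ) (u : ℂ) : ‖vec x u‖ ^ 2 = x ^ 2 + ‖u‖ ^ 2 := by rw [norm_sq_E3]; simp

lemma contDiff_coord (i : Fin 3) : Smooth (fun v : E3 => v i) :=
  (EuclideanSpace.proj (𝕜 := ℝ) (i : Fin 3) : E3 →L[ℝ] ℝ).contDiff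

lemma contDiff_cplx : Smooth cplx :=
  equivRealProdCLM.symm.contDiff.comp ((contDiff_coord 1).prodMk (contDiff_coord 2))

lemma contDiff_vec : Smooth (fun p : ℝ × ℂ => vec p.1 p.2) := by
  rw [contDiff_euclidean]
  intro i
  fin_cases i
  · exact contDiff_fst
  · exact reCLM.contDiff.comp contDiff_snd
  · exact imCLM.contDiff.comp contDiff_snd

lemma cplx_smul (a : ℝ) (v : E3) : cplx (a • v) = a * cplx v := by apply Complex.ext <;> simp [cplx]

/-- A complex number as a vector of the euclidean plane. -/
def vec2 (z : ℂ) : 𝔼[2] := !₂[z.re, z.im]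

/-- A vector of the euclidean plane as a complex number. -/
def cplx2 (v : 𝔼[2]) : ℂ := ⟨v 0, v 1⟩

@[simp] theorem cplx2_vec2 (z : ℂ) : cplx2 (vec2 z) = z := rfl

@[simp] theorem vec2_cplx2 (v : 𝔼[2]) : vec2 (cplx2 v) = v := by
  ext i; fin_cases i <;> rfl

lemma norm_sq_vec2 (z : ℂ) : ‖vec2 z‖ ^ 2 = ‖z‖ ^ 2 := by
  rw [EuclideanSpace.norm_sq_eq, vec2, sq_norm, normSq_apply]
  simp
  ring

lemma norm_vec2 (z : ℂ) : ‖vec2 z‖ = ‖z‖ := by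
  have := norm_sq_vec2 z
  rwa [sq_eq_sq₀ (norm_nonneg _) (norm_nonneg _)] at this

lemma norm_cplx2 (v : 𝔼[2]) : ‖cplx2 v‖ = ‖v‖ := by rw [← norm_vec2, vec2_cplx2]

lemma contDiff_vec2 : Smooth vec2 := by
  rw [contDiff_euclidean]
  intro i
  fin_cases i
  · exact reCLM.contDiff
  · exact imCLM.contDiff

lemma contDiff_cplx2 : Smooth cplx2 :=
  equivRealProdCLM.symm.contDiff.comp
    ((EuclideanSpace.proj (𝕜 := ℝ) (0 : Fin 2) : 𝔼[2] →L[ℝ] ℝ).contDiff.prodMk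
      (EuclideanSpace.proj (𝕜 := ℝ) (1 : Fin 2) : 𝔼[2] →L[ℝ] ℝ).contDiff)

variable {E H N : Type*} [NormedAddCommGroup E] [NormedSpace ℝ E] [TopologicalSpace H]
    {I : ModelWithCorners ℝ E H} [TopologicalSpace N] [ChartedSpace H N]

/-- A map into a sphere is smooth if it is smooth as a map into euclidean space. -/
lemma contMDiffAt_sphere {d : ℕ} {f : N → Sph d} {x : N}
    (h : ContMDiffAt I 𝓘(ℝ, 𝔼[d + 1]) ∞
      (fun y => (f y : 𝔼[d + 1])) x) :
    ContMDiffAt I (𝓡 d) ∞ f x := by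
  have hfact : Fact (Module.finrank ℝ (𝔼[d + 1]) = d + 1) :=
    ⟨finrank_euclideanSpace_fin⟩
  rw [contMDiffAt_iff_target]
  refine ⟨(Topology.IsInducing.subtypeVal.continuousAt_iff).2 h.continuousAt, ?_⟩
  let v := f x
  let U : _ ≃ₗᵢ[ℝ] _ :=
    (OrthonormalBasis.fromOrthogonalSpanSingleton (𝕜 := ℝ)
        d (ne_zero_of_mem_unit_sphere (-v))).repr
  have h1 : SmoothAt (fun y => U (stereoToFun ((-v : Sph d) : 𝔼[d + 1]) y))
      (v : 𝔼[d + 1]) := by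
    refine U.contDiff.contDiffAt.comp _ ?_
    refine (contDiffOn_stereoToFun (n := ∞)).contDiffAt ?_
    refine IsOpen.mem_nhds ?_ ?_
    · exact isOpen_ne_fun (by fun_prop) (by fun_prop)
    · have := norm_eq_of_mem_sphere v
      norm_num
  exact ContMDiffAt.comp x (f := fun y => (f y : 𝔼[d + 1])) h1.contMDiffAt h

/-- The point of the sphere in a given direction (arbitrary for the zero vector). -/
def sphProj {d : ℕ} (w : 𝔼[d + 1]) : Sph d :=
  if h : w = 0 then ⟨EuclideanSpace.single 0 1, by simp⟩ else
    ⟨‖w‖⁻¹ • w, by simp [norm_smul, inv_mul_cancel₀ (norm_ne_zero_iff.2 h)]⟩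

lemma coe_sphProj {d : ℕ} {w : 𝔼[d + 1]} (h : w ≠ 0) :
    (sphProj w : 𝔼[d + 1]) = ‖w‖⁻¹ • w := by
  rw [sphProj, dif_neg h]

lemma coe_sphProj_of_norm {d : ℕ} {w : 𝔼[d + 1]} (h : ‖w‖ = 1) :
    (sphProj w : 𝔼[d + 1]) = w := by
  rw [coe_sphProj (by rw [← norm_ne_zero_iff, h]; norm_num), h]; simp

lemma sphProj_coe {d : ℕ} (v : Sph d) : sphProj (v : 𝔼[d + 1]) = v :=
  Subtype.ext (coe_sphProj_of_norm (norm_eq_of_mem_sphere v))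

lemma contMDiffAt_sphProj {d : ℕ} {w : 𝔼[d + 1]} (h : w ≠ 0) :
    ContMDiffAt 𝓘(ℝ, 𝔼[d + 1]) (𝓡 d) ∞ sphProj w := by
  apply contMDiffAt_sphere
  have h1 : SmoothAt (fun w : 𝔼[d + 1] => ‖w‖⁻¹ • w) w :=
    ((contDiffAt_norm ℝ h).inv (norm_ne_zero_iff.2 h)).smul contDiffAt_id
  refine (h1.congr_of_eventuallyEq ?_).contMDiffAt
  filter_upwards [isOpen_ne.mem_nhds h] with y hy
  exact coe_sphProj hy

end Coordinates

/-! ### The hole function -/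

section Hole

/-- The positive factor of the hole function. -/
def holeFactor (r s : ℝ) : ℝ :=
  (1 - smoothTransition (8 * s - 3)) * 4 + smoothTransition (8 * s - 3) / (s - r ^ 2)

/-- The hole function: it has the sign of `s - r²`, a simple zero at `s = r²`, and is
equal to `1` for `s ≥ 1/2`. -/
def holeProfile (r s : ℝ) : ℝ := (s - r ^ 2) * holeFactor r s

variable {r s : ℝ}

lemma holeFactor_of_le (hs : s ≤ 3 / 8) : holeFactor r s = 4 := by
  rw [holeFactor, smoothTransition.zero_of_nonpos (by linarith)]; simp

lemma holeFactor_of_ge (hs : 1 / 2 ≤ s) : holeFactor r s = (s - r ^ 2)⁻¹ := by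
  rw [holeFactor, smoothTransition.one_of_one_le (by linarith)]; simp

lemma holeProfile_of_ge (h0 : 0 < r) (hr : r ≤ 1 / 2) (hs : 1 / 2 ≤ s) : holeProfile r s = 1 := by
  rw [holeProfile, holeFactor_of_ge hs, mul_inv_cancel₀]; nlinarith

lemma holeFactor_pos (h0 : 0 < r) (hr : r ≤ 1 / 2) : 0 < holeFactor r s := by
  rcases le_or_gt s (3 / 8) with h | h
  · rw [holeFactor_of_le h]; norm_num
  · have h1 : 0 < s - r ^ 2 := by nlinarith
    have h3 := smoothTransition.le_one (8 * s - 3)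
    have h4 : 0 < smoothTransition (8 * s - 3) :=
      smoothTransition.pos_of_pos (by linarith)
    have h5 := div_pos h4 h1
    rw [holeFactor]; linarith

lemma contDiff_holeFactor (h0 : 0 < r) (hr : r ≤ 1 / 2) : Smooth (holeFactor r) := by
  rw [contDiff_iff_contDiffAt]
  intro s
  rcases lt_or_ge s (3 / 8) with h | h
  · refine (contDiffAt_const (c := (4 : ℝ))).congr_of_eventuallyEq ?_
    filter_upwards [gt_mem_nhds h] with x hx
    exact holeFactor_of_le hx.le
  · have h1 : s - r ^ 2 ≠ 0 := by nlinarith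
    have h2 : SmoothAt (fun s : ℝ => smoothTransition (8 * s - 3)) s :=
      smoothTransition.contDiff.contDiffAt.comp s (by fun_prop)
    exact ((contDiffAt_const.sub h2).mul contDiffAt_const).add
      (h2.div (contDiffAt_id.sub contDiffAt_const) h1)

lemma contDiff_holeProfile (h0 : 0 < r) (hr : r ≤ 1 / 2) : Smooth (holeProfile r) :=
  (contDiff_id.sub contDiff_const).mul (contDiff_holeFactor h0 hr)

lemma holeProfile_eq_zero_iff (h0 : 0 < r) (hr : r ≤ 1 / 2) : holeProfile r s = 0 ↔ s = r ^ 2 := by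
  rw [holeProfile, mul_eq_zero, or_iff_left (holeFactor_pos h0 hr).ne', sub_eq_zero]

lemma holeProfile_nonneg_iff (h0 : 0 < r) (hr : r ≤ 1 / 2) : 0 ≤ holeProfile r s ↔ r ^ 2 ≤ s := by
  rw [holeProfile, mul_nonneg_iff_of_pos_right (holeFactor_pos h0 hr), sub_nonneg]

lemma deriv_holeProfile (hr0 : 0 < r) (hr : r ≤ 1 / 2) : deriv (holeProfile r) (r ^ 2) ≠ 0 := by
  have h1 : holeProfile r =ᶠ[𝓝 (r ^ 2)] fun s => (s - r ^ 2) * 4 := by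
    filter_upwards [gt_mem_nhds (by nlinarith : r ^ 2 < 3 / 8)] with s hs
    rw [holeProfile, holeFactor_of_le hs.le]
  rw [h1.deriv_eq]; simp

end Hole

/-! ### The product of the circle and the two-sphere as a collapsed annulus -/

section Annulus

/-- `S¹ × S² → ℂ²`, onto `{|υ|² = (1 - |ζ|²) holeProfile(|ζ|²)}` over the annulus `r ≤ |ζ| ≤ 1`. -/
def ann (r : ℝ) (q : Sph 1 × Sph 2) : ℂ × ℂ :=
  (√(((1 - r ^ 2) * (q.2 : E3) 0 + 1 + r ^ 2) / 2) * cplx2 q.1,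
   ((1 - r ^ 2) / 2 * √(holeFactor r (((1 - r ^ 2) * (q.2 : E3) 0 + 1 + r ^ 2) / 2)) : ℝ)
    * cplx q.2)

/-- The inverse of `ann`. -/
def annInv (r : ℝ) (p : ℂ × ℂ) : Sph 1 × Sph 2 :=
  (sphProj (vec2 p.1),
   sphProj (vec ((2 * ‖p.1‖ ^ 2 - 1 - r ^ 2) / (1 - r ^ 2))
    ((2 / ((1 - r ^ 2) * √(holeFactor r (‖p.1‖ ^ 2))) : ℝ) * p.2)))

variable {r : ℝ}

lemma sph_norm_sq (q : Sph 2) : (q : E3) 0 ^ 2 + ‖cplx q‖ ^ 2 = 1 := by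
  rw [← norm_sq_E3]; norm_num

lemma sph_abs_le (q : Sph 2) : -1 ≤ (q : E3) 0 ∧ (q : E3) 0 ≤ 1 := by
  have := sph_norm_sq q
  constructor <;> nlinarith

lemma ann_norm_sq_fst (q : Sph 1 × Sph 2) :
    ‖(ann r q).1‖ ^ 2 = ((1 - r ^ 2) * (q.2 : E3) 0 + 1 + r ^ 2) / 2 := by
  have h1 := sph_abs_le q.2
  rw [ann, norm_mul, norm_cplx2, norm_eq_of_mem_sphere q.1, norm_coe,
    abs_of_nonneg (Real.sqrt_nonneg _), mul_one, sq_sqrt]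
  nlinarith

lemma ann_norm_sq_snd (h0 : 0 < r) (hr : r ≤ 1 / 2) (q : Sph 1 × Sph 2) :
    ‖(ann r q).2‖ ^ 2 = (1 - ‖(ann r q).1‖ ^ 2) * holeProfile r (‖(ann r q).1‖ ^ 2) := by
  rw [ann_norm_sq_fst (r := r)]
  set s := ((1 - r ^ 2) * (q.2 : E3) 0 + 1 + r ^ 2) / 2 with hs
  have h1 : (q.2 : E3) 0 = (2 * s - 1 - r ^ 2) / (1 - r ^ 2) := by
    have : 1 - r ^ 2 ≠ 0 := by nlinarith
    rw [hs]; field_simp; ring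
  have h2 := sph_norm_sq q.2
  have h3 : ‖cplx (q.2 : E3)‖ ^ 2 = 1 - ((2 * s - 1 - r ^ 2) / (1 - r ^ 2)) ^ 2 := by
    rw [← h1]; linarith
  have h4 : (1 - r ^ 2) ≠ 0 := by nlinarith
  rw [ann, norm_mul, norm_real, mul_pow, h3, norm_eq_abs, sq_abs, mul_pow,
    sq_sqrt (holeFactor_pos h0 hr).le, holeProfile, ← hs]
  field_simp; ring

lemma ann_fst_le (h0 : 0 < r) (hr : r ≤ 1 / 2) (q : Sph 1 × Sph 2) :
    r ^ 2 ≤ ‖(ann r q).1‖ ^ 2 ∧ ‖(ann r q).1‖ ^ 2 ≤ 1 := by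
  rw [ann_norm_sq_fst]
  have h1 := sph_abs_le q.2
  have hr2 : r ^ 2 ≤ 1 / 4 := by nlinarith
  constructor <;> nlinarith

lemma annInv_ann (h0 : 0 < r) (hr : r ≤ 1 / 2) (q : Sph 1 × Sph 2) :
    annInv r (ann r q) = q := by
  have hs := ann_norm_sq_fst (r := r) q
  have h4 : (1 - r ^ 2) ≠ 0 := by nlinarith
  have hpos := (ann_fst_le h0 hr q).1
  refine Prod.ext ?_ ?_
  · have h1 : vec2 (ann r q).1 = ‖(ann r q).1‖ • (q.1 : 𝔼[2]) := by
      have h2 : ‖(ann r q).1‖ = √(((1 - r ^ 2) * (q.2 : E3) 0 + 1 + r ^ 2) / 2) := by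
        rw [← hs, sqrt_sq (norm_nonneg _)]
      rw [h2]
      conv_rhs => rw [← vec2_cplx2 (q.1 : 𝔼[2])]
      rw [ann]
      ext i; fin_cases i <;> simp [vec2]
    have h3 : ‖(ann r q).1‖ ≠ 0 := by intro h; nlinarith
    have h5 := norm_eq_of_mem_sphere q.1
    apply Subtype.ext
    change (sphProj (vec2 (ann r q).1) : 𝔼[2]) = q.1
    rw [coe_sphProj, h1, norm_smul, h5, norm_norm, mul_one, smul_smul, inv_mul_cancel₀ h3, one_smul]
    rw [← norm_ne_zero_iff, norm_vec2]; exact h3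
  · have h1 : (2 * ‖(ann r q).1‖ ^ 2 - 1 - r ^ 2) / (1 - r ^ 2) = (q.2 : E3) 0 := by
      rw [hs]; field_simp; ring
    have h2 : ((2 / ((1 - r ^ 2) * √(holeFactor r (‖(ann r q).1‖ ^ 2))) : ℝ) : ℂ) * (ann r q).2
        = cplx q.2 := by
      rw [hs, ann, ← mul_assoc, ← ofReal_mul]
      have h6 : √(holeFactor r (((1 - r ^ 2) * (q.2 : E3) 0 + 1 + r ^ 2) / 2)) ≠ 0 :=
        (sqrt_pos.2 (holeFactor_pos h0 hr)).ne'
      have h7 : 2 / ((1 - r ^ 2) * √(holeFactor r (((1 - r ^ 2) * (q.2 : E3) 0 + 1 + r ^ 2) / 2)))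
          * ((1 - r ^ 2) / 2 * √(holeFactor r (((1 - r ^ 2) * (q.2 : E3) 0 + 1 + r ^ 2) / 2)))
          = 1 := by
        field_simp
      rw [h7]; simp
    change sphProj _ = q.2
    rw [h1, h2, vec_cplx, sphProj_coe]

lemma vec_annInv_norm (h0 : 0 < r) (hr : r ≤ 1 / 2) {p : ℂ × ℂ}
    (hp : ‖p.2‖ ^ 2 = (1 - ‖p.1‖ ^ 2) * holeProfile r (‖p.1‖ ^ 2)) :
    ‖vec ((2 * ‖p.1‖ ^ 2 - 1 - r ^ 2) / (1 - r ^ 2))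
    ((2 / ((1 - r ^ 2) * √(holeFactor r (‖p.1‖ ^ 2))) : ℝ) * p.2)‖ = 1 := by
  have h4 : (1 - r ^ 2) ≠ 0 := by nlinarith
  have h5 := holeFactor_pos (s := ‖p.1‖ ^ 2) h0 hr
  rw [← sq_eq_sq₀ (norm_nonneg _) zero_le_one, norm_sq_vec, norm_mul, mul_pow, hp, holeProfile,
    norm_coe, sq_abs, div_pow (2 : ℝ), mul_pow, sq_sqrt h5.le]
  field_simp; ring

lemma ann_annInv (h0 : 0 < r) (hr : r ≤ 1 / 2) {p : ℂ × ℂ} (hp1 : p.1 ≠ 0)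
    (hp : ‖p.2‖ ^ 2 = (1 - ‖p.1‖ ^ 2) * holeProfile r (‖p.1‖ ^ 2)) :
    ann r (annInv r p) = p := by
  have h4 : (1 - r ^ 2) ≠ 0 := by nlinarith
  have hv := vec_annInv_norm h0 hr hp
  have h2 : ((annInv r p).2 : E3) = vec ((2 * ‖p.1‖ ^ 2 - 1 - r ^ 2) / (1 - r ^ 2))
    ((2 / ((1 - r ^ 2) * √(holeFactor r (‖p.1‖ ^ 2))) : ℝ) * p.2) := coe_sphProj_of_norm hv
  have h1 : ((annInv r p).1 : 𝔼[2]) = ‖p.1‖⁻¹ • vec2 p.1 := by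
    have : vec2 p.1 ≠ 0 := by rw [← norm_ne_zero_iff, norm_vec2, norm_ne_zero_iff]; exact hp1
    rw [← norm_vec2]; exact coe_sphProj this
  have h3 : ((1 - r ^ 2) * ((annInv r p).2 : E3) 0 + 1 + r ^ 2) / 2 = ‖p.1‖ ^ 2 := by
    rw [h2, vec_zero]; field_simp; ring
  have h6 := norm_ne_zero_iff.2 hp1
  refine Prod.ext ?_ ?_
  · simp only [ann]
    rw [h3, sqrt_sq (norm_nonneg _), h1]
    have : cplx2 (‖p.1‖⁻¹ • vec2 p.1) = (‖p.1‖⁻¹ : ℝ) * p.1 := by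
      apply Complex.ext <;> simp [cplx2, vec2]
    rw [this, ← mul_assoc, ← ofReal_mul, mul_inv_cancel₀ h6]; simp
  · simp only [ann]
    rw [h3, h2, cplx_vec, ← mul_assoc, ← ofReal_mul]
    have h7 := (sqrt_pos.2 (holeFactor_pos (s := ‖p.1‖ ^ 2) h0 hr)).ne'
    have : (1 - r ^ 2) / 2 * √(holeFactor r (‖p.1‖ ^ 2)) *
        (2 / ((1 - r ^ 2) * √(holeFactor r (‖p.1‖ ^ 2)))) = 1 := by field_simp
    rw [this]; simp

lemma contMDiff_ann (h0 : 0 < r) (hr : r ≤ 1 / 2) :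
    ContMDiff ((𝓡 1).prod (𝓡 2)) 𝓘(ℝ, ℂ × ℂ) ∞ (ann r) := by
  have hfact1 : Fact (Module.finrank ℝ (𝔼[1 + 1]) = 1 + 1) :=
    ⟨finrank_euclideanSpace_fin⟩
  have hfact2 : Fact (Module.finrank ℝ (𝔼[2 + 1]) = 2 + 1) :=
    ⟨finrank_euclideanSpace_fin⟩
  intro q
  let f : 𝔼[2] × E3 → ℂ × ℂ := fun q =>
    (√(((1 - r ^ 2) * q.2 0 + 1 + r ^ 2) / 2) * cplx2 q.1,
     ((1 - r ^ 2) / 2 * √(holeFactor r (((1 - r ^ 2) * q.2 0 + 1 + r ^ 2) / 2)) : ℝ)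
      * cplx q.2)
  have hq := sph_abs_le q.2
  have hr2 : r ^ 2 ≤ 1 / 4 := by nlinarith
  have hs : 0 < ((1 - r ^ 2) * (q.2 : E3) 0 + 1 + r ^ 2) / 2 := by nlinarith
  have hin : Smooth (fun q : 𝔼[2] × E3 =>
      ((1 - r ^ 2) * q.2 0 + 1 + r ^ 2) / 2) := by
    have := (contDiff_coord 0).comp (contDiff_snd (𝕜 := ℝ) (E := 𝔼[2]) (F := E3)
      (n := ∞))
    exact (((contDiff_const.mul this).add contDiff_const).add contDiff_const).div_const _
  have hf : SmoothAt f ((q.1 : 𝔼[2]), (q.2 : E3)) := by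
    refine ContDiffAt.prodMk ?_ ?_
    · refine ContDiffAt.mul (ofRealCLM.contDiff.contDiffAt.comp _
        (hin.contDiffAt.sqrt hs.ne')) ?_
      exact (contDiff_cplx2.comp contDiff_fst).contDiffAt
    · refine ContDiffAt.mul (ofRealCLM.contDiff.contDiffAt.comp _
        (contDiffAt_const.mul ?_)) ((contDiff_cplx.comp contDiff_snd).contDiffAt)
      exact ((contDiff_holeFactor h0 hr).comp hin).contDiffAt.sqrt (holeFactor_pos h0 hr).ne'
  have hc : ContMDiffAt ((𝓡 1).prod (𝓡 2)) 𝓘(ℝ, 𝔼[2] × E3) ∞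
      (fun q : Sph 1 × Sph 2 => ((q.1 : 𝔼[2]), (q.2 : E3))) q := by
    refine ContMDiffAt.prodMk_space ?_ ?_
    · exact (contMDiff_coe_sphere (n := 1) (E := 𝔼[2])).contMDiffAt.comp q
        contMDiffAt_fst
    · exact (contMDiff_coe_sphere (n := 2) (E := E3)).contMDiffAt.comp q contMDiffAt_snd
  exact hf.contMDiffAt.comp q hc

lemma contMDiffAt_annInv (h0 : 0 < r) (hr : r ≤ 1 / 2) {p : ℂ × ℂ} (hp1 : p.1 ≠ 0)
    (hp : ‖p.2‖ ^ 2 = (1 - ‖p.1‖ ^ 2) * holeProfile r (‖p.1‖ ^ 2)) :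
    ContMDiffAt 𝓘(ℝ, ℂ × ℂ) ((𝓡 1).prod (𝓡 2)) ∞ (annInv r) p := by
  have h4 : (1 - r ^ 2) ≠ 0 := by nlinarith
  refine ContMDiffAt.prodMk ?_ ?_
  · have h1 := (contDiff_vec2.comp contDiff_fst).contMDiff p
    have h2 : vec2 p.1 ≠ 0 := by rw [← norm_ne_zero_iff, norm_vec2, norm_ne_zero_iff]; exact hp1
    exact (contMDiffAt_sphProj h2).comp p h1
  · have hn : Smooth (fun p : ℂ × ℂ => ‖p.1‖ ^ 2) := (contDiff_norm_sq ℝ).comp contDiff_fst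
    have h5 := holeFactor_pos (s := ‖p.1‖ ^ 2) h0 hr
    have h1 : SmoothAt (fun p : ℂ × ℂ => (((2 * ‖p.1‖ ^ 2 - 1 - r ^ 2) / (1 - r ^ 2) : ℝ),
      ((2 / ((1 - r ^ 2) * √(holeFactor r (‖p.1‖ ^ 2))) : ℝ) : ℂ) * p.2)) p := by
      refine ContDiffAt.prodMk ?_ ?_
      · exact ((((contDiff_const.mul hn).sub contDiff_const).sub
          contDiff_const).div_const _).contDiffAt
      · refine ContDiffAt.mul (ofRealCLM.contDiff.contDiffAt.comp _
          (contDiffAt_const.div (contDiffAt_const.mul ?_) ?_)) contDiff_snd.contDiffAt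
        · exact ((contDiff_holeFactor h0 hr).comp hn).contDiffAt.sqrt h5.ne'
        · exact mul_ne_zero h4 (sqrt_pos.2 h5).ne'
    have h2 := (contDiff_vec.contDiffAt.comp p h1).contMDiffAt
    have h3 : vec ((2 * ‖p.1‖ ^ 2 - 1 - r ^ 2) / (1 - r ^ 2))
        ((2 / ((1 - r ^ 2) * √(holeFactor r (‖p.1‖ ^ 2))) : ℝ) * p.2) ≠ 0 := by
      rw [← norm_ne_zero_iff, vec_annInv_norm h0 hr hp]; norm_num
    exact (contMDiffAt_sphProj h3).comp p h2

end Annulus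

/-! ### Punching a hole -/

/-- A region of the plane (the source of `m`) with a diffeomorphism `m` onto a neighbourhood of
the closed unit disc minus the boundary point `1`, and the radius `r` of a concentric disc. -/
structure Cell where
  m : OpenPartialHomeomorph ℂ ℂ
  smooth : ContDiffOn ℝ ∞ m m.source
  smooth_symm : ContDiffOn ℝ ∞ m.symm m.target
  disc_subset : Metric.closedBall 0 1 \ {1} ⊆ m.target
  one_notMem : (1 : ℂ) ∉ m.target
  r : ℝ
  r_pos : 0 < r
  r_le : r ≤ 1 / 2

namespace Cell

variable (C : Cell)

open Classical in
/-- The function whose zero set is the circle `|m| = r`, and which is `1` away from the hole. -/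
def hole (z : ℂ) : ℝ := if z ∈ C.m.source then holeProfile C.r (‖C.m z‖ ^ 2) else 1

lemma hole_of_mem {z : ℂ} (hz : z ∈ C.m.source) : C.hole z = holeProfile C.r (‖C.m z‖ ^ 2) :=
  if_pos hz

lemma hole_of_notMem {z : ℂ} (hz : z ∉ C.m.source) : C.hole z = 1 := if_neg hz

/-- The part of the region that is mapped to the disc `|m|² ≤ 1/2`. -/
def core : Set ℂ := C.m.symm '' Metric.closedBall 0 (√(1 / 2))

lemma closedBall_subset : Metric.closedBall 0 (√(1 / 2)) ⊆ C.m.target := by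
  intro z hz
  have h1 : √(1 / 2) < 1 := by rw [Real.sqrt_lt' one_pos]; norm_num
  have h2 : ‖z‖ ≤ √(1 / 2) := by simpa using hz
  refine C.disc_subset ⟨by simpa using h2.trans h1.le, ?_⟩
  rintro rfl
  simp only [norm_one] at h2
  linarith

lemma isClosed_core : IsClosed C.core :=
  ((isCompact_closedBall _ _).image_of_continuousOn
    (C.smooth_symm.continuousOn.mono C.closedBall_subset)).isClosed

lemma core_subset : C.core ⊆ C.m.source := by
  rintro _ ⟨z, hz, rfl⟩
  exact C.m.map_target (C.closedBall_subset hz)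

lemma mem_core_iff {z : ℂ} (hz : z ∈ C.m.source) : z ∈ C.core ↔ ‖C.m z‖ ^ 2 ≤ 1 / 2 := by
  have h : ‖C.m z‖ ^ 2 ≤ 1 / 2 ↔ C.m z ∈ Metric.closedBall 0 (√(1 / 2)) := by
    rw [mem_closedBall_zero_iff, Real.le_sqrt (norm_nonneg _) (by norm_num)]
  rw [h]
  constructor
  · rintro ⟨w, hw, rfl⟩
    rwa [C.m.right_inv (C.closedBall_subset hw)]
  · exact fun h => ⟨_, h, C.m.left_inv hz⟩

lemma hole_of_notMem_core {z : ℂ} (hz : z ∉ C.core) : C.hole z = 1 := by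
  by_cases h : z ∈ C.m.source
  · rw [C.hole_of_mem h, holeProfile_of_ge C.r_pos C.r_le]
    rw [C.mem_core_iff h] at hz
    linarith
  · exact C.hole_of_notMem h

lemma contDiff_hole : Smooth C.hole := by
  rw [contDiff_iff_contDiffAt]
  intro z
  by_cases hz : z ∈ C.m.source
  · have h1 := C.smooth.contDiffAt (C.m.open_source.mem_nhds hz)
    have h2 : SmoothAt (fun z => holeProfile C.r (‖C.m z‖ ^ 2)) z :=
      (contDiff_holeProfile C.r_pos C.r_le).contDiffAt.comp z
        ((contDiff_norm_sq ℝ).contDiffAt.comp z h1)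
    refine h2.congr_of_eventuallyEq ?_
    filter_upwards [C.m.open_source.mem_nhds hz] with y hy
    exact C.hole_of_mem hy
  · refine (contDiffAt_const (c := 1)).congr_of_eventuallyEq ?_
    filter_upwards [C.isClosed_core.isOpen_compl.mem_nhds (fun h => hz (C.core_subset h))] with y hy
    exact C.hole_of_notMem_core hy

lemma fderiv_hole_ne_zero {z : ℂ} (hz : C.hole z = 0) : fderiv ℝ C.hole z ≠ 0 := by
  have hs : z ∈ C.m.source := by
    by_contra h
    rw [C.hole_of_notMem h] at hz
    exact one_ne_zero hz
  have hr : ‖C.m z‖ ^ 2 = C.r ^ 2 := by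
    rwa [C.hole_of_mem hs, holeProfile_eq_zero_iff C.r_pos C.r_le] at hz
  have ht := C.m.map_source hs
  -- Differentiate along the curve `s ↦ m⁻¹ (s m(z))`.
  have h1 := C.smooth_symm.contDiffAt (C.m.open_target.mem_nhds ht)
  have h2 : HasDerivAt (fun s : ℝ => s • C.m z) (C.m z) 1 := by
    simpa using (hasDerivAt_id (1 : ℝ)).smul_const (C.m z)
  have h1' : HasFDerivAt C.m.symm (fderiv ℝ C.m.symm (C.m z)) ((1 : ℝ) • C.m z) := by
    rw [one_smul]; exact (h1.differentiableAt (by simp)).hasFDerivAt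
  have h4 : HasFDerivAt C.hole (fderiv ℝ C.hole z) (C.m.symm ((1 : ℝ) • C.m z)) := by
    rw [one_smul, C.m.left_inv hs]
    exact (C.contDiff_hole.differentiable (by simp) z).hasFDerivAt
  have h5 :=
      HasFDerivAt.comp_hasDerivAt (f := fun s : ℝ => C.m.symm (s • C.m z)) (1 : ℝ)
      h4 (h1'.comp_hasDerivAt 1 h2)
  have h6 : (fun s => C.hole (C.m.symm (s • C.m z))) =ᶠ[𝓝 1]
      fun s => holeProfile C.r (s ^ 2 * C.r ^ 2) := by
    have hn : C.m.target ∈ 𝓝 ((1 : ℝ) • C.m z) := by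
      rw [one_smul]; exact C.m.open_target.mem_nhds ht
    filter_upwards [h2.continuousAt.preimage_mem_nhds hn] with s hs
    rw [C.hole_of_mem (C.m.map_target hs), C.m.right_inv hs, norm_smul, mul_pow, hr,
      norm_eq_abs, sq_abs]
  have h7 : HasDerivAt (fun s => holeProfile C.r (s ^ 2 * C.r ^ 2))
      (deriv (holeProfile C.r) (C.r ^ 2) * (2 * C.r ^ 2)) 1 := by
    have h8 : HasDerivAt (fun s => s ^ 2 * C.r ^ 2) (2 * C.r ^ 2) 1 := by
      simpa using (hasDerivAt_pow 2 1).mul_const (C.r ^ 2)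
    have h9 : HasDerivAt (holeProfile C.r) (deriv (holeProfile C.r) (C.r ^ 2))
        (1 ^ 2 * C.r ^ 2) := by
      rw [one_pow, one_mul]
      exact ((contDiff_holeProfile C.r_pos C.r_le).differentiable (by simp) _).hasDerivAt
    exact HasDerivAt.comp (1 : ℝ) h9 h8
  have h10 := h5.unique (h7.congr_of_eventuallyEq h6)
  intro h0
  rw [h0] at h10
  have h11 : deriv (holeProfile C.r) (C.r ^ 2) * (2 * C.r ^ 2) ≠ 0 :=
    mul_ne_zero (deriv_holeProfile C.r_pos C.r_le) (by have := C.r_pos; positivity)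
  exact h11 h10.symm

/-- The domain `D` looks in the cell like the unit disc near its boundary, up to the positive
factor `lam²`. -/
structure Fits (D : RegDomain) (lam : ℂ → ℝ) : Prop where
  smooth : ContDiffOn ℝ ∞ lam C.m.source
  pos : ∀ z ∈ C.m.source, 0 < lam z
  eq : ∀ z ∈ C.m.source, D.g z = lam z ^ 2 * (1 - ‖C.m z‖ ^ 2)

end Cell

/-- The domain `D` with a hole punched in the cell `C`. -/
def RegDomain.punch (D : RegDomain) (C : Cell) {lam : ℂ → ℝ} (h : C.Fits D lam) : RegDomain where
  g z := D.g z * C.hole z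
  smooth := D.smooth.mul C.contDiff_hole
  regular z hz := by
    have h1 : fderiv ℝ (fun z => D.g z * C.hole z) z =
        D.g z • fderiv ℝ C.hole z + C.hole z • fderiv ℝ D.g z :=
      fderiv_fun_mul (D.smooth.differentiable (by simp) z)
        (C.contDiff_hole.differentiable (by simp) z)
    rw [h1]
    have hboth : ¬ (D.g z = 0 ∧ C.hole z = 0) := by
      rintro ⟨ha, hb⟩
      have hs : z ∈ C.m.source := by
        by_contra h
        rw [C.hole_of_notMem h] at hb
        exact one_ne_zero hb
      rw [C.hole_of_mem hs, holeProfile_eq_zero_iff C.r_pos C.r_le] at hb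
      rw [h.eq z hs, hb] at ha
      have h2 := h.pos z hs
      have h3 : 0 < 1 - C.r ^ 2 := by nlinarith [C.r_pos, C.r_le]
      have := mul_pos (pow_pos h2 2) h3
      linarith
    rcases mul_eq_zero.1 hz with h2 | h2
    · rw [h2, zero_smul, zero_add]
      exact smul_ne_zero (fun h3 => hboth ⟨h2, h3⟩) (D.regular z h2)
    · rw [h2, zero_smul, add_zero]
      exact smul_ne_zero (fun h3 => hboth ⟨h3, h2⟩) (C.fderiv_hole_ne_zero h2)

namespace RegDomain

variable (D : RegDomain)

open Classical in
/-- The point of the hypersurface with given coordinates, if they satisfy the equation. -/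
def lift [Nonempty D.Mfd] (p : ℂ × ℂ) : D.Mfd :=
  if h : ‖p.2‖ ^ 2 = D.g p.1 then ofCoord p.1 p.2 h else Classical.arbitrary _

lemma val_lift [Nonempty D.Mfd] {p : ℂ × ℂ} (h : ‖p.2‖ ^ 2 = D.g p.1) :
    D.val (D.lift p) = p := by
  rw [lift, dif_pos h, val_ofCoord]

lemma lift_val [Nonempty D.Mfd] x : D.lift (D.val x) = x :=
  D.val_injective (D.val_lift (D.val_prop x))

end RegDomain

/-! ### Stereographic projection of the three-sphere in `ℂ²` -/

/-- The inverse of the stereographic projection of `S³ ⊂ ℂ²` which sends `0` to `(1, 0)`; the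
scale `6` is such that the ball of radius `2` stays outside `|ζ|² ≤ 1/2`. -/
def stereoA (y : E3) : ℂ × ℂ :=
  (⟨(36 - ‖y‖ ^ 2) / (36 + ‖y‖ ^ 2), 12 * y 0 / (36 + ‖y‖ ^ 2)⟩,
    (12 / (36 + ‖y‖ ^ 2) : ℝ) * cplx y)

/-- The inverse of the stereographic projection of `S³ ⊂ ℂ²` which sends `∞` to `(1, 0)`. -/
def stereoB (y : E3) : ℂ × ℂ :=
  (⟨(36 * ‖y‖ ^ 2 - 1) / (36 * ‖y‖ ^ 2 + 1), 12 * y 0 / (36 * ‖y‖ ^ 2 + 1)⟩,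
    (12 / (36 * ‖y‖ ^ 2 + 1) : ℝ) * cplx y)

lemma stereoB_re y : (stereoB y).1.re = (36 * ‖y‖ ^ 2 - 1) / (36 * ‖y‖ ^ 2 + 1) :=
  rfl

lemma stereoB_im y : (stereoB y).1.im = 12 * y 0 / (36 * ‖y‖ ^ 2 + 1) :=
  rfl

lemma stereoA_re y : (stereoA y).1.re = (36 - ‖y‖ ^ 2) / (36 + ‖y‖ ^ 2) :=
  rfl

lemma stereoA_im y : (stereoA y).1.im = 12 * y 0 / (36 + ‖y‖ ^ 2) :=
  rfl

lemma stereoB_snd y : ‖(stereoB y).2‖ ^ 2 = 1 - ‖(stereoB y).1‖ ^ 2 := by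
  have h2 : ‖cplx y‖ ^ 2 = ‖y‖ ^ 2 - y 0 ^ 2 := by rw [norm_sq_E3]; ring
  rw [sq_norm (stereoB y).1, normSq_apply, stereoB_im]
  rw [stereoB, norm_mul, mul_pow, h2, norm_coe, sq_abs]
  field_simp; ring

lemma stereoA_snd y : ‖(stereoA y).2‖ ^ 2 = 1 - ‖(stereoA y).1‖ ^ 2 := by
  have h2 : ‖cplx y‖ ^ 2 = ‖y‖ ^ 2 - y 0 ^ 2 := by rw [norm_sq_E3]; ring
  rw [sq_norm (stereoA y).1, normSq_apply, stereoA_im]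
  rw [stereoA, norm_mul, mul_pow, h2, norm_coe, sq_abs]
  field_simp; ring

lemma stereoA_inv3 {y : E3} (hy : y ≠ 0) : stereoA (inv3 y) = stereoB y := by
  have h1 : inv3 y 0 = y 0 / ‖y‖ ^ 2 := by simp [inv3]; ring
  refine Prod.ext (Complex.ext ?_ ?_) ?_
  · rw [stereoA_re, stereoB_re, norm_inv3]; field_simp
  · rw [stereoA_im, stereoB_im, norm_inv3, h1]; field_simp
  · rw [stereoA]
    simp only
    rw [norm_inv3, inv3, cplx_smul, ← mul_assoc, ← ofReal_mul]
    congr 2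
    field_simp

lemma contDiff_complexMk {a b : E → ℝ}
    (ha : Smooth a) (hb : Smooth b) : Smooth (fun x => (⟨a x, b x⟩ : ℂ)) :=
  equivRealProdCLM.symm.contDiff.comp (ha.prodMk hb)

lemma contDiffAt_cdiv {f g : E → ℂ} {x : E}
    (hf : SmoothAt f x) (hg : SmoothAt g x) (h : g x ≠ 0) :
    SmoothAt (fun y => f y / g y) x := by
  exact hf.mul (hg.inv h)

lemma contDiff_stereoA : Smooth stereoA := by
  have hn : Smooth (fun y : E3 => ‖y‖ ^ 2) := contDiff_norm_sq ℝ
  have h1 : Smooth (fun y => 36 + ‖y‖ ^ 2) := contDiff_const.add hn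
  have h2 : ∀ y : E3, 36 + ‖y‖ ^ 2 ≠ 0 := fun y => by positivity
  have h3 : Smooth (fun y => ((12 / (36 + ‖y‖ ^ 2) : ℝ) : ℂ)) :=
    ofRealCLM.contDiff.comp (contDiff_const.div h1 h2)
  exact (contDiff_complexMk ((contDiff_const.sub hn).div h1 h2)
    ((contDiff_const.mul (contDiff_coord 0)).div h1 h2)).prodMk (h3.mul contDiff_cplx)

lemma contDiff_stereoB : Smooth stereoB := by
  have hn : Smooth (fun y : E3 => 36 * ‖y‖ ^ 2) := contDiff_const.mul (contDiff_norm_sq ℝ)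
  have h1 : Smooth (fun y => 36 * ‖y‖ ^ 2 + 1) := hn.add contDiff_const
  have h2 : ∀ y : E3, 36 * ‖y‖ ^ 2 + 1 ≠ 0 := fun y => by positivity
  have h3 : Smooth (fun y => ((12 / (36 * ‖y‖ ^ 2 + 1) : ℝ) : ℂ)) :=
    ofRealCLM.contDiff.comp (contDiff_const.div h1 h2)
  exact (contDiff_complexMk ((hn.sub contDiff_const).div h1 h2)
    ((contDiff_const.mul (contDiff_coord 0)).div h1 h2)).prodMk (h3.mul contDiff_cplx)

/-- The stereographic projection inverse to `stereoB`. -/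
def projB (p : ℂ × ℂ) : E3 := (6 * (1 - p.1.re))⁻¹ • vec p.1.im p.2

/-- The stereographic projection inverse to `stereoA`. -/
def projA (p : ℂ × ℂ) : E3 := (6 / (1 + p.1.re)) • vec p.1.im p.2

lemma vec_mul_mul (a x : ℝ) u : vec (a * x) (a * u) = a • vec x u := by
  ext i; fin_cases i <;> simp [vec]

lemma projB_stereoB y : projB (stereoB y) = y := by
  have h1 : (6 * (1 - (stereoB y).1.re))⁻¹ = (36 * ‖y‖ ^ 2 + 1) / 12 := by
    rw [stereoB_re]; field_simp; ring
  have h2 : vec (stereoB y).1.im (stereoB y).2 = (12 / (36 * ‖y‖ ^ 2 + 1)) • y := by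
    rw [stereoB, ← vec_cplx y, ← vec_mul_mul, vec_cplx, mul_div_right_comm]
  rw [projB, h1, h2, smul_smul]
  have : (36 * ‖y‖ ^ 2 + 1) / 12 * (12 / (36 * ‖y‖ ^ 2 + 1)) = 1 := by field_simp
  rw [this, one_smul]

lemma projA_stereoA y : projA (stereoA y) = y := by
  have h1 : 6 / (1 + (stereoA y).1.re) = (36 + ‖y‖ ^ 2) / 12 := by rw [stereoA_re]; field_simp; ring
  have h2 : vec (stereoA y).1.im (stereoA y).2 = (12 / (36 + ‖y‖ ^ 2)) • y := by
    rw [stereoA, ← vec_cplx y, ← vec_mul_mul, vec_cplx, mul_div_right_comm]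
  rw [projA, h1, h2, smul_smul]
  have : (36 + ‖y‖ ^ 2) / 12 * (12 / (36 + ‖y‖ ^ 2)) = 1 := by field_simp
  rw [this, one_smul]

lemma stereoB_projB {p : ℂ × ℂ} (hp : ‖p.2‖ ^ 2 = 1 - ‖p.1‖ ^ 2) (h1 : p.1.re ≠ 1) :
    stereoB (projB p) = p := by
  have hN : 36 * ‖projB p‖ ^ 2 = (1 + p.1.re) / (1 - p.1.re) := by
    rw [projB, norm_smul, mul_pow, norm_sq_vec, hp, sq_norm, normSq_apply,
      norm_eq_abs, sq_abs]
    field_simp; ring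
  have hN1 : 36 * ‖projB p‖ ^ 2 + 1 = 2 / (1 - p.1.re) := by rw [hN]; field_simp; ring
  refine Prod.ext (Complex.ext ?_ ?_) ?_
  · rw [stereoB_re, hN]; field_simp; ring
  · rw [stereoB_im, hN1, projB]; simp; field_simp; ring
  · rw [stereoB]
    rw [hN1, projB, cplx_smul, ← mul_assoc, ← ofReal_mul]
    have : 12 / (2 / (1 - p.1.re)) * (6 * (1 - p.1.re))⁻¹ = 1 := by field_simp; norm_num
    rw [this]; simp

lemma stereoA_projA {p : ℂ × ℂ} (hp : ‖p.2‖ ^ 2 = 1 - ‖p.1‖ ^ 2) (h1 : p.1.re ≠ -1) :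
    stereoA (projA p) = p := by
  have h2 : 1 + p.1.re ≠ 0 := fun h => h1 (by linarith)
  have hN : ‖projA p‖ ^ 2 = 36 * (1 - p.1.re) / (1 + p.1.re) := by
    rw [projA, norm_smul, mul_pow, norm_sq_vec, hp, sq_norm, normSq_apply,
      norm_eq_abs, sq_abs]
    field_simp; ring
  have hN1 : 36 + ‖projA p‖ ^ 2 = 72 / (1 + p.1.re) := by rw [hN]; field_simp; ring
  refine Prod.ext (Complex.ext ?_ ?_) ?_
  · rw [stereoA_re, hN]; field_simp; ring
  · rw [stereoA_im, hN1, projA]; simp; field_simp; ring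
  · rw [stereoA]
    rw [hN1, projA, cplx_smul, ← mul_assoc, ← ofReal_mul]
    have : 12 / (72 / (1 + p.1.re)) * (6 / (1 + p.1.re)) = 1 := by field_simp; norm_num
    rw [this]; simp

lemma contDiffAt_vec_im p : SmoothAt (fun p : ℂ × ℂ => vec p.1.im p.2) p :=
  contDiff_vec.contDiffAt.comp p
    (((imCLM.contDiff.comp contDiff_fst).prodMk contDiff_snd).contDiffAt)

lemma contDiffAt_projB {p : ℂ × ℂ} (h1 : p.1.re ≠ 1) : SmoothAt projB p := by
  have hre : SmoothAt (fun p => p.1.re) p :=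
    (reCLM.contDiff.comp contDiff_fst).contDiffAt
  exact ((contDiffAt_const.mul (contDiffAt_const.sub hre)).inv
    (mul_ne_zero (by norm_num) (sub_ne_zero.2 h1.symm))).smul (contDiffAt_vec_im p)

lemma contDiffAt_projA {p : ℂ × ℂ} (h1 : p.1.re ≠ -1) : SmoothAt projA p := by
  have hre : SmoothAt (fun p => p.1.re) p :=
    (reCLM.contDiff.comp contDiff_fst).contDiffAt
  exact (contDiffAt_const.div (contDiffAt_const.add hre)
    (fun h => h1 (by linarith))).smul (contDiffAt_vec_im p)

/-- The ball of radius `2` is mapped to the region `|ζ|² > 1/2`. -/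
lemma half_lt_stereoA {y : E3} (hy : ‖y‖ < 2) : 1 / 2 < ‖(stereoA y).1‖ ^ 2 := by
  have h := stereoA_snd y
  have h1 : ‖(stereoA y).2‖ ^ 2 < 1 / 2 := by
    have h2 : ‖cplx y‖ ^ 2 ≤ ‖y‖ ^ 2 := by rw [norm_sq_E3]; nlinarith
    have h3 : ‖y‖ ^ 2 < 4 := by nlinarith [norm_nonneg y]
    rw [stereoA, norm_mul, mul_pow, norm_coe, sq_abs, div_pow,
      div_mul_eq_mul_div, div_lt_iff₀ (by positivity)]
    nlinarith
  linarith

lemma stereoB_fst_mem y : (stereoB y).1 ∈ Metric.closedBall (0 : ℂ) 1 \ {1} := by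
  constructor
  · have h := stereoB_snd y
    rw [mem_closedBall_zero_iff]; nlinarith [norm_nonneg (stereoB y).1]
  · intro h
    have h1 : (stereoB y).1.re = 1 := by rw [mem_singleton_iff.1 h]; rfl
    rw [stereoB_re, div_eq_one_iff_eq (by positivity)] at h1
    linarith

lemma stereoA_re_ne y : (stereoA y).1.re ≠ -1 := by
  rw [stereoA_re]
  have : 0 < 36 + ‖y‖ ^ 2 := by positivity
  rw [Ne, div_eq_iff this.ne']
  intro h
  linarith

section Punch

variable {D : RegDomain} {C : Cell} {lam : ℂ → ℝ} (h : C.Fits D lam)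

lemma Cell.Fits.punch_g z : (D.punch C h).g z = D.g z * C.hole z := rfl

include h in
/-- Points of the hypersurface over the cell, in the coordinates given by the unit disc. -/
lemma Cell.Fits.eq_of_mem (x : D.Mfd) (hx : (D.val x).1 ∈ C.m.source) :
    ‖(((lam (D.val x).1)⁻¹ : ℝ) : ℂ) * (D.val x).2‖ ^ 2 = 1 - ‖C.m (D.val x).1‖ ^ 2 := by
  have h1 := h.pos _ hx
  rw [norm_mul, mul_pow, D.val_prop, h.eq _ hx, norm_coe, sq_abs]
  field_simp

lemma Cell.Fits.eq_of_mem_punch (x : (D.punch C h).Mfd)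
    (hx : ((D.punch C h).val x).1 ∈ C.m.source) :
    ‖(((lam ((D.punch C h).val x).1)⁻¹ : ℝ) : ℂ) * ((D.punch C h).val x).2‖ ^ 2 =
      (1 - ‖C.m ((D.punch C h).val x).1‖ ^ 2) *
        holeProfile C.r (‖C.m ((D.punch C h).val x).1‖ ^ 2) := by
  have h1 := h.pos _ hx
  rw [norm_mul, mul_pow, RegDomain.val_prop, h.punch_g, h.eq _ hx, C.hole_of_mem hx,
    norm_coe, sq_abs]
  field_simp

lemma Cell.Fits.map_ne_zero (x : (D.punch C h).Mfd)
    (hx : ((D.punch C h).val x).1 ∈ C.m.source) : C.m ((D.punch C h).val x).1 ≠ 0 := by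
  intro h0
  have h1 := h.eq_of_mem_punch x hx
  have h2 := (holeProfile_nonneg_iff C.r_pos C.r_le).not.2
    (not_le.2 (pow_pos C.r_pos 2))
  rw [h0, norm_zero] at h1
  have : (0 : ℝ) ^ 2 = 0 := by norm_num
  rw [this] at h1
  have h3 := sq_nonneg ‖(((lam ((D.punch C h).val x).1)⁻¹ : ℝ) : ℂ) * ((D.punch C h).val x).2‖
  rw [h1] at h3
  simp only [sub_zero, one_mul] at h3
  exact h2 h3

variable (C lam) in
/-- The map from the model over the unit disc to the model over the cell. -/
def cellMap (p : ℂ × ℂ) : ℂ × ℂ := (C.m.symm p.1, lam (C.m.symm p.1) * p.2)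

variable (C lam) in
/-- The inverse of `cellMap`. -/
def cellInv (p : ℂ × ℂ) : ℂ × ℂ := (C.m p.1, ((lam p.1)⁻¹ : ℝ) * p.2)

include h in
lemma cellInv_cellMap {p : ℂ × ℂ} (hp : p.1 ∈ C.m.target) :
    cellInv C lam (cellMap C lam p) = p := by
  have h1 := h.pos _ (C.m.map_target hp)
  rw [cellInv, cellMap]
  simp only [C.m.right_inv hp, ← mul_assoc, ← ofReal_mul, inv_mul_cancel₀ h1.ne']; simp

include h in
lemma cellMap_cellInv {p : ℂ × ℂ} (hp : p.1 ∈ C.m.source) :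
    cellMap C lam (cellInv C lam p) = p := by
  rw [cellInv, cellMap]
  simp only [C.m.left_inv hp, ← mul_assoc, ← ofReal_mul, mul_inv_cancel₀ (h.pos _ hp).ne']; simp

include h in
lemma contDiffAt_cellMap {p : ℂ × ℂ} (hp : p.1 ∈ C.m.target) :
    SmoothAt (cellMap C lam) p := by
  have h1 :=
      ContDiffAt.comp p (C.smooth_symm.contDiffAt (C.m.open_target.mem_nhds hp))
      contDiffAt_fst
  have h2 := ContDiffAt.comp (f := fun p : ℂ × ℂ => C.m.symm p.1) p
      (h.smooth.contDiffAt (C.m.open_source.mem_nhds (C.m.map_target hp))) h1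
  exact h1.prodMk ((ofRealCLM.contDiff.contDiffAt.comp p h2).mul contDiffAt_snd)

include h in
lemma contDiffAt_cellInv {p : ℂ × ℂ} (hp : p.1 ∈ C.m.source) :
    SmoothAt (cellInv C lam) p := by
  have h1 := ContDiffAt.comp p (C.smooth.contDiffAt (C.m.open_source.mem_nhds hp))
      contDiffAt_fst
  have h2 := ContDiffAt.comp (f := fun p : ℂ × ℂ => p.1) p
      (h.smooth.contDiffAt (C.m.open_source.mem_nhds hp)) contDiffAt_fst
  exact h1.prodMk ((ofRealCLM.contDiff.contDiffAt.comp p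
    (h2.inv (h.pos _ hp).ne')).mul contDiffAt_snd)

include h in
lemma cellMap_prop {p : ℂ × ℂ} (hp : p.1 ∈ C.m.target) (hp2 : ‖p.2‖ ^ 2 = 1 - ‖p.1‖ ^ 2) :
    ‖(cellMap C lam p).2‖ ^ 2 = D.g (cellMap C lam p).1 := by
  rw [cellMap, h.eq _ (C.m.map_target hp), C.m.right_inv hp, norm_mul, mul_pow, hp2,
    norm_coe, sq_abs]

lemma cellMap_prop_punch {p : ℂ × ℂ} (hp : p.1 ∈ C.m.target)
    (hp2 : ‖p.2‖ ^ 2 = (1 - ‖p.1‖ ^ 2) * holeProfile C.r (‖p.1‖ ^ 2)) :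
    ‖(cellMap C lam p).2‖ ^ 2 = (D.punch C h).g (cellMap C lam p).1 := by
  rw [cellMap, h.punch_g, h.eq _ (C.m.map_target hp), C.hole_of_mem (C.m.map_target hp),
    C.m.right_inv hp, norm_mul, mul_pow, hp2, norm_coe, sq_abs]
  ring

/-- Punching a hole in a cell `C` of the domain is a connected sum with `S¹ × S²` (the manifold of
the annulus): the discs which are removed are the parts over the cell of the two manifolds. -/
lemma isConnectedSum_punch :
    IsConnectedSum (d := 3) (𝓡 3) ((𝓡 1).prod (𝓡 2)) (𝓡 3) D.Mfd (Sph 1 × Sph 2)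
      (D.punch C h).Mfd := by
  set P := D.punch C h with hP
  have hr0 := C.r_pos
  have hr1 := C.r_le
  have hne1 : Nonempty D.Mfd := ⟨RegDomain.ofCoord _ _
    (cellMap_prop h (C.disc_subset (stereoB_fst_mem 0)) (stereoB_snd 0))⟩
  have hsA : ∀ y : E3, ‖y‖ < 2 → ‖(stereoA y).2‖ ^ 2 = (1 - ‖(stereoA y).1‖ ^ 2) *
      holeProfile C.r (‖(stereoA y).1‖ ^ 2) := fun y hy => by
    rw [holeProfile_of_ge hr0 hr1 (half_lt_stereoA hy).le, mul_one, stereoA_snd]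
  have hA0 : ∀ y : E3, ‖y‖ < 2 → (stereoA y).1 ≠ 0 := fun y hy h0 => by
    have := half_lt_stereoA hy
    rw [h0] at this
    norm_num at this
  have hann1 : ∀ q : Sph 1 × Sph 2, q ≠ annInv C.r (stereoA 0) → (ann C.r q).1 ∈ C.m.target := by
    intro q hq
    refine C.disc_subset ⟨?_, ?_⟩
    · have := (ann_fst_le hr0 hr1 q).2
      rw [mem_closedBall_zero_iff]; nlinarith
    · intro h1
      rw [mem_singleton_iff] at h1
      refine hq ?_
      have h2 : (ann C.r q).2 = 0 := by
        have := ann_norm_sq_snd hr0 hr1 q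
        rw [h1] at this
        simpa using this
      have h3 : stereoA 0 = (1, 0) := by
        refine Prod.ext (Complex.ext ?_ ?_) ?_ <;> simp [stereoA]
        rfl
      rw [h3, ← h1, ← h2, annInv_ann hr0 hr1]
  have hne2 : Nonempty P.Mfd := by
    have h2 : ∀ z ∈ C.m.target, ‖z‖ ^ 2 = C.r ^ 2 → Nonempty P.Mfd := fun z hz hz2 =>
      ⟨RegDomain.ofCoord _ _ (cellMap_prop_punch h (p := (z, 0)) hz (by
        rw [(holeProfile_eq_zero_iff hr0 hr1).2 hz2]; simp))⟩
    refine h2 C.r (C.disc_subset ⟨?_, ?_⟩) ?_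
    · simp [abs_of_pos hr0]; linarith
    · intro h
      have : C.r = 1 := by exact_mod_cast mem_singleton_iff.1 h
      linarith
    · simp
  -- The maps of the gluing.
  let e₁ : E3 → D.Mfd := fun v => D.lift (cellMap C lam (stereoB v))
  let e₂ : E3 → Sph 1 × Sph 2 := fun v => annInv C.r (stereoA (compress v))
  let f₂ : Sph 1 × Sph 2 → P.Mfd := fun q => P.lift (cellMap C lam (ann C.r q))
  let ι : D.Mfd → P.Mfd := fun x => P.lift (D.val x)
  have he₁v : ∀ v, D.val (e₁ v) = cellMap C lam (stereoB v) := fun v =>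
    D.val_lift (cellMap_prop h (C.disc_subset (stereoB_fst_mem v)) (stereoB_snd v))
  have hc0 : compress 0 = 0 := compress_of_le (by simp)
  have he₂0 : e₂ 0 = annInv C.r (stereoA 0) := by simp only [e₂, hc0]
  have hf₂v : ∀ q ≠ e₂ 0, P.val (f₂ q) = cellMap C lam (ann C.r q) := fun q hq =>
    P.val_lift (cellMap_prop_punch h (hann1 q (he₂0 ▸ hq)) (ann_norm_sq_snd hr0 hr1 q))
  have hanne₂ : ∀ v, ann C.r (e₂ v) = stereoA (compress v) := fun v =>
    ann_annInv hr0 hr1 (hA0 _ (norm_compress_lt v)) (hsA _ (norm_compress_lt v))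
  have hιv : ∀ x, (D.val x).1 ∉ C.core → P.val (ι x) = D.val x := fun x hx =>
    P.val_lift (by rw [D.val_prop, h.punch_g, C.hole_of_notMem_core hx, mul_one])
  have he₁src : ∀ v, (D.val (e₁ v)).1 ∈ C.m.source := fun v => by
    rw [he₁v]; exact C.m.map_target (C.disc_subset (stereoB_fst_mem v))
  have he₁inv : ∀ v, projB (cellInv C lam (D.val (e₁ v))) = v := fun v => by
    rw [he₁v, cellInv_cellMap h (C.disc_subset (stereoB_fst_mem v)), projB_stereoB]
  have hre : ∀ x : D.Mfd, (D.val x).1 ∈ C.m.source → (C.m (D.val x).1).re ≠ 1 := by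
    intro x hx h1
    have h2 := h.eq_of_mem x hx
    have h3 : ‖C.m (D.val x).1‖ ^ 2 ≤ 1 := by nlinarith
    rw [sq_norm, normSq_apply] at h3
    have h4 : (C.m (D.val x).1).im = 0 := by nlinarith
    refine C.one_notMem ?_
    rw [← show C.m (D.val x).1 = 1 from Complex.ext h1 h4]
    exact C.m.map_source hx
  have hinve₁ : ∀ x : D.Mfd, (D.val x).1 ∈ C.m.source →
      e₁ (projB (cellInv C lam (D.val x))) = x := by
    intro x hx
    apply D.val_injective
    rw [he₁v, stereoB_projB (h.eq_of_mem x hx) (hre x hx), cellMap_cellInv h hx]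
  have hrange : ∀ x : D.Mfd, x ∈ range e₁ ↔ (D.val x).1 ∈ C.m.source := fun x =>
    ⟨by rintro ⟨v, rfl⟩; exact he₁src v, fun hx => ⟨_, hinve₁ x hx⟩⟩
  have hVD := C.m.open_source.preimage (continuous_fst.comp D.continuous_val)
  have hVP := C.m.open_source.preimage (continuous_fst.comp P.continuous_val)
  have he₁ : IsLocalDiffeomorph (𝓡 3) (𝓡 3) ∞ e₁ := by
    have h1 : IsLocalDiffeomorphOn (𝓡 3) (𝓡 3) ∞ e₁ univ := by
      refine isLocalDiffeomorphOn_of_inverse (g := fun x => projB (cellInv C lam (D.val x)))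
        isOpen_univ hVD ?_ ?_ (fun v _ => he₁src v) (fun x _ => mem_univ _) (fun v _ => he₁inv v)
        (fun x hx => hinve₁ x hx)
      · refine RegDomain.contMDiffOn_of_val isOpen_univ ?_
        simp only [he₁v]
        intro v _
        exact (ContDiffAt.comp v
          (contDiffAt_cellMap h (C.disc_subset (stereoB_fst_mem v)))
          contDiff_stereoB.contDiffAt).contMDiffAt.contMDiffWithinAt
      · intro x hx
        exact (RegDomain.contMDiffAt_comp_val D
          ((contDiffAt_projB (hre x hx)).comp _
            (contDiffAt_cellInv h hx))).contMDiffWithinAt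
    exact fun v => h1 ⟨v, mem_univ v⟩
  have hf₂src : ∀ q ≠ e₂ 0, (P.val (f₂ q)).1 ∈ C.m.source := fun q hq => by
    rw [hf₂v q hq]; exact C.m.map_target (hann1 q (he₂0 ▸ hq))
  have hf₂inv : ∀ q ≠ e₂ 0, annInv C.r (cellInv C lam (P.val (f₂ q))) = q := fun q hq => by
    rw [hf₂v q hq, cellInv_cellMap h (hann1 q (he₂0 ▸ hq)), annInv_ann hr0 hr1]
  have hann2 : ∀ x : P.Mfd, (P.val x).1 ∈ C.m.source →
      ann C.r (annInv C.r (cellInv C lam (P.val x))) = cellInv C lam (P.val x) := fun x hx =>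
    ann_annInv hr0 hr1 (h.map_ne_zero x hx) (h.eq_of_mem_punch x hx)
  have hne₂ : ∀ x : P.Mfd, (P.val x).1 ∈ C.m.source →
      annInv C.r (cellInv C lam (P.val x)) ≠ e₂ 0 := by
    intro x hx h0
    have h1 := hann2 x hx
    rw [h0, hanne₂, hc0] at h1
    have h2 : C.m (P.val x).1 = 1 := by
      have : (stereoA 0).1 = C.m (P.val x).1 := congrArg Prod.fst h1
      rw [← this]
      refine Complex.ext ?_ ?_ <;> simp [stereoA]
    exact C.one_notMem (h2 ▸ C.m.map_source hx)
  have hinvf₂ : ∀ x : P.Mfd, (P.val x).1 ∈ C.m.source →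
      f₂ (annInv C.r (cellInv C lam (P.val x))) = x := by
    intro x hx
    apply P.val_injective
    rw [hf₂v _ (hne₂ x hx), hann2 x hx, cellMap_cellInv h hx]
  have hVc : IsOpen {q : Sph 1 × Sph 2 | 1 / 2 < ‖(ann C.r q).1‖ ^ 2 ∧ (ann C.r q).1.re ≠ -1} := by
    have hc := continuous_fst.comp (contMDiff_ann hr0 hr1).continuous
    exact (isOpen_lt continuous_const (hc.norm.pow 2)).inter
      (isOpen_ne_fun (Complex.continuous_re.comp hc) continuous_const)
  obtain ⟨e, hes, hec, hei⟩ := exists_compress_homeomorph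
  have hprojc : ContMDiffOn ((𝓡 1).prod (𝓡 2)) 𝓘(ℝ, E3) ∞
      (fun q => projA (ann C.r q))
      {q : Sph 1 × Sph 2 | 1 / 2 < ‖(ann C.r q).1‖ ^ 2 ∧ (ann C.r q).1.re ≠ -1} := fun q hq =>
    ((contDiffAt_projA hq.2).contMDiffAt.comp q (contMDiff_ann hr0 hr1 q)).contMDiffWithinAt
  have hsym : ∀ v, e.symm (compress v) = v := fun v => by
    rw [← hec]; exact e.left_inv (hes ▸ mem_univ v)
  have hmem : ∀ v, compress v ∈ e.target := fun v => by
    rw [← hec]; exact e.map_source (hes ▸ mem_univ v)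
  have he₂ : IsLocalDiffeomorph (𝓡 3) ((𝓡 1).prod (𝓡 2)) ∞ e₂ := by
    have h1 : IsLocalDiffeomorphOn (𝓡 3) ((𝓡 1).prod (𝓡 2)) ∞ e₂ univ := by
      refine isLocalDiffeomorphOn_of_inverse (g := fun q => e.symm (projA (ann C.r q)))
        isOpen_univ (hprojc.continuousOn.isOpen_inter_preimage hVc e.open_target) ?_ ?_ ?_
        (fun _ _ => mem_univ _) ?_ ?_
      · intro v _
        exact ((contMDiffAt_annInv hr0 hr1 (hA0 _ (norm_compress_lt v))
          (hsA _ (norm_compress_lt v))).comp v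
          (contDiff_stereoA.comp contDiff_compress).contMDiff.contMDiffAt).contMDiffWithinAt
      · exact hei.contMDiffOn.comp (hprojc.mono inter_subset_left) (fun q hq => hq.2)
      · intro v _
        refine ⟨⟨?_, ?_⟩, ?_⟩
        · rw [hanne₂]; exact half_lt_stereoA (norm_compress_lt v)
        · rw [hanne₂]; exact stereoA_re_ne _
        · rw [mem_preimage, hanne₂, projA_stereoA]; exact hmem v
      · intro v _
        rw [hanne₂, projA_stereoA, hsym]
      · rintro q ⟨⟨hq1, hq2⟩, hq3⟩
        have h2 : compress (e.symm (projA (ann C.r q))) = projA (ann C.r q) := by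
          rw [← hec]; exact e.right_inv hq3
        have h3 : ‖(ann C.r q).2‖ ^ 2 = 1 - ‖(ann C.r q).1‖ ^ 2 := by
          rw [ann_norm_sq_snd hr0 hr1, holeProfile_of_ge hr0 hr1 hq1.le, mul_one]
        simp only [e₂]
        rw [h2, stereoA_projA h3 hq2, annInv_ann hr0 hr1]
    exact fun v => h1 ⟨v, mem_univ v⟩
  have hcoref : ∀ x : D.Mfd, (D.val x).1 ∉ C.m.source → (D.val x).1 ∉ C.core :=
    fun x hx hc => hx (C.core_subset hc)
  have hfst : ∀ v, C.m (D.val (e₁ v)).1 = (stereoB v).1 := fun v => by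
    rw [he₁v]; exact C.m.right_inv (C.disc_subset (stereoB_fst_mem v))
  have hcoree : ∀ v, 1 < ‖v‖ → (D.val (e₁ v)).1 ∉ C.core := by
    intro v hv hc
    rw [C.mem_core_iff (he₁src v), hfst] at hc
    have hv0 : v ≠ 0 := by rintro rfl; simp at hv; linarith
    rw [← stereoA_inv3 hv0] at hc
    have h2 : ‖inv3 v‖ < 2 := by
      rw [norm_inv3]
      exact (inv_lt_one_of_one_lt₀ hv).trans (by norm_num)
    linarith [half_lt_stereoA h2]
  refine isConnectedSum_of_collar (e₂ := e₂) (ι := ι) (f₂ := f₂) he₁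
    (Function.LeftInverse.injective (g := fun x => projB
      (cellInv C lam (D.val x))) he₁inv) he₂ ?_ ?_ ?_ ?_ ?_ ?_ ?_ ?_
  · intro v w hvw
    have h1 := congrArg (ann C.r) hvw
    rw [hanne₂, hanne₂] at h1
    have h2 := congrArg projA h1
    rw [projA_stereoA, projA_stereoA] at h2
    exact compress_injective h2
  · refine isLocalDiffeomorphOn_of_inverse (g := fun x => annInv C.r (cellInv C lam (P.val x)))
      isOpen_compl_singleton hVP ?_ ?_ (fun q hq => hf₂src q hq) (fun x hx => hne₂ x hx)
      (fun q hq => hf₂inv q hq) (fun x hx => hinvf₂ x hx)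
    · refine RegDomain.contMDiffOn_of_val isOpen_compl_singleton ?_
      refine ContMDiffOn.congr ?_ (fun q hq => hf₂v q hq)
      intro q hq
      exact ((contDiffAt_cellMap h (hann1 q (he₂0 ▸ hq))).contMDiffAt.comp q
        (contMDiff_ann hr0 hr1 q)).contMDiffWithinAt
    · intro x hx
      exact (ContMDiffAt.comp x
        (contMDiffAt_annInv hr0 hr1 (h.map_ne_zero x hx) (h.eq_of_mem_punch x hx))
        (RegDomain.contMDiffAt_comp_val P (contDiffAt_cellInv h hx))).contMDiffWithinAt
  · intro q hq q' hq' hqq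
    rw [← hf₂inv q hq, ← hf₂inv q' hq', hqq]
  · have hU1 := C.isClosed_core.isOpen_compl.preimage (continuous_fst.comp D.continuous_val)
    have hU2 : IsOpen {x : P.Mfd | (P.val x).1 ∉ C.core} :=
      C.isClosed_core.isOpen_compl.preimage (continuous_fst.comp P.continuous_val)
    have hD : ∀ x : P.Mfd, (P.val x).1 ∉ C.core → D.val (D.lift (P.val x)) = P.val x :=
      fun x hx => D.val_lift (by rw [P.val_prop, h.punch_g, C.hole_of_notMem_core hx, mul_one])
    have h1 : IsLocalDiffeomorphOn (𝓡 3) (𝓡 3) ∞ ι {x : D.Mfd | (D.val x).1 ∉ C.core} := by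
      refine isLocalDiffeomorphOn_of_inverse (g := fun x => D.lift (P.val x)) hU1 hU2 ?_ ?_ ?_ ?_
        ?_ ?_
      · exact RegDomain.contMDiffOn_of_val hU1
          (ContMDiffOn.congr D.contMDiff_val.contMDiffOn fun x hx => hιv x hx)
      · exact RegDomain.contMDiffOn_of_val hU2
          (ContMDiffOn.congr P.contMDiff_val.contMDiffOn fun x hx => hD x hx)
      · intro x hx
        simpa only [mem_ofPred_eq, hιv x hx] using hx
      · intro x hx
        simpa only [mem_ofPred_eq, hD x hx] using hx
      · intro x hx
        rw [hιv x hx, D.lift_val]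
      · intro x hx
        simp only [ι]
        rw [hD x hx, P.lift_val]
    rintro ⟨x, hx⟩
    refine h1 ⟨x, ?_⟩
    by_cases hxs : (D.val x).1 ∈ C.m.source
    · obtain ⟨v, rfl⟩ := (hrange x).2 hxs
      refine hcoree v ?_
      by_contra! hv
      exact hx ⟨v, by simpa using hv, rfl⟩
    · exact hcoref x hxs
  · intro x hx y hy hxy
    have hy' := hcoref y (fun h => hy ((hrange y).2 h))
    apply D.val_injective
    rw [← hιv x (hcoref x (fun h => hx ((hrange x).2 h))), ← hιv y hy', hxy]
  · intro v hv
    apply P.val_injective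
    have hv0 : v ≠ 0 := by rintro rfl; simp at hv; linarith
    have h1 : ‖inv3 v‖ ≤ 1 := by
      rw [norm_inv3]
      exact (inv_lt_one_of_one_lt₀ hv).le
    have h2 : e₂ (inv3 v) ≠ e₂ 0 := by
      intro h3
      have h4 := congrArg (fun q => projA (ann C.r q)) h3
      simp only [hanne₂, projA_stereoA, hc0, compress_of_le h1] at h4
      exact inv3_ne_zero hv0 h4
    rw [hιv _ (hcoree v hv), he₁v, hf₂v _ h2, hanne₂, compress_of_le h1, stereoA_inv3 hv0]
  · intro x hx y hy hxy
    have hx1 : (D.val x).1 ∉ C.m.source := fun h => hx ((hrange x).2 h)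
    refine hx1 ?_
    rw [← hιv x (hcoref x hx1), hxy]
    exact hf₂src y hy
  · intro z
    by_cases hz : (P.val z).1 ∈ C.m.source
    · exact Or.inr ⟨_, hne₂ z hz, hinvf₂ z hz⟩
    · have h1 := D.val_lift (by rw [P.val_prop, h.punch_g, C.hole_of_notMem hz, mul_one])
      have h2 : (D.val (D.lift (P.val z))).1 ∉ C.m.source := by rwa [h1]
      refine Or.inl ⟨D.lift (P.val z), fun h3 => h2 ((hrange _).1 h3), ?_⟩
      apply P.val_injective
      rw [hιv _ (hcoref _ h2), h1]

/-- Punching a hole adds a summand `S¹ × S²`. -/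
lemma isSumS1S2_punch {n : ℕ} (hn : IsSumS1S2 n D.Mfd) : IsSumS1S2 (n + 1) (D.punch C h).Mfd :=
  ⟨inferInstance, inferInstance, D.Mfd, inferInstance, inferInstance, hn, isConnectedSum_punch h⟩

end Punch

/-! ### The three-sphere -/

/-- The unit disc. -/
def disc : RegDomain where
  g z := 1 - ‖z‖ ^ 2
  smooth := contDiff_const.sub (contDiff_norm_sq ℝ)
  regular z hz h0 := by
    have h1 : HasFDerivAt (fun z : ℂ => 1 - ‖z‖ ^ 2) (-(2 • innerSL ℝ z)) z := by
      simpa using (hasStrictFDerivAt_norm_sq z).hasFDerivAt.const_sub 1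
    rw [h1.fderiv] at h0
    have h2 := congrArg (fun A : ℂ →L[ℝ] ℝ => A z) h0
    simp only [neg_apply, smul_apply, innerSL_apply_apply,
      real_inner_self_eq_norm_sq, zero_apply, nsmul_eq_mul] at h2
    norm_num at h2
    rw [h2] at hz
    simp at hz

lemma disc_g z : disc.g z = 1 - ‖z‖ ^ 2 := rfl

/-- The coordinates of `ℂ² = ℝ⁴`. -/
def toR4 (p : ℂ × ℂ) : 𝔼[4] := !₂[p.1.re, p.1.im, p.2.re, p.2.im]

/-- The complex coordinates of `ℝ⁴`. -/
def ofR4 (v : 𝔼[4]) : ℂ × ℂ := (⟨v 0, v 1⟩, ⟨v 2, v 3⟩)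

lemma norm_sq_R4 (v : 𝔼[4]) :
    ‖v‖ ^ 2 = ‖(ofR4 v).1‖ ^ 2 + ‖(ofR4 v).2‖ ^ 2 := by
  rw [EuclideanSpace.norm_sq_eq, sq_norm, sq_norm, normSq_apply,
    normSq_apply]
  simp [Fin.sum_univ_four, ofR4]; ring

lemma ofR4_toR4 p : ofR4 (toR4 p) = p := rfl

lemma toR4_ofR4 v : toR4 (ofR4 v) = v := by ext i; fin_cases i <;> rfl

lemma contDiff_toR4 : Smooth toR4 := by
  rw [contDiff_euclidean]
  intro i
  fin_cases i
  · exact reCLM.contDiff.comp contDiff_fst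
  · exact imCLM.contDiff.comp contDiff_fst
  · exact reCLM.contDiff.comp contDiff_snd
  · exact imCLM.contDiff.comp contDiff_snd

lemma contDiff_ofR4 : Smooth ofR4 :=
  (contDiff_complexMk (EuclideanSpace.proj (0 : Fin 4)).contDiff
    (EuclideanSpace.proj (1 : Fin 4)).contDiff).prodMk
  (contDiff_complexMk (EuclideanSpace.proj (2 : Fin 4)).contDiff
    (EuclideanSpace.proj (3 : Fin 4)).contDiff)

lemma isSumS1S2_disc : IsSumS1S2 0 disc.Mfd := by
  have hfact : Fact (Module.finrank ℝ (𝔼[3 + 1]) = 3 + 1) :=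
    ⟨finrank_euclideanSpace_fin⟩
  have h1 : ∀ x : disc.Mfd, ‖toR4 (disc.val x)‖ = 1 := fun x => by
    have h := norm_sq_R4 (toR4 (disc.val x))
    rw [ofR4_toR4, disc.val_prop, disc_g] at h
    nlinarith [norm_nonneg (toR4 (disc.val x))]
  have h2 : ∀ v : Sph 3, ‖(ofR4 v).2‖ ^ 2 = disc.g (ofR4 v).1 := fun v => by
    have h := norm_sq_R4 v
    rw [norm_eq_of_mem_sphere v] at h
    rw [disc_g]; linarith
  refine ⟨inferInstance, ⟨⟨⟨fun x => ⟨toR4 (disc.val x), by simp [h1 x]⟩,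
    fun v => RegDomain.ofCoord (ofR4 v).1 (ofR4 v).2 (h2 v), fun x => ?_, fun v => ?_⟩, ?_, ?_⟩⟩⟩
  · apply disc.val_injective
    simp [ofR4_toR4]
  · exact Subtype.ext (toR4_ofR4 _)
  · exact fun x => contMDiffAt_sphere (RegDomain.contMDiffAt_comp_val disc contDiff_toR4.contDiffAt)
  · intro v
    exact RegDomain.contMDiffAt_of_val
      ((contDiff_ofR4.contMDiff.comp (contMDiff_coe_sphere)) v)

/-! ### A diffeomorphism from the interval to the line -/

/-- The factor of `stretch`. -/
def stretchFactor (s : ℝ) : ℝ := 1 + smoothTransition (16 * s ^ 2 - 9) / (1 - s ^ 2)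

/-- An odd diffeomorphism from `(-1, 1)` to `ℝ` which is the identity on `[-3/4, 3/4]`. -/
def stretch (s : ℝ) : ℝ := s * stretchFactor s

lemma one_sub_sq_pos {s : ℝ} (hs : s ∈ Ioo (-1 : ℝ) 1) : 0 < 1 - s ^ 2 := by nlinarith [hs.1, hs.2]

lemma stretchFactor_of_abs_le {s : ℝ} (hs : |s| ≤ 3 / 4) : stretchFactor s = 1 := by
  have h : s ^ 2 ≤ 9 / 16 := by nlinarith [sq_abs s, abs_nonneg s]
  rw [stretchFactor, smoothTransition.zero_of_nonpos (by linarith)]; simp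

lemma stretch_of_abs_le {s : ℝ} (hs : |s| ≤ 3 / 4) : stretch s = s := by
  rw [stretch, stretchFactor_of_abs_le hs, mul_one]

lemma one_le_stretchFactor {s : ℝ} (hs : s ∈ Ioo (-1 : ℝ) 1) : 1 ≤ stretchFactor s := by
  have h2 := div_nonneg (smoothTransition.nonneg (16 * s ^ 2 - 9)) (one_sub_sq_pos hs).le
  rw [stretchFactor]; linarith

lemma abs_le_abs_stretch {s : ℝ} (hs : s ∈ Ioo (-1 : ℝ) 1) : |s| ≤ |stretch s| := by
  have h := one_le_stretchFactor hs
  rw [stretch, abs_mul, abs_of_nonneg (by linarith : 0 ≤ stretchFactor s)]; nlinarith [abs_nonneg s]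

lemma contDiffAt_stretchFactor {s : ℝ} (hs : s ∈ Ioo (-1 : ℝ) 1) :
    SmoothAt stretchFactor s := by
  have h1 : SmoothAt (fun s : ℝ => smoothTransition (16 * s ^ 2 - 9)) s :=
    smoothTransition.contDiff.contDiffAt.comp s (by fun_prop)
  exact contDiffAt_const.add (h1.div (by fun_prop) (one_sub_sq_pos hs).ne')

lemma contDiffAt_stretch {s : ℝ} (hs : s ∈ Ioo (-1 : ℝ) 1) : SmoothAt stretch s :=
  contDiffAt_id.mul (contDiffAt_stretchFactor hs)

lemma deriv_stretch_pos {s : ℝ} (hs : s ∈ Ioo (-1 : ℝ) 1) : 0 < deriv stretch s := by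
  have h0 := one_sub_sq_pos hs
  have hT : HasDerivAt smoothTransition (deriv smoothTransition (16 * s ^ 2 - 9))
      (16 * s ^ 2 - 9) :=
    (smoothTransition.contDiff (n := 1).differentiable (by simp) _).hasDerivAt
  have hT0 : 0 ≤ deriv smoothTransition (16 * s ^ 2 - 9) :=
    smoothTransition.monotone.deriv_nonneg
  have h1 : HasDerivAt (fun s : ℝ => 16 * s ^ 2 - 9) (16 * (2 * s)) s := by
    simpa using ((hasDerivAt_pow 2 s).const_mul 16).sub_const 9
  have h2 : HasDerivAt (fun s : ℝ => smoothTransition (16 * s ^ 2 - 9))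
      (deriv smoothTransition (16 * s ^ 2 - 9) * (16 * (2 * s))) s :=
    HasDerivAt.comp (h₂ := smoothTransition) s hT h1
  have h3 : HasDerivAt (fun s : ℝ => 1 - s ^ 2) (-(2 * s)) s := by
    simpa using (hasDerivAt_pow 2 s).const_sub 1
  have h4 : HasDerivAt stretch _ s := (hasDerivAt_id s).mul ((h2.div h3 h0.ne').const_add 1)
  rw [h4.deriv]
  have h5 := smoothTransition.nonneg (16 * s ^ 2 - 9)
  set T' := deriv smoothTransition (16 * s ^ 2 - 9)
  set T := smoothTransition (16 * s ^ 2 - 9)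
  have h6 : id s * ((T' * (16 * (2 * s)) * (1 - s ^ 2) - T * -(2 * s)) / (1 - s ^ 2) ^ 2) =
      (T' * (32 * s ^ 2) * (1 - s ^ 2) + T * (2 * s ^ 2)) / (1 - s ^ 2) ^ 2 := by
    simp only [id]; ring
  have h7 : 0 ≤ (T' * (32 * s ^ 2) * (1 - s ^ 2) + T * (2 * s ^ 2)) / (1 - s ^ 2) ^ 2 := by
    positivity
  have h9 := one_le_stretchFactor hs
  rw [h6]; linarith

lemma strictMonoOn_stretch : StrictMonoOn stretch (Ioo (-1) 1) := by
  refine strictMonoOn_of_deriv_pos (convex_Ioo _ _)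
    (fun s hs => (contDiffAt_stretch hs).continuousAt.continuousWithinAt) ?_
  rw [interior_Ioo]
  exact fun s hs => deriv_stretch_pos hs

lemma stretch_neg (s : ℝ) : stretch (-s) = -stretch s := by simp [stretch, stretchFactor]

lemma surjOn_stretch : SurjOn stretch (Ioo (-1) 1) univ := by
  have key : ∀ y : ℝ, 0 ≤ y → ∃ s ∈ Ioo (-1 : ℝ) 1, stretch s = y := by
    intro y hy
    -- `stretch s ≥ s / (1 - s²)` for `s ≥ 4/5`, which exceeds `y` here.
    set b : ℝ := 1 - 1 / (5 * (y + 1)) with hb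
    have h1 : 1 / (5 * (y + 1)) ≤ 1 / 5 := by apply one_div_le_one_div_of_le (by norm_num); linarith
    have h2 : 0 < 1 / (5 * (y + 1)) := by positivity
    have hb2 : b < 1 := by linarith
    have hbm : b ∈ Ioo (-1 : ℝ) 1 := ⟨by linarith, hb2⟩
    have hfb : y ≤ stretch b := by
      have hT : smoothTransition (16 * b ^ 2 - 9) = 1 :=
        smoothTransition.one_of_one_le (by nlinarith)
      have h4 : 1 - b ^ 2 ≤ 2 / (5 * (y + 1)) := by
        have : 1 - b ^ 2 = (1 - b) * (1 + b) := by ring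
        have h5 : 1 - b = 1 / (5 * (y + 1)) := by rw [hb]; ring
        rw [this, h5]
        have : 2 / (5 * (y + 1)) = 1 / (5 * (y + 1)) * 2 := by ring
        rw [this]
        gcongr
        linarith
      have h6 : 2 * (y + 1) ≤ 1 / (1 - b ^ 2) := by
        rw [le_div_iff₀ (one_sub_sq_pos hbm)]
        have : (y + 1) * (2 / (5 * (y + 1))) = 2 / 5 := by field_simp
        nlinarith
      rw [stretch, stretchFactor, hT]; nlinarith
    have hc : ContinuousOn stretch (Icc 0 b) := fun s hs =>
      (contDiffAt_stretch ⟨by linarith [hs.1], by linarith [hs.2]⟩).continuousAt.continuousWithinAt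
    have h0 : stretch 0 = 0 := by simp [stretch]
    obtain ⟨s, hs, hsy⟩ := intermediate_value_Icc (by linarith) hc
      (show y ∈ Icc (stretch 0) (stretch b) from ⟨by rw [h0]; exact hy, hfb⟩)
    exact ⟨s, ⟨by linarith [hs.1], by linarith [hs.2]⟩, hsy⟩
  intro y _
  rcases le_total 0 y with hy | hy
  · exact key y hy
  · obtain ⟨s, hs, hsy⟩ := key (-y) (by linarith)
    exact ⟨-s, ⟨by linarith [hs.2], by linarith [hs.1]⟩, by rw [stretch_neg, hsy, neg_neg]⟩

lemma exists_stretch_inverse : ∃ g : ℝ → ℝ, Smooth g ∧ (∀ y, g y ∈ Ioo (-1 : ℝ) 1) ∧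
    (∀ y, stretch (g y) = y) ∧ ∀ s ∈ Ioo (-1 : ℝ) 1, g (stretch s) = s := by
  obtain ⟨e, hes, hec, hei⟩ := exists_openPartialHomeomorph_of_injOn isOpen_Ioo
    (fun s hs => (contDiffAt_stretch hs).contDiffWithinAt) strictMonoOn_stretch.injOn
    (fun s hs => ⟨(ContinuousLinearEquiv.unitsEquivAut ℝ (Units.mk0 _ (deriv_stretch_pos hs).ne')),
      by
        have h := ((contDiffAt_stretch hs).differentiableAt (by simp)).hasDerivAt.hasFDerivAt
        convert! h using 1⟩)
  have ht : e.target = univ := by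
    rw [← e.image_source_eq_target, hes, hec]
    exact univ_subset_iff.1 surjOn_stretch
  refine ⟨e.symm, ?_, fun y => ?_, fun y => ?_, fun s hs => ?_⟩
  · rw [← contDiffOn_univ, ← ht]; exact hei
  · rw [← hes]; exact e.map_target (ht ▸ mem_univ y)
  · rw [← hec]; exact e.right_inv (ht ▸ mem_univ y)
  · rw [← hec]; exact e.left_inv (hes ▸ hs)

/-- The inverse of `stretch`. -/
def unstretch : ℝ → ℝ := exists_stretch_inverse.choose

lemma contDiff_unstretch : Smooth unstretch := exists_stretch_inverse.choose_spec.1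

lemma unstretch_mem (y : ℝ) : unstretch y ∈ Ioo (-1 : ℝ) 1 :=
  exists_stretch_inverse.choose_spec.2.1 y

lemma stretch_unstretch (y : ℝ) : stretch (unstretch y) = y :=
  exists_stretch_inverse.choose_spec.2.2.1 y

lemma unstretch_stretch {s : ℝ} (hs : s ∈ Ioo (-1 : ℝ) 1) : unstretch (stretch s) = s :=
  exists_stretch_inverse.choose_spec.2.2.2 s hs

/-! ### The hole cells -/

/-- The size of a hole cell: a hole of radius `2 r / (1 + r²)` around a point at distance `c` from
the ray through a `k`-th root of `-1`. -/
structure HoleData where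
  k : ℕ
  k_pos : 1 ≤ k
  c : ℝ
  c_pos : 0 < c
  c_le : c ≤ 1
  r : ℝ
  r_pos : 0 < r
  r_le : r ≤ 1 / 8
  hole_lt : 2 * r / (1 + r ^ 2) < 3 / 4 * c

local notation "ctr(" σ ", " H ")" => ((σ * HoleData.c H : ℝ) : ℂ)

namespace HoleData

variable (H : HoleData)

/-- The inverse of the height of the centre of the circle `|ζ| = r` in the upper half plane.  After
scaling by it, this circle has the centre `i` and the radius `rho`. -/
def eta : ℝ := (1 - H.r ^ 2) / (1 + H.r ^ 2)

/-- The radius of the holes. -/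
def rho : ℝ := 2 * H.r / (1 + H.r ^ 2)

lemma eta_pos : 0 < H.eta := by
  have := H.r_pos; have := H.r_le
  exact div_pos (by nlinarith) (by positivity)

lemma rho_pos : 0 < H.rho := by
  have := H.r_pos
  exact div_pos (by positivity) (by positivity)

lemma eta_sq_add : H.eta ^ 2 + H.rho ^ 2 = 1 := by
  rw [eta, rho]; field_simp; ring

lemma rho_le : H.rho ≤ 1 / 4 := by
  have := H.r_le
  rw [rho, div_le_iff₀ (by positivity)]; nlinarith

/-- The upper half plane coordinate of a cell, near the outer boundary circle of the disc. -/
def half (τ : ℝ) (z : ℂ) : ℂ :=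
  ⟨H.c * stretch ((H.k * z.arg - τ * H.c) / H.c) / H.eta,
    2 * stretch (4 * (1 - ‖z‖ ^ 2) / 3) / H.eta⟩

/-- The inverse of `half`. -/
def halfInv (τ : ℝ) (W : ℂ) : ℂ :=
  √(1 - 3 * unstretch (H.eta * W.im / 2) / 4) *
    exp (((H.c * unstretch (H.eta * W.re / H.c) + τ * H.c) / H.k : ℝ) * I)

/-- The part of the sector in which `half` is a coordinate. -/
def sector (τ : ℝ) : Set ℂ :=
  {z | z ∈ slitPlane ∧ (H.k * z.arg - τ * H.c) / H.c ∈ Ioo (-1 : ℝ) 1 ∧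
    4 * (1 - ‖z‖ ^ 2) / 3 ∈ Ioo (-1 : ℝ) 1}

variable {H} {τ : ℝ}

lemma contDiffAt_arg {z : ℂ} (hz : z ∈ slitPlane) : SmoothAt arg z := by
  have h : SmoothAt (fun z => (Complex.log z).im) z :=
    imCLM.contDiff.contDiffAt.comp z ((Complex.contDiffAt_log hz).restrict_scalars ℝ)
  simpa only [log_im] using h

lemma contDiffAt_half {z : ℂ} (hz : z ∈ H.sector τ) : SmoothAt (H.half τ) z := by
  obtain ⟨h1, h2, h3⟩ := hz
  have ha : SmoothAt (fun z : ℂ => (H.k * z.arg - τ * H.c) / H.c) z :=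
    ((contDiffAt_const.mul (contDiffAt_arg h1)).sub contDiffAt_const).div_const _
  have hn : SmoothAt (fun z : ℂ => 4 * (1 - ‖z‖ ^ 2) / 3) z :=
    (contDiffAt_const.mul (contDiffAt_const.sub (contDiff_norm_sq ℝ).contDiffAt)).div_const _
  have h4 := ContDiffAt.comp (g := stretch) z (contDiffAt_stretch h2) ha
  have h5 := ContDiffAt.comp (g := stretch) z (contDiffAt_stretch h3) hn
  exact equivRealProdCLM.symm.contDiff.contDiffAt.comp z
    (((contDiffAt_const.mul h4).div_const _).prodMk ((contDiffAt_const.mul h5).div_const _))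

lemma radius_pos (W : ℂ) : 0 < 1 - 3 * unstretch (H.eta * W.im / 2) / 4 := by
  linarith [(unstretch_mem (H.eta * W.im / 2)).2]

lemma contDiff_halfInv : Smooth (H.halfInv τ) := by
  have h1 : Smooth (fun W : ℂ => unstretch (H.eta * W.im / 2)) :=
    contDiff_unstretch.comp ((contDiff_const.mul imCLM.contDiff).div_const _)
  have h2 : Smooth (fun W : ℂ => unstretch (H.eta * W.re / H.c)) :=
    contDiff_unstretch.comp ((contDiff_const.mul reCLM.contDiff).div_const _)
  have h3 :=
      (contDiff_const.sub ((contDiff_const.mul h1).div_const _)).sqrt fun W => (radius_pos W).ne'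
  exact (ofRealCLM.contDiff.comp h3).mul (ContDiff.cexp
    ((ofRealCLM.contDiff.comp (((contDiff_const.mul h2).add contDiff_const).div_const _)).mul
      contDiff_const))

lemma norm_halfInv (W : ℂ) : ‖H.halfInv τ W‖ ^ 2 = 1 - 3 * unstretch (H.eta * W.im / 2) / 4 := by
  rw [halfInv, norm_mul, norm_exp_ofReal_mul_I, mul_one, norm_coe, sq_abs, sq_sqrt
    (radius_pos W).le]

lemma k_pos' : (0 : ℝ) < H.k := by exact_mod_cast H.k_pos

lemma one_le_k : (1 : ℝ) ≤ H.k := by exact_mod_cast H.k_pos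

lemma halfInv_arg_mem (hτ : |τ| ≤ 1) (W : ℂ) :
    (H.c * unstretch (H.eta * W.re / H.c) + τ * H.c) / H.k ∈ Ioo (-Real.pi) Real.pi := by
  have h1 := unstretch_mem (H.eta * W.re / H.c)
  have h2 := H.c_pos; have h3 := H.c_le; have h4 := H.k_pos'; have h5 := H.one_le_k
  have hpi := pi_gt_three
  obtain ⟨h6, h7⟩ := abs_le.1 hτ
  rw [mem_Ioo, lt_div_iff₀ h4, div_lt_iff₀ h4]
  constructor <;> nlinarith [h1.1, h1.2]

lemma arg_halfInv (hτ : |τ| ≤ 1) (W : ℂ) : (H.halfInv τ W).arg =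
    (H.c * unstretch (H.eta * W.re / H.c) + τ * H.c) / H.k := by
  have h := H.halfInv_arg_mem hτ W
  rw [halfInv, arg_real_mul _ (sqrt_pos.2 (radius_pos W)), arg_exp,
    mul_I_im, ofReal_re,
    toIocMod_eq_self two_pi_pos |>.2 ⟨h.1, by linarith [h.2]⟩]

lemma halfInv_coords (hτ : |τ| ≤ 1) (W : ℂ) :
    (H.k * (H.halfInv τ W).arg - τ * H.c) / H.c = unstretch (H.eta * W.re / H.c) ∧
    4 * (1 - ‖H.halfInv τ W‖ ^ 2) / 3 = unstretch (H.eta * W.im / 2) := by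
  have h2 := H.c_pos; have h4 := H.k_pos'
  rw [arg_halfInv hτ, norm_halfInv]
  constructor
  · field_simp; ring
  · ring

lemma halfInv_ne_zero (W : ℂ) : H.halfInv τ W ≠ 0 := by
  intro h
  have h1 := norm_halfInv (H := H) (τ := τ) W
  rw [h] at h1
  have := radius_pos (H := H) W
  rw [← h1] at this
  simp at this

lemma halfInv_mem (hτ : |τ| ≤ 1) (W : ℂ) : H.halfInv τ W ∈ H.sector τ := by
  obtain ⟨h1, h2⟩ := halfInv_coords hτ W
  refine ⟨?_, ?_, ?_⟩
  · rw [mem_slitPlane_iff_arg, arg_halfInv hτ]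
    exact ⟨(H.halfInv_arg_mem hτ W).2.ne, halfInv_ne_zero W⟩
  · rw [h1]; exact unstretch_mem _
  · rw [h2]; exact unstretch_mem _

lemma half_halfInv (hτ : |τ| ≤ 1) (W : ℂ) : H.half τ (H.halfInv τ W) = W := by
  obtain ⟨h1, h2⟩ := halfInv_coords hτ W
  have h3 := H.c_pos; have h4 := H.eta_pos
  rw [half, h1, h2, stretch_unstretch, stretch_unstretch]
  refine Complex.ext ?_ ?_
  · field_simp
  · field_simp

lemma halfInv_half {z : ℂ} (hz : z ∈ H.sector τ) : H.halfInv τ (H.half τ z) = z := by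
  have h3 := H.c_pos; have h4 := H.eta_pos; have h5 := H.k_pos'
  obtain ⟨h0, h1, h2⟩ := hz
  rw [halfInv]
  have e1 : H.eta * (H.half τ z).im / 2 = stretch (4 * (1 - ‖z‖ ^ 2) / 3) := by
    simp only [half]; field_simp
  have e2 : H.eta * (H.half τ z).re / H.c = stretch ((H.k * z.arg - τ * H.c) / H.c) := by
    simp only [half]; field_simp
  rw [e1, e2, unstretch_stretch h1, unstretch_stretch h2]
  have e3 : 1 - 3 * (4 * (1 - ‖z‖ ^ 2) / 3) / 4 = ‖z‖ ^ 2 := by ring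
  have e4 : (H.c * ((H.k * z.arg - τ * H.c) / H.c) + τ * H.c) / H.k = z.arg := by field_simp; ring
  rw [e3, e4, sqrt_sq (norm_nonneg _), norm_mul_exp_arg_mul_I]

lemma isOpen_sector : IsOpen (H.sector τ) := by
  have h1 : ContinuousOn (fun z : ℂ => (H.k * z.arg - τ * H.c) / H.c) slitPlane :=
    ((continuousOn_const.mul fun z hz => (Complex.continuousAt_arg hz).continuousWithinAt).sub
      continuousOn_const).div_const _
  have h2 : Continuous (fun z : ℂ => 4 * (1 - ‖z‖ ^ 2) / 3) := by fun_prop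
  have h3 := (h1.isOpen_inter_preimage Complex.isOpen_slitPlane
    (isOpen_Ioo (a := (-1 : ℝ)) (b := 1))).inter ((isOpen_Ioo (a := (-1 : ℝ)) (b := 1)).preimage h2)
  convert! h3 using 1
  ext z
  simp only [sector, mem_ofPred_eq, mem_inter_iff, mem_preimage, and_assoc]

variable (H τ) in
/-- The coordinate of a cell, centred at the ray through the unit vector `ρ`. -/
def cellFun (ρ z : ℂ) : ℂ :=
  (H.half τ (z / ρ) - I) / (H.half τ (z / ρ) + I)

/-- The inverse Cayley transform. -/
def cayleyInv (ζ : ℂ) : ℂ := I * (1 + ζ) / (1 - ζ)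

lemma cayleyInv_add {ζ : ℂ} (h : ζ ≠ 1) : cayleyInv ζ + I = 2 * I / (1 - ζ) := by
  rw [cayleyInv]; field_simp; ring

lemma cayleyInv_sub {ζ : ℂ} (h : ζ ≠ 1) :
    cayleyInv ζ - I = 2 * I * ζ / (1 - ζ) := by
  rw [cayleyInv]; field_simp; ring

lemma cayleyInv_add_ne_zero {ζ : ℂ} (h : ζ ≠ 1) : cayleyInv ζ + I ≠ 0 := by
  rw [cayleyInv_add h]
  exact div_ne_zero (by simp) (sub_ne_zero.2 h.symm)

lemma cayley_cayleyInv {ζ : ℂ} (h : ζ ≠ 1) :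
    (cayleyInv ζ - I) / (cayleyInv ζ + I) = ζ := by
  rw [cayleyInv_add h, cayleyInv_sub h]; field_simp

lemma cayley_ne_one (W : ℂ) : (W - I) / (W + I) ≠ 1 := by
  intro h
  by_cases h0 : W + I = 0
  · rw [h0, div_zero] at h; exact zero_ne_one h
  · rw [div_eq_one_iff_eq h0] at h
    have h1 : (2 : ℂ) * I = 0 := by linear_combination -h
    simp at h1

lemma cayleyInv_cayley {W : ℂ} (h : W + I ≠ 0) :
    cayleyInv ((W - I) / (W + I)) = W := by
  have h1 : 1 - (W - I) / (W + I) = 2 * I / (W + I) := by field_simp; ring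
  have h2 : 1 + (W - I) / (W + I) = 2 * W / (W + I) := by field_simp; ring
  rw [cayleyInv, h1, h2]
  field_simp

lemma contDiffOn_cellFun (ρ : ℂ) : ContDiffOn ℝ ∞ (H.cellFun τ ρ)
    {z | z / ρ ∈ H.sector τ ∧ H.half τ (z / ρ) + I ≠ 0} := by
  intro z hz
  have h1 := ContDiffAt.comp (g := H.half τ) (f := fun z => z / ρ) z (contDiffAt_half hz.1)
      (contDiffAt_id.div_const _)
  exact (contDiffAt_cdiv (h1.sub contDiffAt_const) (h1.add contDiffAt_const)
    hz.2).contDiffWithinAt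

lemma contDiffOn_cellFun_inv (ρ : ℂ) :
    ContDiffOn ℝ ∞ (fun ζ => H.halfInv τ (cayleyInv ζ) * ρ) {1}ᶜ := by
  intro ζ hζ
  have h1 : SmoothAt cayleyInv ζ :=
    contDiffAt_cdiv (contDiffAt_const.mul (contDiffAt_const.add contDiffAt_id))
      (contDiffAt_const.sub contDiffAt_id) (sub_ne_zero.2 (Ne.symm hζ))
  exact ((contDiff_halfInv.contDiffAt.comp ζ h1).mul contDiffAt_const).contDiffWithinAt

variable (H) in
/-- The cell around the ray through the unit vector `ρ`, on the side given by the sign `τ`. -/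
def cell (τ : ℝ) (hτ : |τ| ≤ 1) (ρ : ℂ) (hρ : ‖ρ‖ = 1) : Cell where
  m :=
    { toFun := H.cellFun τ ρ
      invFun := fun ζ => H.halfInv τ (cayleyInv ζ) * ρ
      source := {z | z / ρ ∈ H.sector τ ∧ H.half τ (z / ρ) + I ≠ 0}
      target := {1}ᶜ
      map_source' := fun z _ => cayley_ne_one _
      map_target' := by
        intro ζ hζ
        have hρ0 : ρ ≠ 0 := norm_ne_zero_iff.1 (by rw [hρ]; exact one_ne_zero)
        rw [mem_ofPred_eq, mul_div_cancel_right₀ _ hρ0, half_halfInv hτ]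
        exact ⟨halfInv_mem hτ _, cayleyInv_add_ne_zero hζ⟩
      left_inv' := by
        rintro z ⟨hz, hz1⟩
        have hρ0 : ρ ≠ 0 := norm_ne_zero_iff.1 (by rw [hρ]; exact one_ne_zero)
        rw [cellFun, cayleyInv_cayley hz1, halfInv_half hz, div_mul_cancel₀ _ hρ0]
      right_inv' := by
        intro ζ hζ
        have hρ0 : ρ ≠ 0 := norm_ne_zero_iff.1 (by rw [hρ]; exact one_ne_zero)
        rw [cellFun, mul_div_cancel_right₀ _ hρ0, half_halfInv hτ, cayley_cayleyInv hζ]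
      open_source := by
        have h1 : ContinuousOn (fun z => H.half τ (z / ρ) + I)
            ((fun z => z / ρ) ⁻¹' H.sector τ) := fun z hz =>
          ((ContinuousAt.comp (g := H.half τ) (f := fun z => z / ρ)
            (contDiffAt_half hz).continuousAt
            (by fun_prop)).add_const _).continuousWithinAt
        exact h1.isOpen_inter_preimage (isOpen_sector.preimage (by fun_prop))
          isOpen_compl_singleton
      open_target := isOpen_compl_singleton
      continuousOn_toFun := (contDiffOn_cellFun ρ).continuousOn
      continuousOn_invFun := (contDiffOn_cellFun_inv ρ).continuousOn }
  smooth := contDiffOn_cellFun ρ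
  smooth_symm := contDiffOn_cellFun_inv ρ
  disc_subset := fun z hz => hz.2
  one_notMem := by simp
  r := H.r
  r_pos := H.r_pos
  r_le := by linarith [H.r_le]

end HoleData

/-! ### The planar domain -/

/-- The `l`-th of the `k`-th roots of `-1`. -/
def negRoot (k l : ℕ) : ℂ :=
  exp ((Real.pi / k : ℝ) * I) * exp (2 * Real.pi * I / k) ^ l

lemma norm_negRoot (k l : ℕ) : ‖negRoot k l‖ = 1 := by
  have h : (2 * Real.pi * I / k : ℂ) = ((2 * Real.pi / k : ℝ) : ℂ) * I := by push_cast; ring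
  rw [negRoot, norm_mul, norm_pow, h, norm_exp_ofReal_mul_I, norm_exp_ofReal_mul_I]; simp

lemma negRoot_ne_zero (k l : ℕ) : negRoot k l ≠ 0 :=
  norm_ne_zero_iff.1 (by rw [norm_negRoot]; exact one_ne_zero)

lemma exp_pi_div_pow {k : ℕ} (hk : 1 ≤ k) :
    exp ((Real.pi / k : ℝ) * I) ^ k = -1 := by
  have hk0 : k ≠ 0 := by exact_mod_cast (by omega : k ≠ 0)
  rw [← exp_nat_mul, ← Complex.exp_pi_mul_I]
  congr 1
  push_cast
  field_simp

lemma negRoot_pow {k : ℕ} (hk : 1 ≤ k) l : negRoot k l ^ k = -1 := by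
  rw [negRoot, mul_pow, exp_pi_div_pow hk, ← pow_mul, mul_comm l k, pow_mul,
    (Complex.isPrimitiveRoot_exp k (by omega)).pow_eq_one]
  simp

lemma negRoot_injOn {k : ℕ} (hk : 1 ≤ k) {l l' : ℕ} (hl : l < k) (hl' : l' < k)
    (h : negRoot k l = negRoot k l') : l = l' :=
  (Complex.isPrimitiveRoot_exp k (by omega)).pow_inj hl hl'
    (mul_left_cancel₀ (exp_ne_zero _) h)

lemma exists_negRoot {k : ℕ} (hk : 1 ≤ k) {z : ℂ} (hz : z ^ k = -1) :
    ∃ l < k, negRoot k l = z := by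
  have : NeZero k := ⟨by omega⟩
  obtain ⟨l, hl, h⟩ := (Complex.isPrimitiveRoot_exp k (by omega)).eq_pow_of_pow_eq_one
    (ξ := z / exp ((Real.pi / k : ℝ) * I)) (by rw [div_pow, hz, exp_pi_div_pow hk]; simp)
  exact ⟨l, hl, by rw [negRoot, h]; field_simp⟩

lemma pow_eq_norm_mul_exp (z : ℂ) (k : ℕ) :
    z ^ k = ((‖z‖ ^ k : ℝ) : ℂ) * exp ((k * z.arg : ℝ) * I) := by
  conv_lhs => rw [← norm_mul_exp_arg_mul_I z]
  rw [mul_pow, ← exp_nat_mul]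
  push_cast
  congr 2
  ring

lemma arg_neg_pow {k : ℕ} {ρ Z : ℂ} (hρ : ρ ^ k = -1) (hρ0 : ρ ≠ 0) (hZ : Z ≠ 0)
    (h : k * (Z / ρ).arg ∈ Iπ) : (-Z ^ k).arg = k * (Z / ρ).arg := by
  have h1 : -Z ^ k = (Z / ρ) ^ k := by rw [div_pow, hρ, div_neg, div_one]
  have h2 : 0 < ‖Z / ρ‖ ^ k := pow_pos (norm_pos_iff.2 (div_ne_zero hZ hρ0)) _
  rw [h1, pow_eq_norm_mul_exp, arg_real_mul _ h2, arg_exp, mul_I_im,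
    ofReal_re, (toIocMod_eq_self two_pi_pos).2 ⟨h.1, by linarith [h.2]⟩]

/-- The coordinate on the annulus `1/4 ≤ |Z|² ≤ 1`, which is mapped `k`-fold to `|Im| ≤ 1`;
it vanishes at `k` points of the circle `|Z|² = 5/8`. -/
def ringCoord (k : ℕ) (Z : ℂ) : ℂ := ⟨(-Z ^ k).arg, (8 * ‖Z‖ ^ 2 - 5) / 3⟩

local notation "crd(" H ")" => ringCoord (HoleData.k H)

/-- The unit disc without the centre. -/
def centralCell : Cell where
  m := (OpenPartialHomeomorph.refl ℂ).restrOpen {1}ᶜ isOpen_compl_singleton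
  smooth := contDiff_id.contDiffOn
  smooth_symm := contDiff_id.contDiffOn
  disc_subset := fun z hz => by simpa using hz.2
  one_notMem := by simp
  r := 1 / 2
  r_pos := by norm_num
  r_le := le_rfl

/-- The annulus function. -/
def annulusFn (Z : ℂ) : ℝ := (1 - ‖Z‖ ^ 2) * holeProfile (1 / 2) (‖Z‖ ^ 2)

lemma centralCell_fits : centralCell.Fits disc (fun _ => 1) where
  smooth := contDiffOn_const
  pos _ _ := one_pos
  eq z _ := by
    simp only [one_pow, one_mul]; rfl

lemma centralCell_hole Z : centralCell.hole Z = holeProfile (1 / 2) (‖Z‖ ^ 2) := by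
  by_cases h : Z ∈ centralCell.m.source
  · exact centralCell.hole_of_mem h
  · rw [centralCell.hole_of_notMem h]
    have h1 : Z = 1 := by
      by_contra h2
      exact h (by simpa [centralCell] using h2)
    rw [h1, holeProfile_of_ge (by norm_num) (by norm_num) (by norm_num)]

lemma contDiff_annulusFn : Smooth annulusFn :=
  (contDiff_const.sub (contDiff_norm_sq ℝ)).mul
    ((contDiff_holeProfile (by norm_num) (by norm_num)).comp (contDiff_norm_sq ℝ))

namespace HoleData

variable (H : HoleData)

/-- The `n`-th hole cell: the two sides of the `n / 2`-th ray. -/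
def nthCell (n : ℕ) : Cell :=
  H.cell ((-1) ^ n) (by simp) (negRoot H.k (n / 2)) (norm_negRoot _ _)

variable {H}

lemma mem_nthCell {n : ℕ} {Z : ℂ} : Z ∈ (H.nthCell n).m.source ↔
    Z / negRoot H.k (n / 2) ∈ H.sector ((-1) ^ n) ∧
      H.half ((-1) ^ n) (Z / negRoot H.k (n / 2)) + I ≠ 0 := Iff.rfl

lemma ne_zero_of_mem {n : ℕ} {Z : ℂ} (hZ : Z ∈ (H.nthCell n).m.source) : Z ≠ 0 := by
  rintro rfl
  have h := (mem_nthCell.1 hZ).1.1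
  rw [zero_div] at h
  exact Complex.zero_notMem_slitPlane h

lemma norm_div_negRoot Z (n : ℕ) : ‖Z / negRoot H.k n‖ = ‖Z‖ := by
  rw [norm_div, norm_negRoot, div_one]

lemma sector_arg {τ : ℝ} {z : ℂ} (hz : z ∈ H.sector τ) :
    |H.k * z.arg - τ * H.c| < H.c := by
  have h1 := hz.2.1
  have h2 := H.c_pos
  rw [mem_Ioo, lt_div_iff₀ h2, div_lt_iff₀ h2] at h1
  rw [abs_lt]
  constructor <;> linarith [h1.2]

lemma ringCoord_re_of_mem {n : ℕ} {Z : ℂ} (hZ : Z ∈ (H.nthCell n).m.source) :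
    (crd(H) Z).re = H.k * (Z / negRoot H.k (n / 2)).arg := by
  have h1 := abs_lt.1 (sector_arg (mem_nthCell.1 hZ).1)
  have h2 := H.c_le
  have h3 := pi_gt_three
  have h4 : |((-1 : ℝ)) ^ n| = 1 := by simp
  have h5 := abs_le.1 h4.le
  refine arg_neg_pow (negRoot_pow H.k_pos _) (negRoot_ne_zero _ _) (ne_zero_of_mem hZ) ⟨?_, ?_⟩
  · nlinarith [h1.2, h5.1, H.c_pos]
  · nlinarith [h1.2, h5.2, H.c_pos]

lemma neg_one_pow_cases n : (n % 2 = 0 ∧ (-1 : ℝ) ^ n = 1) ∨ (n % 2 = 1 ∧ (-1 : ℝ) ^ n = -1) := by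
  rcases Nat.even_or_odd n with h | h
  · exact Or.inl ⟨Nat.even_iff.1 h, h.neg_one_pow⟩
  · exact Or.inr ⟨Nat.odd_iff.1 h, h.neg_one_pow⟩

lemma nthCell_disjoint {n n' : ℕ} (hn : n < 2 * H.k) (hn' : n' < 2 * H.k) {Z : ℂ}
    (h : Z ∈ (H.nthCell n).m.source) (h' : Z ∈ (H.nthCell n').m.source) : n = n' := by
  have e1 := ringCoord_re_of_mem h
  have e2 := ringCoord_re_of_mem h'
  have a1 := abs_lt.1 (sector_arg (mem_nthCell.1 h).1)
  have a2 := abs_lt.1 (sector_arg (mem_nthCell.1 h').1)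
  rw [← e1] at a1
  rw [← e2] at a2
  have h2 : n % 2 = n' % 2 := by
    rcases neg_one_pow_cases n with ⟨b1, b2⟩ | ⟨b1, b2⟩ <;>
      rcases neg_one_pow_cases n' with ⟨b3, b4⟩ | ⟨b3, b4⟩ <;> rw [b1, b3] <;>
      rw [b2] at a1 <;> rw [b4] at a2 <;> exfalso <;> linarith [a1.2, a2.1, a2.2]
  have h3 : (Z / negRoot H.k (n / 2)).arg = (Z / negRoot H.k (n' / 2)).arg := by
    have := e1.symm.trans e2
    exact mul_left_cancel₀ H.k_pos'.ne' this
  have h4 := Complex.ext_norm_arg (by rw [norm_div_negRoot, norm_div_negRoot]) h3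
  have h5 : negRoot H.k (n / 2) = negRoot H.k (n' / 2) := by
    have b1 := negRoot_ne_zero H.k (n / 2)
    have b2 := negRoot_ne_zero H.k (n' / 2)
    rw [div_eq_div_iff b1 b2] at h4
    exact (mul_left_cancel₀ (ne_zero_of_mem h) h4).symm
  have h6 := negRoot_injOn H.k_pos (by omega) (by omega) h5
  omega

lemma norm_sq_cayley {W : ℂ} (hW : W + I ≠ 0) :
    1 - ‖(W - I) / (W + I)‖ ^ 2 = 4 * W.im / ‖W + I‖ ^ 2 := by
  rw [norm_div]
  field_simp
  rw [sq_norm, sq_norm, normSq_apply, normSq_apply]; simp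
  ring

lemma quarter_lt_of_mem {n : ℕ} {Z : ℂ} (hZ : Z ∈ (H.nthCell n).m.source) :
    1 / 4 < ‖Z‖ ^ 2 ∧ ‖Z‖ ^ 2 < 7 / 4 := by
  have h := (mem_nthCell.1 hZ).1.2.2
  rw [norm_div_negRoot] at h
  constructor <;> linarith [h.1, h.2]

lemma nthCell_m {n : ℕ} (Z : ℂ) : (H.nthCell n).m Z =
    (H.half ((-1) ^ n) (Z / negRoot H.k (n / 2)) - I) /
      (H.half ((-1) ^ n) (Z / negRoot H.k (n / 2)) + I) := rfl

lemma contDiffAt_half_div {n : ℕ} {Z : ℂ} (hZ : Z ∈ (H.nthCell n).m.source) :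
    SmoothAt (fun Z => H.half ((-1) ^ n) (Z / negRoot H.k (n / 2))) Z :=
  ContDiffAt.comp (g := H.half ((-1) ^ n)) Z
    (contDiffAt_half (mem_nthCell.1 hZ).1) (contDiffAt_id.div_const _)

/-- The annulus function has the form required for punching holes in the cells. -/
lemma exists_fits (n : ℕ) : ∃ lam : ℂ → ℝ, ContDiffOn ℝ ∞ lam (H.nthCell n).m.source ∧
    (∀ z ∈ (H.nthCell n).m.source, 0 < lam z) ∧
    ∀ z ∈ (H.nthCell n).m.source, annulusFn z = lam z ^ 2 * (1 - ‖(H.nthCell n).m z‖ ^ 2) := by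
  let W : ℂ → ℂ := fun Z => H.half ((-1) ^ n) (Z / negRoot H.k (n / 2))
  let B : ℂ → ℝ := fun Z => holeProfile (1 / 2) (‖Z‖ ^ 2) * (3 * H.eta * ‖W Z + I‖ ^ 2) /
    (32 * stretchFactor (4 * (1 - ‖Z‖ ^ 2) / 3))
  have hs : ∀ z ∈ (H.nthCell n).m.source, 4 * (1 - ‖z‖ ^ 2) / 3 ∈ Ioo (-1 : ℝ) 1 := fun z hz => by
    have := (mem_nthCell.1 hz).1.2.2
    rwa [norm_div_negRoot] at this
  have heta := H.eta_pos
  have hprof : ∀ z ∈ (H.nthCell n).m.source, 0 < holeProfile (1 / 2) (‖z‖ ^ 2) := fun z hz => by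
    have h1 := (quarter_lt_of_mem hz).1
    refine lt_of_le_of_ne ((holeProfile_nonneg_iff (by norm_num) (by norm_num)).2
      (by linarith)) fun h => ?_
    linarith [(holeProfile_eq_zero_iff (by norm_num) (by norm_num)).1 h.symm]
  have hB : ∀ z ∈ (H.nthCell n).m.source, 0 < B z := fun z hz => by
    have h2 := one_le_stretchFactor (hs z hz)
    have h3 := norm_pos_iff.2 (mem_nthCell.1 hz).2
    exact div_pos (mul_pos (hprof z hz) (by positivity)) (by linarith)
  have hBs : ContDiffOn ℝ ∞ B (H.nthCell n).m.source := fun z hz => by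
    have h1 : SmoothAt (fun z => 4 * (1 - ‖z‖ ^ 2) / 3) z :=
      ((contDiff_const.mul (contDiff_const.sub (contDiff_norm_sq ℝ))).div_const _).contDiffAt
    have h2 := ContDiffAt.comp z (contDiffAt_stretchFactor (hs z hz)) h1
    have h3 : SmoothAt (fun z => ‖W z + I‖ ^ 2) z :=
      (contDiff_norm_sq ℝ).contDiffAt.comp z ((contDiffAt_half_div hz).add contDiffAt_const)
    have h4 : SmoothAt (fun z => holeProfile (1 / 2) (‖z‖ ^ 2)) z :=
      ((contDiff_holeProfile (by norm_num) (by norm_num)).comp (contDiff_norm_sq ℝ)).contDiffAt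
    have h5 := one_le_stretchFactor (hs z hz)
    exact ((h4.mul (contDiffAt_const.mul h3)).div (contDiffAt_const.mul h2)
      (mul_ne_zero (by norm_num) (by simp only [Function.comp_apply]; linarith))).contDiffWithinAt
  refine ⟨fun z => √(B z), fun z hz => ?_, fun z hz => sqrt_pos.2 (hB z hz), fun z hz => ?_⟩
  · exact (((hBs.contDiffAt ((H.nthCell n).m.open_source.mem_nhds hz)).sqrt
      (hB z hz).ne')).contDiffWithinAt
  · have h1 : ‖W z + I‖ ^ 2 ≠ 0 := pow_ne_zero _ (norm_ne_zero_iff.2 (mem_nthCell.1 hz).2)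
    have h2 := one_le_stretchFactor (hs z hz)
    have h3 : stretchFactor (4 * (1 - ‖z‖ ^ 2) / 3) ≠ 0 := by linarith
    have h4 : (W z).im = 2 * (4 * (1 - ‖z‖ ^ 2) / 3 * stretchFactor (4 * (1 - ‖z‖ ^ 2) / 3)) /
        H.eta := by
      simp only [W, half, stretch, norm_div_negRoot]
    rw [sq_sqrt (hB z hz).le, nthCell_m, norm_sq_cayley (mem_nthCell.1 hz).2]
    rw [h4]
    simp only [B, annulusFn]
    generalize stretchFactor (4 * (1 - ‖z‖ ^ 2) / 3) = F at h3 ⊢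
    generalize ‖W z + I‖ ^ 2 = N at h1 ⊢
    field_simp; ring

variable (H) in
/-- The annulus with `2 k` holes. -/
lemma exists_regDomain : ∃ D : RegDomain, IsSumS1S2 (2 * H.k + 1) D.Mfd ∧
    ∀ Z, D.g Z = annulusFn Z * ∏ n ∈ Finset.range (2 * H.k), (H.nthCell n).hole Z := by
  have key : ∀ N ≤ 2 * H.k, ∃ D : RegDomain, IsSumS1S2 (N + 1) D.Mfd ∧
      ∀ Z, D.g Z = annulusFn Z * ∏ n ∈ Finset.range N, (H.nthCell n).hole Z := by
    intro N
    induction N with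
    | zero =>
      refine fun _ => ⟨disc.punch centralCell centralCell_fits,
        isSumS1S2_punch centralCell_fits isSumS1S2_disc, fun Z => ?_⟩
      rw [centralCell_fits.punch_g, disc_g, centralCell_hole]; simp [annulusFn]
    | succ N ih =>
      intro hN
      obtain ⟨D, hD, hg⟩ := ih (by omega)
      obtain ⟨lam, h1, h2, h3⟩ := H.exists_fits N
      have hfit : (H.nthCell N).Fits D lam := ⟨h1, h2, fun z hz => by
        rw [hg, Finset.prod_eq_one, mul_one, h3 z hz]
        intro n hn
        have hnN := Finset.mem_range.1 hn
        refine (H.nthCell n).hole_of_notMem fun hz' => ?_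
        have := nthCell_disjoint (by omega) (by omega) hz hz'
        omega⟩
      refine ⟨D.punch _ hfit, isSumS1S2_punch hfit hD, fun Z => ?_⟩
      rw [hfit.punch_g, hg, Finset.prod_range_succ, mul_assoc]
  exact key _ le_rfl


variable {H : HoleData}

/-- The positive factor of the hole function. -/
def holeUnit (H : HoleData) (n : ℕ) (Z : ℂ) : ℝ :=
  (1 - H.r ^ 2) / (H.eta ^ 2 * ‖H.half ((-1) ^ n) (Z / negRoot H.k (n / 2)) + I‖ ^ 2) *
    holeFactor H.r (‖(H.nthCell n).m Z‖ ^ 2)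

lemma holeUnit_pos {n : ℕ} {Z : ℂ} (hZ : Z ∈ (H.nthCell n).m.source) : 0 < H.holeUnit n Z := by
  have h1 := H.eta_pos
  have h2 := norm_pos_iff.2 (mem_nthCell.1 hZ).2
  have h3 : 0 < 1 - H.r ^ 2 := by nlinarith [H.r_pos, H.r_le]
  exact mul_pos (by positivity) (holeFactor_pos H.r_pos (by linarith [H.r_le]))

lemma contDiffAt_holeUnit {n : ℕ} {Z : ℂ} (hZ : Z ∈ (H.nthCell n).m.source) :
    SmoothAt (H.holeUnit n) Z := by
  have h1 : SmoothAt (fun z => ‖H.half ((-1) ^ n) (z / negRoot H.k (n / 2)) + I‖ ^ 2)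
      Z := (contDiff_norm_sq ℝ).contDiffAt.comp Z ((contDiffAt_half_div hZ).add contDiffAt_const)
  have h2 := (contDiff_norm_sq ℝ).contDiffAt.comp Z
      ((H.nthCell n).smooth.contDiffAt ((H.nthCell n).m.open_source.mem_nhds hZ))
  have h3 : H.eta ^ 2 * ‖H.half ((-1) ^ n) (Z / negRoot H.k (n / 2)) + I‖ ^ 2 ≠ 0 :=
    mul_ne_zero (pow_ne_zero _ H.eta_pos.ne')
      (pow_ne_zero _ (norm_ne_zero_iff.2 (mem_nthCell.1 hZ).2))
  exact (contDiffAt_const.div (contDiffAt_const.mul h1) h3).mul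
    ((contDiff_holeFactor H.r_pos (by linarith [H.r_le])).contDiffAt.comp Z h2)

lemma hole_eq {n : ℕ} {Z : ℂ} (hZ : Z ∈ (H.nthCell n).m.source) : (H.nthCell n).hole Z =
    (‖H.eta * H.half ((-1) ^ n) (Z / negRoot H.k (n / 2)) - I‖ ^ 2 - H.rho ^ 2) *
      H.holeUnit n Z := by
  have hW := (mem_nthCell.1 hZ).2
  rw [(H.nthCell n).hole_of_mem hZ, holeUnit, ← mul_assoc]
  change (‖(H.nthCell n).m Z‖ ^ 2 - H.r ^ 2) * _ = _
  congr 1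
  rw [nthCell_m]
  generalize H.half ((-1) ^ n) (Z / negRoot H.k (n / 2)) = W at hW ⊢
  have hN : ‖W + I‖ ^ 2 ≠ 0 := pow_ne_zero _ (norm_ne_zero_iff.2 hW)
  have he := H.eta_pos
  have h1 : ‖W + I‖ ^ 2 = W.re ^ 2 + (W.im + 1) ^ 2 := by rw [sq_norm, normSq_apply]; simp; ring
  have h2 : ‖W - I‖ ^ 2 = W.re ^ 2 + (W.im - 1) ^ 2 := by rw [sq_norm, normSq_apply]; simp; ring
  have h3 : ‖H.eta * W - I‖ ^ 2 = (H.eta * W.re) ^ 2 + (H.eta * W.im - 1) ^ 2 := by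
    rw [sq_norm, normSq_apply]; simp; ring
  rw [norm_div, div_pow, h3]
  rw [h1] at hN
  rw [h1, h2]
  have h4 : H.rho ^ 2 = 1 - H.eta ^ 2 := by linarith [H.eta_sq_add]
  have h5 : 1 - H.r ^ 2 = H.eta * (1 + H.r ^ 2) := by rw [eta]; field_simp
  rw [h4]
  field_simp
  have h6 : H.r ^ 2 * (1 + H.eta) = 1 - H.eta := by linarith
  linear_combination (-2 * H.eta * W.im) * h6

/-- Near the hole, the half plane coordinate is an affine function of `ringCoord`. -/
lemma norm_half_eq {n : ℕ} {Z : ℂ} (hZ : Z ∈ (H.nthCell n).m.source)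
    (h1 : |(crd(H) Z).re - (-1) ^ n * H.c| ≤ 3 / 4 * H.c)
    (h2 : |1 - (crd(H) Z).im| ≤ 3 / 2) :
    ‖H.eta * H.half ((-1) ^ n) (Z / negRoot H.k (n / 2)) - I‖ ^ 2 =
      ‖crd(H) Z - (((-1) ^ n * H.c : ℝ) : ℂ)‖ ^ 2 := by
  have hc := H.c_pos
  have he := H.eta_pos
  rw [ringCoord_re_of_mem hZ] at h1
  have h3 : |(H.k * (Z / negRoot H.k (n / 2)).arg - (-1) ^ n * H.c) / H.c| ≤ 3 / 4 := by
    rw [abs_div, abs_of_pos hc, div_le_iff₀ hc]; exact h1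
  have h4 : |4 * (1 - ‖Z / negRoot H.k (n / 2)‖ ^ 2) / 3| ≤ 3 / 4 := by
    rw [norm_div_negRoot]
    have : 4 * (1 - ‖Z‖ ^ 2) / 3 = (1 - (crd(H) Z).im) / 2 := by simp only [ringCoord]; ring
    rw [this, abs_div]; linarith
  rw [sq_norm, sq_norm, normSq_apply, normSq_apply]
  simp only [sub_re, sub_im, re_ofReal_mul, im_ofReal_mul,
    I_re, I_im, ofReal_re, ofReal_im, ringCoord_re_of_mem hZ]
  rw [half, stretch_of_abs_le h3, stretch_of_abs_le h4, norm_div_negRoot]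
  simp only [ringCoord]
  field_simp; ring

/-- Outside the region of the previous lemma the hole function is positive. -/
lemma rho_lt_norm_half {n : ℕ} {Z : ℂ} (hZ : Z ∈ (H.nthCell n).m.source)
    (h : ¬ (|(crd(H) Z).re - (-1) ^ n * H.c| ≤ 3 / 4 * H.c ∧
      |1 - (crd(H) Z).im| ≤ 3 / 2)) :
    H.rho ^ 2 < ‖H.eta * H.half ((-1) ^ n) (Z / negRoot H.k (n / 2)) - I‖ ^ 2 := by
  have hc := H.c_pos
  have he := H.eta_pos
  have hρ := H.rho_pos
  have hρ1 := H.rho_le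
  have hρ2 : H.rho < 3 / 4 * H.c := H.hole_lt
  have hs := (mem_nthCell.1 hZ).1.2
  have h3 : ‖H.eta * H.half ((-1) ^ n) (Z / negRoot H.k (n / 2)) - I‖ ^ 2 =
      (H.c * stretch ((H.k * (Z / negRoot H.k (n / 2)).arg - (-1) ^ n * H.c) / H.c)) ^ 2 +
      (2 * stretch (4 * (1 - ‖Z / negRoot H.k (n / 2)‖ ^ 2) / 3) - 1) ^ 2 := by
    rw [sq_norm, normSq_apply]
    simp only [sub_re, sub_im, re_ofReal_mul, im_ofReal_mul,
      I_re, I_im, half]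
    field_simp; ring
  rw [h3]
  set A := stretch ((H.k * (Z / negRoot H.k (n / 2)).arg - (-1) ^ n * H.c) / H.c) with hA
  set B := stretch (4 * (1 - ‖Z / negRoot H.k (n / 2)‖ ^ 2) / 3) with hB
  rw [not_and_or, not_le] at h
  rcases h with h | h
  · have h4 := abs_le_abs_stretch hs.1
    rw [← hA, abs_div, abs_of_pos hc, div_le_iff₀ hc, ← ringCoord_re_of_mem hZ] at h4
    have h6 : (H.c * A) ^ 2 = (H.c * |A|) ^ 2 := by rw [mul_pow, mul_pow, sq_abs]
    rw [h6]; nlinarith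
  · have h4 : |1 - (crd(H) Z).im| / 2 ≤ |B| := by
      have h5 := abs_le_abs_stretch hs.2
      have h6 : 4 * (1 - ‖Z / negRoot H.k (n / 2)‖ ^ 2) / 3 = (1 - (crd(H) Z).im) / 2 := by
        rw [norm_div_negRoot]; simp only [ringCoord]; ring
      rwa [← hB, h6, abs_div, abs_of_pos (by norm_num : (0 : ℝ) < 2)] at h5
    have h7 : 3 / 4 < |B| := by linarith
    have h8 : 1 / 4 ≤ (2 * B - 1) ^ 2 := by rcases lt_abs.1 h7 with h8 | h8 <;> nlinarith
    nlinarith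

/-- A point of the hole is in the corresponding cell. -/
lemma exists_mem_nthCell {σ : ℝ} (hσ : σ = 1 ∨ σ = -1) {Z : ℂ}
    (h : ‖crd(H) Z - ctr(σ, H)‖ ≤ H.rho) :
    ∃ n < 2 * H.k, (-1) ^ n = σ ∧ Z ∈ (H.nthCell n).m.source := by
  have hc := H.c_pos; have hc1 := H.c_le
  have hρ1 := H.rho_le
  have hρ2 : H.rho < 3 / 4 * H.c := H.hole_lt
  have hk := H.k_pos'
  have hk1 := H.one_le_k
  have hpi := pi_gt_three
  have hre := (abs_re_le_norm _).trans h
  have him := (abs_im_le_norm _).trans h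
  rw [sub_re, ofReal_re, abs_le] at hre
  rw [sub_im, ofReal_im, abs_le] at him
  have hy : (crd(H) Z).im = (8 * ‖Z‖ ^ 2 - 5) / 3 := rfl
  have hZ : Z ≠ 0 := by
    rintro rfl
    rw [hy] at him
    norm_num at him
    linarith
  have hn := norm_pos_iff.2 hZ
  set x := (crd(H) Z).re with hx
  -- The direction of `Z` is `e^{i x / k}` times a root of `-1`.
  have hroot : (Z / (‖Z‖ * exp ((x / H.k : ℝ) * I))) ^ H.k = -1 := by
    have h1 := norm_mul_exp_arg_mul_I (-Z ^ H.k)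
    rw [norm_neg, norm_pow] at h1
    rw [div_pow, mul_pow, ← exp_nat_mul]
    have h2 : H.k * ((x / H.k : ℝ) * I) = x * I := by
      have : H.k ≠ 0 := by exact_mod_cast hk.ne'
      push_cast; field_simp
    have h3 : Z ^ H.k = -(((‖Z‖ : ℂ)) ^ H.k * exp (x * I)) := by
      rw [← neg_eq_iff_eq_neg, ← h1]; push_cast; rfl
    rw [h2, h3, neg_div, div_self]
    exact mul_ne_zero (pow_ne_zero _ (by exact_mod_cast hn.ne')) (exp_ne_zero _)
  obtain ⟨l, hl, hlZ⟩ := exists_negRoot H.k_pos hroot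
  have hdiv : Z / negRoot H.k l = ‖Z‖ * exp ((x / H.k : ℝ) * I) := by rw [hlZ, div_div_cancel₀ hZ]
  have hxk : x / H.k ∈ Ioo (-Real.pi) Real.pi := by
    rw [mem_Ioo, lt_div_iff₀ hk, div_lt_iff₀ hk]
    rcases hσ with rfl | rfl <;> constructor <;> nlinarith [hre.2]
  have harg : (Z / negRoot H.k l).arg = x / H.k := by
    rw [hdiv, arg_real_mul _ hn, arg_exp, mul_I_im, ofReal_re,
      (toIocMod_eq_self two_pi_pos).2 ⟨hxk.1, by linarith [hxk.2]⟩]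
  have hmem : ∀ n, n / 2 = l → (-1 : ℝ) ^ n = σ → Z ∈ (H.nthCell n).m.source := by
    intro n hn1 hn2
    rw [mem_nthCell, hn1, hn2]
    refine ⟨⟨?_, ?_, ?_⟩, fun h0 => ?_⟩
    · rw [mem_slitPlane_iff_arg, harg]
      exact ⟨hxk.2.ne, div_ne_zero hZ (negRoot_ne_zero _ _)⟩
    · rw [harg, mul_div_cancel₀ _ hk.ne', mem_Ioo, lt_div_iff₀ hc, div_lt_iff₀ hc]
      constructor <;> linarith [hre.2]
    · rw [norm_div_negRoot]
      rw [hy] at him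
      constructor <;> linarith [him.2]
    · have h1 := congrArg im h0
      have h2 : |4 * (1 - ‖Z‖ ^ 2) / 3| ≤ 3 / 4 := by
        rw [hy] at him
        rw [abs_le]; constructor <;> linarith [him.2]
      simp only [half, add_im, I_im, norm_div_negRoot, zero_im,
        stretch_of_abs_le h2] at h1
      have h3 : 0 < 2 * (4 * (1 - ‖Z‖ ^ 2) / 3) / H.eta := by
        apply div_pos _ H.eta_pos
        rw [hy] at him
        linarith [him.2]
      linarith
  rcases hσ with rfl | rfl
  · exact ⟨2 * l, by omega, by simp, hmem _ (by omega) (by simp)⟩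
  · exact ⟨2 * l + 1, by omega, by simp [pow_succ], hmem _ (by omega) (by simp [pow_succ])⟩

/-- Sign of the hole function. -/
lemma hole_sign {n : ℕ} {Z : ℂ} (hZ : Z ∈ (H.nthCell n).m.source) :
    (0 ≤ (H.nthCell n).hole Z ↔ H.rho ≤ ‖crd(H) Z - (((-1) ^ n * H.c : ℝ) : ℂ)‖) ∧
    (0 < (H.nthCell n).hole Z ↔ H.rho < ‖crd(H) Z - (((-1) ^ n * H.c : ℝ) : ℂ)‖) := by
  have hρ := H.rho_pos
  have hu := holeUnit_pos hZ
  rw [hole_eq hZ, mul_nonneg_iff_of_pos_right hu, mul_pos_iff_of_pos_right hu, sub_nonneg, sub_pos]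
  by_cases h : |(crd(H) Z).re - (-1) ^ n * H.c| ≤ 3 / 4 * H.c ∧
      |1 - (crd(H) Z).im| ≤ 3 / 2
  · rw [norm_half_eq hZ h.1 h.2]
    exact ⟨pow_le_pow_iff_left₀ hρ.le (norm_nonneg _) two_ne_zero,
      pow_lt_pow_iff_left₀ hρ.le (norm_nonneg _) two_ne_zero⟩
  · have h1 := rho_lt_norm_half hZ h
    have h2 : H.rho < ‖crd(H) Z - (((-1) ^ n * H.c : ℝ) : ℂ)‖ := by
      by_contra! h3
      refine h ⟨?_, ?_⟩
      · have := (abs_re_le_norm _).trans h3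
        rw [sub_re] at this
        exact this.trans H.hole_lt.le
      · have := (abs_im_le_norm _).trans h3
        rw [sub_im, ofReal_im, abs_le] at this
        have := H.rho_le
        rw [abs_le]; constructor <;> linarith
    exact ⟨⟨fun _ => h2.le, fun _ => h1.le⟩, ⟨fun _ => h2, fun _ => h1⟩⟩

end HoleData

lemma annulusFn_eq (k : ℕ) (Z : ℂ) : annulusFn Z = (1 - (ringCoord k Z).im) *
    (1 + (ringCoord k Z).im) * (9 / 64 * holeFactor (1 / 2) (‖Z‖ ^ 2)) := by
  rw [annulusFn, holeProfile]; simp only [ringCoord]; ring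

namespace HoleData

variable {H : HoleData}

/-- `g` has near `Z` the same sign and zero set as `q`, and vanishes to the same order. -/
def Comparable (g q : ℂ → ℝ) (Z : ℂ) : Prop :=
  ∃ G : ℂ → ℝ, SmoothAt G Z ∧ 0 < G Z ∧ ∀ᶠ Y in 𝓝 Z, g Y = q Y * G Y

lemma annulusFn_pos {Z : ℂ} (h : |(crd(H) Z).im| < 1) : 0 < annulusFn Z := by
  rw [annulusFn_eq H.k]
  have h1 := abs_lt.1 h
  have h2 := holeFactor_pos (r := 1 / 2) (s := ‖Z‖ ^ 2) (by norm_num) (by norm_num)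
  exact mul_pos (mul_pos (by linarith) (by linarith)) (by positivity)

lemma im_lt_of_norm_le {σ : ℝ} {Z : ℂ} (h : ‖crd(H) Z - ctr(σ, H)‖ ≤ H.rho) :
    |(crd(H) Z).im| < 1 := by
  have := (abs_im_le_norm _).trans h
  rw [sub_im, ofReal_im, sub_zero] at this
  linarith [H.rho_le]

/-- If the point is not in a closed hole, all hole functions are positive. -/
lemma hole_pos_of {Z : ℂ}
    (h : ∀ σ : ℝ, σ = 1 ∨ σ = -1 → H.rho < ‖crd(H) Z - ctr(σ, H)‖) (n : ℕ) :
    0 < (H.nthCell n).hole Z := by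
  by_cases hZ : Z ∈ (H.nthCell n).m.source
  · exact (hole_sign hZ).2.2 (h _ (neg_one_pow_eq_or ℝ n))
  · rw [(H.nthCell n).hole_of_notMem hZ]; exact one_pos

lemma hole_nonneg_of {Z : ℂ}
    (h : ∀ σ : ℝ, σ = 1 ∨ σ = -1 → H.rho ≤ ‖crd(H) Z - ctr(σ, H)‖) (n : ℕ) :
    0 ≤ (H.nthCell n).hole Z := by
  by_cases hZ : Z ∈ (H.nthCell n).m.source
  · exact (hole_sign hZ).1.2 (h _ (neg_one_pow_eq_or ℝ n))
  · rw [(H.nthCell n).hole_of_notMem hZ]; exact zero_le_one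

/-- At most one of the holes is relevant at each point. -/
lemma prod_holes_erase {n : ℕ} (hn : n < 2 * H.k) {Z : ℂ} (hZ : Z ∈ (H.nthCell n).m.source) :
    ∏ i ∈ Finset.range (2 * H.k), (H.nthCell i).hole Z = (H.nthCell n).hole Z := by
  refine Finset.prod_eq_single n (fun i hi hin => ?_) (fun h => absurd (Finset.mem_range.2 hn) h)
  refine (H.nthCell i).hole_of_notMem fun hi' => hin ?_
  exact nthCell_disjoint (Finset.mem_range.1 hi) hn hi' hZ

variable (H) in
/-- The planar domain of genus zero with `2 k + 2` boundary circles, in the coordinate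
`ringCoord`. -/
lemma exists_planarDomain : ∃ D : RegDomain, IsSumS1S2 (2 * H.k + 1) D.Mfd ∧
    (∀ Z, 0 ≤ D.g Z ↔ |(crd(H) Z).im| ≤ 1 ∧
      ∀ σ : ℝ, σ = 1 ∨ σ = -1 → H.rho ≤ ‖crd(H) Z - ctr(σ, H)‖) ∧
    (∀ Z, 0 < D.g Z → |(crd(H) Z).im| < 1 ∧
      ∀ σ : ℝ, σ = 1 ∨ σ = -1 → H.rho < ‖crd(H) Z - ctr(σ, H)‖) ∧
    ∀ Z, D.g Z = 0 →
      ((crd(H) Z).im = 1 ∧ Comparable D.g (fun Y => 1 - (crd(H) Y).im) Z) ∨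
      ((crd(H) Z).im = -1 ∧ Comparable D.g (fun Y => 1 + (crd(H) Y).im) Z) ∨
      ∃ σ : ℝ, (σ = 1 ∨ σ = -1) ∧ ‖crd(H) Z - ctr(σ, H)‖ = H.rho ∧
        Comparable D.g (fun Y => ‖crd(H) Y - ctr(σ, H)‖ ^ 2 - H.rho ^ 2) Z := by
  obtain ⟨D, hD, hg⟩ := H.exists_regDomain
  have hsm : ∀ n, Smooth (H.nthCell n).hole := fun n => (H.nthCell n).contDiff_hole
  have hprod : Smooth (fun Z => ∏ n ∈ Finset.range (2 * H.k), (H.nthCell n).hole Z) :=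
    contDiff_prod fun n _ => hsm n
  have hfac : Smooth (fun Z : ℂ => 9 / 64 * holeFactor (1 / 2) (‖Z‖ ^ 2)) :=
    contDiff_const.mul ((contDiff_holeFactor (by norm_num) (by norm_num)).comp (contDiff_norm_sq ℝ))
  have him : Smooth (fun Z => (crd(H) Z).im) := by
    exact ((contDiff_const.mul (contDiff_norm_sq ℝ)).sub contDiff_const).div_const _
  have hfpos : ∀ Z : ℂ, 0 < 9 / 64 * holeFactor (1 / 2) (‖Z‖ ^ 2) := fun Z => by
    have h2 := holeFactor_pos (r := 1 / 2) (s := ‖Z‖ ^ 2) (by norm_num) (by norm_num)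
    positivity
  have hin : ∀ (Z : ℂ) σ, (σ = 1 ∨ σ = -1) →
      ‖crd(H) Z - ctr(σ, H)‖ ≤ H.rho →
      ∃ n < 2 * H.k, (-1) ^ n = σ ∧ Z ∈ (H.nthCell n).m.source ∧
        D.g Z = annulusFn Z * (H.nthCell n).hole Z ∧ 0 < annulusFn Z := by
    intro Z σ hσ hle
    obtain ⟨n, hn, hnσ, hZ⟩ := exists_mem_nthCell hσ hle
    exact ⟨n, hn, hnσ, hZ, by rw [hg, prod_holes_erase hn hZ], annulusFn_pos (im_lt_of_norm_le hle)⟩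
  have hle : ∀ Z, 0 ≤ D.g Z ↔ |(crd(H) Z).im| ≤ 1 ∧
      ∀ σ : ℝ, σ = 1 ∨ σ = -1 → H.rho ≤ ‖crd(H) Z - ctr(σ, H)‖ := by
    refine fun Z => ⟨fun h => ?_, ?_⟩
    · have h1 : ∀ σ : ℝ, σ = 1 ∨ σ = -1 → H.rho ≤ ‖crd(H) Z - ctr(σ, H)‖ := by
        intro σ hσ
        by_contra! h1
        obtain ⟨n, hn, hnσ, hZ, he, hpos⟩ := hin Z σ hσ h1.le
        rw [he, mul_nonneg_iff_of_pos_left hpos, (hole_sign hZ).1, hnσ] at h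
        linarith
      refine ⟨?_, h1⟩
      by_contra! h2
      have h3 : ∀ σ : ℝ, σ = 1 ∨ σ = -1 → H.rho < ‖crd(H) Z - ctr(σ, H)‖ := by
        intro σ hσ
        refine lt_of_le_of_ne (h1 σ hσ) fun h4 => ?_
        linarith [im_lt_of_norm_le h4.ge]
      have h4 : 0 < ∏ n ∈ Finset.range (2 * H.k), (H.nthCell n).hole Z :=
        Finset.prod_pos fun n _ => hole_pos_of h3 n
      rw [hg, mul_nonneg_iff_of_pos_right h4, annulusFn_eq H.k,
        mul_nonneg_iff_of_pos_right (hfpos Z)] at h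
      have h5 : 1 < (crd(H) Z).im ^ 2 := by rw [← sq_abs]; nlinarith
      nlinarith
    · rintro ⟨h1, h2⟩
      rw [hg, annulusFn_eq H.k]
      have h3 := abs_le.1 h1
      exact mul_nonneg (mul_nonneg (mul_nonneg (by linarith) (by linarith)) (hfpos Z).le)
        (Finset.prod_nonneg fun n _ => hole_nonneg_of h2 n)
  refine ⟨D, hD, hle, fun Z h => ⟨?_, fun σ hσ => ?_⟩, fun Z hZ => ?_⟩
  · refine lt_of_le_of_ne ((hle Z).1 h.le).1 fun h1 => ?_
    have h2 : annulusFn Z = 0 := by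
      rw [annulusFn_eq H.k]
      rcases (abs_eq one_pos.le).1 h1 with h1 | h1 <;> rw [h1] <;> ring
    rw [hg, h2, zero_mul] at h
    exact lt_irrefl _ h
  · by_contra! h1
    obtain ⟨n, hn, hnσ, hZ, he, hpos⟩ := hin Z σ hσ h1
    rw [he, mul_pos_iff_of_pos_left hpos, (hole_sign hZ).2, hnσ] at h
    linarith
  · by_cases h : ∃ σ : ℝ, (σ = 1 ∨ σ = -1) ∧ ‖crd(H) Z - ctr(σ, H)‖ ≤ H.rho
    · obtain ⟨σ, hσ, hle⟩ := h
      obtain ⟨n, hn, hnσ, hZs, he, hpos⟩ := hin Z σ hσ hle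
      have h0 : (H.nthCell n).hole Z = 0 := by
        rw [he] at hZ
        exact (mul_eq_zero.1 hZ).resolve_left hpos.ne'
      have hge := (hole_sign hZs).1.1 h0.ge
      rw [hnσ] at hge
      have heq := le_antisymm hle hge
      refine Or.inr (Or.inr ⟨σ, hσ, heq, fun Y => H.holeUnit n Y * annulusFn Y, ?_, ?_, ?_⟩)
      · exact (contDiffAt_holeUnit hZs).mul contDiff_annulusFn.contDiffAt
      · exact mul_pos (holeUnit_pos hZs) hpos
      · have hcont : ContinuousAt (crd(H)) Z := by
          have hre : ContinuousAt (fun Y => H.k * (Y / negRoot H.k (n / 2)).arg) Z :=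
            continuousAt_const.mul (ContinuousAt.comp
              (f := fun Y => Y / negRoot H.k (n / 2))
              (Complex.continuousAt_arg (mem_nthCell.1 hZs).1.1) (by fun_prop))
          have hre' : ContinuousAt (fun Y => (crd(H) Y).re) Z := by
            refine hre.congr ?_
            filter_upwards [(H.nthCell n).m.open_source.mem_nhds hZs] with Y hY
            exact (ringCoord_re_of_mem hY).symm
          have hpair := (Complex.continuous_ofReal.continuousAt.comp hre').add
            ((Complex.continuous_ofReal.continuousAt.comp
              (him.continuous.continuousAt)).mul (continuousAt_const (y := I)))
          refine hpair.congr (Filter.Eventually.of_forall fun Y => ?_)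
          exact re_add_im _
        have hn1 : ∀ᶠ Y in 𝓝 Z, ‖crd(H) Y - ctr(σ, H)‖ < min (3 / 4 * H.c) (1 / 2) := by
          refine (hcont.sub continuousAt_const).norm.eventually_lt continuousAt_const ?_
          change ‖crd(H) Z - ctr(σ, H)‖ < _
          rw [heq, lt_min_iff]
          exact ⟨H.hole_lt, by linarith [H.rho_le]⟩
        filter_upwards [(H.nthCell n).m.open_source.mem_nhds hZs, hn1] with Y hY hY1
        rw [lt_min_iff] at hY1
        have hre := (abs_re_le_norm _).trans hY1.1.le
        have him1 := (abs_im_le_norm _).trans hY1.2.le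
        rw [sub_re] at hre
        rw [sub_im, ofReal_im, abs_le] at him1
        have hb : |1 - (crd(H) Y).im| ≤ 3 / 2 := by rw [abs_le]; constructor <;> linarith
        rw [hg, prod_holes_erase hn hY, hole_eq hY, norm_half_eq hY (by rw [hnσ]; exact hre) hb,
          hnσ]
        ring
    · push Not at h
      have hpos : 0 < ∏ n ∈ Finset.range (2 * H.k), (H.nthCell n).hole Z :=
        Finset.prod_pos fun n _ => hole_pos_of h n
      rw [hg, mul_eq_zero, or_iff_left hpos.ne', annulusFn_eq H.k, mul_eq_zero,
        or_iff_left (hfpos Z).ne', mul_eq_zero] at hZ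
      rcases hZ with hZ | hZ
      · have h1 : (crd(H) Z).im = 1 := by linarith
        refine Or.inl ⟨h1, fun Y => (1 + (crd(H) Y).im) *
          (9 / 64 * holeFactor (1 / 2) (‖Y‖ ^ 2)) *
            ∏ n ∈ Finset.range (2 * H.k), (H.nthCell n).hole Y, ?_, ?_, ?_⟩
        · exact (((contDiff_const.add him).mul hfac).mul hprod).contDiffAt
        · exact mul_pos (mul_pos (by rw [h1]; norm_num) (hfpos Z)) hpos
        · exact Filter.Eventually.of_forall fun Y => by rw [hg, annulusFn_eq H.k]; ring
      · have h1 : (crd(H) Z).im = -1 := by linarith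
        refine Or.inr (Or.inl ⟨h1, fun Y => (1 - (crd(H) Y).im) *
          (9 / 64 * holeFactor (1 / 2) (‖Y‖ ^ 2)) *
            ∏ n ∈ Finset.range (2 * H.k), (H.nthCell n).hole Y, ?_, ?_, ?_⟩)
        · exact (((contDiff_const.sub him).mul hfac).mul hprod).contDiffAt
        · exact mul_pos (mul_pos (by rw [h1]; norm_num) (hfpos Z)) hpos
        · exact Filter.Eventually.of_forall fun Y => by rw [hg, annulusFn_eq H.k]; ring

end HoleData

/-! ### Interpolation between the identity and the logarithmic coordinate -/

/-- The difference of the logarithmic coordinate `log ((2 + w) / (2 - w))` and `w`. -/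
def logDiff (w : ℂ) : ℂ := Complex.log ((2 + w) / (2 - w)) - w

lemma two_sub_ne_zero {w : ℂ} (hw : ‖w‖ < 1) : 2 - w ≠ 0 := by
  intro h
  have : w = 2 := by linear_combination -h
  rw [this] at hw
  norm_num at hw

lemma re_moebius {w : ℂ} (hw : ‖w‖ < 1) : 0 < ((2 + w) / (2 - w)).re := by
  have h2 := Complex.normSq_pos.2 (two_sub_ne_zero hw)
  have h3 : ‖w‖ ^ 2 < 1 := by nlinarith [norm_nonneg w]
  rw [sq_norm, normSq_apply] at h3
  rw [Complex.div_re, ← add_div]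
  apply div_pos _ h2
  simp; nlinarith

lemma hasDerivAt_logDiff {w : ℂ} (hw : ‖w‖ < 1) :
    HasDerivAt logDiff (w ^ 2 / (4 - w ^ 2)) w := by
  have h1 := two_sub_ne_zero hw
  have h1' : 2 + w ≠ 0 := by
    have := two_sub_ne_zero (by rwa [norm_neg])
    rwa [sub_neg_eq_add] at this
  have h3 : (4 - w ^ 2) ≠ 0 := by
    have : 4 - w ^ 2 = (2 - w) * (2 + w) := by ring
    rw [this]; exact mul_ne_zero h1 h1'
  have h2 : HasDerivAt (fun w => (2 + w) / (2 - w))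
      ((1 * (2 - w) - (2 + w) * (-1)) / (2 - w) ^ 2) w :=
    ((hasDerivAt_id w).const_add 2).div ((hasDerivAt_id w).const_sub 2) h1
  convert! ((h2.clog (mem_slitPlane_iff.2 (Or.inl (re_moebius hw)))).sub (hasDerivAt_id w)) using 1
  field_simp; ring

lemma norm_deriv_logDiff_le {w : ℂ} (hw : ‖w‖ ≤ 1 / 2) : ‖w ^ 2 / (4 - w ^ 2)‖ ≤ ‖w‖ ^ 2 / 3 := by
  have h1 : 3 ≤ ‖4 - w ^ 2‖ := by
    have h2 := norm_sub_norm_le 4 (w ^ 2)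
    rw [norm_pow] at h2
    have h3 : ‖(4 : ℂ)‖ = 4 := by norm_num
    nlinarith [norm_nonneg w]
  rw [norm_div, norm_pow]
  exact div_le_div_of_nonneg_left (by positivity) (by norm_num) h1

lemma logDiff_zero : logDiff 0 = 0 := by simp [logDiff]

lemma norm_logDiff_le {w : ℂ} (hw : ‖w‖ ≤ 1 / 2) : ‖logDiff w‖ ≤ ‖w‖ ^ 3 / 3 := by
  have h := (convex_closedBall 0 ‖w‖).norm_image_sub_le_of_norm_hasDerivWithin_le
    (f' := fun w => w ^ 2 / (4 - w ^ 2)) (C := ‖w‖ ^ 2 / 3) (x := 0) (y := w)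
    (fun z hz => (hasDerivAt_logDiff (by
      have := mem_closedBall_zero_iff.1 hz; linarith)).hasDerivWithinAt)
    (fun z hz => by
      have h1 := mem_closedBall_zero_iff.1 hz
      refine (norm_deriv_logDiff_le (by linarith)).trans ?_
      gcongr)
    (by simp) (by simp)
  rw [logDiff_zero, sub_zero, sub_zero] at h
  calc ‖logDiff w‖ ≤ ‖w‖ ^ 2 / 3 * ‖w‖ := h
    _ = ‖w‖ ^ 3 / 3 := by ring

/-- A diffeomorphism which interpolates between the identity near `0` and the logarithmic coordinate
away from `0`, and whose derivative is close to the identity. -/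
def interp (e : ℝ) (w : ℂ) : ℂ :=
  w + (smoothTransition (‖w‖ ^ 2 / e ^ 2 - 1) : ℂ) * logDiff w

lemma interp_of_le {e : ℝ} (he : 0 < e) {w : ℂ} (hw : ‖w‖ ≤ e) : interp e w = w := by
  have h : ‖w‖ ^ 2 / e ^ 2 - 1 ≤ 0 := by
    rw [sub_nonpos, div_le_one (by positivity)]
    exact pow_le_pow_left₀ (norm_nonneg _) hw 2
  rw [interp, smoothTransition.zero_of_nonpos h]; simp

lemma interp_of_ge {e : ℝ} (he : 0 < e) {w : ℂ} (hw : 3 / 2 * e ≤ ‖w‖) :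
    interp e w = Complex.log ((2 + w) / (2 - w)) := by
  have h : 1 ≤ ‖w‖ ^ 2 / e ^ 2 - 1 := by
    rw [le_sub_iff_add_le, le_div_iff₀ (by positivity)]; nlinarith
  rw [interp, smoothTransition.one_of_one_le h, logDiff]; simp

lemma contDiffAt_logDiff {w : ℂ} (hw : ‖w‖ < 1) : SmoothAt logDiff w := by
  have h1 : ContDiffAt ℂ ∞ (fun w => (2 + w) / (2 - w)) w :=
    (contDiffAt_const.add contDiffAt_id).div (contDiffAt_const.sub contDiffAt_id)
      (two_sub_ne_zero hw)
  have h2 := ContDiffAt.comp w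
      (Complex.contDiffAt_log (mem_slitPlane_iff.2 (Or.inl (re_moebius hw)))) h1
  exact (h2.sub contDiffAt_id).restrict_scalars ℝ

lemma contDiffAt_interp {e : ℝ} {w : ℂ} (hw : ‖w‖ < 1) : SmoothAt (interp e) w := by
  have h1 : SmoothAt (fun w => smoothTransition (‖w‖ ^ 2 / e ^ 2 - 1)) w :=
    smoothTransition.contDiff.contDiffAt.comp w
      (((contDiff_norm_sq ℝ).contDiffAt.div_const _).sub contDiffAt_const)
  exact contDiffAt_id.add ((ofRealCLM.contDiff.contDiffAt.comp w h1).mul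
    (contDiffAt_logDiff hw))

lemma exists_deriv_smoothTransition_le :
    ∃ C : ℝ, 0 < C ∧ ∀ s ∈ Icc (-1 : ℝ) 1, |deriv smoothTransition s| ≤ C := by
  obtain ⟨C, hC⟩ := (isCompact_Icc (b := 1)).exists_bound_of_continuousOn
    ((smoothTransition.contDiff).continuous_deriv le_rfl).continuousOn
  exact ⟨max C 1, by positivity, fun s hs => (hC s hs).trans (le_max_left _ _)⟩

/-- The scale of the interpolation can be chosen such that `interp` is `C¹`-close to the
identity. -/
lemma exists_interp_scale : ∃ e : ℝ, 0 < e ∧ e ≤ 1 / 12 ∧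
    ∀ w : ℂ, ‖w‖ < 1 / 2 → ‖fderiv ℝ (fun w => interp e w - w) w‖ ≤ 1 / 4 := by
  obtain ⟨C, hC, hbd⟩ := exists_deriv_smoothTransition_le
  -- The derivative of the cutoff contributes at most `8 C e² / 3`.
  set e : ℝ := min (1 / 12) (1 / (32 * C)) with he
  have he0 : 0 < e := by positivity
  have he1 : e ≤ 1 / 12 := min_le_left _ _
  have heC : C * e ^ 2 ≤ 1 / 32 := by
    have h1 : e ≤ 1 / (32 * C) := min_le_right _ _
    have h2 : C * e ≤ 1 / 32 := by
      calc C * e ≤ C * (1 / (32 * C)) := by gcongr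
        _ = 1 / 32 := by field_simp
    nlinarith
  refine ⟨e, he0, he1, fun w hw => ?_⟩
  have hu : HasFDerivAt (fun w : ℂ => ‖w‖ ^ 2 / e ^ 2 - 1) ((e ^ 2)⁻¹ • (2 • innerSL ℝ w)) w := by
    have h := (((hasStrictFDerivAt_norm_sq w).hasFDerivAt).const_smul (e ^ 2)⁻¹).sub_const 1
    refine h.congr_of_eventuallyEq (Filter.Eventually.of_forall fun y => ?_)
    simp only [Pi.smul_apply, smul_eq_mul]
    rw [div_eq_inv_mul]
  have hT : HasDerivAt smoothTransition (deriv smoothTransition (‖w‖ ^ 2 / e ^ 2 - 1))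
      (‖w‖ ^ 2 / e ^ 2 - 1) :=
    (smoothTransition.contDiff (n := 1).differentiable (by simp) _).hasDerivAt
  set T' := deriv smoothTransition (‖w‖ ^ 2 / e ^ 2 - 1) with hT'
  have h1 : HasFDerivAt (fun w => smoothTransition (‖w‖ ^ 2 / e ^ 2 - 1))
      (T' • ((e ^ 2)⁻¹ • (2 • innerSL ℝ w))) w :=
    HasDerivAt.comp_hasFDerivAt (h₂ := smoothTransition) w hT hu
  have h2 : HasFDerivAt logDiff (((w ^ 2 / (4 - w ^ 2)) • (1 : ℂ →L[ℝ] ℂ))) w := by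
    convert! ((hasDerivAt_logDiff (by linarith)).hasFDerivAt.restrictScalars ℝ) using 1
    ext; simp [mul_comm]
  have h3 : HasFDerivAt (fun w => interp e w - w)
      (smoothTransition (‖w‖ ^ 2 / e ^ 2 - 1) • ((w ^ 2 / (4 - w ^ 2)) • 1) +
        (T' • ((e ^ 2)⁻¹ • (2 • innerSL ℝ w))).smulRight (logDiff w)) w := by
    refine (h1.smul h2).congr_of_eventuallyEq (Filter.Eventually.of_forall fun y => ?_)
    simp only [interp, real_smul, add_sub_cancel_left, Pi.smul_apply']
  rw [h3.fderiv]
  have hb1 : ‖smoothTransition (‖w‖ ^ 2 / e ^ 2 - 1) •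
      ((w ^ 2 / (4 - w ^ 2)) • (1 : ℂ →L[ℝ] ℂ))‖ ≤ 1 / 12 := by
    rw [norm_smul, norm_smul, norm_eq_abs, abs_of_nonneg (smoothTransition.nonneg _)]
    have hone : ‖(1 : ℂ →L[ℝ] ℂ)‖ ≤ 1 := ContinuousLinearMap.norm_id_le
    have h4 := smoothTransition.le_one (‖w‖ ^ 2 / e ^ 2 - 1)
    have h6 : ‖w ^ 2 / (4 - w ^ 2)‖ ≤ 1 / 12 := by
      refine (norm_deriv_logDiff_le hw.le).trans ?_
      nlinarith [norm_nonneg w]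
    calc smoothTransition (‖w‖ ^ 2 / e ^ 2 - 1) * (‖w ^ 2 / (4 - w ^ 2)‖ * ‖(1 : ℂ →L[ℝ] ℂ)‖)
        ≤ 1 * (1 / 12 * 1) := by gcongr
      _ = 1 / 12 := by norm_num
  have hb2 : ‖(T' • ((e ^ 2)⁻¹ • (2 • innerSL ℝ w))).smulRight (logDiff w)‖ ≤ 1 / 6 := by
    rcases le_or_gt (‖w‖ ^ 2) (2 * e ^ 2) with h | h
    · have hmem : ‖w‖ ^ 2 / e ^ 2 - 1 ∈ Icc (-1 : ℝ) 1 := by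
        have h4 : ‖w‖ ^ 2 / e ^ 2 ≤ 2 := by rw [div_le_iff₀ (by positivity)]; exact h
        have h5 : 0 ≤ ‖w‖ ^ 2 / e ^ 2 := by positivity
        constructor <;> linarith
      have h6 := hbd _ hmem
      rw [ContinuousLinearMap.norm_smulRight_apply, norm_smul, norm_smul,
        ← Nat.cast_smul_eq_nsmul ℝ,
        norm_smul, innerSL_apply_norm, norm_eq_abs, norm_eq_abs,
        abs_of_pos (by positivity : 0 < (e ^ 2)⁻¹)]
      have h7 : ‖((2 : ℕ) : ℝ)‖ = 2 := by norm_num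
      rw [h7]
      have h8 := norm_logDiff_le hw.le
      calc |T'| * ((e ^ 2)⁻¹ * (2 * ‖w‖)) * ‖logDiff w‖
          ≤ C * ((e ^ 2)⁻¹ * (2 * ‖w‖)) * (‖w‖ ^ 3 / 3) := by gcongr
        _ = 2 / 3 * C * (e ^ 2)⁻¹ * (‖w‖ ^ 2) ^ 2 := by ring
        _ ≤ 2 / 3 * C * (e ^ 2)⁻¹ * (2 * e ^ 2) ^ 2 := by gcongr
        _ = 8 / 3 * (C * e ^ 2) := by field_simp; ring
        _ ≤ 1 / 6 := by linarith
    · have h4 : smoothTransition =ᶠ[𝓝 (‖w‖ ^ 2 / e ^ 2 - 1)] fun _ => 1 := by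
        have h5 : 1 < ‖w‖ ^ 2 / e ^ 2 - 1 := by
          rw [lt_sub_iff_add_lt, lt_div_iff₀ (by positivity)]; linarith
        filter_upwards [lt_mem_nhds h5] with s hs
        exact smoothTransition.one_of_one_le hs.le
      have h5 : T' = 0 := by rw [hT', h4.deriv_eq]; simp
      rw [h5, zero_smul, ContinuousLinearMap.zero_smulRight]; norm_num
  calc _ ≤ _ := norm_add_le _ _
    _ ≤ 1 / 12 + 1 / 6 := add_le_add hb1 hb2
    _ = 1 / 4 := by norm_num

/-- The scale of the interpolation. -/
def interpScale : ℝ := exists_interp_scale.choose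

lemma interpScale_pos : 0 < interpScale := exists_interp_scale.choose_spec.1

lemma interpScale_le : interpScale ≤ 1 / 12 := exists_interp_scale.choose_spec.2.1

/-- The coordinate on the handle: the identity near `0`, and `log ((2 + w) / (2 - w))` for
`|w| ≥ 1/8`. -/
def handleCoord (w : ℂ) : ℂ := interp interpScale w

lemma handleCoord_of_le {w : ℂ} (hw : ‖w‖ ≤ interpScale) : handleCoord w = w :=
  interp_of_le interpScale_pos hw

lemma handleCoord_of_ge {w : ℂ} (hw : 1 / 8 ≤ ‖w‖) :
    handleCoord w = Complex.log ((2 + w) / (2 - w)) :=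
  interp_of_ge interpScale_pos (by linarith [interpScale_le])

lemma contDiffAt_handleCoord {w : ℂ} (hw : ‖w‖ < 1) : SmoothAt handleCoord w :=
  contDiffAt_interp hw

lemma norm_fderiv_handleCoord_sub_le {w : ℂ} (hw : ‖w‖ < 1 / 2) :
    ‖fderiv ℝ (fun w => handleCoord w - w) w‖ ≤ 1 / 4 :=
  exists_interp_scale.choose_spec.2.2 w hw

lemma norm_handleCoord_sub_sub_le {w w' : ℂ} (hw : ‖w‖ < 1 / 2) (hw' : ‖w'‖ < 1 / 2) :
    ‖(handleCoord w - w) - (handleCoord w' - w')‖ ≤ 1 / 4 * ‖w - w'‖ := by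
  refine (convex_ball 0 (1 / 2)).norm_image_sub_le_of_norm_fderiv_le
    (𝕜 := ℝ) (f := fun w => handleCoord w - w) (fun z hz => ?_) (fun z hz => ?_)
    (mem_ball_zero_iff.2 hw') (mem_ball_zero_iff.2 hw)
  · have h1 := mem_ball_zero_iff.1 hz
    exact ((contDiffAt_handleCoord (by linarith)).differentiableAt (by simp)).sub
      differentiableAt_id
  · exact norm_fderiv_handleCoord_sub_le (mem_ball_zero_iff.1 hz)

lemma norm_sub_le_handleCoord {w w' : ℂ} (hw : ‖w‖ < 1 / 2) (hw' : ‖w'‖ < 1 / 2) :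
    3 / 4 * ‖w - w'‖ ≤ ‖handleCoord w - handleCoord w'‖ := by
  have h := norm_handleCoord_sub_sub_le hw hw'
  have h1 := norm_sub_norm_le (w - w') (handleCoord w - handleCoord w')
  have h2 : ‖w - w' - (handleCoord w - handleCoord w')‖ =
      ‖(handleCoord w - w) - (handleCoord w' - w')‖ := by
    rw [← norm_neg]; ring
  linarith

lemma handleCoord_injOn : InjOn handleCoord (Metric.ball 0 (1 / 2)) := by
  intro w hw w' hw' h
  have h1 := norm_sub_le_handleCoord (mem_ball_zero_iff.1 hw) (mem_ball_zero_iff.1 hw')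
  rw [h, sub_self, norm_zero] at h1
  exact sub_eq_zero.1 (norm_eq_zero.1 (le_antisymm (by linarith) (norm_nonneg _)))

lemma handleCoord_zero : handleCoord 0 = 0 :=
  handleCoord_of_le (by rw [norm_zero]; exact interpScale_pos.le)

lemma norm_handleCoord {w : ℂ} (hw : ‖w‖ < 1 / 2) :
    3 / 4 * ‖w‖ ≤ ‖handleCoord w‖ ∧ ‖handleCoord w‖ ≤ 5 / 4 * ‖w‖ := by
  have h0 : ‖(0 : ℂ)‖ < 1 / 2 := by rw [norm_zero]; norm_num
  have h1 := norm_sub_le_handleCoord hw h0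
  have h2 := norm_handleCoord_sub_sub_le hw h0
  rw [handleCoord_zero] at h1 h2
  simp only [sub_zero] at h1 h2
  have h3 := norm_sub_norm_le (handleCoord w) w
  exact ⟨h1, by linarith⟩

lemma handleCoord_ne_zero {w : ℂ} (hw : ‖w‖ < 1 / 2) (h0 : w ≠ 0) : handleCoord w ≠ 0 := by
  have h1 := (norm_handleCoord hw).1
  have h2 := norm_pos_iff.2 h0
  exact norm_pos_iff.1 (by linarith)

lemma fderiv_handleCoord_injective {w : ℂ} (hw : ‖w‖ < 1 / 2) :
    Function.Injective (fderiv ℝ handleCoord w) := by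
  rw [injective_iff_map_eq_zero]
  intro v hv
  have h1 := norm_fderiv_handleCoord_sub_le hw
  have h2 : fderiv ℝ (fun w => handleCoord w - w) w = fderiv ℝ handleCoord w - 1 :=
    fderiv_fun_sub ((contDiffAt_handleCoord (by linarith)).differentiableAt (by simp))
      differentiableAt_id |>.trans (by rw [fderiv_id]; rfl)
  have h3 := (fderiv ℝ (fun w => handleCoord w - w) w).le_opNorm v
  rw [h2] at h3 h1
  simp only [sub_apply, hv, zero_sub, norm_neg] at h3
  have h4 : ‖v‖ ≤ 1 / 4 * ‖v‖ := h3.trans (by gcongr)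
  exact norm_eq_zero.1 (le_antisymm (by linarith) (norm_nonneg v))

lemma exists_handleCoord_eq {b : ℂ} (hb : ‖b‖ ≤ 1 / 3) :
    ∃ w, ‖w‖ ≤ 4 / 9 ∧ handleCoord w = b := by
  have hmaps : MapsTo (fun w => b - (handleCoord w - w)) (Metric.closedBall 0 (4 / 9))
      (Metric.closedBall 0 (4 / 9)) := by
    intro w hw
    rw [mem_closedBall_zero_iff] at hw ⊢
    have h0 : ‖(0 : ℂ)‖ < 1 / 2 := by rw [norm_zero]; norm_num
    have h2 := norm_handleCoord_sub_sub_le (by linarith : ‖w‖ < 1 / 2) h0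
    rw [handleCoord_zero] at h2
    simp only [sub_zero] at h2
    have h3 := norm_sub_le b (handleCoord w - w)
    linarith
  have hcontr : ContractingWith (1 / 4) (hmaps.restrict _ _ _) := by
    refine ⟨by rw [← NNReal.coe_lt_coe]; norm_num, LipschitzWith.of_dist_le_mul fun x y => ?_⟩
    rw [Subtype.dist_eq, Subtype.dist_eq, dist_eq_norm, dist_eq_norm]
    have hx := mem_closedBall_zero_iff.1 x.2
    have hy := mem_closedBall_zero_iff.1 y.2
    have h1 := norm_handleCoord_sub_sub_le (by linarith : ‖(y : ℂ)‖ < 1 / 2)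
      (by linarith : ‖(x : ℂ)‖ < 1 / 2)
    simp only [MapsTo.val_restrict_apply]
    rw [norm_sub_rev (x : ℂ)]
    convert! h1 using 2
    ring
  obtain ⟨w, hw, hfix, -⟩ := hcontr.exists_fixedPoint' Metric.isClosed_closedBall.isComplete hmaps
    (x := 0) (by norm_num) (edist_ne_top _ _)
  refine ⟨w, mem_closedBall_zero_iff.1 hw, ?_⟩
  have h1 : b - (handleCoord w - w) = w := hfix
  linear_combination -h1

/-! ### The parameter along the handle -/

/-- The parameter of the surgery profile as a function of the modulus on the handle: it is `c / β`
for `β ≤ 2 c` and `-β` for `β ≥ 1/4`. -/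
def handleParam (c β : ℝ) : ℝ :=
  (1 - smoothTransition ((β - 2 * c) / (1 / 4 - 2 * c))) * (c / β) -
    smoothTransition ((β - 2 * c) / (1 / 4 - 2 * c)) * β

section Param

variable {c β : ℝ}

lemma handleParam_of_le (hc : c < 1 / 8) (hβ : β ≤ 2 * c) : handleParam c β = c / β := by
  have h : (β - 2 * c) / (1 / 4 - 2 * c) ≤ 0 := div_nonpos_of_nonpos_of_nonneg (by linarith)
      (by linarith)
  rw [handleParam, smoothTransition.zero_of_nonpos h]; ring

lemma handleParam_of_ge (hc : c < 1 / 8) (hβ : 1 / 4 ≤ β) : handleParam c β = -β := by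
  have h : 1 ≤ (β - 2 * c) / (1 / 4 - 2 * c) := by rw [le_div_iff₀ (by linarith)]; linarith
  rw [handleParam, smoothTransition.one_of_one_le h]; ring

lemma contDiffAt_handleParam (hβ : 0 < β) : SmoothAt (handleParam c) β := by
  have h1 : SmoothAt (fun β => smoothTransition ((β - 2 * c) / (1 / 4 - 2 * c))) β :=
    smoothTransition.contDiff.contDiffAt.comp β
      ((contDiffAt_id.sub contDiffAt_const).div_const _)
  exact ((contDiffAt_const.sub h1).mul (contDiffAt_const.div contDiffAt_id hβ.ne')).sub
    (h1.mul contDiffAt_id)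

lemma deriv_handleParam_neg (hc0 : 0 < c) (hc : c < 1 / 8) (hβ : 0 < β) :
    deriv (handleParam c) β < 0 := by
  set T' := deriv smoothTransition ((β - 2 * c) / (1 / 4 - 2 * c)) with hT'
  have hT : HasDerivAt smoothTransition T' ((β - 2 * c) / (1 / 4 - 2 * c)) :=
    (smoothTransition.contDiff (n := 1).differentiable (by simp) _).hasDerivAt
  have hT0 : 0 ≤ T' := smoothTransition.monotone.deriv_nonneg
  have h1 : HasDerivAt (fun β => (β - 2 * c) / (1 / 4 - 2 * c)) (1 / (1 / 4 - 2 * c)) β :=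
    ((hasDerivAt_id β).sub_const _).div_const _
  have h2 : HasDerivAt (fun β => smoothTransition ((β - 2 * c) / (1 / 4 - 2 * c)))
      (T' * (1 / (1 / 4 - 2 * c))) β := HasDerivAt.comp (h₂ := smoothTransition) β hT h1
  have h3 : HasDerivAt (fun β => c / β) (-(c / β ^ 2)) β := by
    convert! ((hasDerivAt_inv hβ.ne').const_mul c) using 1
    ring
  have h4 : HasDerivAt (handleParam c) _ β :=
    ((h2.const_sub 1).mul h3).sub (h2.mul (hasDerivAt_id β))
  rw [h4.deriv]
  have h5 := smoothTransition.nonneg ((β - 2 * c) / (1 / 4 - 2 * c))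
  have h6 := smoothTransition.le_one ((β - 2 * c) / (1 / 4 - 2 * c))
  set T := smoothTransition ((β - 2 * c) / (1 / 4 - 2 * c))
  have h7 : 0 < c / β ^ 2 := by positivity
  have h8 : 0 ≤ T' * (1 / (1 / 4 - 2 * c)) := mul_nonneg hT0 (one_div_nonneg.2 (by linarith))
  have h9 : 0 < c / β := by positivity
  have h10 : 0 < (1 - T) * (c / β ^ 2) + T := by
    rcases h5.eq_or_lt with h | h
    · rw [← h]; linarith
    · have := mul_nonneg (by linarith : 0 ≤ 1 - T) h7.le
      linarith
  nlinarith [mul_nonneg h8 hβ.le]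

lemma strictAntiOn_handleParam (hc0 : 0 < c) (hc : c < 1 / 8) :
    StrictAntiOn (handleParam c) (Ioi 0) := by
  refine strictAntiOn_of_deriv_neg (convex_Ioi _)
    (fun β hβ => (contDiffAt_handleParam hβ).continuousAt.continuousWithinAt) ?_
  rw [interior_Ioi]
  exact fun β hβ => deriv_handleParam_neg hc0 hc hβ

lemma exists_handleParam_eq (hc0 : 0 < c) (hc : c < 1 / 8) (s : ℝ) :
    ∃ β, 0 < β ∧ handleParam c β = s := by
  -- Intermediate values between `c / β ≥ s` for small `β` and `-β ≤ s` for large `β`.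
  set a : ℝ := min (2 * c) (c / (|s| + 1)) with ha
  have hs : 0 < |s| + 1 := by positivity
  have ha0 : 0 < a := lt_min (by linarith) (by positivity)
  set b : ℝ := |s| + 1 with hb
  have hab : a ≤ b := (min_le_left _ _).trans (by have := abs_nonneg s; linarith)
  have hfa : s ≤ handleParam c a := by
    rw [handleParam_of_le hc (min_le_left _ _), le_div_iff₀ ha0]
    have h1 : a ≤ c / (|s| + 1) := min_le_right _ _
    rw [le_div_iff₀ hs] at h1
    nlinarith [le_abs_self s]
  have hfb : handleParam c b ≤ s := by
    rw [handleParam_of_ge hc (by have := abs_nonneg s; linarith)]; linarith [neg_abs_le s]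
  obtain ⟨β, hβ, hβs⟩ := intermediate_value_Icc' hab
    (fun β hβ => (contDiffAt_handleParam (lt_of_lt_of_le ha0 hβ.1)).continuousAt.continuousWithinAt)
    (show s ∈ Icc (handleParam c b) (handleParam c a) from ⟨hfb, hfa⟩)
  exact ⟨β, lt_of_lt_of_le ha0 hβ.1, hβs⟩

end Param

/-! ### Immersions -/

section Immersion

variable {E F G : Type*} [NormedAddCommGroup E] [NormedSpace ℝ E] [NormedAddCommGroup F]
  [NormedSpace ℝ F] [NormedAddCommGroup G] [NormedSpace ℝ G]

/-- The map is smooth at the point and an immersion there. -/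
structure ImmersesAt (f : E → F) (x : E) : Prop where
  contDiffAt : SmoothAt f x
  injective : Function.Injective (fderiv ℝ f x)

lemma ImmersesAt.hasFDerivAt {f : E → F} {x : E} (hf : ImmersesAt f x) :
    HasFDerivAt f (fderiv ℝ f x) x :=
  (hf.contDiffAt.differentiableAt (by simp)).hasFDerivAt

lemma ImmersesAt.comp {g : F → G} {f : E → F} {x : E} (hg : ImmersesAt g (f x))
    (hf : ImmersesAt f x) : ImmersesAt (fun y => g (f y)) x := by
  refine ⟨ContDiffAt.comp x hg.contDiffAt hf.contDiffAt, ?_⟩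
  have h : HasFDerivAt (fun y => g (f y)) _ x :=
    HasFDerivAt.comp x hg.hasFDerivAt hf.hasFDerivAt
  rw [h.fderiv]
  exact hg.injective.comp hf.injective

/-- A smooth map is an immersion if it is one after composition with a differentiable map. -/
lemma ImmersesAt.of_comp {g : F → G} {f : E → F} {x : E} (hf : SmoothAt f x)
    (hg : DifferentiableAt ℝ g (f x)) (h : ImmersesAt (fun y => g (f y)) x) : ImmersesAt f x := by
  refine ⟨hf, ?_⟩
  have h1 := h.injective
  have h2 : HasFDerivAt (fun y => g (f y)) _ x := HasFDerivAt.comp x hg.hasFDerivAt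
    (hf.differentiableAt (by simp)).hasFDerivAt
  rw [h2.fderiv] at h1
  exact Function.Injective.of_comp h1

lemma ImmersesAt.congr {f g : E → F} {x : E} (hf : ImmersesAt f x) (h : g =ᶠ[𝓝 x] f) :
    ImmersesAt g x :=
  ⟨hf.contDiffAt.congr_of_eventuallyEq h, by rw [h.fderiv_eq]; exact hf.injective⟩

lemma immersesAt_id x : ImmersesAt (fun y : E => y) x :=
  ⟨contDiffAt_id, by rw [fderiv_fun_id]; exact Function.injective_id⟩

end Immersion

/-! ### The handle -/

section Handle

variable (S : SurgeryProfile) (c : ℝ)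

lemma SurgeryProfile.pos s : 0 < S.p s ^ 2 + S.q s ^ 2 := by
  rcases lt_or_ge |s| S.R with h | h
  · exact (S.mem_disc s h).1
  · have hR := S.hR.1
    rcases le_abs.1 h with h1 | h1
    · rw [(S.right s h1).1]
      have : 0 < s := by linarith
      positivity
    · have h2 := S.left s (by linarith)
      rw [h2.2]
      have : 0 < -s := by linarith
      positivity

/-- The handle, in the coordinates `(a, b)` of the surgery, as a map from the punctured plane. -/
def handleMap (b : ℂ) : ℂ × ℂ :=
  ((S.p (handleParam c ‖b‖) : ℂ) * (b / ‖b‖), ((S.σ * S.q (handleParam c ‖b‖) : ℝ) : ℂ) * (b / ‖b‖))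

lemma SurgeryProfile.abs_σ : |S.σ| = 1 := by rcases S.hσ with h | h <;> rw [h] <;> simp

lemma SurgeryProfile.σ_mul_σ : S.σ * S.σ = 1 := by rcases S.hσ with h | h <;> rw [h] <;> norm_num

lemma norm_handleMap {b : ℂ} (hb : b ≠ 0) : ‖(handleMap S c b).1‖ = S.p (handleParam c ‖b‖) ∧
    ‖(handleMap S c b).2‖ = S.q (handleParam c ‖b‖) := by
  have h1 : ‖b / (‖b‖ : ℂ)‖ = 1 := by
    rw [norm_div, norm_real, norm_norm, div_self (norm_ne_zero_iff.2 hb)]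
  have h2 := S.nonneg (handleParam c ‖b‖)
  rw [handleMap]
  simp only [norm_mul, h1, norm_coe, abs_mul, S.abs_σ, mul_one, one_mul,
    abs_of_nonneg h2.1, abs_of_nonneg h2.2, and_self]

variable {c} in
lemma handleMap_injective (hc0 : 0 < c) (hc : c < 1 / 8) {b b' : ℂ} (hb : b ≠ 0) (hb' : b' ≠ 0)
    (h : handleMap S c b = handleMap S c b') : b = b' := by
  have h1 := norm_handleMap S c hb
  have h2 := norm_handleMap S c hb'
  rw [h] at h1
  have h3 : handleParam c ‖b‖ = handleParam c ‖b'‖ := by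
    apply S.injective
    simp only [Prod.mk.injEq]
    exact ⟨h1.1.symm.trans h2.1, h1.2.symm.trans h2.2⟩
  have h4 := (strictAntiOn_handleParam hc0 hc).injOn (norm_pos_iff.2 hb)
    (norm_pos_iff.2 hb') h3
  have h5 : (‖b'‖ : ℂ) ≠ 0 := by exact_mod_cast norm_ne_zero_iff.2 hb'
  rw [handleMap, h4, Prod.mk.injEq] at h
  have h6 := S.pos (handleParam c ‖b'‖)
  by_cases hp : S.p (handleParam c ‖b'‖) = 0
  · have hq : S.q (handleParam c ‖b'‖) ≠ 0 := by
      intro hq; rw [hp, hq] at h6; norm_num at h6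
    have hσ : S.σ ≠ 0 := by have := S.σ_mul_σ; intro h0; rw [h0] at this; norm_num at this
    have h7 := mul_left_cancel₀ (by exact_mod_cast mul_ne_zero hσ hq) h.2
    rwa [div_left_inj' h5] at h7
  · have h7 := mul_left_cancel₀ (by exact_mod_cast hp) h.1
    rwa [div_left_inj' h5] at h7

lemma handleMap_exp (ℓ : ℂ) : handleMap S c (exp ℓ) =
    ((S.p (handleParam c (Real.exp ℓ.re)) : ℂ) * exp (ℓ.im * I),
      ((S.σ * S.q (handleParam c (Real.exp ℓ.re)) : ℝ) : ℂ) * exp (ℓ.im * I)) := by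
  have h1 : exp ℓ / (Real.exp ℓ.re : ℂ) = exp (ℓ.im * I) := by
    rw [div_eq_iff (by exact_mod_cast Real.exp_ne_zero _)]
    conv_lhs => rw [← re_add_im ℓ, exp_add]
    push_cast; ring
  rw [handleMap, norm_exp, h1]

lemma contDiffAt_handleMap {b : ℂ} (hb : b ≠ 0) : SmoothAt (handleMap S c) b := by
  have h0 := norm_pos_iff.2 hb
  have hn : SmoothAt (fun b => ‖b‖) b := contDiffAt_norm ℝ hb
  have h1 := ContDiffAt.comp (g := handleParam c) b (contDiffAt_handleParam h0) hn
  have h2 : SmoothAt (fun b => b / (‖b‖ : ℂ)) b :=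
    contDiffAt_cdiv contDiffAt_id (ofRealCLM.contDiff.contDiffAt.comp b hn)
      (by exact_mod_cast h0.ne')
  exact ((ofRealCLM.contDiff.contDiffAt.comp b (S.smooth_p.contDiffAt.comp b h1)).mul
    h2).prodMk ((ofRealCLM.contDiff.contDiffAt.comp b
      (contDiffAt_const.mul (S.smooth_q.contDiffAt.comp b h1))).mul h2)

/-- The derivative of a function in polar coordinates. -/
lemma hasFDerivAt_polar {P : ℝ → ℝ} {P' : ℝ} {ℓ : ℂ} (hP : HasDerivAt P P' ℓ.re) :
    HasFDerivAt (fun ℓ : ℂ => (P ℓ.re : ℂ) * exp (ℓ.im * I))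
      ((P ℓ.re : ℂ) • (exp (ℓ.im * I) • (imCLM.smulRight I)) +
        exp (ℓ.im * I) • (ofRealCLM.comp (P' • reCLM))) ℓ := by
  have h1 := ofRealCLM.hasFDerivAt.comp ℓ
      (HasDerivAt.comp_hasFDerivAt (f := fun ℓ : ℂ => ℓ.re) ℓ hP
        reCLM.hasFDerivAt)
  have h2 : HasFDerivAt (fun ℓ : ℂ => ℓ.im * I)
      (imCLM.smulRight I) ℓ := by
    have h := (imCLM.smulRight I).hasFDerivAt (x := ℓ)
    exact h.congr_of_eventuallyEq (Filter.Eventually.of_forall fun y => by simp)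
  exact h1.mul h2.cexp

variable {c} in
lemma immersesAt_handleMap (hc0 : 0 < c) (hc : c < 1 / 8) {b : ℂ} (hb : b ≠ 0) :
    ImmersesAt (handleMap S c) b := by
  refine ⟨contDiffAt_handleMap S c hb, ?_⟩
  obtain ⟨ℓ, rfl⟩ : ∃ ℓ, exp ℓ = b := ⟨Complex.log b, exp_log hb⟩
  set s := handleParam c (Real.exp ℓ.re) with hs
  have hpos := exp_pos ℓ.re
  have hs' := HasDerivAt.comp (h₂ := handleParam c) ℓ.re
      ((contDiffAt_handleParam hpos).differentiableAt (by simp)).hasDerivAt (Real.hasDerivAt_exp _)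
  set ds := deriv (handleParam c) (Real.exp ℓ.re) * Real.exp ℓ.re with hds
  have hds0 := mul_ne_zero (deriv_handleParam_neg hc0 hc hpos).ne hpos.ne'
  have hp : HasDerivAt (fun x => S.p (handleParam c (Real.exp x))) (deriv S.p s * ds) ℓ.re :=
    HasDerivAt.comp (h := fun x => handleParam c (Real.exp x)) ℓ.re
      (S.smooth_p.differentiable (by simp) _).hasDerivAt hs'
  have hq : HasDerivAt (fun x => S.σ * S.q (handleParam c (Real.exp x)))
      (S.σ * (deriv S.q s * ds)) ℓ.re :=
    (HasDerivAt.comp (h := fun x => handleParam c (Real.exp x)) ℓ.re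
      (S.smooth_q.differentiable (by simp) _).hasDerivAt hs').const_mul _
  have hA := (hasFDerivAt_polar hp).prodMk (hasFDerivAt_polar hq)
  have hB : HasFDerivAt (fun ℓ => handleMap S c (exp ℓ))
      ((fderiv ℝ (handleMap S c) (exp ℓ)).comp
        ((exp ℓ • (1 : ℂ →L[ℝ] ℂ)))) ℓ := by
    refine HasFDerivAt.comp ℓ
      ((contDiffAt_handleMap S c hb).differentiableAt (by simp)).hasFDerivAt ?_
    convert! ((Complex.hasDerivAt_exp ℓ).hasFDerivAt.restrictScalars ℝ) using 1
    ext; simp [mul_comm]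
  have hAB := hB.unique (hA.congr_of_eventuallyEq
    (Filter.Eventually.of_forall fun ℓ => handleMap_exp S c ℓ))
  rw [injective_iff_map_eq_zero]
  intro v hv
  have hv1 := congrArg (fun T => T (v / exp ℓ)) hAB
  simp only [ContinuousLinearMap.comp_apply, smul_apply, one_apply_eq_self, smul_eq_mul,
    mul_div_cancel₀ v (exp_ne_zero ℓ), hv] at hv1
  set x := v / exp ℓ with hx
  have hE := exp_ne_zero (ℓ.im * I)
  have h1 := congrArg Prod.fst hv1.symm
  have h2 := congrArg Prod.snd hv1.symm
  simp only [ContinuousLinearMap.prod_apply, add_apply, smul_apply, smul_eq_mul,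
    ContinuousLinearMap.smulRight_apply, Complex.imCLM_apply, ContinuousLinearMap.comp_apply,
    Complex.ofRealCLM_apply, Complex.reCLM_apply, real_smul, Prod.fst_zero,
    Prod.snd_zero, ← hs] at h1 h2
  have h3 : ((deriv S.p s * ds * x.re : ℝ) : ℂ) + ((S.p s * x.im : ℝ) : ℂ) * I = 0 := by
    apply mul_left_cancel₀ hE
    rw [mul_zero, ← h1]; push_cast; ring
  have h4 : ((S.σ * (deriv S.q s * ds) * x.re : ℝ) : ℂ) + ((S.σ * S.q s * x.im : ℝ) : ℂ) * I
      = 0 := by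
    apply mul_left_cancel₀ hE
    rw [mul_zero, ← h2]; push_cast; ring
  have e1 := congrArg re h3
  have e2 := congrArg im h3
  have e3 := congrArg re h4
  have e4 := congrArg im h4
  simp at e1 e2 e3 e4
  have hσ : S.σ ≠ 0 := by have := S.σ_mul_σ; intro h0; rw [h0] at this; norm_num at this
  have hre : x.re = 0 := by
    by_contra h
    rcases S.regular s with h5 | h5
    · tauto
    · tauto
  have him : x.im = 0 := by
    by_contra h
    have h5 : S.p s = 0 := by tauto
    have h6 : S.q s = 0 := by tauto
    have := S.pos s
    rw [h5, h6] at this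
    norm_num at this
  have hx0 : x = 0 := Complex.ext hre him
  rw [div_eq_zero_iff] at hx0
  exact hx0.resolve_right (exp_ne_zero ℓ)

variable {c} in
/-- The surgery parameter `s ≥ -1/4` is attained in the part of the plane where `handleCoord` is
surjective. -/
lemma exists_handleMap_eq (hc0 : 0 < c) (hc : c < 1 / 8) {s : ℝ} (hs : -(1 / 4) ≤ s) {ξ : ℂ}
    (hξ : ‖ξ‖ = 1) : ∃ w, w ≠ 0 ∧ ‖w‖ ≤ 4 / 9 ∧
      handleMap S c (handleCoord w) = ((S.p s : ℂ) * ξ, ((S.σ * S.q s : ℝ) : ℂ) * ξ) ∧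
        handleParam c ‖handleCoord w‖ = s := by
  obtain ⟨β, hβ, hβs⟩ := exists_handleParam_eq hc0 hc s
  have hβ1 : β ≤ 1 / 4 := by
    by_contra! h
    rw [handleParam_of_ge hc h.le] at hβs
    linarith
  have hb : ‖β * ξ‖ = β := by
    rw [norm_mul, hξ, mul_one, norm_coe, abs_of_pos hβ]
  obtain ⟨w, hw, hwb⟩ := exists_handleCoord_eq (by rw [hb]; linarith)
  have hβC : (β : ℂ) ≠ 0 := by exact_mod_cast hβ.ne'
  refine ⟨w, ?_, hw, ?_, ?_⟩
  · rintro rfl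
    rw [handleCoord_zero] at hwb
    have := congrArg norm hwb
    rw [norm_zero] at this
    linarith
  · rw [hwb, handleMap, hb, hβs, mul_div_cancel_left₀ _ hβC]
  · rw [hwb, hb, hβs]

end Handle

/-! ### The surgered surface in the planar coordinate -/

/-- The data of the parametrization: the surgery, the planar domain, and the size `k₀` of the
handle in it.  The radii and the distances of the holes are such that the holes are the discs
`|V| > e` and `|V| < 1/e` in the coordinate `V` of `Model.innerV`. -/
structure Model where
  S : SurgeryProfile
  t : ℝ
  one_lt : 1 < t
  H : HoleData
  k₀ : ℝ
  k₀_pos : 0 < k₀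
  k₀_le : 2 * k₀ ≤ interpScale
  c_eq : H.c = k₀ * (Real.exp 1 ^ 2 + 1) / (2 * (Real.exp 1 ^ 2 - 1))
  rho_eq : H.rho = k₀ * Real.exp 1 / (Real.exp 1 ^ 2 - 1)

lemma exp_one_bounds : 2.7 < Real.exp 1 ∧ Real.exp 1 < 2.72 :=
  ⟨lt_trans (by norm_num) Real.exp_one_gt_d9, lt_trans Real.exp_one_lt_d9 (by norm_num)⟩

lemma exists_model (S : SurgeryProfile) {t : ℝ} (ht : 1 < t) {k : ℕ} (hk : 1 ≤ k) :
    ∃ M : Model, M.S = S ∧ M.t = t ∧ M.H.k = k := by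
  obtain ⟨he1, he2⟩ := exp_one_bounds
  set e := Real.exp 1 with he
  -- With this radius `k₀ = ρ (e² - 1) / e ≤ 6 r`, which gives `2 k₀ ≤ interpScale`.
  set r : ℝ := interpScale / 12 with hr
  have hi0 := interpScale_pos
  have hi1 := interpScale_le
  have hr0 : 0 < r := by positivity
  set ρ : ℝ := 2 * r / (1 + r ^ 2) with hρ
  have hρ0 : 0 < ρ := by positivity
  have hρ1 : ρ ≤ 2 * r := by rw [div_le_iff₀ (by positivity)]; nlinarith
  have he3 : 0 < e ^ 2 - 1 := by nlinarith
  set k₀ : ℝ := ρ * (e ^ 2 - 1) / e with hk₀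
  have hk0 : 0 < k₀ := by positivity
  have hk1 : 2 * k₀ ≤ interpScale := by
    have h1 : (e ^ 2 - 1) / e ≤ 3 := by rw [div_le_iff₀ (by linarith)]; nlinarith
    have h2 : k₀ = ρ * ((e ^ 2 - 1) / e) := by rw [hk₀]; ring
    have h3 : k₀ ≤ 2 * r * 3 := by rw [h2]; gcongr
    rw [hr] at h3; linarith
  set c : ℝ := k₀ * (e ^ 2 + 1) / (2 * (e ^ 2 - 1)) with hc
  have hc' : c = ρ * (e ^ 2 + 1) / (2 * e) := by rw [hc, hk₀]; field_simp
  have hc0 : 0 < c := by positivity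
  have hc1 : c ≤ 1 := by
    rw [div_le_one (by positivity)]; nlinarith
  have hlt : ρ < 3 / 4 * c := by
    rw [hc', ← mul_div_assoc, lt_div_iff₀ (by positivity)]
    have h1 : 8 * e < 3 * (e ^ 2 + 1) := by nlinarith
    nlinarith
  exact ⟨⟨S, t, ht, ⟨k, hk, c, hc0, hc1, r, hr0, by linarith, hlt⟩, k₀, hk0, hk1, rfl,
    by rw [HoleData.rho, ← hρ, ← he, hk₀]; field_simp⟩, rfl, rfl, rfl⟩

namespace Model

variable (M : Model)

/-- The scale `log t` between the logarithms of `|w_i|` and the `r_i`. -/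
def L : ℝ := log M.t

lemma L_pos : 0 < M.L := log_pos M.one_lt

lemma k₀_lt : M.k₀ < 1 / 8 := by linarith [M.k₀_le, interpScale_le]

lemma k₀_le' : M.k₀ ≤ 1 / 24 := by linarith [M.k₀_le, interpScale_le]

/-- The holes are contained in the disc of radius `9 k₀ / 8`. -/
lemma c_add_rho_le : M.H.c + M.H.rho ≤ 9 / 8 * M.k₀ := by
  obtain ⟨he1, he2⟩ := exp_one_bounds
  have hk := M.k₀_pos
  rw [M.c_eq, M.rho_eq]
  set e := Real.exp 1 with he
  have he3 : 0 < e ^ 2 - 1 := by nlinarith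
  have h1 : M.k₀ * (e ^ 2 + 1) / (2 * (e ^ 2 - 1)) + M.k₀ * e / (e ^ 2 - 1) =
      M.k₀ * ((e + 1) ^ 2 / (2 * (e ^ 2 - 1))) := by field_simp; ring
  have h2 : (e + 1) ^ 2 / (2 * (e ^ 2 - 1)) ≤ 9 / 8 := by
    rw [div_le_iff₀ (by positivity)]; nlinarith
  rw [h1]; nlinarith

/-- The complex number `r₁ log t + i y₁` and the nonzero complex number with logarithm
`r₂ log t + i y₂`, from the Darboux coordinates `a = (y₁, r₂)` and `b = (-r₁, y₂)`. -/
def ofDarboux (p : ℂ × ℂ) : ℂ × ℂ :=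
  (⟨-(M.L * p.2.re), p.1.re⟩, exp ⟨M.L * p.1.im, p.2.im⟩)

/-- The coordinate `exp (-r₁ + i y₂)` on the second annulus, in the planar coordinate. -/
def innerV (a : ℂ) : ℂ := conj ((2 * M.S.σ * a + M.k₀) / (2 * M.S.σ * a - M.k₀))

/-- The point of the second annulus with coordinate `V`: the logarithm of `-w₁`, and `-w₂`. -/
def innerOut (V : ℂ) : ℂ × ℂ := (((-(M.L * log ‖V‖) : ℝ) : ℂ), V / ‖V‖)

/-- The inversion in the circle of radius `√k₀`. -/
def invert (a : ℂ) : ℂ := M.k₀ / conj a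

/-- The handle in the planar coordinate. -/
def tubeOut (a : ℂ) : ℂ × ℂ := M.ofDarboux (handleMap M.S M.k₀ (handleCoord (M.invert a)))

open Classical in
/-- The part of the surgered surface near `(-1, -1)`, in the planar coordinate `a`: the logarithm
of `-w₁`, and `-w₂`. -/
def out (a : ℂ) : ℂ × ℂ :=
  if M.k₀ < 9 / 20 * ‖a‖ then M.tubeOut a else M.innerOut (M.innerV a)

variable {M} {a : ℂ}

lemma norm_invert : ‖M.invert a‖ = M.k₀ / ‖a‖ := by
  rw [invert, norm_div, norm_coe, abs_of_pos M.k₀_pos, norm_conj]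

lemma invert_ne_zero (ha : a ≠ 0) : M.invert a ≠ 0 :=
  div_ne_zero (by exact_mod_cast M.k₀_pos.ne') ((map_ne_zero _).2 ha)

lemma norm_invert_lt {x : ℝ} (hx : 0 < x) (ha : M.k₀ < x * ‖a‖) : ‖M.invert a‖ < x := by
  have h : 0 < ‖a‖ := by
    have := M.k₀_pos
    by_contra! h
    nlinarith
  rw [norm_invert, div_lt_iff₀ h]; exact ha

lemma ne_zero_of_lt {x : ℝ} (ha : M.k₀ < x * ‖a‖) : a ≠ 0 := by
  rintro rfl
  rw [norm_zero] at ha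
  linarith [M.k₀_pos]

/-- On the first annulus outside the handle. -/
lemma tubeOut_of_le (ha : 1 / 2 ≤ ‖a‖) :
    handleMap M.S M.k₀ (handleCoord (M.invert a)) = (a, 0) := by
  have hk := M.k₀_pos
  have hn : 0 < ‖a‖ := by linarith
  have h1 : ‖M.invert a‖ ≤ 2 * M.k₀ := by rw [norm_invert, div_le_iff₀ hn]; nlinarith
  have h2 := handleCoord_of_le (h1.trans M.k₀_le)
  have h3 : handleParam M.k₀ ‖M.invert a‖ = ‖a‖ := by
    rw [handleParam_of_le M.k₀_lt h1, norm_invert]; field_simp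
  have h4 := M.S.right ‖a‖ (by linarith [M.S.hR.2])
  have h5 : M.invert a / (‖M.invert a‖ : ℂ) = a / ‖a‖ := by
    have h6 : (‖a‖ : ℂ) ≠ 0 := by exact_mod_cast hn.ne'
    have h7 : (M.k₀ : ℂ) ≠ 0 := by exact_mod_cast hk.ne'
    have h8 : conj a ≠ 0 := (map_ne_zero _).2 (norm_pos_iff.1 hn)
    have h9 : (‖a‖ : ℂ) * ‖a‖ = a * conj a := by rw [mul_conj, normSq_eq_norm_sq]; push_cast; ring
    rw [norm_invert, invert]
    push_cast
    field_simp
    linear_combination h9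
  rw [h2, handleMap, h3, h4.1, h4.2, h5]
  have h6 : (‖a‖ : ℂ) ≠ 0 := by exact_mod_cast hn.ne'
  rw [mul_div_cancel₀ _ h6]; simp

lemma out_of_far (ha : 1 / 2 ≤ ‖a‖) :
    M.out a = (⟨0, a.re⟩, exp ⟨M.L * a.im, 0⟩) := by
  have h : M.k₀ < 9 / 20 * ‖a‖ := by linarith [M.k₀_le']
  rw [out, if_pos h, tubeOut, tubeOut_of_le ha, ofDarboux]; simp

lemma exp_eq_innerV (h1 : M.k₀ < ‖a‖) :
    M.innerV a = exp (M.S.σ * Complex.log ((2 + M.invert a) / (2 - M.invert a))) := by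
  have hw := norm_invert_lt one_pos (by linarith)
  have h3 := two_sub_ne_zero hw
  have h3' : 2 + M.invert a ≠ 0 := by
    have := two_sub_ne_zero (by rwa [norm_neg])
    rwa [sub_neg_eq_add] at this
  have h4 : conj a ≠ 0 := (map_ne_zero _).2 (ne_zero_of_lt (x := 1) (by linarith))
  have h5 : M.invert a * conj a = M.k₀ := by rw [invert, div_mul_cancel₀ _ h4]
  have h6 := exp_log (div_ne_zero h3' h3)
  have h7 : M.innerV a = (2 * M.S.σ * conj a + M.k₀) / (2 * M.S.σ * conj a - M.k₀) := by
    rw [innerV]; simp [Complex.conj_ofNat]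
  rw [h7, ← h5]
  rcases M.S.hσ with hσ | hσ
  · rw [hσ]
    push_cast
    rw [one_mul, h6]
    have h8 : 2 * 1 * conj a - M.invert a * conj a = (2 - M.invert a) * conj a := by ring
    rw [h8, show 2 * 1 * conj a + M.invert a * conj a = (2 + M.invert a) * conj a by ring,
      mul_div_mul_right _ _ h4]
  · rw [hσ]
    push_cast
    rw [neg_one_mul, Complex.exp_neg, h6, inv_div]
    have h8 : 2 * -1 * conj a - M.invert a * conj a = -(2 + M.invert a) * conj a := by ring
    rw [h8, show 2 * -1 * conj a + M.invert a * conj a = -(2 - M.invert a) * conj a by ring,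
      mul_div_mul_right _ _ h4, neg_div_neg_eq]

/-- On the second annulus, the two descriptions of the surface agree. -/
lemma tubeOut_eq_innerOut (h1 : M.k₀ < 1 / 2 * ‖a‖) (h2 : 1 / 4 ≤ ‖handleCoord (M.invert a)‖) :
    M.tubeOut a = M.innerOut (M.innerV a) ∧
      (handleMap M.S M.k₀ (handleCoord (M.invert a))).1 = 0 := by
  have hw := norm_invert_lt (by norm_num) h1
  have hw8 : 1 / 8 ≤ ‖M.invert a‖ := by linarith [(norm_handleCoord hw).2]
  have ha := ne_zero_of_lt h1
  have hb := handleCoord_ne_zero hw (invert_ne_zero ha)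
  have h3 := handleParam_of_ge M.k₀_lt h2
  have h4 := M.S.left _ (by rw [h3]; linarith [M.S.hR.2] :
    handleParam M.k₀ ‖handleCoord (M.invert a)‖ ≤ -M.S.R)
  have h6 : handleMap M.S M.k₀ (handleCoord (M.invert a)) =
      (0, M.S.σ * handleCoord (M.invert a)) := by
    have h7 : (‖handleCoord (M.invert a)‖ : ℂ) ≠ 0 := by exact_mod_cast norm_ne_zero_iff.2 hb
    rw [handleMap, h4.1, h4.2, h3]
    push_cast
    rw [zero_mul, neg_neg, mul_assoc, mul_div_cancel₀ _ h7]
  refine ⟨?_, by rw [h6]⟩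
  have hV := exp_eq_innerV (M := M) (a := a) (by have := norm_pos_iff.2 ha; linarith)
  rw [← handleCoord_of_ge hw8] at hV
  rw [tubeOut, h6, hV, innerOut, ofDarboux]
  generalize M.S.σ * handleCoord (M.invert a) = B
  rw [norm_exp]
  refine Prod.ext (Complex.ext (by simp) (by simp)) ?_
  rw [eq_div_iff (by exact_mod_cast Real.exp_ne_zero _), ofReal_exp, ← exp_add]
  congr 1
  exact Complex.ext (by simp) (by simp)

lemma out_of_tube (h1 : M.k₀ < 1 / 2 * ‖a‖) : M.out a = M.tubeOut a := by
  by_cases h : M.k₀ < 9 / 20 * ‖a‖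
  · rw [out, if_pos h]
  · rw [out, if_neg h]
    refine (tubeOut_eq_innerOut h1 ?_).1.symm
    have hn := norm_pos_iff.2 (ne_zero_of_lt h1)
    have hw1 : 9 / 20 ≤ ‖M.invert a‖ := by rw [norm_invert, le_div_iff₀ hn]; linarith
    linarith [(norm_handleCoord (norm_invert_lt (by norm_num) h1)).1]

lemma out_of_inner (h1 : 2 / 5 * ‖a‖ < M.k₀) : M.out a = M.innerOut (M.innerV a) := by
  by_cases h : M.k₀ < 9 / 20 * ‖a‖
  · rw [out, if_pos h]
    have h2 : M.k₀ < 1 / 2 * ‖a‖ := by linarith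
    refine (tubeOut_eq_innerOut h2 ?_).1
    have hn := norm_pos_iff.2 (ne_zero_of_lt h2)
    have hw1 : 2 / 5 ≤ ‖M.invert a‖ := by rw [norm_invert, le_div_iff₀ hn]; linarith
    linarith [(norm_handleCoord (norm_invert_lt (by norm_num) h2)).1]
  · rw [out, if_neg h]

/-! #### The holes in the coordinate `V` -/

variable (M) in
/-- The condition on the planar coordinate of not being in a hole. -/
def Reg (a : ℂ) : Prop :=
  ∀ τ : ℝ, τ = 1 ∨ τ = -1 → M.H.rho ≤ ‖a - ctr(τ, M.H)‖

lemma reg_of_le (h : 9 / 8 * M.k₀ ≤ ‖a‖) : M.Reg a := by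
  intro τ hτ
  have h1 := norm_sub_norm_le a ctr(τ, M.H)
  have h2 : ‖ctr(τ, M.H)‖ = M.H.c := by
    rw [norm_coe, abs_mul, abs_of_pos M.H.c_pos]
    rcases hτ with h | h <;> rw [h] <;> simp
  linarith [M.c_add_rho_le]

/-- The circle `|V| = e^{±1}` is the boundary of a hole. -/
lemma hole_identity (τ : ℝ) (hτ : τ = 1 ∨ τ = -1) (a : ℂ) :
    Real.exp 1 ^ 2 * ‖2 * τ * a - M.k₀‖ ^ 2 - ‖2 * τ * a + M.k₀‖ ^ 2 =
      4 * (Real.exp 1 ^ 2 - 1) * (‖a - ctr(τ, M.H)‖ ^ 2 - M.H.rho ^ 2) := by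
  have he3 : Real.exp 1 ^ 2 - 1 ≠ 0 := by nlinarith [exp_one_bounds.1]
  have h1 : ‖2 * τ * a - M.k₀‖ ^ 2 = (2 * τ * a.re - M.k₀) ^ 2 + (2 * τ * a.im) ^ 2 := by
    rw [sq_norm, normSq_apply]; simp; ring
  have h2 : ‖2 * τ * a + M.k₀‖ ^ 2 = (2 * τ * a.re + M.k₀) ^ 2 + (2 * τ * a.im) ^ 2 := by
    rw [sq_norm, normSq_apply]; simp; ring
  have h3 : ‖a - ctr(τ, M.H)‖ ^ 2 = (a.re - τ * M.H.c) ^ 2 + a.im ^ 2 := by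
    rw [sq_norm, normSq_apply, sub_re, sub_im, ofReal_re,
      ofReal_im]
    ring
  rw [h1, h2, h3, M.c_eq, M.rho_eq]
  generalize Real.exp 1 = e at he3 ⊢
  rcases hτ with rfl | rfl <;> field_simp <;> ring


variable {M : Model} {a a' : ℂ}

/-! ### The surgered surface as the image of a planar domain -/

lemma σC_mul_σ : (M.S.σ : ℂ) * M.S.σ = 1 := by exact_mod_cast M.S.σ_mul_σ

lemma neg_σ_cases : -M.S.σ = 1 ∨ -M.S.σ = -1 := by rcases M.S.hσ with h | h <;> rw [h] <;> norm_num

lemma norm_neg_σ_sub : ‖2 * ((-M.S.σ : ℝ) : ℂ) * a - M.k₀‖ = ‖2 * (M.S.σ : ℂ) * a + M.k₀‖ := by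
  rw [← norm_neg]; push_cast; ring_nf

lemma norm_neg_σ_add : ‖2 * ((-M.S.σ : ℝ) : ℂ) * a + M.k₀‖ = ‖2 * (M.S.σ : ℂ) * a - M.k₀‖ := by
  rw [← norm_neg]; push_cast; ring_nf

variable (M) in
lemma eq_or_eq_neg_σ {τ : ℝ} (hτ : τ = 1 ∨ τ = -1) : τ = M.S.σ ∨ τ = -M.S.σ := by
  rcases hτ with rfl | rfl <;> rcases M.S.hσ with h | h <;> rw [h] <;> norm_num

/-- Outside the holes, `e⁻¹ ≤ |V| ≤ e`. -/
lemma innerV_bounds (h : M.Reg a) : 2 * (M.S.σ : ℂ) * a - M.k₀ ≠ 0 ∧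
    2 * (M.S.σ : ℂ) * a + M.k₀ ≠ 0 ∧ |log ‖M.innerV a‖| ≤ 1 := by
  obtain ⟨he1, -⟩ := exp_one_bounds
  have he3 : 0 < Real.exp 1 ^ 2 - 1 := by nlinarith
  have h1 := hole_identity M.S.σ M.S.hσ (M := M) a
  have h2 := hole_identity (-M.S.σ) neg_σ_cases (M := M) a
  have hr := M.H.rho_pos
  have h3 : 0 ≤ ‖a - ctr(M.S.σ, M.H)‖ ^ 2 - M.H.rho ^ 2 := by nlinarith [h M.S.σ M.S.hσ]
  have h4 : 0 ≤ ‖a - ctr(-M.S.σ, M.H)‖ ^ 2 - M.H.rho ^ 2 := by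
    nlinarith [h (-M.S.σ) neg_σ_cases]
  rw [norm_neg_σ_sub, norm_neg_σ_add] at h2
  have h7 : ‖2 * (M.S.σ : ℂ) * a + M.k₀‖ ≤ Real.exp 1 * ‖2 * (M.S.σ : ℂ) * a - M.k₀‖ := by
    apply le_of_sq_le_sq _ (by positivity)
    rw [mul_pow]; nlinarith
  have h8 : ‖2 * (M.S.σ : ℂ) * a - M.k₀‖ ≤ Real.exp 1 * ‖2 * (M.S.σ : ℂ) * a + M.k₀‖ := by
    apply le_of_sq_le_sq _ (by positivity)
    rw [mul_pow]; nlinarith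
  have hsub : ¬ (2 * (M.S.σ : ℂ) * a - M.k₀ = 0 ∧ 2 * (M.S.σ : ℂ) * a + M.k₀ = 0) := by
    rintro ⟨e1, e2⟩
    have : (M.k₀ : ℂ) = 0 := by linear_combination (e2 - e1) / 2
    exact M.k₀_pos.ne' (by exact_mod_cast this)
  have h9 : 2 * (M.S.σ : ℂ) * a - M.k₀ ≠ 0 := by
    intro e1
    rw [e1, norm_zero, mul_zero] at h7
    exact hsub ⟨e1, norm_le_zero_iff.1 h7⟩
  have h10 : 2 * (M.S.σ : ℂ) * a + M.k₀ ≠ 0 := by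
    intro e1
    rw [e1, norm_zero, mul_zero] at h8
    exact h9 (norm_le_zero_iff.1 h8)
  refine ⟨h9, h10, ?_⟩
  have n1 := norm_pos_iff.2 h9
  have n2 := norm_pos_iff.2 h10
  rw [innerV, norm_conj, norm_div, log_div n2.ne' n1.ne', abs_le]
  constructor
  · have := Real.log_le_log n1 h8
    rw [log_mul (Real.exp_ne_zero _) n2.ne', log_exp] at this
    linarith
  · have := Real.log_le_log n2 h7
    rw [log_mul (Real.exp_ne_zero _) n1.ne', log_exp] at this
    linarith

lemma innerV_ne_zero (h : M.Reg a) : M.innerV a ≠ 0 :=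
  (map_ne_zero _).2 (div_ne_zero (innerV_bounds h).2.1 (innerV_bounds h).1)

lemma innerV_sub_one (h : 2 * (M.S.σ : ℂ) * a - M.k₀ ≠ 0) :
    M.innerV a - 1 = conj (2 * M.k₀ / (2 * M.S.σ * a - M.k₀)) := by
  rw [innerV, ← map_one conj, ← map_sub]
  congr 1
  field_simp; ring

lemma innerV_inj (h : 2 * (M.S.σ : ℂ) * a - M.k₀ ≠ 0) (h' : 2 * (M.S.σ : ℂ) * a' - M.k₀ ≠ 0)
    (e : M.innerV a = M.innerV a') : a = a' := by
  have h1 := congrArg (· - 1) e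
  simp only [innerV_sub_one h, innerV_sub_one h'] at h1
  have h2 := (starRingEnd ℂ).injective h1
  have hk : (M.k₀ : ℂ) ≠ 0 := by exact_mod_cast M.k₀_pos.ne'
  rw [div_eq_div_iff h h'] at h2
  have h3 := mul_left_cancel₀ (mul_ne_zero two_ne_zero hk) h2
  linear_combination (-(M.S.σ : ℂ) / 2) * h3 - (a - a') * σC_mul_σ (M := M)

/-- On the inner part of the second annulus the coordinate `V` stays away from `1`. -/
lemma le_norm_innerV_sub_one (h : M.Reg a) (ha : ¬ M.k₀ < 9 / 20 * ‖a‖) :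
    9 / 25 ≤ ‖M.innerV a - 1‖ := by
  have h1 := (innerV_bounds h).1
  have hk := M.k₀_pos
  have h2 : ‖2 * (M.S.σ : ℂ) * a - M.k₀‖ ≤ 2 * ‖a‖ + M.k₀ := by
    refine (norm_sub_le _ _).trans ?_
    rw [norm_mul, norm_mul, norm_real, norm_coe,
      norm_eq_abs, M.S.abs_σ, abs_of_pos hk]
    simp
  rw [innerV_sub_one h1, norm_conj, norm_div, norm_mul, norm_coe, abs_of_pos hk,
    Complex.norm_ofNat, le_div_iff₀ (norm_pos_iff.2 h1)]
  push Not at ha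
  linarith

lemma norm_exp_sub_one_lt {B : ℂ} (hB : ‖B‖ ≤ 1 / 4) : ‖exp B - 1‖ < 9 / 25 := by
  have h1 := Complex.norm_exp_sub_one_sub_id_le (x := B) (by linarith)
  have h2 := norm_add_le (exp B - 1 - B) B
  rw [sub_add_cancel] at h2
  nlinarith [norm_nonneg B]

/-! #### The Darboux coordinates -/

variable (M) in
/-- The point `(w₁, w₂)` with given Darboux coordinates. -/
def point (p : ℂ × ℂ) : ℂ × ℂ := (-exp (M.ofDarboux p).1, -(M.ofDarboux p).2)

variable (M) in
/-- The Darboux coordinates of a point of `(ℂ*)²`. -/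
def darboux (w : ℂ × ℂ) : ℂ × ℂ :=
  (⟨(-w.1).arg, log ‖w.2‖ / M.L⟩, ⟨-(log ‖w.1‖ / M.L), (-w.2).arg⟩)

lemma arg_exp_of_mem {z : ℂ} (h : z.im ∈ Iπ) : (exp z).arg = z.im := by
  rw [arg_exp, (toIocMod_eq_self two_pi_pos).2 ⟨h.1, by linarith [h.2]⟩]

lemma darboux_point {p : ℂ × ℂ} (h1 : p.1.re ∈ Iπ)
    (h2 : p.2.im ∈ Iπ) : M.darboux (M.point p) = p := by
  have hL := M.L_pos.ne'
  simp only [darboux, point, neg_neg, norm_neg, ofDarboux, norm_exp, log_exp]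
  rw [arg_exp_of_mem h1, arg_exp_of_mem (z := ⟨M.L * p.1.im, p.2.im⟩) h2]
  exact Prod.ext (Complex.ext rfl (by simp [hL])) (Complex.ext (by field_simp) rfl)

lemma point_darboux {w : ℂ × ℂ} (h1 : w.1 ≠ 0) (h2 : w.2 ≠ 0) : M.point (M.darboux w) = w := by
  have hL := M.L_pos.ne'
  have key : ∀ z : ℂ, z ≠ 0 → ∀ x, x = log ‖z‖ → -exp ⟨x, (-z).arg⟩ = z := by
    rintro z hz x rfl
    have : (⟨log ‖z‖, (-z).arg⟩ : ℂ) = Complex.log (-z) :=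
      Complex.ext (by rw [log_re, norm_neg]) (by rw [log_im])
    rw [this, exp_log (neg_ne_zero.2 hz), neg_neg]
  refine Prod.ext (key _ h1 _ ?_) (key _ h2 _ ?_) <;> simp [darboux] <;> field_simp

lemma innerOut_exp (B : ℂ) : M.innerOut (exp B) = M.ofDarboux (0, B) := by
  rw [innerOut, ofDarboux, norm_exp]
  refine Prod.ext (Complex.ext (by simp) (by simp)) ?_
  rw [div_eq_iff (by exact_mod_cast Real.exp_ne_zero _), ofReal_exp, ← exp_add]
  congr 1
  exact Complex.ext (by simp) (by simp)

/-! #### Bounds on the handle -/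

/-- The surgery parameter of the point with planar coordinate `a`. -/
def param (M : Model) (a : ℂ) : ℝ := handleParam M.k₀ ‖handleCoord (M.invert a)‖

/-- The Darboux coordinates of the point of the handle with planar coordinate `a`. -/
def tube (M : Model) (a : ℂ) : ℂ × ℂ := handleMap M.S M.k₀ (handleCoord (M.invert a))

lemma tubeOut_eq (a : ℂ) : M.tubeOut a = M.ofDarboux (M.tube a) := rfl

lemma norm_handleCoord_pos (h1 : M.k₀ < 1 / 2 * ‖a‖) : 0 < ‖handleCoord (M.invert a)‖ :=
  norm_pos_iff.2 (handleCoord_ne_zero (norm_invert_lt (by norm_num) h1)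
    (invert_ne_zero (ne_zero_of_lt h1)))

lemma norm_tube (h1 : M.k₀ < 1 / 2 * ‖a‖) :
    ‖(M.tube a).1‖ = M.S.p (M.param a) ∧ ‖(M.tube a).2‖ = M.S.q (M.param a) :=
  norm_handleMap _ _ (norm_pos_iff.1 (norm_handleCoord_pos h1))

lemma neg_quarter_lt_param (h1 : M.k₀ < 1 / 2 * ‖a‖) (h2 : ‖handleCoord (M.invert a)‖ < 1 / 4) :
    -(1 / 4) < M.param a := by
  have h := strictAntiOn_handleParam M.k₀_pos M.k₀_lt (norm_handleCoord_pos h1)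
    (by norm_num : (0 : ℝ) < 1 / 4) h2
  rwa [handleParam_of_ge M.k₀_lt le_rfl] at h

lemma neg_lt_param (h1 : M.k₀ < 1 / 2 * ‖a‖) : -(5 / 8) < M.param a := by
  rcases lt_or_ge ‖handleCoord (M.invert a)‖ (1 / 4) with h | h
  · linarith [neg_quarter_lt_param h1 h]
  · rw [param, handleParam_of_ge M.k₀_lt h]
    have := norm_invert_lt (M := M) (by norm_num) h1
    linarith [(norm_handleCoord this).2]

lemma param_lt_one (h1 : M.k₀ < 1 / 2 * ‖a‖) (h2 : ‖a‖ < 1 / 2) : M.param a < 1 := by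
  have hk := M.k₀_pos
  have h3 : 2 * M.k₀ < ‖M.invert a‖ := by
    rw [norm_invert, lt_div_iff₀ (norm_pos_iff.2 (ne_zero_of_lt h1))]; nlinarith
  have h4 := (norm_handleCoord (norm_invert_lt (M := M) (by norm_num) h1)).1
  have h5 := strictAntiOn_handleParam M.k₀_pos M.k₀_lt
    (by simpa using hk : M.k₀ ∈ Ioi (0 : ℝ)) (norm_handleCoord_pos h1)
    (by linarith : M.k₀ < ‖handleCoord (M.invert a)‖)
  rwa [handleParam_of_le (β := M.k₀) M.k₀_lt (by linarith), div_self hk.ne'] at h5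

lemma profile_lt {s : ℝ} (h1 : -1 < s) (h2 : s < 1) : M.S.p s < 1 ∧ M.S.q s < 1 := by
  have hR := M.S.hR
  rcases lt_or_ge |s| M.S.R with h | h
  · have := (M.S.mem_disc s h).2
    constructor <;> nlinarith
  · rcases le_abs.1 h with h | h
    · rw [(M.S.right s h).1, (M.S.right s h).2]; constructor <;> linarith
    · rw [(M.S.left s (by linarith)).1, (M.S.left s (by linarith)).2]; constructor <;> linarith

lemma mem_Ioc_pi {x : ℝ} (h : |x| ≤ 3) : x ∈ Iπ := by
  have := pi_gt_three
  exact ⟨by linarith [(abs_le.1 h).1], by linarith [(abs_le.1 h).2]⟩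

lemma tube_far (ha : 1 / 2 ≤ ‖a‖) : M.tube a = (a, 0) := tubeOut_of_le ha

lemma tube_mem (h1 : M.k₀ < 1 / 2 * ‖a‖) (ha : a.re ∈ Iπ) :
    (M.tube a).1.re ∈ Iπ ∧ (M.tube a).2.im ∈ Iπ := by
  rcases le_or_gt (1 / 2) ‖a‖ with h | h
  · rw [tube_far h]
    exact ⟨ha, mem_Ioc_pi (by simp)⟩
  · have h2 := norm_tube h1
    have h3 := M.profile_lt (by linarith [neg_lt_param h1]) (param_lt_one h1 h)
    exact ⟨mem_Ioc_pi (by linarith [abs_re_le_norm (M.tube a).1]),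
      mem_Ioc_pi (by linarith [abs_im_le_norm (M.tube a).2])⟩

lemma half_of_lt (h : M.k₀ < 9 / 20 * ‖a‖) : M.k₀ < 1 / 2 * ‖a‖ := by linarith [norm_nonneg a]

lemma out_im_mem (ha : a.re ∈ Iπ) :
    (M.out a).1.im ∈ Iπ := by
  by_cases h : M.k₀ < 9 / 20 * ‖a‖
  · rw [out, if_pos h]
    exact (tube_mem (half_of_lt h) ha).1
  · rw [out, if_neg h]
    exact mem_Ioc_pi (by simp [innerOut])

/-! #### Injectivity -/

lemma invert_inj (ha : a ≠ 0) (ha' : a' ≠ 0) (h : M.invert a = M.invert a') : a = a' := by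
  have hk : (M.k₀ : ℂ) ≠ 0 := by exact_mod_cast M.k₀_pos.ne'
  rw [invert, invert, div_eq_div_iff ((map_ne_zero _).2 ha) ((map_ne_zero _).2 ha')] at h
  exact ((starRingEnd ℂ).injective (mul_left_cancel₀ hk h)).symm

lemma innerOut_inj {V V' : ℂ} (hV : V ≠ 0) (hV' : V' ≠ 0) (h : M.innerOut V = M.innerOut V') :
    V = V' := by
  rw [innerOut, Prod.mk.injEq] at h
  have h1 : log ‖V‖ = log ‖V'‖ := by
    have h2 := mul_left_cancel₀ M.L_pos.ne' (neg_injective (Complex.ofReal_injective h.1))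
    exact h2
  have h3 := h.2
  rw [Real.log_injOn_pos (norm_pos_iff.2 hV) (norm_pos_iff.2 hV') h1] at h3
  exact (div_left_inj' (by exact_mod_cast norm_ne_zero_iff.2 hV')).1 h3

lemma point_eq_of_ofDarboux {p p' : ℂ × ℂ} (h : M.ofDarboux p = M.ofDarboux p') :
    M.point p = M.point p' := by rw [point, point, h]

/-- A point on the tube is not one of the inner part of the second annulus, unless the planar
coordinates agree. -/
lemma eq_of_tube_inner (h : M.k₀ < 9 / 20 * ‖a‖) (ha : a.re ∈ Iπ)
    (hr : M.Reg a) (h' : ¬ M.k₀ < 9 / 20 * ‖a'‖) (hr' : M.Reg a')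
    (e : M.tubeOut a = M.innerOut (M.innerV a')) : a = a' := by
  have h1 := half_of_lt h
  rcases le_or_gt (1 / 4) ‖handleCoord (M.invert a)‖ with hb | hb
  · rw [(tubeOut_eq_innerOut h1 hb).1] at e
    exact innerV_inj (innerV_bounds hr).1 (innerV_bounds hr').1
      (innerOut_inj (innerV_ne_zero hr) (innerV_ne_zero hr') e)
  · exfalso
    have hV := exp_log (innerV_ne_zero hr')
    rw [← hV, innerOut_exp, tubeOut_eq] at e
    have h2 := tube_mem h1 ha
    have h4 := congrArg M.darboux (point_eq_of_ofDarboux e)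
    rw [darboux_point h2.1 h2.2, darboux_point (mem_Ioc_pi (by simp))
      (Complex.log_im_le_pi _ |> fun h => ⟨Complex.neg_pi_lt_log_im _, h⟩)] at h4
    have h5 := norm_tube h1
    rw [h4] at h5
    have h6 := le_norm_innerV_sub_one hr' h'
    rw [← hV] at h6
    have h7 : ‖Complex.log (M.innerV a')‖ ≤ 1 / 4 := by
      rw [h5.2]
      have hR := M.S.hR
      have hs := neg_quarter_lt_param h1 hb
      rcases lt_or_ge |M.param a| M.S.R with h8 | h8
      · have := (M.S.mem_disc _ h8).2
        nlinarith
      · rcases le_abs.1 h8 with h8 | h8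
        · rw [(M.S.right _ h8).2]; norm_num
        · rw [(M.S.left _ (by linarith)).2]; linarith
    linarith [norm_exp_sub_one_lt h7]

lemma out_injOn : InjOn M.out {a | M.Reg a ∧ a.re ∈ Iπ} := by
  rintro a ⟨hr, ha⟩ a' ⟨hr', ha'⟩ e
  by_cases h : M.k₀ < 9 / 20 * ‖a‖ <;> by_cases h' : M.k₀ < 9 / 20 * ‖a'‖
  · rw [out, if_pos h, out, if_pos h', tubeOut_eq, tubeOut_eq] at e
    have h1 := half_of_lt h
    have h1' := half_of_lt h'
    have h3 := congrArg M.darboux (point_eq_of_ofDarboux e)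
    rw [darboux_point (tube_mem h1 ha).1 (tube_mem h1 ha).2,
      darboux_point (tube_mem h1' ha').1 (tube_mem h1' ha').2] at h3
    have h4 := handleMap_injective M.S M.k₀_pos M.k₀_lt (norm_pos_iff.1 (norm_handleCoord_pos h1))
      (norm_pos_iff.1 (norm_handleCoord_pos h1')) h3
    exact invert_inj (ne_zero_of_lt h1) (ne_zero_of_lt h1')
      (handleCoord_injOn (mem_ball_zero_iff.2 (norm_invert_lt (by norm_num) h1))
        (mem_ball_zero_iff.2 (norm_invert_lt (by norm_num) h1')) h4)
  · rw [out, if_pos h, out, if_neg h'] at e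
    exact eq_of_tube_inner h ha hr h' hr' e
  · rw [out, if_neg h, out, if_pos h'] at e
    exact (eq_of_tube_inner h' ha' hr' h hr e.symm).symm
  · rw [out, if_neg h, out, if_neg h'] at e
    exact innerV_inj (innerV_bounds hr).1 (innerV_bounds hr').1
      (innerOut_inj (innerV_ne_zero hr) (innerV_ne_zero hr') e)


variable {M : Model} {a a' : ℂ}

variable (M) in
/-- The point of the surgered surface with planar coordinate `a`. -/
def pt (a : ℂ) : ℂ × ℂ := (-exp (M.out a).1, -(M.out a).2)

lemma pt_of_tube (h : M.k₀ < 9 / 20 * ‖a‖) : M.pt a = M.point (M.tube a) := by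
  rw [pt, out, if_pos h, tubeOut_eq, point]

lemma pt_of_inner (h : ¬ M.k₀ < 9 / 20 * ‖a‖) (hr : M.Reg a) :
    M.pt a = M.point (0, Complex.log (M.innerV a)) := by
  rw [pt, out, if_neg h, point, ← innerOut_exp, exp_log (innerV_ne_zero hr)]

lemma point_eq_nearPt (p : ℂ × ℂ) :
    M.point p = nearPt M.t (-p.2.re) p.1.re p.1.im p.2.im := by
  rw [point, nearPt, ofDarboux]
  refine Prod.ext ?_ ?_ <;> simp only [neg_inj] <;> congr 1 <;>
    refine Complex.ext ?_ ?_ <;> simp [L, mul_comm]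

lemma logT_point (p : ℂ × ℂ) : logT M.t (M.point p).1 = -p.2.re ∧
    logT M.t (M.point p).2 = p.1.im := by
  have hL : log M.t ≠ 0 := M.L_pos.ne'
  simp only [logT, point, norm_neg, ofDarboux, norm_exp, log_exp, L]
  constructor <;> field_simp

lemma arg_neg_point {p : ℂ × ℂ} (h1 : p.1.re ∈ Iπ)
    (h2 : p.2.im ∈ Iπ) :
    (-(M.point p).1).arg = p.1.re ∧ (-(M.point p).2).arg = p.2.im := by
  have h := darboux_point (M := M) h1 h2
  rw [darboux] at h
  exact ⟨congrArg (fun q => q.1.re) h, congrArg (fun q : ℂ × ℂ => q.2.im) h⟩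

lemma arg_neg_of_eq_zero {z : ℂ} (hz : z ≠ 0) (h : (-z).arg = 0) : z.arg = Real.pi := by
  rw [Complex.arg_eq_zero_iff] at h
  rw [Complex.arg_eq_pi_iff]
  have h1 : z.im = 0 := by simpa using h.2
  refine ⟨lt_of_le_of_ne (by simpa using h.1) fun h2 => hz (Complex.ext h2 h1), h1⟩

lemma arg_neg_of_eq_pi {z : ℂ} (h : z.arg = Real.pi) : (-z).arg = 0 := by
  rw [Complex.arg_eq_pi_iff] at h
  rw [Complex.arg_eq_zero_iff]
  exact ⟨by simpa using h.1.le, by simpa using h.2⟩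

lemma point_ne_zero p : (M.point p).1 ≠ 0 ∧ (M.point p).2 ≠ 0 :=
  ⟨neg_ne_zero.2 (exp_ne_zero _), neg_ne_zero.2 (exp_ne_zero _)⟩

lemma point_mem_annulus₁ {A : ℂ} (h1 : A.re ∈ Iπ) (h2 : |A.im| ≤ 1)
    (h3 : M.S.R ≤ ‖A‖) : M.point (A, 0) ∈ surgered M.t M.S := by
  have e1 := arg_neg_point (M := M) (p := (A, 0)) h1 (mem_Ioc_pi (by simp))
  have e2 := logT_point (M := M) (A, 0)
  refine Or.inl (Or.inl ⟨⟨?_, (point_ne_zero _).2, arg_neg_of_eq_zero (point_ne_zero _).2 e1.2, ?_,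
    ?_⟩, ?_⟩)
  · simp [point, ofDarboux, norm_exp]
  · rw [e2.1]; simp
  · rw [e2.2]; exact h2
  · rw [e1.1, e2.2]
    have h4 : ‖A‖ ^ 2 = A.re ^ 2 + A.im ^ 2 := by rw [sq_norm, normSq_apply]; ring
    have := M.S.hR.1
    simp only [← h4]
    gcongr

lemma point_mem_annulus₂ {B : ℂ} (h1 : B.im ∈ Iπ) (h2 : |B.re| ≤ 1)
    (h3 : M.S.R ≤ ‖B‖) : M.point (0, B) ∈ surgered M.t M.S := by
  have e1 := arg_neg_point (M := M) (p := (0, B)) (mem_Ioc_pi (by simp)) h1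
  have e2 := logT_point (M := M) (0, B)
  refine Or.inl (Or.inr ⟨⟨?_, (point_ne_zero _).1, arg_neg_of_eq_zero (point_ne_zero _).1 e1.1, ?_,
    ?_⟩, ?_⟩)
  · simp [point, ofDarboux, norm_exp]
  · rw [e2.1]; simpa using h2
  · rw [e2.2]; simp
  · rw [e1.2, e2.1, neg_sq]
    have h4 : ‖B‖ ^ 2 = B.re ^ 2 + B.im ^ 2 := by rw [sq_norm, normSq_apply]; ring
    have := M.S.hR.1
    simp only [← h4]
    gcongr

lemma exists_of_mem_annulus₁ {w : ℂ × ℂ} (h : w ∈ annulus₁ M.t)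
    (h' : M.S.R ^ 2 ≤ (-w.1).arg ^ 2 + logT M.t w.2 ^ 2) : ∃ A : ℂ,
      A.re ∈ Iπ ∧ |A.im| ≤ 1 ∧ M.S.R ≤ ‖A‖ ∧ w = M.point (A, 0) := by
  obtain ⟨h1, h2, h3, -, h5⟩ := h
  refine ⟨⟨(-w.1).arg, logT M.t w.2⟩, arg_mem_Ioc _, h5, ?_, ?_⟩
  · apply le_of_sq_le_sq _ (norm_nonneg _)
    rw [sq_norm, normSq_apply]
    linarith
  · have hw1 := norm_ne_zero_iff.1 (by rw [h1]; norm_num)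
    conv_lhs => rw [← point_darboux (M := M) hw1 h2]
    rw [darboux, h1, arg_neg_of_eq_pi h3, log_one, zero_div, neg_zero]; rfl

lemma exists_of_mem_annulus₂ {w : ℂ × ℂ} (h : w ∈ annulus₂ M.t)
    (h' : M.S.R ^ 2 ≤ logT M.t w.1 ^ 2 + (-w.2).arg ^ 2) : ∃ B : ℂ,
      B.im ∈ Iπ ∧ |B.re| ≤ 1 ∧ M.S.R ≤ ‖B‖ ∧ w = M.point (0, B) := by
  obtain ⟨h1, h2, h3, h5, -⟩ := h
  refine ⟨⟨-logT M.t w.1, (-w.2).arg⟩, arg_mem_Ioc _, by simpa using h5, ?_, ?_⟩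
  · apply le_of_sq_le_sq _ (norm_nonneg _)
    rw [sq_norm, normSq_apply]
    linarith
  · have hw1 := norm_ne_zero_iff.1 (by rw [h1]; norm_num)
    conv_lhs => rw [← point_darboux (M := M) h2 hw1]
    rw [darboux, h1, arg_neg_of_eq_pi h3, log_one, zero_div]; rfl

lemma pt_mem_surgered (hr : M.Reg a) (hi : |a.im| ≤ 1) (ha : a.re ∈ Iπ) :
    M.pt a ∈ surgered M.t M.S := by
  by_cases h : M.k₀ < 9 / 20 * ‖a‖
  · rw [pt_of_tube h]
    have h1 := half_of_lt h
    have hm := tube_mem h1 ha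
    have hn := norm_tube h1
    rcases lt_or_ge |M.param a| M.S.R with hs | hs
    · -- on the handle
      set ξ := handleCoord (M.invert a) / (‖handleCoord (M.invert a)‖ : ℂ) with hξ
      have hξ1 : ‖ξ‖ = 1 := by
        rw [norm_div, norm_real, norm_norm, div_self (norm_handleCoord_pos h1).ne']
      have hξ2 : ξ = exp (ξ.arg * I) := by
        conv_lhs => rw [← norm_mul_exp_arg_mul_I ξ, hξ1, Complex.ofReal_one, one_mul]
      have hξr : ξ.re = cos ξ.arg := by conv_lhs => rw [hξ2, Complex.exp_ofReal_mul_I_re]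
      have hξi : ξ.im = sin ξ.arg := by conv_lhs => rw [hξ2, Complex.exp_ofReal_mul_I_im]
      refine Or.inr ⟨M.param a, ξ.arg, hs, ?_⟩
      have ht : M.tube a = ((M.S.p (M.param a) : ℂ) * ξ,
          ((M.S.σ * M.S.q (M.param a) : ℝ) : ℂ) * ξ) :=
        rfl
      rw [point_eq_nearPt, ht]
      simp only [re_ofReal_mul, im_ofReal_mul, hξr, hξi]
    · rcases le_abs.1 hs with hs | hs
      · have h2 := M.S.right _ hs
        rw [h2.1, h2.2] at hn
        have h3 : M.tube a = ((M.tube a).1, 0) := Prod.ext rfl (norm_eq_zero.1 hn.2)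
        rw [h3] at hm ⊢
        refine point_mem_annulus₁ hm.1 ?_ (by rw [hn.1]; exact hs)
        rcases le_or_gt (1 / 2) ‖a‖ with h4 | h4
        · rw [tube_far h4]; exact hi
        · exact (abs_im_le_norm _).trans (by rw [hn.1]; exact (param_lt_one h1 h4).le)
      · have h2 := M.S.left _ (by linarith : M.param a ≤ -M.S.R)
        rw [h2.1, h2.2] at hn
        have h3 : M.tube a = (0, (M.tube a).2) := Prod.ext (norm_eq_zero.1 hn.1) rfl
        rw [h3] at hm ⊢
        refine point_mem_annulus₂ hm.2 ?_ (by rw [hn.2]; exact hs)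
        exact (abs_re_le_norm _).trans (by rw [hn.2]; linarith [neg_lt_param h1])
  · rw [pt_of_inner h hr]
    refine point_mem_annulus₂ ⟨Complex.neg_pi_lt_log_im _, Complex.log_im_le_pi _⟩ ?_ ?_
    · rw [log_re]; exact (innerV_bounds hr).2.2
    · by_contra! h1
      have h2 := norm_exp_sub_one_lt (B := Complex.log (M.innerV a)) (by linarith [M.S.hR.2])
      rw [exp_log (innerV_ne_zero hr)] at h2
      linarith [le_norm_innerV_sub_one hr h]

lemma mem_of_norm_le_half (h : ‖a‖ ≤ 1 / 2) : |a.im| ≤ 1 ∧ a.re ∈ Iπ :=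
  ⟨(abs_im_le_norm a).trans (by linarith),
    mem_Ioc_pi ((abs_re_le_norm a).trans (by linarith))⟩

lemma invert_invert : M.invert (M.invert a) = a := by
  have hk : (M.k₀ : ℂ) ≠ 0 := by exact_mod_cast M.k₀_pos.ne'
  rw [invert, invert, map_div₀, conj_conj, conj_ofReal, div_div_eq_mul_div,
    mul_div_assoc, mul_div_cancel₀ _ hk]

/-- Points of the handle and of the collars next to it. -/
lemma exists_tube_eq {s : ℝ} (hs : -(1 / 4) ≤ s) {ξ : ℂ} (hξ : ‖ξ‖ = 1) (hp : M.S.p s < 1 / 2) :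
    ∃ a, M.Reg a ∧ |a.im| ≤ 1 ∧ a.re ∈ Iπ ∧
      M.pt a = M.point ((M.S.p s : ℂ) * ξ, ((M.S.σ * M.S.q s : ℝ) : ℂ) * ξ) := by
  obtain ⟨w, hw0, hw, he, -⟩ := exists_handleMap_eq M.S M.k₀_pos M.k₀_lt hs hξ
  have hk := M.k₀_pos
  have h1 : 9 / 4 * M.k₀ ≤ ‖M.invert w‖ := by
    rw [norm_invert, le_div_iff₀ (norm_pos_iff.2 hw0)]; nlinarith
  have h2 : M.k₀ < 9 / 20 * ‖M.invert w‖ := by linarith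
  have ht : M.tube (M.invert w) = ((M.S.p s : ℂ) * ξ, ((M.S.σ * M.S.q s : ℝ) : ℂ) * ξ) := by
    rw [tube, invert_invert, he]
  have h3 : ‖M.invert w‖ < 1 / 2 := by
    by_contra! h3
    rw [tube_far h3, Prod.mk.injEq] at ht
    rw [ht.1, norm_mul, hξ, norm_coe, abs_of_nonneg (M.S.nonneg s).1] at h3
    linarith
  have h4 := mem_of_norm_le_half h3.le
  exact ⟨M.invert w, reg_of_le (by linarith), h4.1, h4.2, by rw [pt_of_tube h2, ht]⟩

lemma reg_of_log_le (h1 : 2 * (M.S.σ : ℂ) * a - M.k₀ ≠ 0) (h2 : M.innerV a ≠ 0)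
    (h : |log ‖M.innerV a‖| ≤ 1) : M.Reg a := by
  obtain ⟨he1, -⟩ := exp_one_bounds
  have he3 : 0 < Real.exp 1 ^ 2 - 1 := by nlinarith
  have h3 := norm_pos_iff.2 h1
  have h4 : ‖M.innerV a‖ = ‖2 * M.S.σ * a + M.k₀‖ / ‖2 * (M.S.σ : ℂ) * a - M.k₀‖ := by
    rw [innerV, norm_conj, norm_div]
  have h2' := norm_pos_iff.2 h2
  have h5 : 0 < ‖2 * M.S.σ * a + M.k₀‖ := by
    by_contra! h5
    rw [le_antisymm h5 (norm_nonneg _), zero_div] at h4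
    linarith
  rw [h4, log_div h5.ne' h3.ne', abs_le] at h
  have h7 : ‖2 * M.S.σ * a + M.k₀‖ ≤ Real.exp 1 * ‖2 * (M.S.σ : ℂ) * a - M.k₀‖ := by
    rw [← Real.log_le_log_iff h5 (by positivity), log_mul (Real.exp_ne_zero _) h3.ne',
      log_exp]
    linarith
  have h8 : ‖2 * M.S.σ * a - M.k₀‖ ≤ Real.exp 1 * ‖2 * (M.S.σ : ℂ) * a + M.k₀‖ := by
    rw [← Real.log_le_log_iff h3 (by positivity), log_mul (Real.exp_ne_zero _) h5.ne',
      log_exp]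
    linarith
  have key : ∀ τ : ℝ, (τ = 1 ∨ τ = -1) →
      ‖2 * τ * a + M.k₀‖ ≤ Real.exp 1 * ‖2 * (τ : ℂ) * a - M.k₀‖ →
      M.H.rho ≤ ‖a - ctr(τ, M.H)‖ := by
    intro τ hτ hle
    have h9 := hole_identity τ hτ (M := M) a
    have h10 := pow_le_pow_left₀ (norm_nonneg _) hle 2
    rw [mul_pow] at h10
    apply le_of_sq_le_sq _ (norm_nonneg _)
    by_contra! h11
    nlinarith
  intro τ hτ
  rcases M.eq_or_eq_neg_σ hτ with rfl | rfl
  · exact key _ hτ h7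
  · refine key _ hτ ?_
    rwa [norm_neg_σ_sub, norm_neg_σ_add]

lemma exists_innerV_eq {V : ℂ} (hV : V ≠ 1) :
    ∃ a, 2 * (M.S.σ : ℂ) * a - M.k₀ ≠ 0 ∧ M.innerV a = V := by
  have hk : (M.k₀ : ℂ) ≠ 0 := by exact_mod_cast M.k₀_pos.ne'
  have h1 : conj V - 1 ≠ 0 := by
    rw [← map_one conj, ← map_sub]; exact (map_ne_zero _).2 (sub_ne_zero.2 hV)
  have hσ := σC_mul_σ (M := M)
  refine ⟨M.S.σ * M.k₀ * (conj V + 1) / (2 * (conj V - 1)), ?_, ?_⟩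
  · have e : 2 * M.S.σ * (M.S.σ * M.k₀ * (conj V + 1) / (2 * (conj V - 1))) - M.k₀ =
        2 * M.k₀ / (conj V - 1) := by
      field_simp
      linear_combination (conj V + 1) * hσ
    rw [e]
    exact div_ne_zero (mul_ne_zero two_ne_zero hk) h1
  · have e : 2 * M.S.σ * (M.S.σ * M.k₀ * (conj V + 1) / (2 * (conj V - 1))) =
        M.k₀ * (conj V + 1) / (conj V - 1) := by
      field_simp
      linear_combination (conj V + 1) * hσ
    rw [innerV, e]
    have e2 : (M.k₀ * (conj V + 1) / (conj V - 1) + M.k₀) /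
        (M.k₀ * (conj V + 1) / (conj V - 1) - M.k₀) = conj V := by
      have e3 : M.k₀ * (conj V + 1) / (conj V - 1) - M.k₀ = 2 * M.k₀ / (conj V - 1) := by
        field_simp; ring
      rw [e3]
      field_simp; ring
    rw [e2, conj_conj]

lemma norm_log_moebius {w : ℂ} (hw : ‖w‖ ≤ 1 / 2) :
    ‖Complex.log ((2 + w) / (2 - w))‖ ≤ ‖w‖ + ‖w‖ ^ 3 / 3 := by
  have h := norm_logDiff_le hw
  have h2 := norm_add_le (logDiff w) w
  rw [logDiff, sub_add_cancel] at h2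
  rw [logDiff] at h
  linarith

/-- Points of the second annulus away from the handle. -/
lemma exists_inner_eq {B : ℂ} (h1 : B.im ∈ Iπ) (h2 : |B.re| ≤ 1)
    (h3 : 1 / 4 < ‖B‖) : ∃ a, M.Reg a ∧ |a.im| ≤ 1 ∧ a.re ∈ Iπ ∧
      M.pt a = M.point (0, B) := by
  have hlog := Complex.log_exp h1.1 h1.2
  have hV : exp B ≠ 1 := by
    intro h
    rw [h, Complex.log_one] at hlog
    rw [← hlog] at h3
    norm_num at h3
  obtain ⟨a, ha, hVa⟩ := exists_innerV_eq (M := M) hV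
  have hr := reg_of_log_le ha (by rw [hVa]; exact exp_ne_zero _)
    (by rw [hVa, norm_exp, log_exp]; exact h2)
  by_cases h : M.k₀ < 9 / 20 * ‖a‖
  · have hh := half_of_lt h
    have hn := norm_pos_iff.2 (ne_zero_of_lt h)
    have hw := norm_invert_lt (by norm_num) hh
    have hl := norm_log_moebius hw.le
    have hw0 := norm_nonneg (M.invert a)
    set lam := Complex.log ((2 + M.invert a) / (2 - M.invert a)) with hlam
    have hbd : ‖M.S.σ * lam‖ = ‖lam‖ := by
      rw [norm_mul, norm_coe, M.S.abs_σ, one_mul]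
    have hB : B = M.S.σ * lam := by
      have hlam1 : ‖lam‖ ≤ 3 := by
        have : ‖M.invert a‖ ^ 3 ≤ 1 := pow_le_one₀ hw0 (by linarith)
        linarith
      have h4 := mem_Ioc_pi ((abs_im_le_norm (M.S.σ * lam)).trans (hbd.trans_le hlam1))
      rw [← hlog, ← hVa, exp_eq_innerV (a := a) (by linarith), Complex.log_exp h4.1 h4.2]
    rw [hB, hbd] at h3
    have hw8 : 1 / 8 ≤ ‖M.invert a‖ := by
      by_contra! h8
      have : ‖M.invert a‖ ^ 3 ≤ ‖M.invert a‖ ^ 1 := pow_le_pow_of_le_one hw0 (by linarith)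
          (by norm_num)
      linarith
    have h5 := tubeOut_eq_innerOut hh (by rw [handleCoord_of_ge hw8]; exact h3.le)
    have h6 : ‖a‖ ≤ 1 / 2 := by
      rw [norm_invert, le_div_iff₀ hn] at hw8
      linarith [M.k₀_le']
    have h7 := mem_of_norm_le_half h6
    refine ⟨a, hr, h7.1, h7.2, ?_⟩
    rw [pt, out, if_pos h, h5.1, hVa, innerOut_exp, point]
  · have h6 : ‖a‖ ≤ 1 / 2 := by linarith [M.k₀_le']
    have h7 := mem_of_norm_le_half h6
    refine ⟨a, hr, h7.1, h7.2, ?_⟩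
    rw [pt, out, if_neg h, hVa, innerOut_exp, point]

lemma exists_pt_eq {w : ℂ × ℂ} (hw : w ∈ surgered M.t M.S) :
    ∃ a, M.Reg a ∧ |a.im| ≤ 1 ∧ a.re ∈ Iπ ∧ M.pt a = w := by
  have hR := M.S.hR
  rcases hw with (⟨h, h'⟩ | ⟨h, h'⟩) | ⟨s, α, hs, rfl⟩
  · obtain ⟨A, h1, h2, h3, rfl⟩ := exists_of_mem_annulus₁ h h'
    rcases le_or_gt (1 / 2) ‖A‖ with h4 | h4
    · have h5 := M.k₀_le'
      refine ⟨A, reg_of_le (by linarith), h2, h1, ?_⟩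
      rw [pt_of_tube (by linarith), tube_far h4]
    · have hA : (‖A‖ : ℂ) ≠ 0 := by
        have : 0 < ‖A‖ := by linarith
        exact_mod_cast this.ne'
      have h5 := M.S.right _ h3
      obtain ⟨a, e1, e2, e3, e4⟩ := exists_tube_eq (M := M) (s := ‖A‖) (ξ := A / ‖A‖)
        (by linarith) (by rw [norm_div, norm_real, norm_norm,
          div_self (by exact_mod_cast hA)]) (by rw [h5.1]; exact h4)
      refine ⟨a, e1, e2, e3, ?_⟩
      rw [e4, h5.1, h5.2, mul_div_cancel₀ _ hA]; simp
  · obtain ⟨B, h1, h2, h3, rfl⟩ := exists_of_mem_annulus₂ h h'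
    rcases lt_or_ge (1 / 4) ‖B‖ with h4 | h4
    · exact exists_inner_eq h1 h2 h4
    · have hB0 : 0 < ‖B‖ := by linarith
      have hB : (‖B‖ : ℂ) ≠ 0 := by exact_mod_cast hB0.ne'
      have h5 := M.S.left (-‖B‖) (by linarith)
      obtain ⟨a, e1, e2, e3, e4⟩ := exists_tube_eq (s := -‖B‖) (ξ := M.S.σ * (B / ‖B‖))
        (by linarith) (by rw [norm_mul, norm_div, norm_real, norm_real, norm_norm,
          norm_eq_abs, M.S.abs_σ, div_self hB0.ne', one_mul]) (by rw [h5.1]; norm_num)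
      refine ⟨a, e1, e2, e3, ?_⟩
      rw [e4, h5.1, h5.2]
      congr 1
      refine Prod.ext (by simp) ?_
      push_cast
      have h6 : (‖B‖ : ℂ) * (B / ‖B‖) = B := mul_div_cancel₀ _ hB
      linear_combination (M.S.σ * M.S.σ : ℂ) * h6 + B * σC_mul_σ
  · have h1 := M.S.mem_disc s hs
    obtain ⟨a, e1, e2, e3, e4⟩ := exists_tube_eq (M := M) (s := s)
      (by linarith [(abs_lt.1 hs).1]) (norm_exp_ofReal_mul_I α) (by nlinarith)
    refine ⟨a, e1, e2, e3, ?_⟩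
    rw [e4, point_eq_nearPt]
    simp only [re_ofReal_mul, im_ofReal_mul, Complex.exp_ofReal_mul_I_re,
      Complex.exp_ofReal_mul_I_im]

end Model

lemma ImmersesAt.of_hasDerivAt {f : ℂ → ℂ} {f' x : ℂ} (hf : SmoothAt f x)
    (h : HasDerivAt f f' x) (h0 : f' ≠ 0) : ImmersesAt f x := by
  refine ⟨hf, ?_⟩
  rw [(h.hasFDerivAt.restrictScalars ℝ).fderiv]
  intro v hv
  simpa [h0] using hv

lemma contDiffAt_log_norm {w : ℂ} (hw : w ≠ 0) : SmoothAt (fun w : ℂ => log ‖w‖) w :=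
  (contDiffAt_norm ℝ hw).log (norm_ne_zero_iff.2 hw)

lemma contDiffAt_div_norm {w : ℂ} (hw : w ≠ 0) : SmoothAt (fun w : ℂ => w / (‖w‖ : ℂ)) w :=
  contDiffAt_cdiv contDiffAt_id
    (ofRealCLM.contDiff.contDiffAt.comp w (contDiffAt_norm ℝ hw))
    (by exact_mod_cast norm_ne_zero_iff.2 hw)

lemma contDiffAt_mk {a b : E → ℝ} {x : E}
    (ha : SmoothAt a x) (hb : SmoothAt b x) :
    SmoothAt (fun x => (⟨a x, b x⟩ : ℂ)) x :=
  equivRealProdCLM.symm.contDiff.contDiffAt.comp x (ha.prodMk hb)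

lemma contDiffAt_ringCoord {k : ℕ} {Z : ℂ} (h : -Z ^ k ∈ slitPlane) :
    SmoothAt (ringCoord k) Z := by
  refine contDiffAt_mk ?_ ?_
  · exact ContDiffAt.comp (g := arg) Z (HoleData.contDiffAt_arg h)
      (contDiffAt_id.pow k).neg
  · exact ((contDiffAt_const.mul (contDiff_norm_sq ℝ).contDiffAt).sub contDiffAt_const).div_const _

lemma norm_sq_ringCoord (k : ℕ) (Z : ℂ) : (3 * (ringCoord k Z).im + 5) / 8 = ‖Z‖ ^ 2 := by
  rw [ringCoord]; ring

lemma neg_pow_eq (k : ℕ) (Z : ℂ) :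
    -Z ^ k = ‖Z‖ ^ k * exp ((ringCoord k Z).re * I) := by
  have := norm_mul_exp_arg_mul_I (-Z ^ k)
  rw [norm_neg, norm_pow] at this
  rw [ringCoord]
  conv_lhs => rw [← this]
  push_cast; ring

lemma immersesAt_ringCoord {k : ℕ} (hk : 1 ≤ k) {Z : ℂ} (h : -Z ^ k ∈ slitPlane) :
    ImmersesAt (ringCoord k) Z := by
  have hZ : Z ≠ 0 := by
    rintro rfl
    rw [zero_pow (by omega), neg_zero] at h
    exact slitPlane_ne_zero h rfl
  -- Recover `-Z ^ k`, which is an immersion.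
  let g : ℂ → ℂ := fun a => (√((3 * a.im + 5) / 8) : ℂ) ^ k * exp (a.re * I)
  refine ImmersesAt.of_comp (g := g) (contDiffAt_ringCoord h) ?_ ?_
  · have h1 : SmoothAt (fun a : ℂ => √((3 * a.im + 5) / 8)) (ringCoord k Z) := by
      refine ContDiffAt.sqrt ?_ ?_
      · exact ((contDiffAt_const.mul imCLM.contDiff.contDiffAt).add
          contDiffAt_const).div_const _
      · rw [norm_sq_ringCoord]; exact pow_ne_zero _ (norm_ne_zero_iff.2 hZ)
    have h2 : SmoothAt g (ringCoord k Z) :=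
      ((ofRealCLM.contDiff.contDiffAt.comp _ h1).pow k).mul
        ((ofRealCLM.contDiff.contDiffAt.comp _ reCLM.contDiff.contDiffAt).mul
          contDiffAt_const).cexp
    exact h2.differentiableAt (by simp)
  · have h3 : (fun Y => g (ringCoord k Y)) = fun Y => -Y ^ k := by
      funext Y
      simp only [g]
      rw [norm_sq_ringCoord, sqrt_sq (norm_nonneg _), ← neg_pow_eq]
    rw [h3]
    refine ImmersesAt.of_hasDerivAt (contDiffAt_id.pow k).neg ((hasDerivAt_pow k Z).neg) ?_
    exact neg_ne_zero.2 (mul_ne_zero (by exact_mod_cast (by omega : k ≠ 0)) (pow_ne_zero _ hZ))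

namespace Model

variable {M : Model} {a : ℂ} {Z : ℂ}

lemma contDiffAt_invert (ha : a ≠ 0) : SmoothAt M.invert a :=
  contDiffAt_cdiv contDiffAt_const conjCLE.contDiff.contDiffAt ((map_ne_zero _).2 ha)

lemma immersesAt_invert (ha : a ≠ 0) : ImmersesAt M.invert a := by
  refine ImmersesAt.of_comp (g := M.invert) (contDiffAt_invert ha)
    ((contDiffAt_invert (invert_ne_zero ha)).differentiableAt (by simp)) ?_
  refine (immersesAt_id a).congr ?_
  filter_upwards [isOpen_ne.mem_nhds ha] with b hb
  exact invert_invert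

lemma immersesAt_tube (h : M.k₀ < 1 / 2 * ‖a‖) : ImmersesAt M.tube a := by
  have h1 := norm_invert_lt (by norm_num) h
  refine ImmersesAt.comp (g := handleMap M.S M.k₀) (f := fun a => handleCoord (M.invert a)) ?_ ?_
  · exact immersesAt_handleMap M.S M.k₀_pos M.k₀_lt (norm_pos_iff.1 (norm_handleCoord_pos h))
  · refine ImmersesAt.comp (g := handleCoord) (f := M.invert) ?_
      (immersesAt_invert (ne_zero_of_lt h))
    exact ⟨contDiffAt_handleCoord (by linarith), fderiv_handleCoord_injective h1⟩

lemma contDiff_ofDarboux : Smooth M.ofDarboux := by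
  have h2 : Smooth (fun p : ℂ × ℂ => p.1.im) := imCLM.contDiff.comp contDiff_fst
  have h3 : Smooth (fun p : ℂ × ℂ => p.2.re) := reCLM.contDiff.comp contDiff_snd
  have h4 : Smooth (fun p : ℂ × ℂ => p.2.im) := imCLM.contDiff.comp contDiff_snd
  exact (contDiff_complexMk (contDiff_const.mul h3).neg (reCLM.contDiff.comp contDiff_fst)).prodMk
    (contDiff_complexMk (contDiff_const.mul h2) h4).cexp

lemma contDiffAt_innerV (h : 2 * (M.S.σ : ℂ) * a - M.k₀ ≠ 0) : SmoothAt M.innerV a :=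
  conjCLE.contDiff.contDiffAt.comp a (contDiffAt_cdiv
    ((contDiffAt_const.mul contDiffAt_id).add contDiffAt_const)
    ((contDiffAt_const.mul contDiffAt_id).sub contDiffAt_const) h)

lemma immersesAt_innerV (h : 2 * (M.S.σ : ℂ) * a - M.k₀ ≠ 0) : ImmersesAt M.innerV a := by
  have hk : (M.k₀ : ℂ) ≠ 0 := by exact_mod_cast M.k₀_pos.ne'
  -- The inverse of `V - 1 = conj (2 k₀ / (2 σ a - k₀))`.
  refine ImmersesAt.of_comp (g := fun V : ℂ => (M.S.σ : ℂ) *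
    ((M.k₀ : ℂ) / conj (V - 1) + (M.k₀ : ℂ) / 2))
    (contDiffAt_innerV h) ?_ ?_
  · refine ContDiffAt.differentiableAt (n := ∞) ?_ (by simp)
    refine contDiffAt_const.mul ((contDiffAt_cdiv contDiffAt_const
      (conjCLE.contDiff.contDiffAt.comp _ (contDiffAt_id.sub contDiffAt_const)) ?_).add
      contDiffAt_const)
    change conj (M.innerV a - 1) ≠ 0
    rw [innerV_sub_one h, conj_conj]
    exact div_ne_zero (mul_ne_zero two_ne_zero hk) h
  · refine (immersesAt_id a).congr ?_
    have hc : ContinuousAt (fun a : ℂ => 2 * (M.S.σ : ℂ) * a - M.k₀) a := by fun_prop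
    filter_upwards [hc.eventually_ne h] with b hb
    rw [innerV_sub_one hb, conj_conj]
    field_simp
    linear_combination 2 * b * σC_mul_σ (M := M)

lemma contDiffAt_innerOut {V : ℂ} (hV : V ≠ 0) : SmoothAt M.innerOut V := by
  refine ContDiffAt.prodMk ?_ (contDiffAt_div_norm hV)
  exact ofRealCLM.contDiff.contDiffAt.comp V
    (contDiffAt_const.mul (contDiffAt_log_norm hV)).neg

lemma out_eventuallyEq_tube (h : M.k₀ < 1 / 2 * ‖a‖) :
    M.out =ᶠ[𝓝 a] fun b => M.ofDarboux (M.tube b) := by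
  have hc : ContinuousAt (fun b : ℂ => 1 / 2 * ‖b‖) a := by fun_prop
  filter_upwards [hc.eventually (lt_mem_nhds h)] with b hb
  rw [out_of_tube hb, tubeOut_eq]

lemma out_eventuallyEq_inner (h : 2 / 5 * ‖a‖ < M.k₀) :
    M.out =ᶠ[𝓝 a] fun b => M.innerOut (M.innerV b) := by
  have hc : ContinuousAt (fun b : ℂ => 2 / 5 * ‖b‖) a := by fun_prop
  filter_upwards [hc.eventually (gt_mem_nhds h)] with b hb
  rw [out_of_inner hb]

lemma contDiffAt_out (h : M.Reg a) : SmoothAt M.out a := by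
  by_cases h1 : M.k₀ < 1 / 2 * ‖a‖
  · exact (contDiff_ofDarboux.contDiffAt.comp a
      (immersesAt_tube h1).contDiffAt).congr_of_eventuallyEq
      (out_eventuallyEq_tube h1)
  · refine (ContDiffAt.comp (g := M.innerOut) a (contDiffAt_innerOut (innerV_ne_zero h))
      (contDiffAt_innerV (innerV_bounds h).1)).congr_of_eventuallyEq (out_eventuallyEq_inner ?_)
    linarith [M.k₀_pos]

/-! ### The parametrization of the cover of the surgered surface -/

variable (M) in
/-- The lift of `Model.pt` to the `k`-fold cover. -/
def surf (Z : ℂ) : ℂ × ℂ :=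
  (Z / ‖Z‖ * exp (((M.out (crd(M.H) Z)).1 - (crd(M.H) Z).re * I) / M.H.k),
    -(M.out (crd(M.H) Z)).2)

variable (M) in
/-- The planar domain. -/
def Good (Z : ℂ) : Prop := |(crd(M.H) Z).im| ≤ 1 ∧ M.Reg (crd(M.H) Z)

lemma kC_ne_zero : (M.H.k : ℂ) ≠ 0 := by
  have := M.H.k_pos
  exact_mod_cast (by omega : M.H.k ≠ 0)

lemma Good.norm_bounds (h : M.Good Z) : 1 / 2 ≤ ‖Z‖ ∧ ‖Z‖ ≤ 1 := by
  have h1 := norm_sq_ringCoord M.H.k Z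
  have h2 := abs_le.1 h.1
  have h3 := norm_nonneg Z
  constructor <;> nlinarith

lemma Good.ne_zero (h : M.Good Z) : Z ≠ 0 := norm_pos_iff.1 (by linarith [h.norm_bounds.1])

lemma ringCoord_re_mem (k : ℕ) (Z : ℂ) : (ringCoord k Z).re ∈ Iπ :=
  arg_mem_Ioc _

lemma surf_pow (hZ : Z ≠ 0) :
    ((M.surf Z).1 ^ M.H.k, (M.surf Z).2) = M.pt (crd(M.H) Z) := by
  refine Prod.ext ?_ rfl
  have h0 : (‖Z‖ : ℂ) ≠ 0 := by exact_mod_cast norm_ne_zero_iff.2 hZ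
  simp only [surf, pt]
  rw [mul_pow, div_pow, ← exp_nat_mul, mul_div_cancel₀ _ kC_ne_zero, Complex.exp_sub]
  have h2 : Z ^ M.H.k = -((‖Z‖ : ℂ) ^ M.H.k * exp ((crd(M.H) Z).re * I)) := by
    rw [← (neg_pow_eq M.H.k Z), neg_neg]
  rw [h2]
  field_simp

lemma surf_injOn : InjOn M.surf {Z | M.Good Z} := by
  intro Z hZ Z' hZ' e
  have h1 := surf_pow (M := M) hZ.ne_zero
  rw [e, surf_pow (M := M) hZ'.ne_zero, pt, Prod.mk.injEq] at h1
  have h3 : M.out (crd(M.H) Z) = M.out (crd(M.H) Z') := by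
    refine Prod.ext ?_ (neg_injective h1.2).symm
    exact Complex.exp_inj_of_neg_pi_lt_of_le_pi (out_im_mem (ringCoord_re_mem _ _)).1
      (out_im_mem (ringCoord_re_mem _ _)).2 (out_im_mem (ringCoord_re_mem _ _)).1
      (out_im_mem (ringCoord_re_mem _ _)).2 (neg_injective h1.1).symm
  have h4 := out_injOn ⟨hZ.2, ringCoord_re_mem _ _⟩ ⟨hZ'.2, ringCoord_re_mem _ _⟩ h3
  have h5 : ‖Z‖ = ‖Z'‖ := by
    have := norm_sq_ringCoord M.H.k Z
    rw [h4, norm_sq_ringCoord] at this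
    exact ((sq_eq_sq₀ (norm_nonneg _) (norm_nonneg _)).1 this).symm
  have h6 := congrArg Prod.fst e
  simp only [surf, h4, h5] at h6
  have h7 := mul_right_cancel₀ (exp_ne_zero _) h6
  exact (div_left_inj' (by exact_mod_cast norm_ne_zero_iff.2 hZ'.ne_zero)).1 h7

lemma surf_mem (h : M.Good Z) : ((M.surf Z).1 ^ M.H.k, (M.surf Z).2) ∈ surgered M.t M.S := by
  rw [surf_pow h.ne_zero]
  exact pt_mem_surgered h.2 h.1 (ringCoord_re_mem _ _)

lemma surf_ne_zero (h : M.Good Z) : (M.surf Z).1 ≠ 0 ∧ (M.surf Z).2 ≠ 0 := by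
  constructor
  · refine mul_ne_zero (div_ne_zero h.ne_zero ?_) (exp_ne_zero _)
    exact_mod_cast norm_ne_zero_iff.2 h.ne_zero
  · have h1 := congrArg Prod.snd (surf_pow (M := M) h.ne_zero)
    rw [h1]
    by_cases h2 : M.k₀ < 9 / 20 * ‖crd(M.H) Z‖
    · rw [pt_of_tube h2]; exact (point_ne_zero _).2
    · rw [pt_of_inner h2 h.2]; exact (point_ne_zero _).2

lemma exists_surf_eq {z : ℂ × ℂ} (h : (z.1 ^ M.H.k, z.2) ∈ surgered M.t M.S) :
    ∃ Z, M.Good Z ∧ M.surf Z = z := by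
  obtain ⟨a, hr, hi, ha, he⟩ := exists_pt_eq h
  rw [pt, Prod.mk.injEq] at he
  set E : ℂ := exp (((M.out a).1 - a.re * I) / M.H.k) with hE
  have hE0 : E ≠ 0 := exp_ne_zero _
  have hk := M.H.k_pos
  have hEk : E ^ M.H.k * exp (a.re * I) = exp (M.out a).1 := by
    rw [← exp_nat_mul, mul_div_cancel₀ _ kC_ne_zero, ← exp_add, sub_add_cancel]
  have hu : (z.1 / E) ^ M.H.k = -exp (a.re * I) := by
    rw [div_pow, ← he.1, ← hEk]
    field_simp
  have hu1 : ‖z.1 / E‖ = 1 := by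
    have := congrArg norm hu
    rw [norm_pow, norm_neg, norm_exp_ofReal_mul_I] at this
    exact (pow_eq_one_iff_of_nonneg (norm_nonneg _) (by omega)).1 this
  set ρ : ℝ := √((3 * a.im + 5) / 8) with hρ
  have hρ0 : 0 < ρ := sqrt_pos.2 (by linarith [(abs_le.1 hi).1])
  have hn : ‖(ρ : ℂ) * (z.1 / E)‖ = ρ := by
    rw [norm_mul, hu1, mul_one, norm_coe, abs_of_pos hρ0]
  have hρC : (ρ : ℂ) ≠ 0 := by exact_mod_cast hρ0.ne'
  have hc : crd(M.H) (ρ * (z.1 / E)) = a := by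
    refine Complex.ext ?_ ?_
    · simp only [ringCoord]
      rw [mul_pow, hu, mul_neg, neg_neg, ← Complex.ofReal_pow, arg_real_mul _ (by positivity),
        arg_exp_of_mem (by simpa using ha)]
      simp
    · simp only [ringCoord]
      rw [hn, sq_sqrt (by linarith [(abs_le.1 hi).1])]; ring
  refine ⟨ρ * (z.1 / E), ⟨by rw [hc]; exact hi, by rw [hc]; exact hr⟩, ?_⟩
  rw [surf, hc, hn, mul_div_cancel_left₀ _ hρC, div_mul_cancel₀ _ hE0, he.2]

/-! #### The parametrization is an immersion -/

lemma mem_slitPlane_of_norm_le (hZ : Z ≠ 0) (h : ‖crd(M.H) Z‖ ≤ 1 / 2) :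
    -Z ^ M.H.k ∈ slitPlane := by
  rw [mem_slitPlane_iff_arg]
  refine ⟨fun h1 => ?_, neg_ne_zero.2 (pow_ne_zero _ hZ)⟩
  have h2 := (abs_re_le_norm (crd(M.H) Z)).trans h
  rw [ringCoord] at h2
  rw [h1, abs_of_pos Real.pi_pos] at h2
  linarith [pi_gt_three]

lemma eventually_half_le (hZ : Z ≠ 0) (h : 1 / 2 < ‖crd(M.H) Z‖) :
    ∀ᶠ Y in 𝓝 Z, 1 / 2 ≤ ‖crd(M.H) Y‖ := by
  by_cases h1 : -Z ^ M.H.k ∈ slitPlane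
  · filter_upwards [(contDiffAt_ringCoord h1).continuousAt.norm.eventually (lt_mem_nhds h)] with
      Y hY
    exact hY.le
  · -- On the cut, `-Z ^ k` has negative real part.
    have h2 : (-Z ^ M.H.k).re < 0 := by
      rw [mem_slitPlane_iff] at h1
      push Not at h1
      refine lt_of_le_of_ne h1.1 fun h3 => ?_
      exact neg_ne_zero.2 (pow_ne_zero M.H.k hZ) (Complex.ext h3 h1.2)
    have hc : ContinuousAt (fun Y : ℂ => (-Y ^ M.H.k).re) Z := by fun_prop
    filter_upwards [hc.eventually (gt_mem_nhds h2)] with Y hY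
    have h3 : ¬ |(-Y ^ M.H.k).arg| ≤ Real.pi / 2 := by
      rw [Complex.abs_arg_le_pi_div_two_iff]; linarith
    push Not at h3
    have h4 := abs_re_le_norm (crd(M.H) Y)
    simp only [ringCoord] at h4 ⊢
    linarith [pi_gt_three]

lemma surf_of_far (h : 1 / 2 ≤ ‖crd(M.H) Z‖) :
    M.surf Z = (Z / ‖Z‖, -((Real.exp (M.L * ((8 * ‖Z‖ ^ 2 - 5) / 3)) : ℝ) : ℂ)) := by
  rw [surf, out_of_far h]
  refine Prod.ext ?_ ?_
  · have : (⟨0, (crd(M.H) Z).re⟩ : ℂ) - (crd(M.H) Z).re * I = 0 :=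
      Complex.ext (by simp) (by simp)
    rw [this, zero_div, Complex.exp_zero, mul_one]
  · simp only [neg_inj]
    rw [ofReal_exp]
    congr 1

lemma immersesAt_surf_far (hZ : Z ≠ 0) (h : 1 / 2 < ‖crd(M.H) Z‖) :
    ImmersesAt M.surf Z := by
  have hL := M.L_pos.ne'
  have hev := eventually_half_le hZ h
  have h1 : SmoothAt (fun Z : ℂ =>
      (Z / (‖Z‖ : ℂ), -((Real.exp (M.L * ((8 * ‖Z‖ ^ 2 - 5) / 3)) : ℝ) : ℂ))) Z := by
    refine (contDiffAt_div_norm hZ).prodMk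
      (ofRealCLM.contDiff.contDiffAt.comp Z (ContDiffAt.exp ?_)).neg
    exact contDiffAt_const.mul
      (((contDiffAt_const.mul (contDiff_norm_sq ℝ).contDiffAt).sub contDiffAt_const).div_const _)
  refine ImmersesAt.of_comp (g := fun w : ℂ × ℂ => w.1 * (√((3 * (log ‖w.2‖ / M.L) + 5) / 8) : ℂ))
    (h1.congr_of_eventuallyEq (hev.mono fun Y hY => surf_of_far hY)) ?_ ?_
  · have hw : (M.surf Z).2 ≠ 0 := by
      rw [surf_of_far h.le]
      exact neg_ne_zero.2 (by exact_mod_cast Real.exp_ne_zero _)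
    have h3 : SmoothAt (fun w : ℂ × ℂ => (3 * (log ‖w.2‖ / M.L) + 5) / 8) (M.surf Z) := by
      have := ContDiffAt.comp (g := fun w : ℂ => log ‖w‖) (M.surf Z) (contDiffAt_log_norm hw)
        contDiffAt_snd
      exact ((contDiffAt_const.mul (this.div_const _)).add contDiffAt_const).div_const _
    have h4 : (3 * (log ‖(M.surf Z).2‖ / M.L) + 5) / 8 ≠ 0 := by
      rw [surf_of_far h.le]
      rw [norm_neg, norm_coe, abs_exp, log_exp,
        mul_div_cancel_left₀ _ hL]
      ring_nf
      positivity
    exact (contDiffAt_fst.mul (ofRealCLM.contDiff.contDiffAt.comp _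
      (h3.sqrt h4))).differentiableAt (by simp)
  · refine (immersesAt_id Z).congr ?_
    filter_upwards [hev, isOpen_ne.mem_nhds hZ] with Y hY hY0
    rw [surf_of_far hY]
    rw [norm_neg, norm_coe, abs_exp, log_exp,
      mul_div_cancel_left₀ _ hL]
    have : (3 * ((8 * ‖Y‖ ^ 2 - 5) / 3) + 5) / 8 = ‖Y‖ ^ 2 := by ring
    rw [this, sqrt_sq (norm_nonneg _)]
    exact div_mul_cancel₀ _ (by exact_mod_cast norm_ne_zero_iff.2 hY0)

lemma contDiffAt_surf_of_slit (h : M.Good Z) (hs : -Z ^ M.H.k ∈ slitPlane) :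
    SmoothAt M.surf Z := by
  have hr := contDiffAt_ringCoord hs
  have ho := ContDiffAt.comp (g := M.out) Z (contDiffAt_out h.2) hr
  have hre := ofRealCLM.contDiff.contDiffAt.comp Z (reCLM.contDiff.contDiffAt.comp Z hr)
  exact ((contDiffAt_div_norm h.ne_zero).mul
    ((ho.fst.sub (hre.mul contDiffAt_const)).div_const _).cexp).prodMk ho.snd.neg

lemma contDiffAt_darboux {w : ℂ × ℂ} (h1 : -w.1 ∈ slitPlane)
    (h2 : -w.2 ∈ slitPlane) : SmoothAt M.darboux w := by
  have hw1 := neg_ne_zero.1 (slitPlane_ne_zero h1)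
  have hw2 := neg_ne_zero.1 (slitPlane_ne_zero h2)
  refine (contDiffAt_mk ?_ ?_).prodMk (contDiffAt_mk ?_ ?_)
  · exact ContDiffAt.comp (g := arg) w (HoleData.contDiffAt_arg h1) contDiffAt_fst.neg
  · exact (ContDiffAt.comp (g := fun w : ℂ => log ‖w‖) w (contDiffAt_log_norm hw2)
      contDiffAt_snd).div_const _
  · exact ((ContDiffAt.comp (g := fun w : ℂ => log ‖w‖) w (contDiffAt_log_norm hw1)
      contDiffAt_fst).div_const _).neg
  · exact ContDiffAt.comp (g := arg) w (HoleData.contDiffAt_arg h2) contDiffAt_snd.neg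

lemma pt_of_tube' (h : M.k₀ < 1 / 2 * ‖a‖) : M.pt a = M.point (M.tube a) := by
  rw [pt, out_of_tube h, tubeOut_eq, point]

lemma tube_bounds (h1 : M.k₀ < 1 / 2 * ‖a‖) (h : ‖a‖ ≤ 1 / 2) :
    |(M.tube a).1.re| ≤ 1 ∧ |(M.tube a).2.im| ≤ 1 := by
  rcases h.lt_or_eq with h | h
  · have h2 := norm_tube h1
    have h3 := M.profile_lt (by linarith [neg_lt_param h1]) (param_lt_one h1 h)
    exact ⟨(abs_re_le_norm (M.tube a).1).trans (by linarith),
      (abs_im_le_norm (M.tube a).2).trans (by linarith)⟩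
  · rw [tube_far h.ge]
    exact ⟨(abs_re_le_norm a).trans (by linarith), by simp⟩

lemma mem_slitPlane_of_abs_arg {z : ℂ} (hz : z ≠ 0) (h : |z.arg| ≤ 1) : z ∈ slitPlane := by
  rw [mem_slitPlane_iff_arg]
  refine ⟨fun h1 => ?_, hz⟩
  rw [h1, abs_of_pos Real.pi_pos] at h
  linarith [pi_gt_three]

lemma immersesAt_surf (h : M.Good Z) : ImmersesAt M.surf Z := by
  have hZ := h.ne_zero
  rcases lt_or_ge (1 / 2) ‖crd(M.H) Z‖ with h1 | h1
  · exact immersesAt_surf_far hZ h1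
  have hs := mem_slitPlane_of_norm_le hZ h1
  have hsm := contDiffAt_surf_of_slit h hs
  have hri := immersesAt_ringCoord M.H.k_pos hs
  have hpow : Smooth (fun w : ℂ × ℂ => (w.1 ^ M.H.k, w.2)) :=
    (contDiff_fst.pow _).prodMk contDiff_snd
  by_cases h2 : M.k₀ < 1 / 2 * ‖crd(M.H) Z‖
  · refine ImmersesAt.of_comp (g := fun w => M.darboux (w.1 ^ M.H.k, w.2)) hsm ?_ ?_
    · refine ContDiffAt.differentiableAt (n := ∞) (ContDiffAt.comp (g := M.darboux) _ ?_
        hpow.contDiffAt) (by simp)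
      rw [surf_pow hZ, pt_of_tube' h2]
      have h3 := tube_bounds h2 h1
      have h4 := arg_neg_point (M := M) (mem_Ioc_pi (h3.1.trans (by norm_num)))
        (mem_Ioc_pi (h3.2.trans (by norm_num)))
      exact contDiffAt_darboux
        (mem_slitPlane_of_abs_arg (neg_ne_zero.2 (point_ne_zero _).1) (by rw [h4.1]; exact h3.1))
        (mem_slitPlane_of_abs_arg (neg_ne_zero.2 (point_ne_zero _).2) (by rw [h4.2]; exact h3.2))
    · refine (ImmersesAt.comp (immersesAt_tube h2) hri).congr ?_
      have hc : ContinuousAt (fun Y => 1 / 2 * ‖crd(M.H) Y‖) Z :=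
        continuousAt_const.mul hri.contDiffAt.continuousAt.norm
      filter_upwards [hc.eventually (lt_mem_nhds h2), isOpen_ne.mem_nhds hZ] with Y hY hY0
      have h5 := tube_mem hY (ringCoord_re_mem M.H.k Y)
      rw [surf_pow hY0, pt_of_tube' hY, darboux_point h5.1 h5.2]
  · have h3 : 2 / 5 * ‖crd(M.H) Z‖ < M.k₀ := by
      linarith [M.k₀_pos]
    have hL := M.L_pos.ne'
    refine ImmersesAt.of_comp (g := fun w : ℂ × ℂ =>
      ((Real.exp (-(log ‖w.1 ^ M.H.k‖ / M.L)) : ℝ) : ℂ) * -w.2) hsm ?_ ?_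
    · refine ContDiffAt.differentiableAt (n := ∞) ?_ (by simp)
      have h4 : SmoothAt (fun w : ℂ × ℂ => log ‖w.1 ^ M.H.k‖) (M.surf Z) :=
        ContDiffAt.comp (g := fun w : ℂ => log ‖w‖) _
          (contDiffAt_log_norm (pow_ne_zero _ (surf_ne_zero h).1)) (contDiffAt_fst.pow _)
      exact (ofRealCLM.contDiff.contDiffAt.comp _ (h4.div_const _).neg.exp).mul
        contDiffAt_snd.neg
    · refine (ImmersesAt.comp (immersesAt_innerV (innerV_bounds h.2).1) hri).congr ?_
      have hc : ContinuousAt (fun Y => 2 / 5 * ‖crd(M.H) Y‖) Z :=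
        continuousAt_const.mul hri.contDiffAt.continuousAt.norm
      have hc2 : ContinuousAt (fun Y => M.innerV (crd(M.H) Y)) Z :=
        ContinuousAt.comp (g := M.innerV) (contDiffAt_innerV (innerV_bounds h.2).1).continuousAt
          hri.contDiffAt.continuousAt
      filter_upwards [hc.eventually (gt_mem_nhds h3), isOpen_ne.mem_nhds hZ,
        hc2.eventually_ne (innerV_ne_zero h.2)] with Y hY hY0 hV
      have h6 := surf_pow (M := M) hY0
      rw [pt, out_of_inner hY, innerOut, Prod.mk.injEq] at h6
      rw [h6.1, h6.2, norm_neg, norm_exp, log_exp, ofReal_re]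
      have hV0 := norm_pos_iff.2 hV
      have h7 : -(-(M.L * log ‖M.innerV (crd(M.H) Y)‖) / M.L) =
          log ‖M.innerV (crd(M.H) Y)‖ := by field_simp
      rw [h7, Real.exp_log hV0, neg_neg]
      exact mul_div_cancel₀ _ (by exact_mod_cast hV0.ne')

end Model

section Localization

/-! ### The tropical localization -/

/-- The logarithms to the base `t` of the absolute values of the monomials, in terms of those of
`w₁` and `w₂`. -/
def ell (r₁ r₂ : ℝ) : Fin 5 → ℝ := ![0, r₁ - 1, r₂ - 1, -r₁ - 1, -r₂ - 1]

/-- The coefficients `1 - φ_i`. -/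
def Choices.weight (c : Choices) (e : Fin 5 → ℝ) (i : Fin 5) : ℝ :=
  ∏ j, c.κ (2 * (e j - e i) / c.η)

variable {c : Choices} {t : ℝ} {w₁ w₂ : ℂ} {i : Fin 5}

lemma norm_eq_exp_logT (ht : 1 < t) {w : ℂ} (hw : w ≠ 0) :
    ‖w‖ = Real.exp (log t * logT t w) := by
  rw [logT, mul_div_cancel₀ _ (log_pos ht).ne', Real.exp_log (norm_pos_iff.2 hw)]

lemma mono_ne_zero (ht : 1 < t) (h1 : w₁ ≠ 0) (h2 : w₂ ≠ 0) (i : Fin 5) :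
    mono t w₁ w₂ i ≠ 0 := by
  have : t ≠ 0 := by exact_mod_cast (by linarith : t ≠ 0)
  fin_cases i <;> simp [mono, *]

lemma logT_mono (ht : 1 < t) (h1 : w₁ ≠ 0) (h2 : w₂ ≠ 0) (i : Fin 5) :
    logT t (mono t w₁ w₂ i) = ell (logT t w₁) (logT t w₂) i := by
  have hL := (log_pos ht).ne'
  have ht0 : t ≠ 0 := by linarith
  fin_cases i <;> simp [mono, ell, logT, log_mul, *] <;> field_simp <;> ring

lemma norm_mono (ht : 1 < t) (h1 : w₁ ≠ 0) (h2 : w₂ ≠ 0) (i : Fin 5) :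
    ‖mono t w₁ w₂ i‖ = Real.exp (log t * ell (logT t w₁) (logT t w₂) i) := by
  rw [norm_eq_exp_logT ht (mono_ne_zero ht h1 h2 i), logT_mono ht h1 h2]

lemma Choices.h_eq (ht : 1 < t) (h1 : w₁ ≠ 0) (h2 : w₂ ≠ 0) :
    c.h t w₁ w₂ = ∑ i, (c.weight (ell (logT t w₁) (logT t w₂)) i : ℂ) * mono t w₁ w₂ i := by
  simp only [Choices.h, Choices.family, Choices.φ, one_mul, sub_sub_cancel, Choices.weight,
    logT_mono ht h1 h2]

lemma Choices.weight_mem e (i : Fin 5) : c.weight e i ∈ Icc (0 : ℝ) 1 :=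
  ⟨Finset.prod_nonneg fun _ _ => (c.hκ.mem_Icc _).1,
    Finset.prod_le_one (fun _ _ => (c.hκ.mem_Icc _).1) fun _ _ => (c.hκ.mem_Icc _).2⟩

lemma Choices.weight_eq_zero {e : Fin 5 → ℝ} (j : Fin 5) (h : c.η ≤ e j - e i) :
    c.weight e i = 0 :=
  Finset.prod_eq_zero (Finset.mem_univ j) (c.hκ.eq_zero _ (by rw [le_div_iff₀ c.hη.1]; linarith))

lemma Choices.weight_eq_one {e : Fin 5 → ℝ} (h : ∀ j, e j - e i ≤ c.η / 2) :
    c.weight e i = 1 :=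
  Finset.prod_eq_one fun j _ => c.hκ.eq_one _ (by rw [div_le_one c.hη.1]; linarith [h j])

/-- If at most the constant monomial and the `i`-th one are not small, only these contribute. -/
lemma Choices.h_eq_of_ell (ht : 1 < t) (h1 : w₁ ≠ 0) (h2 : w₂ ≠ 0) (hi0 : i ≠ 0)
    (hj : ∀ j, j ≠ 0 → j ≠ i → ell (logT t w₁) (logT t w₂) j ≤ -1 / 4)
    (hi : ell (logT t w₁) (logT t w₂) i ≤ c.η / 2) :
    c.h t w₁ w₂ = 1 + (c.weight (ell (logT t w₁) (logT t w₂)) i : ℂ) * mono t w₁ w₂ i := by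
  have hη := c.hη
  have he0 : ell (logT t w₁) (logT t w₂) 0 = 0 := rfl
  rw [Choices.h_eq ht h1 h2, Finset.sum_eq_add 0 i hi0.symm]
  · rw [c.weight_eq_one]
    · simp [mono]
    · intro j
      rw [he0]
      by_cases h0 : j = 0
      · rw [h0]; linarith
      · by_cases h : j = i
        · rw [h]; linarith
        · linarith [hj j h0 h]
  · rintro j - ⟨hj0, hji⟩
    rw [c.weight_eq_zero 0 (by rw [he0]; linarith [hj j hj0 hji]), ofReal_zero, zero_mul]
  · exact fun h => absurd (Finset.mem_univ _) h
  · exact fun h => absurd (Finset.mem_univ _) h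

/-- Near the discriminant, the localization is a sum of two monomials. -/
lemma Choices.h_eq_one_add (ht : 1 < t) (h1 : w₁ ≠ 0) (h2 : w₂ ≠ 0) (hi0 : i ≠ 0)
    (hj : ∀ j, j ≠ 0 → j ≠ i → ell (logT t w₁) (logT t w₂) j ≤ -1 / 4)
    (hi : |ell (logT t w₁) (logT t w₂) i| ≤ c.η / 2) : c.h t w₁ w₂ = 1 + mono t w₁ w₂ i := by
  have hi' := abs_le.1 hi
  rw [c.h_eq_of_ell ht h1 h2 hi0 hj hi'.2, c.weight_eq_one]
  · simp
  · intro j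
    by_cases h0 : j = 0
    · rw [h0, show ell (logT t w₁) (logT t w₂) 0 = 0 from rfl]; linarith
    · by_cases h : j = i
      · rw [h]; linarith
      · linarith [hj j h0 h]

lemma Choices.h_of_neg (ht : 1 < t) (h1 : w₁ ≠ 0) (h2 : w₂ ≠ 0) (hi0 : i ≠ 0)
    (hj : ∀ j, j ≠ 0 → j ≠ i → ell (logT t w₁) (logT t w₂) j ≤ -1 / 4)
    (hi : ell (logT t w₁) (logT t w₂) i ≤ 0)
    (hm : mono t w₁ w₂ i = -((‖mono t w₁ w₂ i‖ : ℝ) : ℂ)) :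
    ∃ x : ℝ, 0 ≤ x ∧ c.h t w₁ w₂ = x ∧ (x = 0 → ell (logT t w₁) (logT t w₂) i = 0) := by
  have hη := c.hη
  have hL := log_pos ht
  have hw := c.weight_mem (ell (logT t w₁) (logT t w₂)) i
  have hn := norm_mono ht h1 h2 i
  have hle : ‖mono t w₁ w₂ i‖ ≤ 1 := by
    rw [hn]; exact Real.exp_le_one_iff.2 (mul_nonpos_of_nonneg_of_nonpos hL.le hi)
  have h0 := norm_nonneg (mono t w₁ w₂ i)
  refine ⟨1 - c.weight (ell (logT t w₁) (logT t w₂)) i * ‖mono t w₁ w₂ i‖, by nlinarith [hw.2],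
    ?_, fun h => ?_⟩
  · rw [c.h_eq_of_ell ht h1 h2 hi0 hj (by linarith), hm]
    push_cast
    simp only [norm_neg, norm_real, norm_norm]; ring
  · by_contra h3
    have h4 : ‖mono t w₁ w₂ i‖ < 1 := by
      rw [hn]; exact Real.exp_lt_one_iff.2 (mul_neg_of_pos_of_neg hL (lt_of_le_of_ne hi h3))
    nlinarith [hw.2]

lemma eq_neg_norm_of_arg {z : ℂ} (h : z.arg = Real.pi) : z = -(‖z‖ : ℂ) := by
  conv_lhs => rw [← norm_mul_exp_arg_mul_I z, h, Complex.exp_pi_mul_I, mul_neg_one]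

lemma eq_neg_norm_mul {a z : ℂ} (ha : a = ‖a‖) (hz : z = -(‖z‖ : ℂ)) :
    a * z = -((‖a * z‖ : ℝ) : ℂ) := by
  rw [norm_mul]
  conv_lhs => rw [ha, hz]
  push_cast; ring

lemma inv_eq_neg_norm {z : ℂ} (hz : z = -(‖z‖ : ℂ)) : z⁻¹ = -((‖z⁻¹‖ : ℝ) : ℂ) := by
  conv_lhs => rw [hz]
  rw [norm_inv, inv_neg, ofReal_inv]

/-- On the surgered surface `h` is real and nonnegative, with zeros only over `|r_i| = 1`. -/
lemma Choices.h_surgered (c : Choices) (ht : 1 < t) {S : SurgeryProfile} {w : ℂ × ℂ}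
    (hw : w ∈ surgered t S) : ∃ x : ℝ, 0 ≤ x ∧ c.h t w.1 w.2 = x ∧
      (x = 0 → |logT t w.1| = 1 ∨ |logT t w.2| = 1) := by
  have hη := c.hη
  have htn : (t : ℂ)⁻¹ = ‖(t : ℂ)⁻¹‖ := by
    rw [norm_inv, norm_coe, abs_of_pos (by linarith), ofReal_inv]
  have key : ∀ (i : Fin 5) (h1 : w.1 ≠ 0) (h2 : w.2 ≠ 0), i ≠ 0 →
      (∀ j, j ≠ 0 → j ≠ i → ell (logT t w.1) (logT t w.2) j ≤ -1 / 4) →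
      ell (logT t w.1) (logT t w.2) i ≤ 0 →
      mono t w.1 w.2 i = -((‖mono t w.1 w.2 i‖ : ℝ) : ℂ) →
      (ell (logT t w.1) (logT t w.2) i = 0 → |logT t w.1| = 1 ∨ |logT t w.2| = 1) →
      ∃ x : ℝ, 0 ≤ x ∧ c.h t w.1 w.2 = x ∧ (x = 0 → |logT t w.1| = 1 ∨ |logT t w.2| = 1) := by
    intro i h1 h2 hi0 hj hi hm hlast
    obtain ⟨x, hx, hx1, hx2⟩ := c.h_of_neg ht h1 h2 hi0 hj hi hm
    exact ⟨x, hx, hx1, fun h => hlast (hx2 h)⟩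
  rcases hw with (⟨⟨h1, h2, h3, -, h5⟩, -⟩ | ⟨⟨h1, h2, h3, h5, -⟩, -⟩) | ⟨s, α, hs, hw⟩
  · have hw1 := norm_ne_zero_iff.1 (by rw [h1]; norm_num)
    have hr : logT t w.1 = 0 := by rw [logT, h1, log_one, zero_div]
    have hz := eq_neg_norm_of_arg h3
    have h6 := abs_le.1 h5
    rcases le_total 0 (logT t w.2) with h | h
    · refine key 2 hw1 h2 (by decide) ?_ ?_ (eq_neg_norm_mul htn hz) fun h7 => Or.inr ?_
      · rw [hr]; intro j; fin_cases j <;> simp [ell] <;> linarith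
      · rw [hr]; simp [ell]; linarith
      · simp [ell] at h7; rw [abs_of_nonneg h]; linarith
    · refine key 4 hw1 h2 (by decide) ?_ ?_ (eq_neg_norm_mul htn (inv_eq_neg_norm hz))
        fun h7 => Or.inr ?_
      · rw [hr]; intro j; fin_cases j <;> simp [ell] <;> linarith
      · rw [hr]; simp [ell]; linarith
      · simp [ell] at h7; rw [abs_of_nonpos h]; linarith
  · have hw1 := norm_ne_zero_iff.1 (by rw [h1]; norm_num)
    have hr : logT t w.2 = 0 := by rw [logT, h1, log_one, zero_div]
    have hz := eq_neg_norm_of_arg h3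
    have h6 := abs_le.1 h5
    rcases le_total 0 (logT t w.1) with h | h
    · refine key 1 h2 hw1 (by decide) ?_ ?_ (eq_neg_norm_mul htn hz) fun h7 => Or.inl ?_
      · rw [hr]; intro j; fin_cases j <;> simp [ell] <;> linarith
      · rw [hr]; simp [ell]; linarith
      · simp [ell] at h7; rw [abs_of_nonneg h]; linarith
    · refine key 3 h2 hw1 (by decide) ?_ ?_ (eq_neg_norm_mul htn (inv_eq_neg_norm hz))
        fun h7 => Or.inl ?_
      · rw [hr]; intro j; fin_cases j <;> simp [ell] <;> linarith
      · rw [hr]; simp [ell]; linarith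
      · simp [ell] at h7; rw [abs_of_nonpos h]; linarith
  · -- On the handle only the constant monomial contributes.
    have hL := log_pos ht
    have hR := S.hR
    have hp := (S.mem_disc s hs).2
    have hn := S.nonneg s
    have h1 : w.1 ≠ 0 := by rw [hw]; exact neg_ne_zero.2 (exp_ne_zero _)
    have h2 : w.2 ≠ 0 := by rw [hw]; exact neg_ne_zero.2 (exp_ne_zero _)
    have e1 : logT t w.1 = -(S.σ * S.q s * cos α) := by
      rw [hw, logT, nearPt, norm_neg, norm_exp]
      simp; field_simp; rw [Complex.cos_ofReal_re]
    have e2 : logT t w.2 = S.p s * sin α := by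
      rw [hw, logT, nearPt, norm_neg, norm_exp]
      simp; field_simp; rw [Complex.sin_ofReal_re]
    have b1 : |logT t w.1| ≤ 1 / 4 := by
      rw [e1, abs_neg, abs_mul, abs_mul, S.abs_σ, abs_of_nonneg hn.2]
      nlinarith [Real.abs_cos_le_one α]
    have b2 : |logT t w.2| ≤ 1 / 4 := by
      rw [e2, abs_mul, abs_of_nonneg hn.1]; nlinarith [Real.abs_sin_le_one α]
    have b1' := abs_le.1 b1
    have b2' := abs_le.1 b2
    have hall : ∀ j, j ≠ 0 → ell (logT t w.1) (logT t w.2) j ≤ -1 / 4 := by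
      intro j; fin_cases j <;> simp [ell] <;> linarith
    refine ⟨1, zero_le_one, ?_, fun h => absurd h one_ne_zero⟩
    have h3 := hall 1 (by decide)
    have he0 : ell (logT t w.1) (logT t w.2) 0 = 0 := rfl
    rw [c.h_eq_of_ell ht h1 h2 (i := 1) (by decide) (fun j hj _ => hall j hj) (by linarith),
      c.weight_eq_zero 0 (by rw [he0]; linarith)]
    simp

/-! #### Smoothness -/

section SmoothFamilies

variable {E : Type*} [NormedAddCommGroup E] [NormedSpace ℝ E] {f g : E → ℂ} {x : E}

lemma contDiffAt_logT (hf : SmoothAt f x) (h : f x ≠ 0) :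
    SmoothAt (fun y => logT t (f y)) x :=
  (ContDiffAt.comp x (contDiffAt_log_norm h) hf).div_const _

lemma contDiffAt_inv' (hf : SmoothAt f x) (h : f x ≠ 0) :
    SmoothAt (fun y => (f y)⁻¹) x := by
  simpa using contDiffAt_cdiv (f := fun _ : E => 1) contDiffAt_const hf h

lemma contDiffAt_mono (hf : SmoothAt f x) (hg : SmoothAt g x) (h1 : f x ≠ 0)
    (h2 : g x ≠ 0) i : SmoothAt (fun y => mono t (f y) (g y) i) x := by
  fin_cases i <;> simp only [mono]
  exacts [contDiffAt_const, contDiffAt_const.mul hf, contDiffAt_const.mul hg,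
    contDiffAt_const.mul (contDiffAt_inv' hf h1), contDiffAt_const.mul (contDiffAt_inv' hg h2)]

lemma contDiffAt_weight {e : E → Fin 5 → ℝ} (he : ∀ i, SmoothAt (fun y => e y i) x)
    i : SmoothAt (fun y => c.weight (e y) i) x :=
  contDiffAt_prod fun j _ => c.hκ.smooth.contDiffAt.comp x
    ((contDiffAt_const.mul ((he j).sub (he i))).div_const _)

lemma contDiffAt_h (hf : SmoothAt f x) (hg : SmoothAt g x) (h1 : f x ≠ 0)
    (h2 : g x ≠ 0) : SmoothAt (fun y => c.h t (f y) (g y)) x := by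
  simp only [Choices.h, Choices.family, Choices.φ, one_mul, sub_sub_cancel]
  exact ContDiffAt.sum fun i _ => (ofRealCLM.contDiff.contDiffAt.comp x
    (contDiffAt_weight (e := fun y i => logT t (mono t (f y) (g y) i)) (fun j => by
      by_cases ht : t = 0
      · simp only [logT, ht, Real.log_zero, div_zero]; exact contDiffAt_const
      · exact contDiffAt_logT (contDiffAt_mono hf hg h1 h2 j) (by
          fin_cases j <;> simp [mono, *])) i)).mul (contDiffAt_mono hf hg h1 h2 i)

lemma sum_sq_pos t (w₁ w₂ : ℂ) : 1 ≤ ∑ i, ‖mono t w₁ w₂ i‖ ^ 2 := by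
  have := Finset.single_le_sum (f := fun i => ‖mono t w₁ w₂ i‖ ^ 2) (fun i _ => by positivity)
    (Finset.mem_univ 0)
  simpa [mono] using this

lemma contDiffAt_χ (hf : SmoothAt f x) (hg : SmoothAt g x) (h1 : f x ≠ 0)
    (h2 : g x ≠ 0) : SmoothAt (fun y => c.χ t (f y) (g y)) x := by
  have h3 : SmoothAt (fun y => ∑ i, ‖mono t (f y) (g y) i‖ ^ 2) x :=
    ContDiffAt.sum fun i _ => (contDiff_norm_sq ℝ).contDiffAt.comp x (contDiffAt_mono hf hg h1 h2 i)
  refine c.hψ.smooth.contDiffAt.comp x (ContDiffAt.div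
    ((contDiff_norm_sq ℝ).contDiffAt.comp x (contDiffAt_h hf hg h1 h2))
      (contDiffAt_const.mul h3) ?_)
  have := sum_sq_pos t (f x) (g x)
  have := c.hδ.1
  positivity

end SmoothFamilies

end Localization

open HoleData

/-! ### The localization on the planar domain -/

/-- An analytic function with a simple zero is comparable to the coordinate. -/
lemma exists_factor {F : ℝ → ℝ} {F' : ℝ} (hF : AnalyticAt ℝ F 0) (h0 : F 0 = 0)
    (h : HasDerivAt F F' 0) (hpos : 0 < F') :
    ∃ G : ℝ → ℝ, SmoothAt G 0 ∧ 0 < G 0 ∧ ∀ x, F x = x * G x := by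
  obtain ⟨p, hp⟩ := hF
  refine ⟨dslope F 0, hp.has_fpower_series_dslope_fslope.analyticAt.contDiffAt, ?_, fun x => ?_⟩
  · rw [dslope_same, h.deriv]; exact hpos
  · have := sub_smul_dslope F 0 x
    rw [sub_zero, h0, sub_zero] at this
    exact this.symm

lemma comparable_one_sub_exp {h q m : ℂ → ℝ} {Z : ℂ} {f : ℝ → ℝ} {f' : ℝ} (hf : AnalyticAt ℝ f 0)
    (hf0 : f 0 = 0) (hf' : HasDerivAt f f' 0) (hpos : 0 < f') (hq : SmoothAt q Z)
    (hm : SmoothAt m Z) (hq0 : q Z = 0) (hm0 : 0 < m Z)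
    (he : ∀ᶠ Y in 𝓝 Z, h Y = 1 - Real.exp (-f (q Y * m Y))) : Comparable h q Z := by
  obtain ⟨G, hG, hG0, hFG⟩ := exists_factor (F := fun x => 1 - Real.exp (-f x)) (F' := f')
    (analyticAt_const.sub hf.neg.rexp) (by simp [hf0])
    (by simpa [hf0] using hf'.neg.exp.const_sub 1) hpos
  refine ⟨fun Y => m Y * G (q Y * m Y), hm.mul ?_, ?_, ?_⟩
  · exact ContDiffAt.comp Z (by rw [hq0, zero_mul]; exact hG) (hq.mul hm)
  · change 0 < m Z * G (q Z * m Z)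
    rw [hq0, zero_mul]; exact mul_pos hm0 hG0
  · filter_upwards [he] with Y hY
    rw [hY, hFG]; ring

/-- Locally defined smooth quotients by a function with regular zero set patch together. -/
lemma RegDomain.exists_quotient (D : RegDomain) {h : ℂ → ℝ} {s : Set ℂ}
    (hs : ∀ Z ∈ s, ∃ K : ℂ → ℝ, SmoothAt K Z ∧ 0 < K Z ∧ ∀ᶠ Y in 𝓝 Z, h Y = D.g Y * K Y) :
    ∃ K : ℂ → ℝ, ∀ Z ∈ s, SmoothAt K Z ∧ 0 < K Z ∧ h Z = D.g Z * K Z := by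
  classical
  have hv : ∀ Z, ∃ v, D.g Z = 0 → fderiv ℝ D.g Z v ≠ 0 := by
    intro Z
    by_cases h0 : D.g Z = 0
    · obtain ⟨v, hv⟩ := DFunLike.exists_ne (D.regular Z h0)
      exact ⟨v, fun _ => by simpa using hv⟩
    · exact ⟨0, fun h => absurd h h0⟩
  choose v hv using hv
  -- On the zero set, the quotient is that of the derivatives.
  set Q : ℂ → ℝ := fun Y => if D.g Y = 0 then fderiv ℝ h Y (v Y) / fderiv ℝ D.g Y (v Y)
    else h Y / D.g Y with hQ
  refine ⟨Q, fun Z hZ => ?_⟩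
  obtain ⟨K, hK, hK0, he⟩ := hs Z hZ
  have hKd : ∀ᶠ Y in 𝓝 Z, ContDiffAt ℝ 1 K Y := (hK.of_le (by simp)).eventually (by simp)
  have hQK : ∀ᶠ Y in 𝓝 Z, Q Y = K Y := by
    filter_upwards [he.eventually_nhds, hKd] with Y hY hYd
    simp only [hQ]
    split_ifs with h0
    · have hd := ((D.smooth.differentiable (by simp) Y).hasFDerivAt.mul
          (hYd.differentiableAt (by simp)).hasFDerivAt).congr_of_eventuallyEq hY
      rw [hd.fderiv, h0, zero_smul, zero_add, smul_apply, smul_eq_mul,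
        mul_div_cancel_right₀ _ (hv Y h0)]
    · rw [hY.self_of_nhds, mul_div_cancel_left₀ _ h0]
  exact ⟨hK.congr_of_eventuallyEq hQK, by rw [hQK.self_of_nhds]; exact hK0,
    by rw [hQK.self_of_nhds]; exact he.self_of_nhds⟩

lemma eq_neg_norm_of_eq {z : ℂ} {x : ℝ} (hx : 0 ≤ x) (h : z = -x) : z = -(‖z‖ : ℂ) := by
  rw [h, norm_neg, norm_coe, abs_of_nonneg hx]

namespace Model

variable {M : Model} {a Z : ℂ} {c : Choices} {i : Fin 5}

lemma two_mul_add_ne_zero (h : M.Reg a) {τ : ℝ} (hτ : τ = 1 ∨ τ = -1) :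
    2 * τ * a + M.k₀ ≠ 0 := by
  have h1 := innerV_bounds h
  rcases M.eq_or_eq_neg_σ hτ with rfl | rfl
  · exact h1.2.1
  · have h2 : 2 * ((-M.S.σ : ℝ) : ℂ) * a + M.k₀ = -(2 * M.S.σ * a - M.k₀) := by
      push_cast; ring
    rw [h2]
    exact neg_ne_zero.2 h1.1

/-- The coordinate `V` near the boundary of a hole. -/
lemma log_identity {τ : ℝ} (hτ : τ = 1 ∨ τ = -1) (h1 : 2 * (τ : ℂ) * a - M.k₀ ≠ 0)
    (h2 : 2 * (τ : ℂ) * a + M.k₀ ≠ 0) : 0 < 1 + (‖a - ctr(τ, M.H)‖ ^ 2 - M.H.rho ^ 2) *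
      (4 * (Real.exp 1 ^ 2 - 1) / ‖2 * τ * a + M.k₀‖ ^ 2) ∧
    1 - τ * M.S.σ * log ‖M.innerV a‖ = 1 / 2 * log (1 +
      (‖a - ctr(τ, M.H)‖ ^ 2 - M.H.rho ^ 2) *
        (4 * (Real.exp 1 ^ 2 - 1) / ‖2 * τ * a + M.k₀‖ ^ 2)) := by
  have n1 := norm_pos_iff.2 h1
  have n2 := norm_pos_iff.2 h2
  have hx : 1 + (‖a - ctr(τ, M.H)‖ ^ 2 - M.H.rho ^ 2) *
      (4 * (Real.exp 1 ^ 2 - 1) / ‖2 * τ * a + M.k₀‖ ^ 2) =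
      (Real.exp 1 * ‖2 * τ * a - M.k₀‖ / ‖2 * τ * a + M.k₀‖) ^ 2 := by
    have h := hole_identity τ hτ (M := M) a
    have n2' := n2.ne'
    generalize ‖2 * τ * a + M.k₀‖ = P at h n2' ⊢
    generalize ‖2 * τ * a - M.k₀‖ = N at h ⊢
    field_simp
    linear_combination -h
  have hV : τ * M.S.σ * log ‖M.innerV a‖ =
      log ‖2 * τ * a + M.k₀‖ - log ‖2 * τ * a - M.k₀‖ := by
    rcases M.eq_or_eq_neg_σ hτ with rfl | rfl
    · rw [M.S.σ_mul_σ, one_mul, innerV, norm_conj, norm_div, log_div n2.ne' n1.ne']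
    · rw [norm_neg_σ_sub] at n1 ⊢
      rw [norm_neg_σ_add] at n2 ⊢
      rw [neg_mul, M.S.σ_mul_σ, innerV, norm_conj, norm_div, log_div n1.ne' n2.ne']; ring
  rw [hx, hV, Real.log_pow, log_div (mul_pos (exp_pos 1) n1).ne' n2.ne',
    log_mul (Real.exp_ne_zero _) n1.ne', log_exp]
  refine ⟨by positivity, ?_⟩
  ring

lemma norm_logT_pt_lt (h1 : |a.im| < 1)
    (h2 : ∀ τ : ℝ, τ = 1 ∨ τ = -1 → M.H.rho < ‖a - ctr(τ, M.H)‖) :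
    |logT M.t (M.pt a).1| < 1 ∧ |logT M.t (M.pt a).2| < 1 := by
  have hr : M.Reg a := fun τ hτ => (h2 τ hτ).le
  by_cases h : M.k₀ < 9 / 20 * ‖a‖
  · have h3 := half_of_lt h
    rw [pt_of_tube h, (logT_point _).1, (logT_point _).2, abs_neg]
    rcases le_or_gt (1 / 2) ‖a‖ with h4 | h4
    · rw [tube_far h4]; simpa using h1
    · have h5 := norm_tube h3
      have h6 := M.profile_lt (by linarith [neg_lt_param h3]) (param_lt_one h3 h4)
      exact ⟨(abs_re_le_norm _).trans_lt (by rw [h5.2]; exact h6.2),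
        (abs_im_le_norm _).trans_lt (by rw [h5.1]; exact h6.1)⟩
  · rw [pt_of_inner h hr, (logT_point _).1, (logT_point _).2]
    refine ⟨?_, by simp⟩
    simp only [abs_neg, log_re]
    refine lt_of_le_of_ne (innerV_bounds hr).2.2 fun h3 => ?_
    obtain ⟨τ, hτ, hτ1⟩ : ∃ τ : ℝ, (τ = 1 ∨ τ = -1) ∧ τ * M.S.σ * log ‖M.innerV a‖ = 1 := by
      have hσ := M.S.σ_mul_σ
      rcases (abs_eq one_pos.le).1 h3 with h4 | h4
      · exact ⟨M.S.σ, M.S.hσ, by rw [h4, hσ, one_mul]⟩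
      · exact ⟨-M.S.σ, neg_σ_cases, by rw [h4]; linarith⟩
    have hτ' : 2 * τ * a - M.k₀ ≠ 0 := by
      have := two_mul_add_ne_zero hr (τ := -τ) (by rcases hτ with h | h <;> rw [h] <;> norm_num)
      rw [← neg_ne_zero]; convert! this using 1; push_cast; ring
    obtain ⟨h5, h6⟩ := log_identity hτ hτ' (two_mul_add_ne_zero hr hτ)
    rw [hτ1] at h6
    have h7 := Real.log_eq_zero.1 (by linarith : log _ = 0)
    have h8 : 0 < (‖a - ctr(τ, M.H)‖ ^ 2 - M.H.rho ^ 2) *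
        (4 * (Real.exp 1 ^ 2 - 1) / ‖2 * τ * a + M.k₀‖ ^ 2) := by
      have := norm_pos_iff.2 (two_mul_add_ne_zero hr hτ)
      have := exp_one_bounds.1
      have := h2 τ hτ
      have := M.H.rho_pos
      exact mul_pos (by nlinarith) (div_pos (by nlinarith) (by positivity))
    rcases h7 with h7 | h7 | h7 <;> linarith

variable (M) in
/-- The map from the planar domain to the surgered surface. -/
def W (Z : ℂ) : ℂ × ℂ := M.pt (crd(M.H) Z)

variable (M) in
/-- The localized function on the planar domain; it is real there. -/
def hR (c : Choices) (Z : ℂ) : ℝ := (c.h M.t (M.W Z).1 (M.W Z).2).re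

lemma W_eq (hZ : Z ≠ 0) : M.W Z = ((M.surf Z).1 ^ M.H.k, (M.surf Z).2) := (surf_pow hZ).symm

lemma W_ne_zero (h : M.Good Z) : (M.W Z).1 ≠ 0 ∧ (M.W Z).2 ≠ 0 := by
  rw [W_eq h.ne_zero]
  exact ⟨pow_ne_zero _ (surf_ne_zero h).1, (surf_ne_zero h).2⟩

lemma contDiffAt_W (h : M.Good Z) : SmoothAt M.W Z := by
  have h1 := (immersesAt_surf h).contDiffAt
  refine ((h1.fst.pow M.H.k).prodMk h1.snd).congr_of_eventuallyEq ?_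
  filter_upwards [isOpen_ne.mem_nhds h.ne_zero] with Y hY
  exact W_eq hY

lemma contDiffAt_hR (h : M.Good Z) : SmoothAt (M.hR c) Z :=
  reCLM.contDiff.contDiffAt.comp Z (contDiffAt_h (contDiffAt_W h).fst (contDiffAt_W h).snd
    (W_ne_zero h).1 (W_ne_zero h).2)

lemma W_mem (h : M.Good Z) : M.W Z ∈ surgered M.t M.S :=
  pt_mem_surgered h.2 h.1 (ringCoord_re_mem _ _)

variable (M) in
/-- The logarithms of the monomials on the planar domain. -/
def ellW (Z : ℂ) : Fin 5 → ℝ := ell (logT M.t (M.W Z).1) (logT M.t (M.W Z).2)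

lemma continuousAt_ellW (h : M.Good Z) i : ContinuousAt (fun Y => M.ellW Y i) Z := by
  have h1 := (contDiffAt_logT (t := M.t) (contDiffAt_W h).fst (W_ne_zero h).1).continuousAt
  have h2 := (contDiffAt_logT (t := M.t) (contDiffAt_W h).snd (W_ne_zero h).2).continuousAt
  fin_cases i <;> simp only
  exacts [continuousAt_const, h1.sub continuousAt_const, h2.sub continuousAt_const,
    h1.neg.sub continuousAt_const, h2.neg.sub continuousAt_const]

/-- Near a boundary point, where the constant and the `i`-th monomial cancel. -/
lemma eventually_hR_eq (c : Choices) (h : M.Good Z) (hi0 : i ≠ 0)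
    (hj : ∀ j, j ≠ 0 → j ≠ i → M.ellW Z j < -1 / 4) (hi : M.ellW Z i = 0)
    (hm : ∀ᶠ Y in 𝓝 Z, mono M.t (M.W Y).1 (M.W Y).2 i = -(‖mono M.t (M.W Y).1 (M.W Y).2 i‖ : ℂ)) :
    ∀ᶠ Y in 𝓝 Z, M.hR c Y = 1 - Real.exp (M.L * M.ellW Y i) := by
  have hη := c.hη
  have e1 := Filter.eventually_all.2 fun j => Filter.eventually_imp_distrib_left.2 fun h0 =>
      Filter.eventually_imp_distrib_left.2 fun h1 =>
        (continuousAt_ellW h j).eventually (gt_mem_nhds (hj j h0 h1))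
  have e2 : ∀ᶠ Y in 𝓝 Z, |M.ellW Y i| < c.η / 2 :=
    (continuousAt_ellW h i).abs.eventually (gt_mem_nhds (by
      change |M.ellW Z i| < _
      rw [hi]; linarith))
  have e3 := (contDiffAt_W h).continuousAt.fst.eventually_ne (W_ne_zero h).1
  have e4 := (contDiffAt_W h).continuousAt.snd.eventually_ne (W_ne_zero h).2
  filter_upwards [e1, e2, e3, e4, hm] with Y y1 y2 y3 y4 y5
  rw [hR, c.h_eq_one_add M.one_lt y3 y4 hi0 (fun j a b => (y1 j a b).le) y2.le, y5,
    norm_mono M.one_lt y3 y4]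
  rfl

lemma t_inv_eq : (M.t : ℂ)⁻¹ = ‖(M.t : ℂ)⁻¹‖ := by
  have := M.one_lt
  rw [norm_inv, norm_coe, abs_of_pos (by linarith), ofReal_inv]

lemma norm_ge_of_im (h : |a.im| = 1) : 1 / 2 < ‖a‖ := by linarith [abs_im_le_norm a]

lemma logT_W_far (hZ : Z ≠ 0) (h : 1 / 2 ≤ ‖crd(M.H) Z‖) :
    logT M.t (M.W Z).1 = 0 ∧ logT M.t (M.W Z).2 = (crd(M.H) Z).im ∧
      (M.W Z).2 = -(‖(M.W Z).2‖ : ℂ) := by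
  have hL := M.L_pos.ne'
  rw [W_eq hZ, surf_of_far h]
  refine ⟨?_, ?_, eq_neg_norm_of_eq (exp_pos _).le rfl⟩
  · simp [logT]
  · simp only [logT, norm_neg, norm_coe, abs_exp, log_exp]
    exact mul_div_cancel_left₀ _ hL

lemma contDiff_ringCoord_im k : Smooth (fun Y => (ringCoord k Y).im) :=
  ((contDiff_const.mul (contDiff_norm_sq ℝ)).sub contDiff_const).div_const _

lemma comparable_outer (c : Choices) (h : M.Good Z) {τ : ℝ} (hτ : τ = 1 ∨ τ = -1)
    (hi : (crd(M.H) Z).im = τ) :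
    Comparable (M.hR c) (fun Y => 1 - τ * (crd(M.H) Y).im) Z := by
  have hZ := h.ne_zero
  have hτ1 : |τ| = 1 := by rcases hτ with h | h <;> rw [h] <;> simp
  have hττ : τ * τ = 1 := by rcases hτ with h | h <;> rw [h] <;> norm_num
  have hfar := norm_ge_of_im (by rw [hi]; exact hτ1)
  have hev := (isOpen_ne.eventually_mem hZ).and (eventually_half_le hZ hfar)
  obtain ⟨i, hi0, hell, hm⟩ : ∃ i : Fin 5, i ≠ 0 ∧ (∀ r, ell 0 r i = τ * r - 1 ∧
      ∀ j, j ≠ 0 → j ≠ i → ell 0 τ j ≤ -1) ∧ ∀ w : ℂ × ℂ, w.2 = -(‖w.2‖ : ℂ) →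
        mono M.t w.1 w.2 i = -(‖mono M.t w.1 w.2 i‖ : ℂ) := by
    rcases hτ with rfl | rfl
    · refine ⟨2, by decide, fun r => ⟨by simp [ell], fun j => ?_⟩,
        fun w hw => eq_neg_norm_mul t_inv_eq hw⟩
      fin_cases j <;> simp [ell]
    · refine ⟨4, by decide, fun r => ⟨by simp [ell], fun j => ?_⟩,
        fun w hw => eq_neg_norm_mul t_inv_eq (inv_eq_neg_norm hw)⟩
      fin_cases j <;> simp [ell]
  have hell' : ∀ Y, Y ≠ 0 → 1 / 2 ≤ ‖crd(M.H) Y‖ →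
      M.ellW Y = ell 0 (crd(M.H) Y).im := by
    intro Y h1 h2
    rw [ellW, (logT_W_far h1 h2).1, (logT_W_far h1 h2).2.1]
  have key := eventually_hR_eq c h hi0
    (fun j h1 h2 => by
      rw [hell' Z hZ hfar.le, hi]
      linarith [(hell τ).2 j h1 h2])
    (by rw [hell' Z hZ hfar.le, hi, (hell _).1, hττ, sub_self])
    (hev.mono fun Y hY => hm _ (logT_W_far hY.1 hY.2).2.2)
  refine comparable_one_sub_exp (f := fun x => M.L * x) (f' := M.L)
    (analyticAt_const.mul analyticAt_id) (by simp)
    (by simpa using (hasDerivAt_id 0).const_mul M.L) M.L_pos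
    (contDiff_const.sub (contDiff_const.mul (contDiff_ringCoord_im _))).contDiffAt contDiffAt_const
    (by rw [hi, hττ, sub_self]) one_pos ?_
  filter_upwards [key, hev] with Y hY hY2
  rw [hY, hell' Y hY2.1 hY2.2, (hell _).1]
  congr 2
  ring

lemma logT_W_inner (h : 2 / 5 * ‖crd(M.H) Z‖ < M.k₀) :
    logT M.t (M.W Z).1 = -log ‖M.innerV (crd(M.H) Z)‖ ∧ logT M.t (M.W Z).2 = 0 ∧
      (M.W Z).1 = -(‖(M.W Z).1‖ : ℂ) := by
  rw [W, pt, out_of_inner h, innerOut]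
  refine ⟨?_, ?_, ?_⟩
  · rw [logT, norm_neg, norm_exp, log_exp, ← mul_neg]
    exact mul_div_cancel_left₀ _ M.L_pos.ne'
  · simp [logT]
  · exact eq_neg_norm_of_eq (exp_pos _).le (by rw [ofReal_exp])

lemma comparable_hole (c : Choices) (h : M.Good Z) {τ : ℝ} (hτ : τ = 1 ∨ τ = -1)
    (hi : ‖crd(M.H) Z - ctr(τ, M.H)‖ = M.H.rho) : Comparable (M.hR c)
      (fun Y => ‖crd(M.H) Y - ctr(τ, M.H)‖ ^ 2 - M.H.rho ^ 2) Z := by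
  have hZ := h.ne_zero
  have hk := M.k₀_pos
  have hna : ‖crd(M.H) Z‖ ≤ 9 / 8 * M.k₀ := by
    have h1 := norm_add_le (crd(M.H) Z - ctr(τ, M.H)) ctr(τ, M.H)
    rw [sub_add_cancel, norm_coe, abs_mul, abs_of_pos M.H.c_pos] at h1
    have hτ1 : |τ| = 1 := by rcases hτ with h | h <;> rw [h] <;> simp
    rw [hτ1] at h1
    linarith [M.c_add_rho_le]
  have hs := mem_slitPlane_of_norm_le (M := M) hZ (by linarith [M.k₀_le'])
  have hrc := contDiffAt_ringCoord hs
  have hτ' : -τ = 1 ∨ -τ = -1 := by rcases hτ with h | h <;> rw [h] <;> norm_num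
  set q : ℂ → ℝ := fun Y => ‖crd(M.H) Y - ctr(τ, M.H)‖ ^ 2 - M.H.rho ^ 2 with hq
  set m : ℂ → ℝ := fun Y => 4 * (Real.exp 1 ^ 2 - 1) / ‖2 * τ * crd(M.H) Y + M.k₀‖ ^ 2 with hm
  have hP : SmoothAt (fun Y => 2 * τ * crd(M.H) Y + M.k₀) Z :=
    (contDiffAt_const.mul hrc).add contDiffAt_const
  have hN : SmoothAt (fun Y => 2 * τ * crd(M.H) Y - M.k₀) Z :=
    (contDiffAt_const.mul hrc).sub contDiffAt_const
  have hP0 := two_mul_add_ne_zero h.2 hτ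
  have hN0 : 2 * τ * crd(M.H) Z - M.k₀ ≠ 0 := by
    rw [← neg_ne_zero]; convert! (two_mul_add_ne_zero h.2 hτ') using 1; push_cast; ring
  have hVc :=
      ContinuousAt.comp (contDiffAt_innerV (innerV_bounds h.2).1).continuousAt
      hrc.continuousAt
  have hev : ∀ᶠ Y in 𝓝 Z, Y ≠ 0 ∧ 2 / 5 * ‖crd(M.H) Y‖ < M.k₀ ∧
      M.innerV (crd(M.H) Y) ≠ 0 ∧ 2 * τ * crd(M.H) Y + M.k₀ ≠ 0 ∧
      2 * τ * crd(M.H) Y - M.k₀ ≠ 0 := by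
    have h1 : ContinuousAt (fun Y => 2 / 5 * ‖crd(M.H) Y‖) Z :=
      continuousAt_const.mul hrc.continuousAt.norm
    filter_upwards [isOpen_ne.eventually_mem hZ, h1.eventually
      (gt_mem_nhds (show 2 / 5 * ‖crd(M.H) Z‖ < M.k₀ by linarith)),
      hVc.eventually_ne (innerV_ne_zero h.2), hP.continuousAt.eventually_ne hP0,
      hN.continuousAt.eventually_ne hN0] with Y a b c d e using ⟨a, b, c, d, e⟩
  obtain ⟨i, hi0, hell, hmn⟩ : ∃ i : Fin 5, i ≠ 0 ∧ (∀ v, ell (-v) 0 i = -(1 - τ * M.S.σ * v) ∧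
      (1 - τ * M.S.σ * v = 0 → ∀ j, j ≠ 0 → j ≠ i → ell (-v) 0 j ≤ -1)) ∧
      ∀ w : ℂ × ℂ, w.1 = -(‖w.1‖ : ℂ) →
        mono M.t w.1 w.2 i = -(‖mono M.t w.1 w.2 i‖ : ℂ) := by
    have hs : τ * M.S.σ = 1 ∨ τ * M.S.σ = -1 := by
      rcases hτ with rfl | rfl <;> rcases M.S.hσ with h | h <;> rw [h] <;> norm_num
    rcases hs with hs | hs <;> rw [hs]
    · refine ⟨3, by decide, fun v => ⟨by simp [ell], fun hv j => ?_⟩,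
        fun w hw => eq_neg_norm_mul t_inv_eq (inv_eq_neg_norm hw)⟩
      fin_cases j <;> simp [ell]; linarith
    · refine ⟨1, by decide, fun v => ⟨by simp [ell]; ring, fun hv j => ?_⟩,
        fun w hw => eq_neg_norm_mul t_inv_eq hw⟩
      fin_cases j <;> simp [ell]; linarith
  have hZev := hev.self_of_nhds
  have hell' : ∀ Y, 2 / 5 * ‖crd(M.H) Y‖ < M.k₀ →
      M.ellW Y = ell (-log ‖M.innerV (crd(M.H) Y)‖) 0 := by
    intro Y h2
    rw [ellW, (logT_W_inner h2).1, (logT_W_inner h2).2.1]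
  have hq0 : q Z = 0 := by simp only [hq]; rw [hi, sub_self]
  have hZ0 : 1 - τ * M.S.σ * log ‖M.innerV (crd(M.H) Z)‖ = 0 := by
    rw [(log_identity hτ hN0 hP0).2, hi, sub_self, zero_mul, add_zero, log_one, mul_zero]
  have key := eventually_hR_eq c h hi0
    (fun j h1 h2 => by
      rw [hell' Z hZev.2.1]
      linarith [(hell _).2 hZ0 j h1 h2])
    (by rw [hell' Z hZev.2.1, (hell _).1, hZ0, neg_zero])
    (hev.mono fun Y hY => hmn _ (logT_W_inner hY.2.1).2.2)
  have he := exp_one_bounds.1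
  refine comparable_one_sub_exp (f := fun x => M.L * (1 / 2 * log (1 + x))) (f' := M.L / 2)
    (m := m) ?_ (by simp) ?_ (half_pos M.L_pos) ?_ ?_ hq0 ?_ ?_
  · exact analyticAt_const.mul (analyticAt_const.mul
      ((analyticAt_const.add analyticAt_id).log (by simp)))
  · have h1 := (((hasDerivAt_id 0).const_add 1).log (by simp)).const_mul (1 / 2)
    have h2 := h1.const_mul M.L
    simp only [id, add_zero, div_one, mul_one] at h2
    rwa [show M.L / 2 = M.L * (1 / 2) by ring]
  · exact ((contDiff_norm_sq ℝ).contDiffAt.comp Z (hrc.sub contDiffAt_const)).sub contDiffAt_const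
  · exact contDiffAt_const.div ((contDiff_norm_sq ℝ).contDiffAt.comp Z hP)
      (pow_ne_zero _ (norm_ne_zero_iff.2 hP0))
  · have := norm_pos_iff.2 hP0
    exact div_pos (by nlinarith) (by positivity)
  · filter_upwards [key, hev] with Y hY hY2
    rw [hY, hell' Y hY2.2.1, (hell _).1,
      (log_identity hτ hY2.2.2.2.2 hY2.2.2.2.1).2, mul_neg]

/-- `h` is the product of the function defining the planar domain and a positive function. -/
lemma exists_factorization (c : Choices) (M : Model) : ∃ D : RegDomain,
    IsSumS1S2 (2 * M.H.k + 1) D.Mfd ∧ (∀ Z, 0 ≤ D.g Z ↔ M.Good Z) ∧ ∃ H : ℂ → ℝ,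
      ∀ Z, 0 ≤ D.g Z → SmoothAt H Z ∧ 0 < H Z ∧
        c.h M.t (M.W Z).1 (M.W Z).2 = ((D.g Z * H Z : ℝ) : ℂ) := by
  obtain ⟨D, h1, h2, h3, h4⟩ := M.H.exists_planarDomain
  have hreal : ∀ Z, M.Good Z → c.h M.t (M.W Z).1 (M.W Z).2 = (M.hR c Z : ℂ) := by
    intro Z hZ
    obtain ⟨x, -, hx, -⟩ := c.h_surgered M.one_lt (W_mem hZ)
    rw [hR, hx, ofReal_re]
  have hquot : ∀ Z, ∀ q : ℂ → ℝ, Comparable D.g q Z → Comparable (M.hR c) q Z →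
      ∃ K : ℂ → ℝ, SmoothAt K Z ∧ 0 < K Z ∧ ∀ᶠ Y in 𝓝 Z, M.hR c Y = D.g Y * K Y := by
    rintro Z q ⟨G, hG, hG0, hGe⟩ ⟨K, hK, hK0, hKe⟩
    refine ⟨fun Y => K Y / G Y, hK.div hG hG0.ne', div_pos hK0 hG0, ?_⟩
    filter_upwards [hGe, hKe, hG.continuousAt.eventually_ne hG0.ne'] with Y y1 y2 y3
    rw [y1, y2]
    field_simp
  obtain ⟨H, hH⟩ := D.exists_quotient (h := M.hR c) (by
    intro Z hZ
    have hZ' := hZ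
    rcases ((h2 Z).2 hZ).eq_or_lt' with h0 | h0
    · rcases h4 Z h0 with ⟨e1, e2⟩ | ⟨e1, e2⟩ | ⟨τ, hτ, e1, e2⟩
      · exact hquot Z _ e2 (by simpa using comparable_outer c hZ' (Or.inl rfl) e1)
      · exact hquot Z _ e2 (by simpa using comparable_outer c hZ' (Or.inr rfl) e1)
      · exact hquot Z _ e2 (comparable_hole c hZ' hτ e1)
    · obtain ⟨x, hx0, hx, hx1⟩ := c.h_surgered M.one_lt (W_mem hZ')
      have hlt := norm_logT_pt_lt (h3 Z h0).1 (h3 Z h0).2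
      have hpos : 0 < M.hR c Z := by
        rw [hR, hx]
        refine lt_of_le_of_ne hx0 fun h => ?_
        rcases hx1 h.symm with h | h
        · exact hlt.1.ne h
        · exact hlt.2.ne h
      have hgd := D.smooth.contDiffAt (x := Z)
      refine ⟨fun Y => M.hR c Y / D.g Y, (contDiffAt_hR hZ').div hgd h0.ne', div_pos hpos h0, ?_⟩
      filter_upwards [hgd.continuousAt.eventually_ne h0.ne'] with Y hY
      field_simp)
  refine ⟨D, h1, h2, H, fun Z hZ => ?_⟩
  have h5 := hH Z ((h2 Z).1 hZ)
  exact ⟨h5.1, h5.2.1, by rw [hreal Z ((h2 Z).1 hZ), h5.2.2]⟩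

end Model

/-! ### The level set of the moment map -/

/-- The value of `|u|²` where `μ = ε`, for `h ≠ 0`. -/
def levelSq (ε h χ : ℝ) : ℝ :=
  (-(h ^ 2 - 2 * ε * (1 - χ)) + √((h ^ 2 - 2 * ε * (1 - χ)) ^ 2 + 8 * ε * h ^ 2)) / 2

open Classical in
/-- The value of `|u|² / h` where `μ = ε`, which extends smoothly over `h = 0`. -/
def levelRatio (ε h χ : ℝ) : ℝ :=
  if χ = 1 then (-h + √(h ^ 2 + 8 * ε)) / 2 else levelSq ε h χ / h

section Level

variable {ε h χ : ℝ}

lemma levelSq_pos (hε : 0 < ε) (hh : h ≠ 0) : 0 < levelSq ε h χ := by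
  have h1 : 0 < h ^ 2 := by positivity
  set b := h ^ 2 - 2 * ε * (1 - χ) with hb
  have h2 : |b| < √(b ^ 2 + 8 * ε * h ^ 2) := by
    rw [← Real.sqrt_sq_eq_abs]
    exact Real.sqrt_lt_sqrt (sq_nonneg b) (by nlinarith)
  rw [levelSq]; linarith [le_abs_self b]

/-- With `s = |u|²` and `|v|² = h² / s`, the equation `μ = ε` becomes this quadratic one. -/
lemma levelSq_eq (hε : 0 < ε) :
    levelSq ε h χ ^ 2 + (h ^ 2 - 2 * ε * (1 - χ)) * levelSq ε h χ = 2 * ε * h ^ 2 := by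
  have h1 := sq_sqrt (by positivity :
    0 ≤ (h ^ 2 - 2 * ε * (1 - χ)) ^ 2 + 8 * ε * h ^ 2)
  rw [levelSq]
  linear_combination h1 / 4

lemma levelRatio_eq (hh : 0 < h) : levelRatio ε h χ = levelSq ε h χ / h := by
  rw [levelRatio]
  split_ifs with h1
  · have h2 : √((h ^ 2 - 2 * ε * (1 - χ)) ^ 2 + 8 * ε * h ^ 2) = h * √(h ^ 2 + 8 * ε) := by
      rw [h1, ← sqrt_sq hh.le, ← Real.sqrt_mul (sq_nonneg h), sqrt_sq hh.le]
      ring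
    rw [levelSq, h2, h1]
    field_simp; ring
  · rfl

lemma levelRatio_pos (hε : 0 < ε) (hh : 0 ≤ h) (hχ : h = 0 → χ = 1) : 0 < levelRatio ε h χ := by
  rcases hh.eq_or_lt' with h0 | h0
  · rw [levelRatio, if_pos (hχ h0), h0, neg_zero, zero_add]
    exact half_pos (sqrt_pos.2 (by positivity))
  · rw [levelRatio_eq h0]
    exact div_pos (levelSq_pos hε h0.ne') h0

lemma levelRatio_spec (hε : 0 < ε) (hh : 0 ≤ h) (hχ : h = 0 → χ = 1) :
    h * levelRatio ε h χ / 2 + ε * χ / (1 + h / levelRatio ε h χ) = ε := by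
  rcases hh.eq_or_lt' with h0 | h0
  · rw [hχ h0, h0]; ring
  · rw [levelRatio_eq h0]
    have h1 := levelSq_pos (χ := χ) hε h0.ne'
    set X := levelSq ε h χ
    have h4 : 1 + h / (X / h) = (X + h * h) / X := by field_simp
    rw [h4]
    field_simp
    linear_combination (levelSq_eq (h := h) hε)

/-- The level set `μ = ε` is determined by `|u|²`. -/
lemma levelRatio_unique (hε : 0 < ε) (hh : 0 ≤ h) (hχ : h = 0 → χ = 1) {u v : ℂ} (huv : u * v = h)
    (hμ : ‖u‖ ^ 2 / 2 + ε * χ / (1 + ‖v‖ ^ 2) = ε) : ‖u‖ ^ 2 = h * levelRatio ε h χ := by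
  rcases hh.eq_or_lt' with h0 | h0
  · rw [h0, ofReal_zero, mul_eq_zero] at huv
    rw [hχ h0] at hμ
    rw [h0]
    rcases huv with h1 | h1
    · rw [h1]; simp
    · rw [h1] at hμ; simp at hμ; rw [hμ]; simp
  · have hu : u ≠ 0 := by
      rintro rfl
      rw [zero_mul] at huv
      exact h0.ne (by exact_mod_cast huv)
    have h2 : ‖u‖ ^ 2 * ‖v‖ ^ 2 = h ^ 2 := by
      rw [← mul_pow, ← norm_mul, huv, norm_coe, sq_abs]
    rw [levelRatio_eq h0, mul_div_cancel₀ _ h0.ne']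
    have h3 := levelSq_pos (χ := χ) hε h0.ne'
    set X := levelSq ε h χ
    set Y := ‖u‖ ^ 2
    field_simp at hμ
    have h6 : Y ^ 2 + (h ^ 2 - 2 * ε * (1 - χ)) * Y = 2 * ε * h ^ 2 := by
      linear_combination Y * hμ + (2 * ε - Y) * h2
    have h7 : (Y - X) * (X * Y + 2 * ε * h ^ 2) = 0 := by
      linear_combination X * h6 - Y * (levelSq_eq (χ := χ) hε)
    have h8 : 0 < X * Y + 2 * ε * h ^ 2 := by positivity
    linarith [(mul_eq_zero.1 h7).resolve_right h8.ne']

lemma contDiffAt_levelRatio {f g : ℂ → ℝ} {Z : ℂ} (hε : 0 < ε) (hf : SmoothAt f Z)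
    (hg : SmoothAt g Z) (h0 : 0 ≤ f Z) (h1 : f Z = 0 → ∀ᶠ Y in 𝓝 Z, g Y = 1) :
    SmoothAt (fun Y => levelRatio ε (f Y) (g Y)) Z := by
  rcases h0.eq_or_lt' with h2 | h2
  · have h3 : SmoothAt (fun Y => (-f Y + √(f Y ^ 2 + 8 * ε)) / 2) Z :=
      (hf.neg.add (((hf.pow 2).add contDiffAt_const).sqrt (by positivity))).div_const _
    refine h3.congr_of_eventuallyEq ((h1 h2).mono fun Y hY => ?_)
    simp only [levelRatio, if_pos hY]
  · have hb : SmoothAt (fun Y => f Y ^ 2 - 2 * ε * (1 - g Y)) Z :=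
      (hf.pow 2).sub (contDiffAt_const.mul (contDiffAt_const.sub hg))
    have h3 : SmoothAt (fun Y => levelSq ε (f Y) (g Y) / f Y) Z :=
      ((hb.neg.add (((hb.pow 2).add (contDiffAt_const.mul (hf.pow 2))).sqrt
        (by positivity))).div_const _).div hf h2.ne'
    refine h3.congr_of_eventuallyEq ?_
    filter_upwards [hf.continuousAt.eventually (lt_mem_nhds h2)] with Y hY
    exact levelRatio_eq hY

end Level

/-- The cutoff function is `1` near the zero set of `h`. -/
lemma Choices.eventually_χ (c : Choices)
    {t : ℝ} {f g : E → ℂ} {x : E} (hf : SmoothAt f x) (hg : SmoothAt g x) (h1 : f x ≠ 0)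
    (h2 : g x ≠ 0) (h0 : c.h t (f x) (g x) = 0) : ∀ᶠ y in 𝓝 x, c.χ t (f y) (g y) = 1 := by
  have h3 := (contDiffAt_h (c := c) (t := t) hf hg h1 h2).continuousAt.norm
  have hδ := c.hδ.1
  have h4 : ‖c.h t (f x) (g x)‖ < c.δ := by rwa [h0, norm_zero]
  filter_upwards [h3.eventually (gt_mem_nhds h4)] with y hy
  have h5 := sum_sq_pos t (f y) (g y)
  refine c.hψ.eq_one _ ((div_le_one (by positivity)).2 ?_)
  calc ‖c.h t (f y) (g y)‖ ^ 2 ≤ c.δ ^ 2 * 1 := by rw [mul_one]; gcongr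
    _ ≤ _ := by gcongr

/-- The choices in the parametrization of the Lagrangian. -/
structure Param where
  c : Choices
  M : Model
  D : RegDomain
  H : ℂ → ℝ
  ε : ℝ
  ε_pos : 0 < ε
  good : ∀ Z, 0 ≤ D.g Z ↔ M.Good Z
  smooth : ∀ Z, M.Good Z → SmoothAt H Z
  pos : ∀ Z, M.Good Z → 0 < H Z
  h_eq : ∀ Z, M.Good Z → c.h M.t (M.W Z).1 (M.W Z).2 = ((D.g Z * H Z : ℝ) : ℂ)

namespace Param

variable (P : Param) {Z : ℂ} {p : ℂ × ℂ}

/-- The cutoff function on the planar domain. -/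
def χ (Z : ℂ) : ℝ := P.c.χ P.M.t (P.M.W Z).1 (P.M.W Z).2

/-- The factor `|u|² / h`. -/
def K (Z : ℂ) : ℝ := levelRatio P.ε (P.D.g Z * P.H Z) (P.χ Z)

/-- The factor `u / U`. -/
def scale (Z : ℂ) : ℝ := √(P.H Z * P.K Z)

/-- The parametrization of the Lagrangian. -/
def J (p : ℂ × ℂ) : Amb :=
  (p.2 * P.scale p.1, conj p.2 * (P.scale p.1 / P.K p.1 : ℝ), P.M.surf p.1)

variable {P}

lemma h_nonneg (hZ : P.M.Good Z) : 0 ≤ P.D.g Z * P.H Z :=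
  mul_nonneg ((P.good Z).2 hZ) (P.pos Z hZ).le

lemma eventually_χ (hZ : P.M.Good Z) (h0 : P.D.g Z * P.H Z = 0) : ∀ᶠ Y in 𝓝 Z, P.χ Y = 1 :=
  P.c.eventually_χ (Model.contDiffAt_W hZ).fst (Model.contDiffAt_W hZ).snd (Model.W_ne_zero hZ).1
    (Model.W_ne_zero hZ).2 (by rw [P.h_eq Z hZ, h0, ofReal_zero])

lemma χ_eq_one (hZ : P.M.Good Z) (h0 : P.D.g Z * P.H Z = 0) : P.χ Z = 1 :=
  (eventually_χ hZ h0).self_of_nhds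

lemma K_pos (hZ : P.M.Good Z) : 0 < P.K Z :=
  levelRatio_pos P.ε_pos (h_nonneg hZ) (χ_eq_one hZ)

lemma contDiffAt_K (hZ : P.M.Good Z) : SmoothAt P.K Z :=
  contDiffAt_levelRatio P.ε_pos (P.D.smooth.contDiffAt.mul (P.smooth Z hZ))
    (contDiffAt_χ (Model.contDiffAt_W hZ).fst (Model.contDiffAt_W hZ).snd (Model.W_ne_zero hZ).1
      (Model.W_ne_zero hZ).2) (h_nonneg hZ) (eventually_χ hZ)

lemma scale_pos (hZ : P.M.Good Z) : 0 < P.scale Z :=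
  sqrt_pos.2 (mul_pos (P.pos Z hZ) (K_pos hZ))

lemma scale_sq (hZ : P.M.Good Z) : P.scale Z ^ 2 = P.H Z * P.K Z :=
  sq_sqrt (mul_pos (P.pos Z hZ) (K_pos hZ)).le

lemma contDiffAt_scale (hZ : P.M.Good Z) : SmoothAt P.scale Z :=
  ((P.smooth Z hZ).mul (contDiffAt_K hZ)).sqrt (mul_pos (P.pos Z hZ) (K_pos hZ)).ne'

lemma contDiffAt_ofReal_comp {f : E → ℝ}
    {x : E} (hf : SmoothAt f x) : SmoothAt (fun y => (f y : ℂ)) x :=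
  ofRealCLM.contDiff.contDiffAt.comp x hf

lemma immersesAt_J (hp : P.M.Good p.1) : ImmersesAt P.J p := by
  have hs := (contDiffAt_scale hp).comp p contDiffAt_fst
  have h2 := (conjCLE.contDiff.contDiffAt.comp p contDiffAt_snd).mul (contDiffAt_ofReal_comp
      (hs.div ((contDiffAt_K hp).comp p contDiffAt_fst) (K_pos hp).ne'))
  have hψ := Model.immersesAt_surf hp
  have h3 := hψ.contDiffAt.comp p contDiffAt_fst
  refine ⟨(contDiffAt_snd.mul (contDiffAt_ofReal_comp hs)).prodMk (h2.prodMk h3), ?_⟩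
  have d1 := (contDiffAt_ofReal_comp hs).differentiableAt (by simp) |>.hasFDerivAt
  have e1 := (hasFDerivAt_snd (p := p)).mul d1
  have e3 := HasFDerivAt.comp p hψ.hasFDerivAt hasFDerivAt_fst
  have e : HasFDerivAt P.J _ p :=
    e1.prodMk ((h2.differentiableAt (by simp)).hasFDerivAt.prodMk e3)
  rw [e.fderiv, injective_iff_map_eq_zero]
  intro v hv
  have v1 : v.1 = 0 := by
    exact (injective_iff_map_eq_zero _).1 hψ.injective v.1 (congrArg (fun x => x.2.2) hv)
  have hd : fderiv ℝ (fun p => (P.scale p.1 : ℂ)) p v = 0 := by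
    have hs1 : HasFDerivAt (fun p => (P.scale p.1 : ℂ)) _ p :=
      HasFDerivAt.comp p
        ((contDiffAt_ofReal_comp (contDiffAt_scale hp)).differentiableAt (by simp)).hasFDerivAt
        hasFDerivAt_fst
    rw [hs1.fderiv]; simp [v1]
  have h4 := congrArg Prod.fst hv
  simp only [ContinuousLinearMap.prod_apply, add_apply, smul_apply, Prod.fst_zero,
    Function.comp_def] at h4
  erw [hd] at h4
  simp only [smul_eq_mul, mul_zero, zero_add, ContinuousLinearMap.coe_snd', mul_eq_zero,
    Complex.ofReal_eq_zero] at h4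
  exact Prod.ext v1 (h4.resolve_left (scale_pos hp).ne')

/-! #### The parametrization is onto, and an embedding -/

lemma good_val m : P.M.Good (P.D.val m).1 := (P.good _).1 (P.D.g_nonneg m)

variable (P) in
/-- The embedding of the Lagrangian, on the circle fibration over the planar domain. -/
def j (m : P.D.Mfd) : Amb := P.J (P.D.val m)

lemma coverMap_J (hp : P.M.Good p.1) : coverMap P.M.H.k (P.J p) =
    (p.2 * P.scale p.1, conj p.2 * (P.scale p.1 / P.K p.1 : ℝ), P.M.W p.1) := by
  rw [Model.W_eq hp.ne_zero]; rfl

lemma norm_sq_uv (m : P.D.Mfd) {Z U : ℂ} (hm : P.D.val m = (Z, U)) :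
    ‖U * P.scale Z‖ ^ 2 = P.D.g Z * P.H Z * P.K Z ∧
    ‖conj U * (P.scale Z / P.K Z : ℝ)‖ ^ 2 = P.D.g Z * P.H Z / P.K Z := by
  have hZ := good_val m
  have hg := P.D.val_prop m
  rw [hm] at hZ hg
  have hs := scale_sq hZ
  constructor
  · rw [norm_mul, mul_pow, hg, norm_coe, sq_abs, hs]; ring
  · rw [norm_mul, mul_pow, norm_conj, hg, norm_coe, sq_abs,
      div_pow, hs]
    field_simp

lemma j_mem_X (m : P.D.Mfd) : P.j m ∈ P.c.X P.M.t P.M.H.k := by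
  have hZ := good_val m
  refine ⟨(Model.surf_ne_zero hZ).1, (Model.surf_ne_zero hZ).2, ?_⟩
  rw [j, coverMap_J hZ]
  have hK := K_pos hZ
  have hg := P.D.val_prop m
  have hs := scale_sq hZ
  generalize P.D.val m = p at hZ hK hg hs ⊢
  simp only [Choices.eqn]
  rw [P.h_eq _ hZ, sub_eq_zero, ← hg]
  have h1 : p.2 * conj p.2 = ((‖p.2‖ ^ 2 : ℝ) : ℂ) := by rw [mul_conj, normSq_eq_norm_sq]
  calc p.2 * (P.scale p.1 : ℂ) * (conj p.2 * ((P.scale p.1 / P.K p.1 : ℝ) : ℂ))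
      = p.2 * conj p.2 * ((P.scale p.1 ^ 2 / P.K p.1 : ℝ) : ℂ) := by push_cast; ring
    _ = _ := by rw [h1, hs, mul_div_cancel_right₀ _ hK.ne']; push_cast; ring

lemma μ_j m : P.c.μ P.M.t P.ε (coverMap P.M.H.k (P.j m)) = P.ε := by
  have hZ := good_val m
  rw [j, coverMap_J hZ]
  have h1 := norm_sq_uv m (Prod.mk.eta).symm
  simp only [Choices.μ]
  rw [h1.1, h1.2]
  exact levelRatio_spec P.ε_pos (h_nonneg hZ) (χ_eq_one hZ)

lemma range_j : range P.j = P.c.Q P.M.t P.ε P.M.S P.M.H.k := by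
  apply Subset.antisymm
  · rintro _ ⟨m, rfl⟩
    exact ⟨j_mem_X m, Model.surf_mem (good_val m), μ_j m⟩
  · rintro ⟨u, v, z₁, z₂⟩ ⟨⟨-, -, h3⟩, h4, h5⟩
    obtain ⟨Z, hZ, he⟩ := Model.exists_surf_eq (M := P.M) (z := (z₁, z₂)) h4
    have hW : P.M.W Z = (z₁ ^ P.M.H.k, z₂) := by rw [Model.W_eq hZ.ne_zero, he]
    have hh := P.h_eq Z hZ
    have hχ : P.χ Z = P.c.χ P.M.t (z₁ ^ P.M.H.k) z₂ := by rw [χ, hW]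
    rw [hW] at hh
    simp only [Choices.eqn, coverMap] at h3
    rw [hh, sub_eq_zero] at h3
    simp only [Choices.μ, coverMap, ← hχ] at h5
    have hu := levelRatio_unique P.ε_pos (h_nonneg hZ) (χ_eq_one hZ) h3 h5
    have hK := K_pos hZ
    have hH := P.pos Z hZ
    have hs0 := (scale_pos hZ).ne'
    have hsC : (P.scale Z : ℂ) ≠ 0 := by exact_mod_cast hs0
    have hU : ‖u / P.scale Z‖ ^ 2 = P.D.g Z := by
      rw [norm_div, div_pow, hu, norm_coe, sq_abs, scale_sq hZ]
      change P.D.g Z * P.H Z * P.K Z / _ = _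
      field_simp
    refine ⟨RegDomain.ofCoord Z (u / P.scale Z) hU, ?_⟩
    rw [j, RegDomain.val_ofCoord, J]
    refine Prod.ext (div_mul_cancel₀ _ hsC) (Prod.ext ?_ he)
    rw [map_div₀, conj_ofReal]
    have h6 : conj u / (P.scale Z : ℂ) * ((P.scale Z / P.K Z : ℝ) : ℂ) = conj u / (P.K Z : ℂ) := by
      push_cast; field_simp
    rw [h6, div_eq_iff (by exact_mod_cast hK.ne')]
    by_cases hu0 : u = 0
    · -- If `u = 0` then `h = 0`, and `v = 0` since `μ = ε`.
      rw [hu0, norm_zero, zero_pow two_ne_zero] at hu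
      have hv : v = 0 := by
        rw [hu0, χ_eq_one hZ ((mul_eq_zero.1 hu.symm).resolve_right hK.ne')] at h5
        simp only [norm_zero] at h5
        field_simp at h5
        have h8 : P.ε * ‖v‖ ^ 2 = 0 := by linarith
        simpa [P.ε_pos.ne'] using h8
      rw [hu0, hv]; simp
    · apply mul_left_cancel₀ hu0
      rw [← mul_assoc, h3, mul_conj, normSq_eq_norm_sq, hu]
      push_cast; rfl

lemma isEmbedding_j : Topology.IsEmbedding P.j := by
  have hcont := continuous_iff_continuousAt.2 fun m =>
    ContinuousAt.comp (g := P.J) (immersesAt_J (good_val m)).contDiffAt.continuousAt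
      P.D.continuous_val.continuousAt
  have hinj : Function.Injective P.j := by
    intro m m' h
    have h2 := Model.surf_injOn (good_val m) (good_val m') (congrArg (fun x => x.2.2) h)
    have h3 := congrArg Prod.fst h
    simp only [j, J, h2] at h3
    exact P.D.val_injective (Prod.ext h2 (mul_right_cancel₀
      (by exact_mod_cast (scale_pos (good_val m')).ne') h3))
  have hcomp : CompactSpace P.D.Mfd := by
    rw [← isCompact_univ_iff, P.D.isInducing_val.isCompact_iff, image_univ]
    have hr : range P.D.val = {p : ℂ × ℂ | ‖p.2‖ ^ 2 = P.D.g p.1} := Subtype.range_coe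
    rw [hr]
    refine Metric.isCompact_of_isClosed_isBounded (isClosed_eq (by fun_prop)
      (P.D.smooth.continuous.comp continuous_fst)) ?_
    obtain ⟨C, hC⟩ := (isCompact_closedBall 0 1).exists_bound_of_continuousOn
      P.D.smooth.continuous.continuousOn
    refine (Metric.isBounded_closedBall (x := 0) (r := 1 + C)).subset fun p hp => ?_
    have hp' := hp
    have h1 := ((P.good p.1).1 (by rw [← hp']; positivity)).norm_bounds.2
    have h2 := (le_abs_self _).trans (hC p.1 (by simpa using h1))
    rw [← hp'] at h2
    rw [mem_closedBall_zero_iff, Prod.norm_def, max_le_iff]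
    constructor <;> nlinarith [sq_nonneg (‖p.2‖ - 1)]
  exact (hcont.isClosedEmbedding hinj).isEmbedding

lemma hasMFDerivAt_j (m : P.D.Mfd) : MDifferentiableAt (𝓡 3) 𝓘(ℝ, ℂ × ℂ) P.D.val m ∧
    ∀ a, mfderiv (𝓡 3) 𝓘(ℝ, Amb) P.j m a =
      fderiv ℝ P.J (P.D.val m) (mfderiv (𝓡 3) 𝓘(ℝ, ℂ × ℂ) P.D.val m a) := by
  have h1 := (P.D.contMDiff_val m).mdifferentiableAt (by simp)
  refine ⟨h1, fun a => ?_⟩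
  have h2 := ((immersesAt_J (good_val m)).contDiffAt.differentiableAt (by simp)).mdifferentiableAt
  have h3 : mfderiv (𝓡 3) 𝓘(ℝ, Amb) P.j m = _ := mfderiv_comp (g := P.J) m h2 h1
  rw [h3, mfderiv_eq_fderiv]; rfl

end Param

/-! ### Exactness -/

namespace SurgeryProfile

variable (S : SurgeryProfile)

/-- The area under the profile. -/
def area (s : ℝ) : ℝ := ∫ x in S.R..s, S.q x * deriv S.p x

lemma contDiff_integrand : Smooth (fun x => S.q x * deriv S.p x) :=
  S.smooth_q.mul ((contDiff_infty_iff_deriv.1 S.smooth_p).2)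

lemma hasDerivAt_area s : HasDerivAt S.area (S.q s * deriv S.p s) s :=
  intervalIntegral.integral_hasDerivAt_right
    (S.contDiff_integrand.continuous.intervalIntegrable _ _)
    S.contDiff_integrand.continuous.stronglyMeasurable.stronglyMeasurableAtFilter
    S.contDiff_integrand.continuous.continuousAt

lemma contDiff_area : Smooth S.area := by
  rw [contDiff_infty_iff_deriv]
  refine ⟨fun s => (S.hasDerivAt_area s).differentiableAt, ?_⟩
  rw [show deriv S.area = fun x => S.q x * deriv S.p x from
    funext fun s => (S.hasDerivAt_area s).deriv]
  exact S.contDiff_integrand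

lemma area_right {s : ℝ} (hs : S.R ≤ s) : S.area s = 0 := by
  rw [area, intervalIntegral.integral_congr, intervalIntegral.integral_zero]
  intro x hx
  rw [uIcc_of_le hs] at hx
  simp [(S.right x hx.1).2]

lemma area_left {s : ℝ} (hs : s ≤ -S.R) : S.area s = S.area (-S.R) := by
  have hi := fun a b => S.contDiff_integrand.continuous.intervalIntegrable
      (μ := MeasureTheory.volume) a b
  rw [area, area, ← intervalIntegral.integral_add_adjacent_intervals (hi S.R (-S.R)) (hi _ _),
    add_eq_left, intervalIntegral.integral_congr,
    intervalIntegral.integral_zero]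
  intro x hx
  rw [uIcc_of_ge hs] at hx
  -- Here `p` attains its minimum.
  have hmin : IsLocalMin S.p x := Filter.Eventually.of_forall fun y => by
    rw [(S.left x hx.2).1]; exact (S.nonneg y).1
  simp [hmin.deriv_eq_zero]

end SurgeryProfile

/-- The differential of the argument of an exponential. -/
lemma im_inv_mul_fderiv {f g : E → ℂ}
    {g' : E →L[ℝ] ℂ} {x : E} (hg : HasFDerivAt g g' x) (h : f =ᶠ[𝓝 x] fun y => -exp (g y))
    η : ((f x)⁻¹ * fderiv ℝ f x η).im = (g' η).im := by
  have h2 : HasFDerivAt (fun y => -exp (g y)) _ x := hg.cexp.neg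
  rw [h.fderiv_eq, h.self_of_nhds, h2.fderiv]
  simp only [neg_apply, smul_apply, smul_eq_mul]
  congr 1
  field_simp

namespace Model

variable {M : Model} {a Z : ℂ}

variable (M) in
/-- The primitive of the tautological form of the surgered surface, in the planar coordinate. -/
def tubePrim (a : ℂ) : ℝ := (M.tube a).1.im * (M.tube a).2.im - M.S.σ * M.S.area (M.param a)

open Classical in
variable (M) in
/-- The primitive, extended by a constant over the inner part of the second annulus. -/
def prim (a : ℂ) : ℝ := if M.k₀ < 9 / 20 * ‖a‖ then M.tubePrim a else -(M.S.σ * M.S.area (-M.S.R))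

lemma tubePrim_of_ge (h : M.k₀ < 1 / 2 * ‖a‖) (hb : 1 / 4 ≤ ‖handleCoord (M.invert a)‖) :
    M.tubePrim a = -(M.S.σ * M.S.area (-M.S.R)) := by
  have h1 : (M.tube a).1 = 0 := (tubeOut_eq_innerOut h hb).2
  rw [tubePrim, h1, zero_im, zero_mul, zero_sub, M.S.area_left]
  rw [param, handleParam_of_ge M.k₀_lt hb]; linarith [M.S.hR.2]

lemma prim_of_tube (h : M.k₀ < 1 / 2 * ‖a‖) : M.prim a = M.tubePrim a := by
  rw [prim]
  split_ifs with h1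
  · rfl
  · refine (tubePrim_of_ge h ?_).symm
    have hw1 : 9 / 20 ≤ ‖M.invert a‖ := by
      rw [norm_invert, le_div_iff₀ (norm_pos_iff.2 (ne_zero_of_lt h))]; linarith
    linarith [(norm_handleCoord (norm_invert_lt (by norm_num) h)).1]

lemma prim_of_inner (h : 2 / 5 * ‖a‖ < M.k₀) : M.prim a = -(M.S.σ * M.S.area (-M.S.R)) := by
  rw [prim]
  split_ifs with h1
  · have h2 := half_of_lt h1
    have hw1 : 2 / 5 ≤ ‖M.invert a‖ := by
      rw [norm_invert, le_div_iff₀ (norm_pos_iff.2 (ne_zero_of_lt h2))]; linarith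
    exact tubePrim_of_ge h2
      (by linarith [(norm_handleCoord (norm_invert_lt (by norm_num) h2)).1])
  · rfl

lemma prim_of_far (h : 1 / 2 ≤ ‖a‖) : M.prim a = 0 := by
  have hk := M.k₀_le'
  have h1 : M.k₀ < 1 / 2 * ‖a‖ := by linarith
  have hn := (norm_tube h1)
  rw [tube_far h, norm_zero] at hn
  -- The surgery parameter is `‖a‖ > R`.
  have hs : M.S.R ≤ M.param a := by
    by_contra! h2
    have h3 := M.S.hR
    rcases lt_or_ge |M.param a| M.S.R with h4 | h4
    · have h5 := (M.S.mem_disc _ h4).2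
      rw [← hn.2] at h5
      nlinarith
    · rcases le_abs.1 h4 with h4 | h4
      · linarith
      · have h5 := (M.S.left _ (by linarith : M.param a ≤ -M.S.R)).2
        linarith
  rw [prim_of_tube h1, tubePrim, tube_far h, M.S.area_right hs]; simp

lemma contDiffAt_param (h : M.k₀ < 1 / 2 * ‖a‖) : SmoothAt M.param a := by
  have h1 := norm_invert_lt (by norm_num) h
  have h2 := ContDiffAt.comp a (contDiffAt_handleCoord (by linarith))
      (contDiffAt_invert (ne_zero_of_lt h))
  exact ContDiffAt.comp a (contDiffAt_handleParam (norm_handleCoord_pos h))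
    (h2.norm ℝ (norm_pos_iff.1 (norm_handleCoord_pos h)))

lemma contDiffAt_tubePrim (h : M.k₀ < 1 / 2 * ‖a‖) : SmoothAt M.tubePrim a := by
  have h1 := (immersesAt_tube h).contDiffAt
  exact ((imCLM.contDiff.contDiffAt.comp a h1.fst).mul
    (imCLM.contDiff.contDiffAt.comp a h1.snd)).sub
    (contDiffAt_const.mul (M.S.contDiff_area.contDiffAt.comp a (contDiffAt_param h)))

/-- The differential of the primitive on the handle. -/
lemma fderiv_tubePrim (h : M.k₀ < 1 / 2 * ‖a‖) (η : ℂ) : fderiv ℝ M.tubePrim a η =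
    -(M.tube a).2.re * (fderiv ℝ M.tube a η).1.re + (M.tube a).1.im * (fderiv ℝ M.tube a η).2.im := by
  set ξ : ℂ → ℂ := fun a => handleCoord (M.invert a) / (‖handleCoord (M.invert a)‖ : ℂ) with hξ
  have hb : SmoothAt (fun a => handleCoord (M.invert a)) a :=
    ContDiffAt.comp (g := handleCoord) a
      (contDiffAt_handleCoord (by linarith [norm_invert_lt (by norm_num) h]))
      (contDiffAt_invert (ne_zero_of_lt h))
  have hb0 := norm_pos_iff.1 (norm_handleCoord_pos h)
  have hξs := ContDiffAt.comp a (contDiffAt_div_norm hb0) hb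
  have hξd := (hξs.differentiableAt (by simp)).hasFDerivAt
  have hs := ((contDiffAt_param h).differentiableAt (by simp)).hasFDerivAt
  set s' := fderiv ℝ M.param a
  have hp := HasDerivAt.comp_hasFDerivAt a
      (M.S.smooth_p.differentiable (by simp) _).hasDerivAt hs
  have hq : HasFDerivAt (fun a => M.S.σ * M.S.q (M.param a))
      (M.S.σ • (deriv M.S.q (M.param a) • s')) a :=
    (HasDerivAt.comp_hasFDerivAt a
      (M.S.smooth_q.differentiable (by simp) _).hasDerivAt hs).const_mul _
  have hA : HasFDerivAt (fun a => ((M.S.p (M.param a) : ℝ) : ℂ) * ξ a) _ a :=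
    (ofRealCLM.hasFDerivAt.comp a hp).mul hξd
  have hB : HasFDerivAt (fun a => ((M.S.σ * M.S.q (M.param a) : ℝ) : ℂ) * ξ a) _ a :=
    (ofRealCLM.hasFDerivAt.comp a hq).mul hξd
  have hT : HasFDerivAt M.tube _ a := hA.prodMk hB
  have hF : HasFDerivAt M.tubePrim _ a :=
    ((imCLM.hasFDerivAt.comp a hA).mul (imCLM.hasFDerivAt.comp a hB)).sub
      ((HasDerivAt.comp_hasFDerivAt a (M.S.hasDerivAt_area _) hs).const_mul M.S.σ)
  -- The unit vector `ξ` is orthogonal to its derivative.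
  have hone : ∀ᶠ b in 𝓝 a, (ξ b).re * (ξ b).re + (ξ b).im * (ξ b).im = 1 := by
    filter_upwards [hb.continuousAt.eventually_ne hb0] with b hb'
    have h1 : ‖ξ b‖ = 1 := by
      rw [hξ]
      rw [norm_div, norm_real, norm_norm, div_self (norm_ne_zero_iff.2 hb')]
    rw [← normSq_apply, normSq_eq_norm_sq, h1, one_pow]
  have hre := reCLM.hasFDerivAt.comp a hξd
  have him := imCLM.hasFDerivAt.comp a hξd
  have horth := DFunLike.congr_fun (((hre.mul hre).add (him.mul him)).unique
    ((hasFDerivAt_const 1 a).congr_of_eventuallyEq hone)) η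
  have h1 := hone.self_of_nhds
  rw [hF.fderiv, hT.fderiv]
  have ht : M.tube a = (((M.S.p (M.param a) : ℝ) : ℂ) * ξ a,
    ((M.S.σ * M.S.q (M.param a) : ℝ) : ℂ) * ξ a) := rfl
  rw [ht]
  simp only [sub_apply, add_apply, smul_apply, ContinuousLinearMap.comp_apply, smul_eq_mul,
    ContinuousLinearMap.prod_apply, Complex.imCLM_apply, Complex.reCLM_apply,
    Complex.ofRealCLM_apply, add_re,
    add_im, mul_re, mul_im, ofReal_re, ofReal_im,
    zero_apply, Function.comp_def] at horth ⊢
  generalize (ξ a).re = x at *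
  generalize (ξ a).im = y at *
  linear_combination (-M.S.σ * M.S.q (M.param a) * deriv M.S.p (M.param a) * s' η) * (-h1) +
    (M.S.σ * M.S.q (M.param a) * M.S.p (M.param a) / 2) * horth

variable (M) in
/-- The tautological form `r₁ dθ₁ + r₂ dθ₂` on the planar domain. -/
def form (Z η : ℂ) : ℝ :=
  logT M.t (M.W Z).1 * ((M.W Z).1⁻¹ * (fderiv ℝ M.W Z η).1).im +
    logT M.t (M.W Z).2 * ((M.W Z).2⁻¹ * (fderiv ℝ M.W Z η).2).im

lemma fderiv_W (h : M.Good Z) (η : ℂ) : (fderiv ℝ M.W Z η).1 = fderiv ℝ (fun Y => (M.W Y).1) Z η ∧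
    (fderiv ℝ M.W Z η).2 = fderiv ℝ (fun Y => (M.W Y).2) Z η := by
  have h1 := ((contDiffAt_W h).differentiableAt (by simp)).hasFDerivAt
  rw [h1.fst.fderiv, h1.snd.fderiv]
  exact ⟨rfl, rfl⟩

lemma primitive_spec (h : M.Good Z) : SmoothAt (fun Y => M.prim (crd(M.H) Y)) Z ∧
    ∀ η, fderiv ℝ (fun Y => M.prim (crd(M.H) Y)) Z η = M.form Z η := by
  have hZ := h.ne_zero
  have hW := fderiv_W h
  rcases lt_or_ge (1 / 2) ‖crd(M.H) Z‖ with h1 | h1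
  · have hev := eventually_half_le hZ h1
    have hc : (fun Y => M.prim (crd(M.H) Y)) =ᶠ[𝓝 Z] fun _ => 0 :=
      hev.mono fun Y hY => prim_of_far hY
    refine ⟨contDiffAt_const.congr_of_eventuallyEq hc, fun η => ?_⟩
    have h2 : (fun Y => (M.W Y).2) =ᶠ[𝓝 Z]
        fun Y => -exp ((M.L * (crd(M.H) Y).im : ℝ) : ℂ) := by
      filter_upwards [hev, isOpen_ne.mem_nhds hZ] with Y hY hY0
      rw [W_eq hY0, surf_of_far hY, ofReal_exp]; rfl
    have h3 := ofRealCLM.hasFDerivAt.comp Z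
      ((((contDiff_ringCoord_im M.H.k).differentiable (by simp)) Z).hasFDerivAt.const_mul M.L)
    rw [hc.fderiv_eq, form, (logT_W_far hZ h1.le).1, (hW η).2, im_inv_mul_fderiv h3 h2]; simp
  have hr := contDiffAt_ringCoord (mem_slitPlane_of_norm_le hZ h1)
  have hrd := (hr.differentiableAt (by simp)).hasFDerivAt
  by_cases h2 : M.k₀ < 1 / 2 * ‖crd(M.H) Z‖
  · have hcont : ContinuousAt (fun Y => 1 / 2 * ‖crd(M.H) Y‖) Z :=
      continuousAt_const.mul hr.continuousAt.norm
    have hev := hcont.eventually (lt_mem_nhds h2)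
    have hc : (fun Y => M.prim (crd(M.H) Y)) =ᶠ[𝓝 Z] fun Y => M.tubePrim (crd(M.H) Y) :=
      hev.mono fun Y hY => prim_of_tube hY
    have ht := contDiffAt_tubePrim h2
    refine ⟨(ContDiffAt.comp (g := M.tubePrim) Z ht hr).congr_of_eventuallyEq hc, fun η => ?_⟩
    have h3 : HasFDerivAt (fun Y => M.tubePrim (crd(M.H) Y)) _ Z :=
      HasFDerivAt.comp Z (ht.differentiableAt (by simp)).hasFDerivAt hrd
    have hTT := HasFDerivAt.comp Z
        ((immersesAt_tube h2).contDiffAt.differentiableAt (by simp)).hasFDerivAt hrd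
    have hpt : ∀ᶠ Y in 𝓝 Z, M.W Y = M.point (M.tube (crd(M.H) Y)) :=
      hev.mono fun Y hY => pt_of_tube' hY
    have mk : ∀ {f g : ℂ → ℝ} {f' g' : ℂ →L[ℝ] ℝ}, HasFDerivAt f f' Z → HasFDerivAt g g' Z →
        HasFDerivAt (fun Y => (⟨f Y, g Y⟩ : ℂ))
          ((equivRealProdCLM.symm : ℝ × ℝ →L[ℝ] ℂ).comp (f'.prod g')) Z :=
      fun hf hg => equivRealProdCLM.symm.hasFDerivAt.comp Z (hf.prodMk hg)
    have c1 := mk ((reCLM.hasFDerivAt.comp Z hTT.snd).const_mul M.L).neg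
      (reCLM.hasFDerivAt.comp Z hTT.fst)
    have c2 := mk ((imCLM.hasFDerivAt.comp Z hTT.fst).const_mul M.L)
      (imCLM.hasFDerivAt.comp Z hTT.snd)
    have e1 := im_inv_mul_fderiv c1
      (hpt.mono fun Y hY => (congrArg Prod.fst hY).trans rfl) η
    have e2 := im_inv_mul_fderiv c2
      (hpt.mono fun Y hY => (congrArg Prod.snd hY).trans rfl) η
    rw [hc.fderiv_eq, h3.fderiv, ContinuousLinearMap.comp_apply, fderiv_tubePrim h2, form,
      (hW η).1, (hW η).2, e1, e2, hpt.self_of_nhds, (logT_point _).1, (logT_point _).2]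
    rfl
  · have h3 : 2 / 5 * ‖crd(M.H) Z‖ < M.k₀ := by
      linarith [M.k₀_pos]
    have hcont : ContinuousAt (fun Y => 2 / 5 * ‖crd(M.H) Y‖) Z :=
      continuousAt_const.mul hr.continuousAt.norm
    have hev := hcont.eventually (gt_mem_nhds h3)
    have hc : (fun Y => M.prim (crd(M.H) Y)) =ᶠ[𝓝 Z]
        fun _ => -(M.S.σ * M.S.area (-M.S.R)) := hev.mono fun Y hY => prim_of_inner hY
    refine ⟨contDiffAt_const.congr_of_eventuallyEq hc, fun η => ?_⟩
    have hV0 := innerV_ne_zero h.2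
    have hV : SmoothAt (fun Y => -(M.L * log ‖M.innerV (crd(M.H) Y)‖)) Z :=
      (contDiffAt_const.mul (ContDiffAt.comp Z
        (contDiffAt_log_norm hV0) (ContDiffAt.comp Z
          (contDiffAt_innerV (innerV_bounds h.2).1) hr))).neg
    have h4 := ofRealCLM.hasFDerivAt.comp Z (hV.differentiableAt (by simp)).hasFDerivAt
    have e1 := im_inv_mul_fderiv (f := fun Y => (M.W Y).1) h4 (hev.mono fun Y hY => by
      change (M.pt (crd(M.H) Y)).1 = _
      rw [pt, out_of_inner hY]; rfl) η
    rw [hc.fderiv_eq, form, (logT_W_inner h3).2.1, (hW η).1, e1]; simp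

end Model

/-! #### The pull back of the primitive form -/

lemma Choices.θ_apply (c : Choices) (t ε : ℝ) (u v w₁ w₂ a b x y : ℂ) :
    c.θ t ε (u, v, w₁, w₂) (a, b, x, y) =
      logT t w₁ * (w₁⁻¹ * x).im + logT t w₂ * (w₂⁻¹ * y).im + 1 / 2 * (conj u * a).im +
        ε * (c.χ t w₁ w₂ / (1 + ‖v‖ ^ 2) * (conj v * b).im - (1 - c.χ t w₁ w₂) * (u⁻¹ * a).im) := rfl

/-- Along circle orbits and radial directions, the fibre part of the form vanishes on `μ = ε`. -/
lemma fibre_form_eq_zero {U η : ℂ} {s s' ds ds' ε χ : ℝ} (hs : s ≠ 0)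
    (hμ : ‖U * s‖ ^ 2 / 2 + ε * χ / (1 + ‖conj U * (s' : ℂ)‖ ^ 2) = ε) :
    1 / 2 * (conj (U * s) * (U * ds + s * η)).im +
      ε * (χ / (1 + ‖conj U * (s' : ℂ)‖ ^ 2) *
        (conj (conj U * (s' : ℂ)) * (conj U * ds' + s' * conj η)).im -
        (1 - χ) * ((U * s)⁻¹ * (U * ds + s * η)).im) = 0 := by
  by_cases h0 : U = 0
  · rw [h0]; simp
  have hn : 0 < ‖U‖ ^ 2 := by positivity
  have hUU : U * conj U = ((‖U‖ ^ 2 : ℝ) : ℂ) := by rw [mul_conj, normSq_eq_norm_sq]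
  have e1 : (conj (U * s) * (U * ds + s * η)).im = s ^ 2 * (conj U * η).im := by
    have : conj (U * s) * (U * ds + s * η) = ((‖U‖ ^ 2 * s * ds : ℝ) : ℂ) +
        ((s ^ 2 : ℝ) : ℂ) * (conj U * η) := by
      rw [map_mul, conj_ofReal]; push_cast at hUU ⊢; linear_combination (s * ds : ℂ) * hUU
    rw [this, add_im, ofReal_im, im_ofReal_mul, zero_add]
  have e2 : (conj (conj U * s') * (conj U * ds' + s' * conj η)).im =
      -(s' ^ 2 * (conj U * η).im) := by
    have : conj (conj U * s') * (conj U * ds' + s' * conj η) =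
        ((‖U‖ ^ 2 * s' * ds' : ℝ) : ℂ) + ((s' ^ 2 : ℝ) : ℂ) * conj (conj U * η) := by
      rw [map_mul, conj_ofReal, map_mul, conj_conj]
      push_cast at hUU ⊢; linear_combination (s' * ds' : ℂ) * hUU
    rw [this, add_im, ofReal_im, im_ofReal_mul, conj_im]; ring
  have e3 : ((U * s)⁻¹ * (U * ds + s * η)).im = (conj U * η).im / ‖U‖ ^ 2 := by
    have hsC : (s : ℂ) ≠ 0 := by exact_mod_cast hs
    have : (U * s)⁻¹ * (U * ds + s * η) = ((ds / s : ℝ) : ℂ) +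
        (conj U * η) / ((‖U‖ ^ 2 : ℝ) : ℂ) := by
      rw [← hUU]
      have := (map_ne_zero (starRingEnd ℂ)).2 h0
      push_cast; field_simp
    rw [this, add_im, ofReal_im, Complex.div_ofReal_im, zero_add]
  have n1 : ‖U * s‖ ^ 2 = ‖U‖ ^ 2 * s ^ 2 := by
    rw [norm_mul, mul_pow, norm_coe, sq_abs]
  have n2 : ‖conj U * s'‖ ^ 2 = ‖U‖ ^ 2 * s' ^ 2 := by
    rw [norm_mul, mul_pow, norm_coe, sq_abs, norm_conj]
  rw [n1, n2] at hμ
  rw [e1, e2, e3, n2]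
  generalize ‖U‖ ^ 2 = n at *
  generalize (conj U * η).im = I
  field_simp at hμ ⊢
  linear_combination I * hμ

namespace Param

variable {P : Param} {p : ℂ × ℂ}

lemma coverθ_j (m : P.D.Mfd) (η : ℂ × ℂ) :
    P.c.coverθ P.M.t P.ε P.M.H.k (P.j m) (fderiv ℝ P.J (P.D.val m) η) =
      P.M.form (P.D.val m).1 η.1 := by
  have hZ := good_val m
  have hJ := (immersesAt_J hZ).hasFDerivAt
  have hcov : DifferentiableAt ℝ (coverMap P.M.H.k) (P.J (P.D.val m)) := by
    change DifferentiableAt ℝ (fun x : Amb => (x.1, x.2.1, x.2.2.1 ^ P.M.H.k, x.2.2.2)) _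
    fun_prop
  have hμ := μ_j m
  rw [j, coverMap_J hZ] at hμ
  rw [Choices.coverθ, j, coverMap_J hZ, ContinuousLinearMap.comp_apply]
  generalize P.D.val m = p at *
  have h1 : fderiv ℝ (coverMap P.M.H.k) (P.J p) (fderiv ℝ P.J p η) =
      fderiv ℝ (fun q => coverMap P.M.H.k (P.J q)) p η := by
    rw [← ContinuousLinearMap.comp_apply]
    congr 1
    exact (HasFDerivAt.comp p hcov.hasFDerivAt hJ).fderiv.symm
  have h2 : (fun q => coverMap P.M.H.k (P.J q)) =ᶠ[𝓝 p] fun q =>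
      (q.2 * P.scale q.1, conj q.2 * (P.scale q.1 / P.K q.1 : ℝ), P.M.W q.1) := by
    filter_upwards [continuousAt_fst.eventually_ne hZ.ne_zero] with q hq
    rw [Model.W_eq hq]; rfl
  have hs1 := ((contDiffAt_scale hZ).differentiableAt (by simp)).hasFDerivAt
  have hs2 := (((contDiffAt_scale hZ).div (contDiffAt_K hZ) (K_pos hZ).ne').differentiableAt
      (by simp)).hasFDerivAt
  have c1 := (hasFDerivAt_snd (p := p)).mul
    (ofRealCLM.hasFDerivAt.comp p (hs1.comp p hasFDerivAt_fst))
  have c2 := (conjCLE.hasFDerivAt.comp p (hasFDerivAt_snd (p := p))).mul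
    (ofRealCLM.hasFDerivAt.comp p (hs2.comp p hasFDerivAt_fst))
  have c3 := HasFDerivAt.comp p
      ((Model.contDiffAt_W hZ).differentiableAt (by simp)).hasFDerivAt hasFDerivAt_fst
  rw [h1, ((c1.prodMk (c2.prodMk c3)).congr_of_eventuallyEq h2).fderiv]
  have key := fibre_form_eq_zero (χ := P.c.χ P.M.t (P.M.W p.1).1 (P.M.W p.1).2) (η := η.2)
    (s := P.scale p.1)
    (s' := P.scale p.1 / P.K p.1) (ds := fderiv ℝ P.scale p.1 η.1)
    (ds' := fderiv ℝ (fun Z => P.scale Z / P.K Z) p.1 η.1) (scale_pos hZ).ne' hμ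
  have hθ := P.c.θ_apply P.M.t P.ε (p.2 * P.scale p.1) (conj p.2 * (P.scale p.1 / P.K p.1 : ℝ))
    (P.M.W p.1).1 (P.M.W p.1).2 (p.2 * fderiv ℝ P.scale p.1 η.1 + P.scale p.1 * η.2)
    (conj p.2 * fderiv ℝ (fun Z => P.scale Z / P.K Z) p.1 η.1 +
      (P.scale p.1 / P.K p.1 : ℝ) * conj η.2) (fderiv ℝ P.M.W p.1 η.1).1 (fderiv ℝ P.M.W p.1 η.1).2
  refine Eq.trans ?_ (hθ.trans ?_)
  · congr 1
  · rw [Model.form]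
    linear_combination key

lemma exact_j : ∃ f : P.D.Mfd → ℝ, ContMDiff (𝓡 3) 𝓘(ℝ, ℝ) ∞ f ∧
    ∀ m (a : TangentSpace (𝓡 3) m), mfderiv (𝓡 3) 𝓘(ℝ, ℝ) f m a =
      P.c.coverθ P.M.t P.ε P.M.H.k (P.j m) (mfderiv (𝓡 3) 𝓘(ℝ, Amb) P.j m a) := by
  set F : ℂ → ℝ := fun Y => P.M.prim (crd(P.M.H) Y) with hF
  have hsm : ∀ m : P.D.Mfd, SmoothAt (fun q => F q.1) (P.D.val m) := fun m =>
    (Model.primitive_spec (good_val m)).1.comp _ contDiffAt_fst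
  refine ⟨fun m => F (P.D.val m).1, fun m => P.D.contMDiffAt_comp_val (hsm m), fun m a => ?_⟩
  obtain ⟨h1, h2⟩ := hasMFDerivAt_j m
  have h3 : mfderiv (𝓡 3) 𝓘(ℝ, ℝ) (fun m => F (P.D.val m).1) m = _ :=
    mfderiv_comp m
      ((hsm m).differentiableAt (by simp)).mdifferentiableAt h1
  have h4 : HasFDerivAt (fun q : ℂ × ℂ => F q.1) _ (P.D.val m) := HasFDerivAt.comp _
    ((Model.primitive_spec (good_val m)).1.differentiableAt (by simp)).hasFDerivAt hasFDerivAt_fst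
  rw [h2]
  refine Eq.trans ?_ (coverθ_j m (mfderiv (𝓡 3) 𝓘(ℝ, ℂ × ℂ) P.D.val m a)).symm
  rw [← (Model.primitive_spec (good_val m)).2, h3, mfderiv_eq_fderiv, h4.fderiv]; rfl

end Param

/-! ### Pull backs of exterior derivatives -/

lemma omega_apply {θ : Amb → Amb →L[ℝ] ℝ} {x : Amb} (h : DifferentiableAt ℝ θ x) (ξ ζ : Amb) :
    omega θ x ![ξ, ζ] = fderiv ℝ θ x ξ ζ - fderiv ℝ θ x ζ ξ := by
  have h1 : DifferentiableAt ℝ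
      (fun y => ContinuousAlternatingMap.ofSubsingleton ℝ Amb ℝ (0 : Fin 1) (θ y)) x :=
    (ContinuousAlternatingMap.ofSubsingletonLIE (𝕜 := ℝ) (E := Amb) (F := ℝ)
      (0 : Fin 1)).toContinuousLinearEquiv.differentiableAt.comp x h
  have h2 : ∀ v, fderiv ℝ (fun y => θ y v) x = (fderiv ℝ θ x).flip v := fun v => by
    rw [fderiv_clm_apply h (differentiableAt_const v)]; simp
  rw [omega, extDeriv_apply h1, Fin.sum_univ_two]
  change (-1 : ℤ) ^ 0 • fderiv ℝ (fun y => θ y ζ) x ξ + (-1 : ℤ) ^ 1 • fderiv ℝ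
    (fun y => θ y ξ) x ζ = _
  rw [h2, h2]; simp [sub_eq_add_neg]

lemma two_le_infty : minSmoothness ℝ 2 ≤ (∞ : WithTop ℕ∞) := by
  rw [minSmoothness_of_isRCLikeNormedField]
  exact WithTop.coe_le_coe.2 le_top

/-- The exterior derivative of a 1-form commutes with pull backs. -/
lemma fderiv_pullback
    {θ : Amb → Amb →L[ℝ] ℝ} {g : E → Amb} {y : E} (hg : SmoothAt g y)
    (h : DifferentiableAt ℝ θ (g y)) :
    DifferentiableAt ℝ (fun z => (θ (g z)).comp (fderiv ℝ g z)) y ∧ ∀ a b,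
    fderiv ℝ (fun z => (θ (g z)).comp (fderiv ℝ g z)) y a b -
      fderiv ℝ (fun z => (θ (g z)).comp (fderiv ℝ g z)) y b a =
      omega θ (g y) ![fderiv ℝ g y a, fderiv ℝ g y b] := by
  have h1 := (hg.differentiableAt (by simp)).hasFDerivAt
  have h2 := ((hg.fderiv_right (m := ∞) (by simp)).differentiableAt (by simp)).hasFDerivAt
  have h3 : HasFDerivAt (fun z => θ (g z)) _ y := h.hasFDerivAt.comp y h1
  have h4 := h3.clm_comp h2
  refine ⟨h4.differentiableAt, fun a b => ?_⟩
  rw [h4.fderiv, omega_apply h]; simp [(hg.isSymmSndFDerivAt two_le_infty) a b]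

/-- An immersed submanifold on which a primitive of `ω` is exact is isotropic. -/
lemma isotropic_of_exact {M : Type} [TopologicalSpace M] [ChartedSpace (𝔼[3]) M]
    [IsManifold (𝓡 3) ∞ M] {j : M → Amb} {f : M → ℝ} {θ : Amb → Amb →L[ℝ] ℝ}
    (hj : ContMDiff (𝓡 3) 𝓘(ℝ, Amb) ∞ j) (hf : ContMDiff (𝓡 3) 𝓘(ℝ, ℝ) ∞ f)
    (h : ∀ m (a : TangentSpace (𝓡 3) m),
      mfderiv (𝓡 3) 𝓘(ℝ, ℝ) f m a = θ (j m) (mfderiv (𝓡 3) 𝓘(ℝ, Amb) j m a))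
    (m : M) (hθ : DifferentiableAt ℝ θ (j m)) (a b : TangentSpace (𝓡 3) m) :
    omega θ (j m) ![mfderiv (𝓡 3) 𝓘(ℝ, Amb) j m a, mfderiv (𝓡 3) 𝓘(ℝ, Amb) j m b] = 0 := by
  set φ := extChartAt (𝓡 3) m
  have ht : ∀ᶠ y in 𝓝 (φ m), y ∈ φ.target := extChartAt_target_mem_nhds m
  have hφ : ∀ y ∈ φ.target, ContMDiffAt 𝓘(ℝ, 𝔼[3]) (𝓡 3) ∞ φ.symm y :=
    fun y hy => (contMDiffOn_extChartAt_symm m).contMDiffAt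
      ((isOpen_extChartAt_target m).mem_nhds hy)
  have hgm : j (φ.symm (φ m)) = j m := by rw [extChartAt_to_inv]
  have hg := ((hj _).comp _ (hφ _ ht.self_of_nhds)).contDiffAt
  have hF := ((hf _).comp _ (hφ _ ht.self_of_nhds)).contDiffAt
  have hd : fderiv ℝ (f ∘ φ.symm) =ᶠ[𝓝 (φ m)]
      fun y => (θ ((j ∘ φ.symm) y)).comp (fderiv ℝ (j ∘ φ.symm) y) := by
    filter_upwards [ht] with y hy
    have h1 := (hφ y hy).mdifferentiableAt (by simp)
    rw [← mfderiv_eq_fderiv, ← mfderiv_eq_fderiv, mfderiv_comp y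
      ((hf _).mdifferentiableAt (by simp)) h1,
      mfderiv_comp y ((hj _).mdifferentiableAt (by simp)) h1]
    ext v
    exact h _ _
  have hm : ∀ a : TangentSpace (𝓡 3) m,
      mfderiv (𝓡 3) 𝓘(ℝ, Amb) j m a = fderiv ℝ (j ∘ φ.symm) (φ m) a := by
    intro a
    have h1 : mfderiv (𝓡 3) 𝓘(ℝ, Amb) j m = _ :=
      if_pos ((hj m).mdifferentiableAt (by simp))
    rw [h1, writtenInExtChartAt]; simp [φ, Function.comp_def]
    rfl
  have hp := (fderiv_pullback hg (by rw [Function.comp_apply, hgm]; exact hθ)).2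
    (show 𝔼[3] from a) (show 𝔼[3] from b)
  rw [← hd.fderiv_eq, (hF.isSymmSndFDerivAt two_le_infty) _ _, sub_self, Function.comp_apply,
    hgm] at hp
  rw [hm, hm]
  exact hp.symm

/-! ### Estimates for the localized Laurent polynomial -/

lemma IsCutoff.exists_deriv_bound {κ : ℝ → ℝ} (h : IsCutoff κ) :
    ∃ K, 0 ≤ K ∧ (∀ s, |deriv κ s| ≤ K) ∧ ∀ s, deriv κ s ≠ 0 → 1 < s ∧ s < 2 := by
  have h0 : ∀ s, deriv κ s ≠ 0 → 1 < s ∧ s < 2 := fun s hs => by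
    constructor
    · by_contra! h1
      have h2 : IsLocalMax κ s := Filter.Eventually.of_forall fun y => by
        rw [h.eq_one s h1]; exact (h.mem_Icc y).2
      exact hs h2.deriv_eq_zero
    · by_contra! h1
      have h2 : IsLocalMin κ s := Filter.Eventually.of_forall fun y => by
        rw [h.eq_zero s h1]; exact (h.mem_Icc y).1
      exact hs h2.deriv_eq_zero
  obtain ⟨K, hK⟩ := (isCompact_Icc (b := 2)).exists_bound_of_continuousOn
    (h.smooth.continuous_deriv (by simp)).continuousOn
  refine ⟨max K 0, le_max_right _ _, fun s => ?_, h0⟩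
  by_cases hs : deriv κ s = 0
  · rw [hs, abs_zero]; exact le_max_right _ _
  · exact (hK s ⟨(h0 s hs).1.le, (h0 s hs).2.le⟩).trans (le_max_left _ _)

/-- The logarithms of the monomials at `(exp r₁, exp r₂)`, where `L = log t`. -/
def nu (L : ℝ) (r : ℂ × ℂ) : Fin 5 → ℂ := ![0, r.1 - L, r.2 - L, -r.1 - L, -r.2 - L]

/-- The linear part of `nu`. -/
def lam (x : ℂ × ℂ) : Fin 5 → ℂ := ![0, x.1, x.2, -x.1, -x.2]

lemma norm_lam_le x (i : Fin 5) : ‖lam x i‖ ≤ ‖x.1‖ + ‖x.2‖ := by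
  fin_cases i <;> (simp [lam]; try positivity)

lemma nu_line (L : ℝ) (r x : ℂ × ℂ) (i : Fin 5) (s : ℝ) :
    nu L (r + s • x) i = nu L r i + s * lam x i := by
  fin_cases i <;> simp [nu, lam] <;> ring

lemma mono_exp {t : ℝ} (ht : 0 < t) (r : ℂ × ℂ) (i : Fin 5) :
    mono t (exp r.1) (exp r.2) i = exp (nu (log t) r i) := by
  have h : (t : ℂ)⁻¹ = exp (-(log t : ℂ)) := by rw [Complex.exp_neg, ← ofReal_exp, Real.exp_log ht]
  fin_cases i <;> simp [mono, nu, h, sub_eq_add_neg, exp_add, Complex.exp_neg, mul_comm]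

namespace Choices

variable (c : Choices)

/-- The coefficients `1 - φ_i` in logarithmic coordinates. -/
def wt (L : ℝ) (r : ℂ × ℂ) (i : Fin 5) : ℝ := c.weight (fun j => (nu L r j).re / L) i

lemma h_exp {t : ℝ} (ht : 1 < t) (r : ℂ × ℂ) : c.h t (exp r.1) (exp r.2) =
    ∑ i, (c.wt (log t) r i : ℂ) * exp (nu (log t) r i) := by
  simp only [Choices.h, Choices.family, Choices.φ, one_mul, sub_sub_cancel, wt, Choices.weight,
    mono_exp (by linarith : 0 < t), logT, norm_exp, log_exp]

/-- The coefficients `1 - φ_i` vary only where the `i`-th monomial is small. -/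
lemma exists_deriv_wt : ∃ C, 0 ≤ C ∧ ∀ {L : ℝ}, 1 ≤ L → ∀ r x : ℂ × ℂ, ∃ a : Fin 5 → ℝ,
    (∀ i, HasDerivAt (fun s : ℝ => c.wt L (r + s • x) i) (a i) 0) ∧
    ∀ B, (∀ j, ‖exp (nu L r j)‖ ≤ B) → ∀ i, |a i| * ‖exp (nu L r i)‖ ≤
      C * Real.exp (-(L * c.η / 2)) * B * (‖x.1‖ + ‖x.2‖) := by
  obtain ⟨K, hK0, hK, hK1⟩ := c.hκ.exists_deriv_bound
  have hη := c.hη.1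
  refine ⟨20 * K / c.η, by positivity, fun {L} hL r x => ?_⟩
  set e : Fin 5 → ℝ := fun j => (nu L r j).re / L
  set d : Fin 5 → ℝ := fun j => (lam x j).re / L
  set N := ‖x.1‖ + ‖x.2‖
  have hd : ∀ j, |d j| ≤ N := fun j => by
    rw [abs_div, abs_of_pos (by linarith : 0 < L)]
    exact (div_le_self (abs_nonneg _) hL).trans ((abs_re_le_norm _).trans (norm_lam_le x j))
  set Φ : Fin 5 → Fin 5 → ℝ → ℝ := fun i j s =>
    c.κ (2 * ((nu L (r + s • x) j).re / L - (nu L (r + s • x) i).re / L) / c.η) with hΦ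
  have h1 : ∀ i j, HasDerivAt (Φ i j) (deriv c.κ (2 * (e j - e i) / c.η) *
      (2 * (d j - d i) / c.η)) 0 := fun i j => by
    have h2 : HasDerivAt (fun s => 2 * ((e j + s * d j) - (e i + s * d i)) / c.η)
        (2 * (d j - d i) / c.η) 0 := by
      have := ((((hasDerivAt_id 0).mul_const (d j)).const_add (e j)).sub
        (((hasDerivAt_id 0).mul_const (d i)).const_add (e i))).const_mul 2 |>.div_const c.η
      simpa using this
    have h3 : HasDerivAt c.κ (deriv c.κ (2 * (e j - e i) / c.η))
        (2 * ((e j + 0 * d j) - (e i + 0 * d i)) / c.η) := by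
      simpa using (c.hκ.smooth.differentiable (by simp) (2 * (e j - e i) / c.η)).hasDerivAt
    refine (h3.comp 0 h2).congr_of_eventuallyEq (Filter.Eventually.of_forall fun s => ?_)
    simp only [Φ, nu_line, e, d, add_re, re_ofReal_mul]
    congr 2
    ring
  refine ⟨fun i => ∑ j, (∏ k ∈ Finset.univ.erase j, Φ i k 0) •
    (deriv c.κ (2 * (e j - e i) / c.η) * (2 * (d j - d i) / c.η)),
    fun i => ?_, fun B hB i => ?_⟩
  · exact HasDerivAt.fun_finsetProd (u := Finset.univ) fun j _ => h1 i j
  have hB0 := (norm_nonneg _).trans (hB 0)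
  rw [← abs_norm (exp _), ← abs_mul, Finset.sum_mul]
  refine (Finset.abs_sum_le_sum_abs _ _).trans ?_
  refine (Finset.sum_le_card_nsmul _ _ (K * (4 * N / c.η) * (Real.exp (-(L * c.η / 2)) * B))
    fun j _ => ?_).trans (le_of_eq ?_)
  · rw [smul_eq_mul, abs_mul, abs_mul, abs_mul, abs_norm]
    by_cases h0 : deriv c.κ (2 * (e j - e i) / c.η) = 0
    · rw [h0]; simp; positivity
    have hp : |∏ k ∈ Finset.univ.erase j, Φ i k 0| ≤ 1 := by
      rw [Finset.abs_prod]
      exact Finset.prod_le_one (fun _ _ => abs_nonneg _) fun k _ =>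
        (abs_of_nonneg (c.hκ.mem_Icc _).1).trans_le (c.hκ.mem_Icc _).2
    have hq : |2 * (d j - d i) / c.η| ≤ 4 * N / c.η := by
      rw [abs_div, abs_of_pos hη, abs_mul, abs_two]
      refine (div_le_div_iff_of_pos_right hη).2 ?_
      linarith [abs_sub (d j) (d i), hd i, hd j]
    have hm : ‖exp (nu L r i)‖ ≤ Real.exp (-(L * c.η / 2)) * B := by
      have h2 := (hK1 _ h0).1
      rw [lt_div_iff₀ hη, ← sub_div, mul_div_assoc', lt_div_iff₀ (by linarith)] at h2
      refine le_trans ?_ (mul_le_mul_of_nonneg_left (hB j) (Real.exp_nonneg _))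
      rw [norm_exp, norm_exp, ← Real.exp_add]
      exact Real.exp_le_exp.2 (by nlinarith)
    calc _ ≤ 1 * (K * (4 * N / c.η)) * (Real.exp (-(L * c.η / 2)) * B) := by
          gcongr
          exact hK _
      _ = _ := by ring
  · simp; ring

end Choices

/-- One of two opposite monomials is small. -/
lemma small_or_small {L : ℝ} (hL : 100 ≤ L) (z : ℂ) :
    ‖exp (z - L)‖ ≤ 1 / 100 ∨ ‖exp (-z - L)‖ ≤ 1 / 100 := by
  have key : ∀ x : ℝ, x ≤ -100 → Real.exp x ≤ 1 / 100 := fun x hx => by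
    rw [← neg_neg x, Real.exp_neg, one_div]
    exact inv_anti₀ (by norm_num) (by linarith [Real.add_one_le_exp (-x)])
  simp only [norm_exp, sub_re, neg_re, ofReal_re]
  rcases le_total z.re 0 with h | h
  · exact Or.inl (key _ (by linarith))
  · exact Or.inr (key _ (by linarith))

lemma norm_add_le_of_small {y z : ℂ} (h : ‖y‖ ≤ 1 / 100 ∨ ‖z‖ ≤ 1 / 100) :
    ‖y + z‖ ≤ ‖y - z‖ + 1 / 50 ∧ (1 ≤ ‖y‖ → ‖y‖ - 1 / 100 ≤ ‖y - z‖) ∧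
      (1 ≤ ‖z‖ → ‖z‖ - 1 / 100 ≤ ‖y - z‖) := by
  have h1 := norm_sub_norm_le y z
  have h2 := norm_sub_norm_le z y
  have h3 := norm_add_le y z
  rw [norm_sub_rev] at h2
  refine ⟨?_, fun h4 => ?_, fun h4 => ?_⟩ <;> rcases h with h | h <;> linarith

namespace Choices

variable (c : Choices)

/-- The polynomial in logarithmic coordinates. -/
def hl (t : ℝ) (r : ℂ × ℂ) : ℂ := c.h t (exp r.1) (exp r.2)

/-- The cutoff function in logarithmic coordinates. -/
def χl (t : ℝ) (r : ℂ × ℂ) : ℝ := c.χ t (exp r.1) (exp r.2)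

lemma contDiff_hl t : Smooth (c.hl t) := contDiff_iff_contDiffAt.2 fun _ =>
  contDiffAt_h (contDiff_exp.contDiffAt.comp _ contDiffAt_fst)
    (contDiff_exp.contDiffAt.comp _ contDiffAt_snd) (exp_ne_zero _) (exp_ne_zero _)

lemma contDiff_χl t : Smooth (c.χl t) := contDiff_iff_contDiffAt.2 fun _ =>
  contDiffAt_χ (contDiff_exp.contDiffAt.comp _ contDiffAt_fst)
    (contDiff_exp.contDiffAt.comp _ contDiffAt_snd) (exp_ne_zero _) (exp_ne_zero _)

lemma eventually_χl {t : ℝ} {r : ℂ × ℂ} (h : c.hl t r = 0) : ∀ᶠ y in 𝓝 r, c.χl t y = 1 :=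
  c.eventually_χ (contDiff_exp.contDiffAt.comp _ contDiffAt_fst)
    (contDiff_exp.contDiffAt.comp _ contDiffAt_snd) (exp_ne_zero _)
    (exp_ne_zero _) h

lemma hasDerivAt_line {E F : Type*} [NormedAddCommGroup E] [NormedSpace ℝ E]
    [NormedAddCommGroup F] [NormedSpace ℝ F] {f : E → F} {r : E} (hf : DifferentiableAt ℝ f r)
      (x : E) :
    HasDerivAt (fun s : ℝ => f (r + s • x)) (fderiv ℝ f r x) 0 := by
  have h : HasDerivAt (fun s : ℝ => r + s • x) x 0 := by
    simpa using ((hasDerivAt_id (0 : ℝ)).smul_const x).const_add r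
  exact HasFDerivAt.comp_hasDerivAt_of_eq 0 hf.hasFDerivAt h (by simp)

lemma hasDerivAt_exp_nu (L : ℝ) (r x : ℂ × ℂ) (i : Fin 5) :
    HasDerivAt (fun s : ℝ => exp (nu L (r + s • x) i))
      (exp (nu L r i) * lam x i) 0 := by
  have h : HasDerivAt (fun s : ℝ => nu L r i + s * lam x i) (lam x i) 0 := by
    simpa using (((hasDerivAt_id 0).ofReal_comp).mul_const (lam x i)).const_add (nu L r i)
  simpa [nu_line] using h.cexp

/-- If `log t` is large, `dh` is nearly complex linear, and near the zero set of `h` it is not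
small compared with the largest monomial. -/
lemma exists_fderiv_hl : ∃ T, 100 ≤ T ∧ ∀ t, 1 < t → T ≤ log t → ∀ r, ∃ B : ℝ, ∃ A₁ A₂ : ℂ,
    1 ≤ B ∧ (∀ j, ‖mono t (exp r.1) (exp r.2) j‖ ≤ B) ∧
    (∃ j, ‖mono t (exp r.1) (exp r.2) j‖ = B) ∧ ‖c.hl t r‖ ≤ 5 * B ∧
    (∀ x, ‖fderiv ℝ (c.hl t) r x - (A₁ * x.1 + A₂ * x.2)‖ ≤ B / 1000 * (‖x.1‖ + ‖x.2‖)) ∧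
    (∀ x, ‖fderiv ℝ (c.hl t) r x‖ ≤ 3 * B * (‖x.1‖ + ‖x.2‖)) ∧
    (8 * ‖c.hl t r‖ ^ 2 ≤ ∑ i, ‖mono t (exp r.1) (exp r.2) i‖ ^ 2 →
      B / 10 ≤ ‖A₁‖ + ‖A₂‖) := by
  obtain ⟨C, hC0, hC⟩ := c.exists_deriv_wt
  have hη := c.hη.1
  refine ⟨100 + 10000 * C / c.η, by have : 0 ≤ 10000 * C / c.η := by positivity
                                    linarith, fun t ht hL r => ?_⟩
  set L := log t
  have hCL : 10000 * C / c.η ≤ L := by linarith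
  have hL1 : 100 ≤ L := by have : 0 ≤ 10000 * C / c.η := by positivity
                           linarith
  simp only [mono_exp (by linarith : 0 < t)]
  set m : Fin 5 → ℂ := fun i => exp (nu L r i)
  obtain ⟨j, -, hj⟩ := Finset.exists_max_image Finset.univ (fun i => ‖m i‖) Finset.univ_nonempty
  set B := ‖m j‖
  have hB : ∀ i, ‖m i‖ ≤ B := fun i => hj i (Finset.mem_univ i)
  have hm0 : m 0 = 1 := by simp [m, nu]
  have hB1 : 1 ≤ B := by simpa [hm0] using hB 0
  have ht : ∀ r, c.hl t r = ∑ i, (c.wt L r i : ℂ) * exp (nu L r i) := c.h_exp ht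
  set α : Fin 5 → ℝ := c.wt L r
  have hα : ∀ i, α i ∈ Icc (0 : ℝ) 1 := fun i => c.weight_mem _ _
  set y : Fin 5 → ℂ := fun i => α i * m i
  have hy : ∀ i, ‖y i‖ ≤ ‖m i‖ := fun i => by
    rw [norm_mul, norm_coe, abs_of_nonneg (hα i).1]
    exact mul_le_of_le_one_left (norm_nonneg _) (hα i).2
  -- A monomial of maximal size is not cut off.
  have hyj : y j = m j := by
    have : α j = 1 := c.weight_eq_one fun k => by
      have h1 := hB k
      simp only [B, m, norm_exp, Real.exp_le_exp] at h1
      rw [← sub_div]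
      exact (div_nonpos_of_nonpos_of_nonneg (by linarith) (by linarith)).trans (by linarith)
    simp [y, this]
  have hh : c.hl t r = y 0 + y 1 + y 2 + y 3 + y 4 := by rw [ht, Fin.sum_univ_five]
  have hD : ∀ x, ‖fderiv ℝ (c.hl t) r x - ((y 1 - y 3) * x.1 + (y 2 - y 4) * x.2)‖ ≤
      B / 1000 * (‖x.1‖ + ‖x.2‖) := fun x => by
    obtain ⟨a, ha1, ha2⟩ := hC (by linarith : 1 ≤ L) r x
    have h1 : HasDerivAt (fun s : ℝ => c.hl t (r + s • x)) (∑ i, ((a i : ℂ) * m i +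
        α i * (m i * lam x i))) 0 := by
      simp only [ht]
      refine HasDerivAt.fun_sum fun i _ => ?_
      exact ((ha1 i).ofReal_comp.fun_mul (hasDerivAt_exp_nu L r x i)).congr_deriv (by simp [m, α])
    rw [HasDerivAt.unique (hasDerivAt_line ((c.contDiff_hl t).differentiable (by simp) r) x) h1]
    have h2 : ∑ i, ((a i : ℂ) * m i + α i * (m i * lam x i)) -
        ((y 1 - y 3) * x.1 + (y 2 - y 4) * x.2) = ∑ i, (a i : ℂ) * m i := by
      simp only [Fin.sum_univ_five, lam]; simp
      ring
    -- What remains comes from the derivatives of the coefficients, and is at most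
    -- `5 C t ^ (-η / 2) B`.
    rw [h2]
    refine (norm_sum_le_of_le _ fun i _ => ?_).trans
      (Finset.sum_le_card_nsmul _ (fun _ => B / 5000 *
        (‖x.1‖ + ‖x.2‖)) _ fun _ _ => le_rfl) |>.trans
      (le_of_eq (by simp; ring))
    rw [norm_mul, norm_real]
    refine (ha2 B hB i).trans (mul_le_mul_of_nonneg_right ?_ (by positivity))
    have h3 : 5000 * C ≤ Real.exp (L * c.η / 2) := by
      rw [div_le_iff₀ hη] at hCL
      linarith [Real.add_one_le_exp (L * c.η / 2)]
    have h4 : C * Real.exp (-(L * c.η / 2)) ≤ 1 / 5000 := by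
      rw [Real.exp_neg, ← div_eq_mul_inv, div_le_iff₀ (exp_pos _)]; linarith
    nlinarith
  -- Since `m₁ m₃ = m₂ m₄ = t⁻²`, no cancellation is possible in `y 1 - y 3` and `y 2 - y 4`.
  have hs2 := small_or_small hL1 r.2
  have e1 := norm_add_le_of_small ((small_or_small hL1 r.1).imp (hy 1).trans (hy 3).trans)
  have e2 := norm_add_le_of_small (hs2.imp (hy 2).trans (hy 4).trans)
  have hyB := fun i => (hy i).trans (hB i)
  refine ⟨B, y 1 - y 3, y 2 - y 4, hB1, hB, ⟨j, rfl⟩, ?_, hD, fun x => ?_, fun h8 => ?_⟩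
  · rw [hh]
    linarith [norm_add_le (y 0 + y 1 + y 2 + y 3) (y 4), norm_add_le (y 0 + y 1 + y 2) (y 3),
      norm_add_le (y 0 + y 1) (y 2), norm_add_le (y 0) (y 1), hyB 0, hyB 1, hyB 2, hyB 3, hyB 4]
  · have h1 := norm_le_norm_add_norm_sub' (fderiv ℝ (c.hl t) r x)
      ((y 1 - y 3) * x.1 + (y 2 - y 4) * x.2)
    have h2 := norm_add_le ((y 1 - y 3) * x.1) ((y 2 - y 4) * x.2)
    rw [norm_mul, norm_mul] at h2
    have h3 := norm_sub_le (y 1) (y 3)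
    have h4 := norm_sub_le (y 2) (y 4)
    nlinarith [hD x, norm_nonneg x.1, norm_nonneg x.2, hyB 1, hyB 2, hyB 3, hyB 4]
  · have h5 : ‖c.hl t r‖ ≤ 4 / 5 * B := by
      have : ∑ i, ‖m i‖ ^ 2 ≤ 5 * B ^ 2 := by
        refine (Finset.sum_le_card_nsmul _ _ (B ^ 2) fun i _ =>
          pow_le_pow_left₀ (norm_nonneg _) (hB i) 2).trans (by simp)
      exact abs_le_of_sq_le_sq' (by nlinarith) (by linarith) |>.2
    have hjB : ‖y j‖ = B := by rw [hyj]
    have n1 := norm_nonneg (y 1 - y 3)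
    have n2 := norm_nonneg (y 2 - y 4)
    fin_cases j
    · have h6 : y 0 = c.hl t r - (y 1 + y 3) - (y 2 + y 4) := by rw [hh]; ring
      have h7 := norm_sub_le (c.hl t r - (y 1 + y 3)) (y 2 + y 4)
      have h9 := norm_sub_le (c.hl t r) (y 1 + y 3)
      rw [← h6] at h7
      simp only [Fin.zero_eta] at hjB
      linarith [e2.1]
    · change ‖y 1‖ = B at hjB
      linarith [e1.2.1 (hB1.trans_eq hjB.symm)]
    · change ‖y 2‖ = B at hjB
      linarith [e2.2.1 (hB1.trans_eq hjB.symm)]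
    · change ‖y 3‖ = B at hjB
      linarith [e1.2.2 (hB1.trans_eq hjB.symm)]
    · change ‖y 4‖ = B at hjB
      linarith [e2.2.2 (hB1.trans_eq hjB.symm)]

end Choices

/-- A nearly complex linear map to `ℂ` with a large complex linear part is onto, and a small
correction of `i x` makes it commute with `i`. -/
lemma exists_correction {f : ℂ × ℂ →L[ℝ] ℂ} {A₁ A₂ : ℂ} {B : ℝ} (hB : 0 < B)
    (hA : B / 10 ≤ ‖A₁‖ + ‖A₂‖)
    (hD : ∀ x, ‖f x - (A₁ * x.1 + A₂ * x.2)‖ ≤ B / 1000 * (‖x.1‖ + ‖x.2‖)) :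
    Function.Surjective f ∧ ∀ x, ∃ z, ‖z.1‖ + ‖z.2‖ ≤ (‖x.1‖ + ‖x.2‖) / 4 ∧
      f (I • x + z) = I * f x := by
  -- It suffices to correct in the direction of the larger coefficient.
  obtain ⟨ι, A, hA', hι⟩ : ∃ (ι : ℂ →L[ℝ] ℂ × ℂ) (A : ℂ), B / 20 ≤ ‖A‖ ∧
      ∀ z, ‖(ι z).1‖ + ‖(ι z).2‖ = ‖z‖ ∧ A₁ * (ι z).1 + A₂ * (ι z).2 = A * z := by
    rcases le_total ‖A₁‖ ‖A₂‖ with h | h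
    · exact ⟨ContinuousLinearMap.inr ℝ ℂ ℂ, A₂, by linarith, fun z => by simp⟩
    · exact ⟨ContinuousLinearMap.inl ℝ ℂ ℂ, A₁, by linarith, fun z => by simp⟩
  have hlow : ∀ z, B * ‖z‖ * (49 / 1000) ≤ ‖f (ι z)‖ := fun z => by
    have h1 := hD (ι z)
    rw [(hι z).1, (hι z).2, norm_sub_rev] at h1
    have h2 := norm_sub_norm_le (A * z) (f (ι z))
    rw [norm_mul] at h2
    nlinarith [norm_nonneg z]
  have hsurj : Function.Surjective (f.comp ι : ℂ →L[ℝ] ℂ) := by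
    refine (LinearMap.injective_iff_surjective (f := ((f.comp ι : ℂ →L[ℝ] ℂ) : ℂ →ₗ[ℝ] ℂ))).1 ?_
    refine (injective_iff_map_eq_zero _).2 fun z hz => ?_
    have h1 := hlow z
    rw [show f (ι z) = 0 from hz, norm_zero] at h1
    by_contra h0
    have : 0 < B * ‖z‖ := by positivity
    linarith
  refine ⟨fun y => (hsurj y).imp' ι fun _ h => h, fun x => ?_⟩
  obtain ⟨z, hz⟩ := hsurj (I * f x - f (I • x))
  replace hz : f (ι z) = _ := hz
  refine ⟨ι z, ?_, by rw [map_add, hz]; ring⟩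
  have h1 := hlow z
  have h2 := hD x
  have h3 := hD (I • x)
  have h4 : f (ι z) = I * (f x - (A₁ * x.1 + A₂ * x.2)) -
      (f (I • x) - (A₁ * (I • x).1 + A₂ * (I • x).2)) := by
    rw [hz]; simp; ring
  have h5 := norm_sub_le (I * (f x - (A₁ * x.1 + A₂ * x.2)))
    (f (I • x) - (A₁ * (I • x).1 + A₂ * (I • x).2))
  rw [← h4, norm_mul, norm_I] at h5
  rw [(hι z).1]
  simp only [Prod.smul_fst, Prod.smul_snd, smul_eq_mul, norm_mul, norm_I] at h3 h5
  have h6 : B * (‖z‖ * 49) ≤ B * (2 * (‖x.1‖ + ‖x.2‖)) := by linarith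
  have h7 := le_of_mul_le_mul_left h6 hB
  linarith [norm_nonneg x.1, norm_nonneg x.2]

namespace Choices

variable (c : Choices)

/-- The properties of `h` and `χ` in logarithmic coordinates from which the nondegeneracy of
`ω_ε` follows. -/
lemma exists_estimates : ∃ T K : ℝ, 100 ≤ T ∧ 1 ≤ K ∧ ∀ t, 1 < t → T ≤ log t → ∀ r,
    (∀ x, |fderiv ℝ (c.χl t) r x| ≤ K * (‖x.1‖ + ‖x.2‖)) ∧
    (∀ x, fderiv ℝ (c.χl t) r x ≠ 0 → 1 ≤ K * ‖c.hl t r‖ ∧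
      ∀ y, ‖fderiv ℝ (c.hl t) r y‖ ≤ K * ‖c.hl t r‖ * (‖y.1‖ + ‖y.2‖)) ∧
    (c.χl t r ≠ 0 → Function.Surjective (fderiv ℝ (c.hl t) r) ∧ ∀ x, ∃ z,
      ‖z.1‖ + ‖z.2‖ ≤ (‖x.1‖ + ‖x.2‖) / 4 ∧
        fderiv ℝ (c.hl t) r (I • x + z) = I * fderiv ℝ (c.hl t) r x) := by
  obtain ⟨T, hT, hT'⟩ := c.exists_fderiv_hl
  obtain ⟨k, hk0, hk, hk1⟩ := c.hψ.exists_deriv_bound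
  obtain ⟨hδ, hδ'⟩ := c.hδ
  set K := k * (30 / c.δ ^ 2 + 4) + 3 / c.δ + 1 with hK
  have hK1 : k * (30 / c.δ ^ 2 + 4) ≤ K := by rw [hK]; linarith [show 0 ≤ 3 / c.δ by positivity]
  have hK2 : 3 / c.δ ≤ K := by rw [hK]; linarith [show 0 ≤ k * (30 / c.δ ^ 2 + 4) by positivity]
  refine ⟨T, K, hT, by rw [hK]; linarith [show 0 ≤ 3 / c.δ by positivity,
    show 0 ≤ k * (30 / c.δ ^ 2 + 4) by positivity], fun t ht htT r => ?_⟩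
  obtain ⟨B, A₁, A₂, hB, hm, ⟨j, hj⟩, hh, hD, hdh, hA⟩ := hT' t ht htT r
  simp only [mono_exp (by linarith : 0 < t)] at hm hj hA
  set L := log t
  set m : Fin 5 → ℂ := fun i => exp (nu L r i)
  set S : ℝ := c.δ ^ 2 * ∑ i, ‖m i‖ ^ 2
  set q : ℝ := ‖c.hl t r‖ ^ 2 / S with hq
  have hSB : c.δ ^ 2 * B ^ 2 ≤ S := by
    refine mul_le_mul_of_nonneg_left ?_ (by positivity)
    rw [← hj]
    exact Finset.single_le_sum (f := fun i => ‖m i‖ ^ 2) (fun i _ => by positivity)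
      (Finset.mem_univ j)
  have hS : 0 < S := by have : 0 < c.δ ^ 2 * B ^ 2 := by positivity
                        linarith
  have hqS : q * S = ‖c.hl t r‖ ^ 2 := div_mul_cancel₀ _ hS.ne'
  have hχ : ∀ r, c.χl t r = c.ψ (‖c.hl t r‖ ^ 2 / (c.δ ^ 2 * ∑ i, ‖exp (nu L r i)‖ ^ 2)) :=
    fun r => by
      rw [χl, χ]
      simp only [mono_exp (by linarith : 0 < t)]; rfl
  -- The derivative of `q` is bounded where `q < 2`; elsewhere `ψ` is constant.
  have hd : ∀ x, ∃ q', fderiv ℝ (c.χl t) r x = deriv c.ψ q * q' ∧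
      (q < 2 → |q'| ≤ (30 / c.δ ^ 2 + 4) * (‖x.1‖ + ‖x.2‖)) := fun x => by
    set N := ‖x.1‖ + ‖x.2‖ with hN
    have h1 := (hasDerivAt_line ((c.contDiff_hl t).differentiable (by simp) r) x).norm_sq
    have h2 : HasDerivAt (fun s : ℝ => c.δ ^ 2 * ∑ i, ‖exp (nu L (r + s • x) i)‖ ^ 2)
        (c.δ ^ 2 * ∑ i, 2 * (‖m i‖ ^ 2 * (lam x i).re)) 0 := by
      refine (HasDerivAt.fun_sum fun i _ => ?_).const_mul _
      refine ((hasDerivAt_exp_nu L r x i).norm_sq).congr_deriv ?_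
      rw [zero_smul, add_zero, Complex.inner, ← normSq_eq_norm_sq,
        mul_right_comm, mul_conj, re_ofReal_mul]
    have h3 := (h1.div h2 (by rw [zero_smul, add_zero]; exact hS.ne'))
    have h4 : HasDerivAt c.ψ (deriv c.ψ q) (‖c.hl t (r + (0 : ℝ) • x)‖ ^ 2 /
        (c.δ ^ 2 * ∑ i, ‖exp (nu L (r + (0 : ℝ) • x) i)‖ ^ 2)) := by
      rw [zero_smul, add_zero]
      exact (c.hψ.smooth.differentiable (by simp) q).hasDerivAt
    have h5 := HasDerivAt.comp 0 h4 h3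
    refine ⟨_, HasDerivAt.unique
      (hasDerivAt_line ((c.contDiff_χl t).differentiable (by simp) r) x) (h5.congr_of_eventuallyEq
        (Filter.Eventually.of_forall fun s => hχ _)), fun hq2 => ?_⟩
    simp only [zero_smul, add_zero]
    have h6 : |2 * inner ℝ (c.hl t r) (fderiv ℝ (c.hl t) r x)| ≤ 30 / c.δ ^ 2 * N * S := by
      rw [abs_mul]
      have e1 := abs_real_inner_le_norm (c.hl t r) (fderiv ℝ (c.hl t) r x)
      have e2 := mul_le_mul hh (hdh x) (norm_nonneg _) (by linarith : 0 ≤ 5 * B)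
      have e3 : 30 / c.δ ^ 2 * N * (c.δ ^ 2 * B ^ 2) ≤ 30 / c.δ ^ 2 * N * S :=
        mul_le_mul_of_nonneg_left hSB (by positivity)
      have e4 : 30 / c.δ ^ 2 * N * (c.δ ^ 2 * B ^ 2) = 2 * (5 * B * (3 * B * N)) := by
        field_simp; ring
      linarith
    have h7 : |c.δ ^ 2 * ∑ i, 2 * (‖m i‖ ^ 2 * (lam x i).re)| ≤ 2 * N * S := by
      rw [abs_mul, abs_of_nonneg (by positivity : 0 ≤ c.δ ^ 2)]
      refine (mul_le_mul_of_nonneg_left (Finset.abs_sum_le_sum_abs _ _) (by positivity)).trans ?_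
      rw [show 2 * N * S = c.δ ^ 2 * ∑ i, 2 * N * ‖m i‖ ^ 2 by rw [← Finset.mul_sum]; ring]
      refine mul_le_mul_of_nonneg_left (Finset.sum_le_sum fun i _ => ?_) (by positivity)
      rw [abs_mul, abs_mul, abs_two, abs_of_nonneg (by positivity : 0 ≤ ‖m i‖ ^ 2)]
      have := (abs_re_le_norm (lam x i)).trans (norm_lam_le x i)
      nlinarith
    rw [abs_div, abs_of_pos (by positivity : 0 < S ^ 2), div_le_iff₀ (by positivity), ← hqS]
    refine (abs_sub _ _).trans ?_
    rw [abs_mul _ S, abs_mul (q * S), abs_of_pos hS, abs_of_nonneg (by positivity : 0 ≤ q * S)]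
    have h8 := mul_le_mul_of_nonneg_right h6 hS.le
    have h9 := mul_le_mul_of_nonneg_left h7 (by positivity : 0 ≤ q * S)
    have h10 : q * S * (2 * N * S) ≤ 2 * S * (2 * N * S) := by gcongr
    linarith
  refine ⟨fun x => ?_, fun x hx => ?_, fun h0 => ?_⟩
  · obtain ⟨q', h1, h2⟩ := hd x
    rw [h1]
    by_cases h0 : deriv c.ψ q = 0
    · rw [h0, zero_mul, abs_zero]; positivity
    · rw [abs_mul]
      refine (mul_le_mul (hk q) (h2 (hk1 q h0).2) (abs_nonneg _) hk0).trans ?_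
      rw [← mul_assoc]
      exact mul_le_mul_of_nonneg_right hK1 (by positivity)
  · obtain ⟨q', h1, -⟩ := hd x
    have h2 := (hk1 q (left_ne_zero_of_mul (h1 ▸ hx))).1
    have h3 : c.δ * B ≤ ‖c.hl t r‖ := by
      refine le_of_sq_le_sq ?_ (norm_nonneg _)
      rw [← hqS]; nlinarith
    have h4 : 3 * B ≤ K * ‖c.hl t r‖ := by
      calc 3 * B = 3 / c.δ * (c.δ * B) := by field_simp
        _ ≤ _ := by gcongr
    exact ⟨by linarith, fun y => (hdh y).trans (mul_le_mul_of_nonneg_right h4 (by positivity))⟩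
  · refine exists_correction (by linarith) (hA ?_) hD
    have h1 : q < 2 := by
      by_contra! h1
      exact h0 ((hχ r).trans (c.hψ.eq_zero _ h1))
    rw [div_lt_iff₀ hS] at h1
    have h2 : S ≤ 1 / 16 * ∑ i, ‖m i‖ ^ 2 :=
      mul_le_mul_of_nonneg_right (by nlinarith) (by positivity)
    linarith

end Choices

/-! ### The symplectic form in logarithmic coordinates -/

/-- Logarithmic coordinates on the cover. -/
def expMap (k : ℕ) (p : Amb) : Amb :=
  (p.1, p.2.1, exp (p.2.2.1 / k), exp p.2.2.2)

lemma contDiff_expMap k : Smooth (expMap k) :=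
  contDiff_fst.prodMk (contDiff_snd.fst.prodMk
    ((contDiff_exp.comp (contDiff_snd.snd.fst.div_const _)).prodMk
      (contDiff_exp.comp contDiff_snd.snd.snd)))

lemma fderiv_expMap (k : ℕ) (p ξ : Amb) : fderiv ℝ (expMap k) p ξ = (ξ.1, ξ.2.1,
    exp (p.2.2.1 / k) * (ξ.2.2.1 / k), exp p.2.2.2 * ξ.2.2.2) := by
  have h1 : HasFDerivAt (fun p : Amb => p.2.2.1 / k) _ p :=
    (dW₁.hasFDerivAt).mul_const (k : ℂ)⁻¹
  have h2 : HasFDerivAt (expMap k) _ p := (dU.hasFDerivAt).prodMk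
    ((dV.hasFDerivAt).prodMk (h1.cexp.prodMk (dW₂.hasFDerivAt (x := p)).cexp))
  rw [h2.fderiv]; simp [dU, dV, dW₁, dW₂, div_eq_inv_mul]

lemma coverMap_expMap {k : ℕ} (hk : 1 ≤ k) p : coverMap k (expMap k p) = expMap 1 p := by
  have : (k : ℂ) ≠ 0 := by exact_mod_cast (by lia : k ≠ 0)
  simp only [coverMap, expMap, ← exp_nat_mul, mul_div_cancel₀ _ this, Nat.cast_one, div_one]

lemma contDiff_coverMap k : Smooth (coverMap k) :=
  contDiff_fst.prodMk (contDiff_snd.fst.prodMk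
    ((contDiff_snd.snd.fst.pow k).prodMk contDiff_snd.snd.snd))

namespace Choices

variable (c : Choices) {t ε : ℝ} {k : ℕ} {p ξ ζ : Amb}

lemma coverθ_expMap (hk : 1 ≤ k) (p ξ : Amb) :
    c.coverθ t ε k (expMap k p) (fderiv ℝ (expMap k) p ξ) =
      p.2.2.1.re / log t * ξ.2.2.1.im + p.2.2.2.re / log t * ξ.2.2.2.im +
        1 / 2 * (conj p.1 * ξ.1).im + ε *
          (c.χl t p.2.2 / (1 + ‖p.2.1‖ ^ 2) * (conj p.2.1 * ξ.2.1).im -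
          (1 - c.χl t p.2.2) * (p.1⁻¹ * ξ.1).im) := by
  have h1 : fderiv ℝ (coverMap k) (expMap k p) (fderiv ℝ (expMap k) p ξ) =
      fderiv ℝ (expMap 1) p ξ := by
    rw [← ContinuousLinearMap.comp_apply, ← fderiv_comp p
      ((contDiff_coverMap k).differentiable (by simp) _)
      ((contDiff_expMap k).differentiable (by simp) _)]
    congr 2
    exact funext (coverMap_expMap hk)
  rw [coverθ, ContinuousLinearMap.comp_apply, h1, coverMap_expMap hk, fderiv_expMap]
  refine (c.θ_apply t ε _ _ _ _ _ _ _ _).trans ?_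
  simp [logT, norm_exp, χl]

/-- The primitive is smooth where `u ≠ 0`, and near points over the discriminant. -/
lemma contDiffAt_θ {x : Amb} (h1 : x.2.2.1 ≠ 0) (h2 : x.2.2.2 ≠ 0)
    (hu : x.1 = 0 → c.h t x.2.2.1 x.2.2.2 = 0) : SmoothAt (c.θ t ε) x := by
  have hW1 : SmoothAt (fun y => y.2.2.1) x := contDiffAt_snd.snd.fst
  have hW2 : SmoothAt (fun y => y.2.2.2) x := contDiffAt_snd.snd.snd
  have hχ := contDiffAt_χ (c := c) (t := t) hW1 hW2 h1 h2
  have key : ∀ {f : Amb → ℝ} {g : Amb → ℂ} (A : Amb →L[ℝ] ℂ), SmoothAt f x →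
      SmoothAt g x → SmoothAt (fun y => f y • (imMul (g y)).comp A) x :=
    fun A hf hg => hf.smul ((contDiffAt_const.clm_comp
      ((ContinuousLinearMap.mul ℝ ℂ).contDiff.contDiffAt.comp x hg)).clm_comp contDiffAt_const)
  have hconj : ∀ {g : Amb → ℂ}, SmoothAt g x → SmoothAt (fun y => conj (g y)) x :=
    fun hg => conjCLE.contDiff.contDiffAt.comp x hg
  have h5 : SmoothAt (fun y => (1 - c.χ t y.2.2.1 y.2.2.2) • (imMul y.1⁻¹).comp dU) x := by
    by_cases h0 : x.1 = 0
    · refine (contDiffAt_const (c := 0)).congr_of_eventuallyEq ?_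
      filter_upwards [c.eventually_χ hW1 hW2 h1 h2 (hu h0)] with y hy
      rw [hy, sub_self, zero_smul]
    · exact key _ (contDiffAt_const.sub hχ) (contDiffAt_inv' contDiffAt_fst h0)
  have h6 : SmoothAt (fun y => 1 + ‖y.2.1‖ ^ 2) x :=
    contDiffAt_const.add ((contDiff_norm_sq ℝ).contDiffAt.comp x contDiffAt_snd.fst)
  have h7 := hχ.div h6 (by positivity)
  exact (((key _ (contDiffAt_logT hW1 h1) (contDiffAt_inv' hW1 h1)).add
    (key _ (contDiffAt_logT hW2 h2) (contDiffAt_inv' hW2 h2))).add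
    (key _ contDiffAt_const (hconj contDiffAt_fst))).add
      (((key dV h7 (hconj contDiffAt_snd.fst)).sub h5).const_smul ε)

lemma contDiffAt_coverθ {x : Amb} (hx : x ∈ c.X t k) : SmoothAt (c.coverθ t ε k) x := by
  obtain ⟨h1, h2, h3⟩ := hx
  refine ContDiffAt.clm_comp (ContDiffAt.comp x
    (c.contDiffAt_θ (pow_ne_zero k h1) h2 fun h0 => ?_) (contDiff_coverMap k).contDiffAt)
    ((contDiff_coverMap k).contDiffAt.fderiv_right (by simp))
  have h4 : x.1 * x.2.1 - c.h t (x.2.2.1 ^ k) x.2.2.2 = 0 := h3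
  rw [show x.1 = 0 from h0, zero_mul, zero_sub, neg_eq_zero] at h4
  exact h4

/-- The symplectic form in logarithmic coordinates. -/
lemma omega_coverθ (hk : 1 ≤ k) (hp : expMap k p ∈ c.X t k) (ξ ζ : Amb) :
    omega (c.coverθ t ε k) (expMap k p) ![fderiv ℝ (expMap k) p ξ, fderiv ℝ (expMap k) p ζ] =
      (log t)⁻¹ * ((conj ξ.2.2.1 * ζ.2.2.1).im + (conj ξ.2.2.2 * ζ.2.2.2).im) +
      (conj ξ.1 * ζ.1).im + ε * (2 * c.χl t p.2.2 * (1 + ‖p.2.1‖ ^ 2)⁻¹ ^ 2 *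
        (conj ξ.2.1 * ζ.2.1).im +
        fderiv ℝ (c.χl t) p.2.2 ξ.2.2 *
          ((1 + ‖p.2.1‖ ^ 2)⁻¹ * (conj p.2.1 * ζ.2.1).im + (p.1⁻¹ * ζ.1).im) -
        fderiv ℝ (c.χl t) p.2.2 ζ.2.2 *
          ((1 + ‖p.2.1‖ ^ 2)⁻¹ * (conj p.2.1 * ξ.2.1).im + (p.1⁻¹ * ξ.1).im)) := by
  have hpb := fderiv_pullback (contDiff_expMap k).contDiffAt
    ((c.contDiffAt_coverθ (ε := ε) hp).differentiableAt (by simp))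
  rw [← hpb.2]
  set w := (1 + ‖p.2.1‖ ^ 2)⁻¹ with hw
  have key : ∀ ξ ζ : Amb, fderiv ℝ (fun z => (c.coverθ t ε k (expMap k z)).comp
      (fderiv ℝ (expMap k) z)) p ξ ζ =
      ξ.2.2.1.re / log t * ζ.2.2.1.im + ξ.2.2.2.re / log t * ζ.2.2.2.im +
      1 / 2 * (conj ξ.1 * ζ.1).im + ε * ((fderiv ℝ (c.χl t) p.2.2 ξ.2.2 * w -
        c.χl t p.2.2 * (2 * (p.2.1.re * ξ.2.1.re + p.2.1.im * ξ.2.1.im) * w ^ 2)) *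
          (conj p.2.1 * ζ.2.1).im + c.χl t p.2.2 * w * (conj ξ.2.1 * ζ.2.1).im -
        (-fderiv ℝ (c.χl t) p.2.2 ξ.2.2 * (p.1⁻¹ * ζ.1).im +
          (1 - c.χl t p.2.2) * (-(ξ.1 * p.1⁻¹ ^ 2 * ζ.1)).im)) := fun ξ ζ => by
    have hlin : ∀ (ℓ : ℂ → ℝ) (z x : ℂ), (∀ s : ℝ, ℓ (z + s • x) = ℓ z + s * ℓ x) →
        HasDerivAt (fun s : ℝ => ℓ (z + s • x)) (ℓ x) 0 := fun ℓ z x h => by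
      simp only [h]
      simpa using ((hasDerivAt_id 0).mul_const (ℓ x)).const_add (ℓ z)
    have hv : HasDerivAt (fun s : ℝ => p.2.1 + s • ξ.2.1) ξ.2.1 0 := by
      simpa using ((hasDerivAt_id (0 : ℝ)).smul_const ξ.2.1).const_add p.2.1
    have hu : HasDerivAt (fun s : ℝ => p.1 + s • ξ.1) ξ.1 0 := by
      simpa using ((hasDerivAt_id (0 : ℝ)).smul_const ξ.1).const_add p.1
    have hχ := hasDerivAt_line ((c.contDiff_χl t).differentiable (by simp) p.2.2) ξ.2.2
    have h1 := (hlin re p.2.2.1 ξ.2.2.1 (by simp)).div_const (log t) |>.mul_const ζ.2.2.1.im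
    have h2 := (hlin re p.2.2.2 ξ.2.2.2 (by simp)).div_const (log t) |>.mul_const ζ.2.2.2.im
    have hc : ∀ z x y : ℂ, HasDerivAt (fun s : ℝ => (conj (z + s • x) * y).im) (conj x * y).im 0 :=
      fun z x y => hlin (fun z => (conj z * y).im) z x fun s => by simp; ring
    have h3 := (hc p.1 ξ.1 ζ.1).const_mul (1 / 2)
    have h4 : HasDerivAt (fun s : ℝ => (1 + ‖p.2.1 + s • ξ.2.1‖ ^ 2)⁻¹)
        (-(2 * (p.2.1.re * ξ.2.1.re + p.2.1.im * ξ.2.1.im) * w ^ 2)) 0 := by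
      refine ((hv.norm_sq.const_add 1).fun_inv (by positivity)).congr_deriv ?_
      simp [hw]; ring
    have h5 : HasDerivAt (fun s : ℝ => (1 - c.χl t (p.2.2 + s • ξ.2.2)) *
        ((p.1 + s • ξ.1)⁻¹ * ζ.1).im) (-fderiv ℝ (c.χl t) p.2.2 ξ.2.2 * (p.1⁻¹ * ζ.1).im +
          (1 - c.χl t p.2.2) * (-(ξ.1 * p.1⁻¹ ^ 2 * ζ.1)).im) 0 := by
      by_cases h0 : p.1 = 0
      · -- Over the discriminant `χ` is locally constant.
        have h6 : ∀ᶠ y in 𝓝 p.2.2, c.χl t y = 1 := by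
          have h7 := hp.2.2
          rw [coverMap_expMap hk] at h7
          exact c.eventually_χl (by simpa [eqn, expMap, h0, hl] using h7)
        have h7 : Filter.Tendsto (fun s : ℝ => p.2.2 + s • ξ.2.2) (𝓝 0) (𝓝 p.2.2) := by
          simpa using (show Continuous fun s : ℝ => p.2.2 + s • ξ.2.2 by fun_prop).tendsto 0
        refine ((hasDerivAt_const 0 (0 : ℝ)).congr_of_eventuallyEq
          ((h7.eventually h6).mono fun s hs => ?_)).congr_deriv ?_
        · simp only [hs, sub_self, zero_mul]
        · rw [h0]; simp
      · have h6 := (hu.fun_inv (by simpa using h0)).mul_const ζ.1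
        have h7 := imCLM.hasFDerivAt.comp_hasDerivAt 0 h6
        refine ((hχ.const_sub 1).fun_mul h7).congr_deriv ?_
        simp [div_eq_mul_inv]
    have h6 := ((h1.add h2).add h3).add ((((hχ.fun_mul h4).fun_mul (hc p.2.1 ξ.2.1 ζ.2.1)).sub
      h5).const_mul ε)
    have h7 := (hasDerivAt_line hpb.1 ξ).clm_apply (hasDerivAt_const 0 ζ)
    have h8 := h7.unique (h6.congr_of_eventuallyEq (Filter.Eventually.of_forall fun s => ?_))
    · simp only [map_zero, add_zero, zero_smul] at h8
      rw [h8]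
      ring
    · change c.coverθ t ε k (expMap k (p + s • ξ)) (fderiv ℝ (expMap k) (p + s • ξ) ζ) = _
      rw [c.coverθ_expMap hk]; simp [div_eq_mul_inv]
  rw [key, key]
  have hw1 : w * (1 + (p.2.1.re ^ 2 + p.2.1.im ^ 2)) = 1 := by
    rw [hw, sq_norm, normSq_apply, ← sq, ← sq]
    exact inv_mul_cancel₀ (by positivity)
  generalize p.1⁻¹ ^ 2 = U
  simp only [mul_im, Complex.conj_re, conj_im, mul_re, Complex.neg_im]
  linear_combination (-2 * ε * c.χl t p.2.2 * w *
    (ξ.2.1.re * ζ.2.1.im - ξ.2.1.im * ζ.2.1.re)) * hw1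


variable (c : Choices) {t ε K : ℝ} {k : ℕ} {p ξ : Amb}

/-- On the tangent spaces of the conic bundle, the logarithmic differential of `u` and the form
`v̄ dv / (1 + |v|²)` add up to a form which is bounded where `h` is not small. -/
lemma norm_fibre_form_le {u v a b f : ℂ} {N : ℝ} (hK : 1 ≤ K * ‖u * v‖)
    (hf : ‖f‖ ≤ K * ‖u * v‖ * N) (ht : a * v + u * b = f) :
    ‖((1 + ‖v‖ ^ 2)⁻¹ : ℝ) * (conj v * b) + u⁻¹ * a‖ ≤ K * N + K * ‖a‖ := by
  have h0 : u * v ≠ 0 := fun h => by rw [h, norm_zero] at hK; linarith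
  obtain ⟨hu, hv⟩ := mul_ne_zero_iff.1 h0
  set w := (1 + ‖v‖ ^ 2)⁻¹ with hw
  have hw0 : 0 < w := by positivity
  have hw1 : w ≤ 1 := inv_le_one_of_one_le₀ (by nlinarith [sq_nonneg ‖v‖])
  have hwn : w * (1 + ‖v‖ ^ 2) = 1 := inv_mul_cancel₀ (by positivity)
  have hwC : w * (1 + v * conj v) = 1 := by
    rw [mul_conj, normSq_eq_norm_sq]; exact_mod_cast hwn
  have e1 : w * (conj v * b) + u⁻¹ * a = ((1 - w : ℝ) : ℂ) * (f / (u * v)) + (w : ℂ) * (a / u) := by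
    rw [← ht]; push_cast; field_simp; linear_combination u * b * hwC
  rw [e1]
  refine (norm_add_le _ _).trans (add_le_add ?_ ?_)
  · rw [norm_mul, norm_coe, abs_of_nonneg (by linarith), norm_div]
    have h2 : ‖f‖ / ‖u * v‖ ≤ K * N := by rw [div_le_iff₀ (norm_pos_iff.2 h0)]; linarith
    exact (mul_le_of_le_one_left (by positivity) (by linarith)).trans h2
  · rw [norm_mul, norm_coe, abs_of_pos hw0, norm_div, mul_div_assoc',
      div_le_iff₀ (norm_pos_iff.2 hu)]
    rw [norm_mul] at hK
    have h4 : w ≤ K * ‖u‖ := by nlinarith [norm_nonneg v]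
    nlinarith [norm_nonneg a]

lemma im_conj_mul_I a : (conj a * (I * a)).im = ‖a‖ ^ 2 := by rw [sq_norm, normSq_apply]; simp

lemma im_conj_mul (a z : ℂ) : ‖a‖ ^ 2 - ‖a‖ * ‖z‖ ≤ (conj a * (I * a + z)).im := by
  have h1 := (abs_le.1 (abs_im_le_norm (conj a * z))).1
  rw [norm_mul, norm_conj] at h1
  rw [mul_add, add_im, im_conj_mul_I]; linarith

/-- The value of `ω_ε` on a tangent vector `(a, b, x)` and the test vector `(i a, i b, i x + z)` is
the left hand side of `h`, with `E` the contribution of `dχ`.  It can only be nonpositive if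
`x = 0` and `a = 0`. -/
lemma nondegenerate_aux {x₁ x₂ z₁ z₂ a b : ℂ} {L E χ w : ℝ} (hL : 1 ≤ L) (hε : 0 < ε)
    (hεK : ε * (100 * K ^ 2 * L) ≤ 1) (hχ : 0 ≤ χ)
    (hz : ‖z₁‖ + ‖z₂‖ ≤ (‖x₁‖ + ‖x₂‖) / 4)
    (hE : |E| ≤ 9 / 4 * K * (‖x₁‖ + ‖x₂‖) * (K * (‖x₁‖ + ‖x₂‖) + K * ‖a‖))
    (h : L⁻¹ * ((conj x₁ * (I * x₁ + z₁)).im + (conj x₂ * (I * x₂ + z₂)).im) +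
      ‖a‖ ^ 2 + ε * (2 * χ * w ^ 2 * ‖b‖ ^ 2 + E) ≤ 0) :
    x₁ = 0 ∧ x₂ = 0 ∧ a = 0 := by
  have h1 := im_conj_mul x₁ z₁
  have h2 := im_conj_mul x₂ z₂
  set A := ‖x₁‖
  set B := ‖x₂‖
  set N := A + B with hN
  set m := ‖a‖
  have hA : 0 ≤ A := norm_nonneg _
  have hB : 0 ≤ B := norm_nonneg _
  have hmain : N ^ 2 / 4 ≤ (conj x₁ * (I * x₁ + z₁)).im + (conj x₂ * (I * x₂ + z₂)).im := by
    nlinarith [sq_nonneg (A - B), norm_nonneg z₁, norm_nonneg z₂]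
  have hL' : 0 < L⁻¹ := inv_pos.2 (by linarith)
  have hL1 := inv_le_one_of_one_le₀ hL
  have hεK' : ε * K ^ 2 ≤ L⁻¹ / 100 := by
    rw [le_div_iff₀ (by norm_num), ← one_div, le_div_iff₀ (by linarith)]; linarith
  have h3 : ε * |E| ≤ L⁻¹ * (1 / 25 * N ^ 2 + 1 / 50 * m ^ 2) := by
    calc ε * |E| ≤ ε * (9 / 4 * K * N * (K * N + K * m)) := by gcongr
      _ = ε * K ^ 2 * (9 / 4 * (N * (N + m))) := by ring
      _ ≤ L⁻¹ / 100 * (9 / 4 * (N * (N + m))) := by gcongr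
      _ ≤ L⁻¹ * (1 / 25 * N ^ 2 + 1 / 50 * m ^ 2) := by
        rw [div_mul_eq_mul_div, mul_div_assoc]; nlinarith [sq_nonneg (N - m)]
  have h4 : -(ε * |E|) ≤ ε * E := by nlinarith [neg_abs_le E]
  have h5 : 0 ≤ ε * (2 * χ * w ^ 2 * ‖b‖ ^ 2) := by positivity
  have h6 := mul_le_mul_of_nonneg_left hmain hL'.le
  have h7 : L⁻¹ * (1 / 50 * m ^ 2) ≤ 1 / 50 * m ^ 2 := mul_le_of_le_one_left (by positivity) hL1
  have h9 : 0 ≤ L⁻¹ * N ^ 2 := by positivity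
  have hm0 := pow_eq_zero_iff two_ne_zero |>.1 (le_antisymm (by linarith) (sq_nonneg m))
  have hN0 : N = 0 := by
    have := le_antisymm (by linarith [sq_nonneg m]) h9
    exact pow_eq_zero_iff two_ne_zero |>.1 ((mul_eq_zero.1 this).resolve_left hL'.ne')
  exact ⟨norm_eq_zero.1 (by linarith), norm_eq_zero.1 (by linarith), norm_eq_zero.1 hm0⟩


variable (c : Choices)

lemma contDiffAt_eqn {t : ℝ} {k : ℕ} {x : Amb} (hx : x ∈ c.X t k) :
    SmoothAt (fun x => c.eqn t (coverMap k x)) x :=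
  (contDiffAt_fst.mul contDiffAt_snd.fst).sub
    (contDiffAt_h (contDiffAt_snd.snd.fst.pow k) contDiffAt_snd.snd.snd (pow_ne_zero k hx.1) hx.2.1)

lemma fderiv_eqn {t : ℝ} {k : ℕ} (hk : 1 ≤ k) {p : Amb} (hp : expMap k p ∈ c.X t k) (ξ : Amb) :
    fderiv ℝ (fun x => c.eqn t (coverMap k x)) (expMap k p) (fderiv ℝ (expMap k) p ξ) =
      ξ.1 * p.2.1 + p.1 * ξ.2.1 - fderiv ℝ (c.hl t) p.2.2 ξ.2.2 := by
  have h1 := HasFDerivAt.comp p ((c.contDiffAt_eqn hp).differentiableAt (by simp)).hasFDerivAt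
    (((contDiff_expMap k).differentiable (by simp)) p).hasFDerivAt
  have h2 : HasFDerivAt (fun q : Amb => q.1 * q.2.1 - c.hl t q.2.2) _ p :=
    ((dU.hasFDerivAt (x := p)).mul (dV.hasFDerivAt (x := p))).sub
      (HasFDerivAt.comp (g := c.hl t) p
        (((c.contDiff_hl t).differentiable (by simp)) p.2.2).hasFDerivAt
        (hasFDerivAt_snd.comp p hasFDerivAt_snd))
  have h3 := h1.unique (h2.congr_of_eventuallyEq (Filter.Eventually.of_forall fun q => by
    simp only [Function.comp_apply, coverMap_expMap hk]
    simp [eqn, expMap, hl]))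
  rw [← ContinuousLinearMap.comp_apply, h3]; simp [dU, dV]
  ring

lemma exists_expMap {k : ℕ} (hk : 1 ≤ k) {x : Amb} (h1 : x.2.2.1 ≠ 0) (h2 : x.2.2.2 ≠ 0) :
    ∃ p, expMap k p = x ∧ Function.Surjective (fderiv ℝ (expMap k) p) := by
  have hk0 : (k : ℂ) ≠ 0 := by exact_mod_cast (by lia : k ≠ 0)
  have e1 : exp (k * Complex.log x.2.2.1 / k) = x.2.2.1 := by
    rw [mul_div_cancel_left₀ _ hk0, exp_log h1]
  refine ⟨(x.1, x.2.1, k * Complex.log x.2.2.1, Complex.log x.2.2.2), ?_, fun y =>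
    ⟨(y.1, y.2.1, k * (y.2.2.1 / x.2.2.1), y.2.2.2 / x.2.2.2), ?_⟩⟩
  · simp only [expMap, e1, exp_log h2]
  · rw [fderiv_expMap]
    simp only [exp_log h1, exp_log h2, mul_div_cancel_left₀ _ hk0,
      mul_div_cancel₀ _ h1, mul_div_cancel₀ _ h2]

lemma exists_isExactSymplectic : ∃ t₀ : ℝ, 1 < t₀ ∧ ∀ t : ℝ, t₀ ≤ t → ∃ ε₀ : ℝ, 0 < ε₀ ∧
    ∀ ε : ℝ, 0 < ε → ε < ε₀ → ∀ k : ℕ, 1 ≤ k →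
      IsExactSymplectic (fun x => c.eqn t (coverMap k x)) (c.X t k) (c.coverθ t ε k) := by
  obtain ⟨T, K, hT, hK, hest⟩ := c.exists_estimates
  have hT1 : 1 < Real.exp T := by rw [Real.one_lt_exp_iff]; linarith
  refine ⟨Real.exp T, hT1, fun t ht => ?_⟩
  have hLT := (Real.le_log_iff_exp_le (by linarith)).2 ht
  have hL : 1 ≤ log t := by linarith
  refine ⟨1 / (100 * K ^ 2 * log t), by positivity, fun ε hε hε' k hk => ?_⟩
  rw [lt_div_iff₀ (by positivity)] at hε'
  have hopen : ∀ x ∈ c.X t k, ∀ᶠ y : Amb in 𝓝 x, y.2.2.1 ≠ 0 ∧ y.2.2.2 ≠ 0 := fun x hx =>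
    (contDiffAt_snd.snd.fst (n := 0) (𝕜 := ℝ) |>.continuousAt.eventually_ne hx.1).and
      (contDiffAt_snd.snd.snd (n := 0) (𝕜 := ℝ) |>.continuousAt.eventually_ne hx.2.1)
  refine ⟨fun x hx => (hopen x hx).mono fun y hy => ⟨fun h => h.2.2, fun h => ⟨hy.1, hy.2, h⟩⟩,
    fun x hx => c.contDiffAt_eqn hx, fun x hx => ?_, fun x hx => c.contDiffAt_coverθ hx,
    fun x hx ξ' hξ' hω => ?_⟩ <;> obtain ⟨p, rfl, hsurj⟩ := exists_expMap hk hx.1 hx.2.1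
    <;> obtain ⟨hχ1, hχ2, hχ3⟩ := hest t (hT1.trans_le ht) hLT p.2.2
    <;> have hX : p.1 * p.2.1 = c.hl t p.2.2 := by
      have := hx.2.2
      rw [coverMap_expMap hk] at this
      simpa [eqn, expMap, hl, sub_eq_zero] using this
  · intro y
    suffices h : ∃ ξ : Amb, ξ.1 * p.2.1 + p.1 * ξ.2.1 - fderiv ℝ (c.hl t) p.2.2 ξ.2.2 = y by
      obtain ⟨ξ, h⟩ := h
      exact ⟨_, (c.fderiv_eqn hk hx ξ).trans h⟩
    by_cases hv : p.2.1 = 0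
    · obtain ⟨x, h⟩ :=
        (hχ3 ((c.eventually_χl (by rw [← hX, hv, mul_zero])).self_of_nhds.trans_ne one_ne_zero)).1
          (-y)
      exact ⟨(0, 0, x), by simp [h]⟩
    · exact ⟨(y / p.2.1, 0, 0), by simp [hv]⟩
  · obtain ⟨ξ, rfl⟩ := hsurj ξ'
    rw [c.fderiv_eqn hk hx, sub_eq_zero] at hξ'
    have hω' : ∀ ζ : Amb, ζ.1 * p.2.1 + p.1 * ζ.2.1 = fderiv ℝ (c.hl t) p.2.2 ζ.2.2 → _ = _ :=
      fun ζ hζ => (c.omega_coverθ (ε := ε) hk hx ξ ζ).symm.trans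
        (hω _ ((c.fderiv_eqn hk hx ζ).trans (sub_eq_zero.2 hζ)))
    set d := fderiv ℝ (c.χl t) p.2.2 with hd
    set w := (1 + ‖p.2.1‖ ^ 2)⁻¹ with hw
    have hw0 : 0 < w := by positivity
    suffices h : ξ.2.2.1 = 0 ∧ ξ.2.2.2 = 0 ∧ ξ.1 = 0 ∧ ξ.2.1 = 0 by
      rw [show ξ = 0 from Prod.ext h.2.2.1 (Prod.ext h.2.2.2 (Prod.ext h.1 h.2.1)), map_zero]
    by_cases h0 : c.χl t p.2.2 = 0
    · -- At a zero, `χ` has a minimum, and `u ≠ 0`.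
      have hd0 : d = 0 := IsLocalMin.fderiv_eq_zero (Filter.Eventually.of_forall fun y => by
        rw [h0]; exact (c.hψ.mem_Icc _).1)
      have hu : p.1 ≠ 0 := fun hu =>
        ((c.eventually_χl (by rw [← hX, hu, zero_mul])).self_of_nhds.trans_ne one_ne_zero) h0
      have h1 := hω' (I * ξ.1, (fderiv ℝ (c.hl t) p.2.2 (I • ξ.2.2) -
        I * ξ.1 * p.2.1) / p.1, I • ξ.2.2) (by field_simp; ring)
      rw [hd0, h0] at h1
      have h2 := nondegenerate_aux (x₁ := ξ.2.2.1) (x₂ := ξ.2.2.2) (z₁ := 0) (z₂ := 0) (a := ξ.1)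
        (b := 0) (E := 0) (χ := 0) (w := 0) hL hε hε'.le le_rfl
        (by simp only [norm_zero, add_zero]; positivity) (by rw [abs_zero]; positivity)
        (le_of_eq (by simp only [im_conj_mul_I ξ.1] at h1; simpa using h1))
      refine ⟨h2.1, h2.2.1, h2.2.2, ?_⟩
      rw [h2.2.2, show ξ.2.2 = 0 from Prod.ext h2.1 h2.2.1, map_zero, zero_mul, zero_add] at hξ'
      exact (mul_eq_zero.1 hξ').resolve_left hu
    · -- Test with `i ξ`, corrected by `z` in order to be tangent to the conic bundle.
      obtain ⟨z, hz, hzI⟩ := (hχ3 h0).2 ξ.2.2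
      have h1 := hω' (I * ξ.1, I * ξ.2.1, I • ξ.2.2 + z)
        (by rw [hzI, ← hξ']; ring)
      set N := ‖ξ.2.2.1‖ + ‖ξ.2.2.2‖ with hN
      set β := (w : ℂ) * (conj p.2.1 * ξ.2.1) + p.1⁻¹ * ξ.1 with hβ
      have e1 : w * (conj p.2.1 * (I * ξ.2.1)).im + (p.1⁻¹ * (I * ξ.1)).im = β.re := by
        rw [hβ]; simp; ring
      have e2 : w * (conj p.2.1 * ξ.2.1).im + (p.1⁻¹ * ξ.1).im = β.im := by
        rw [hβ, add_im, im_ofReal_mul]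
      simp only [e1, e2, im_conj_mul_I] at h1
      have hN0 : 0 ≤ N := by positivity
      have hE : |d ξ.2.2 * β.re - d (I • ξ.2.2 + z) * β.im| ≤
          9 / 4 * K * N * (K * N + K * ‖ξ.1‖) := by
        -- Where `dχ ≠ 0`, the function `h` is bounded below, and `β` is bounded.
        by_cases hdd : d = 0
        · rw [hdd]; simp; positivity
        obtain ⟨x, hx0⟩ : ∃ x, d x ≠ 0 := by by_contra! h; exact hdd (ContinuousLinearMap.ext h)
        obtain ⟨h3, h4⟩ := hχ2 x hx0
        rw [← hX] at h3 h4
        have hb := norm_fibre_form_le h3 (h4 ξ.2.2) hξ'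
        have n1 := hχ1 (I • ξ.2.2 + z)
        have n2 : ‖(I • ξ.2.2 + z).1‖ + ‖(I • ξ.2.2 + z).2‖ ≤ 5 / 4 * N := by
          have h5 := norm_add_le (I * ξ.2.2.1) z.1
          have h6 := norm_add_le (I * ξ.2.2.2) z.2
          rw [norm_mul, norm_I, one_mul] at h5 h6
          simp only [Prod.fst_add, Prod.snd_add, Prod.smul_fst, Prod.smul_snd, smul_eq_mul]
          linarith
        refine (abs_sub _ _).trans ?_
        rw [abs_mul, abs_mul]
        calc _ ≤ K * N * ‖β‖ + K * (5 / 4 * N) * ‖β‖ := by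
              gcongr
              · exact hχ1 _
              · exact abs_re_le_norm _
              · exact n1.trans (by gcongr)
              · exact abs_im_le_norm _
          _ = 9 / 4 * K * N * ‖β‖ := by ring
          _ ≤ _ := by gcongr
      have h2 := nondegenerate_aux (x₁ := ξ.2.2.1) (x₂ := ξ.2.2.2) (z₁ := z.1) (z₂ := z.2)
        (a := ξ.1) (b := ξ.2.1) (χ := c.χl t p.2.2) (w := w) hL hε hε'.le ((c.hψ.mem_Icc _).1) hz hE
        (le_of_eq (by rw [← h1]; simp; left; ring))
      refine ⟨h2.1, h2.2.1, h2.2.2, ?_⟩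
      have hx0 : ξ.2.2 = 0 := Prod.ext h2.1 h2.2.1
      have hz0 : z = 0 := by
        rw [hN, h2.1, h2.2.1] at hz
        simp only [norm_zero, add_zero, zero_div] at hz
        exact Prod.ext (norm_le_zero_iff.1 (by linarith [norm_nonneg z.2]))
          (norm_le_zero_iff.1 (by linarith [norm_nonneg z.1]))
      rw [hx0, hz0, h2.2.2] at h1
      simpa [h0, hε.ne', hw0.ne'] using h1

end Choices

namespace Param

variable (P : Param)

lemma isExactLagrangianEmbedding_j : IsExactLagrangianEmbedding
    (P.c.X P.M.t P.M.H.k) (P.c.coverθ P.M.t P.ε P.M.H.k) P.j := by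
  have hsm : ContMDiff (𝓡 3) 𝓘(ℝ, Amb) ∞ P.j := fun m =>
    P.D.contMDiffAt_comp_val (immersesAt_J (good_val m)).contDiffAt
  obtain ⟨f, hf, hfj⟩ := P.exact_j
  refine ⟨j_mem_X, hsm, isEmbedding_j, fun m => ?_, fun m => isotropic_of_exact hsm hf hfj m
    ((P.c.contDiffAt_coverθ (j_mem_X m)).differentiableAt (by simp)), f, hf, hfj⟩
  intro a b hab
  rw [(hasMFDerivAt_j m).2, (hasMFDerivAt_j m).2] at hab
  exact P.D.mfderiv_val_injective m ((immersesAt_J (good_val m)).injective hab)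

end Param

end ConicBundle

end

theorem mainTheorem11 (c : ConicBundle.Choices) :
    ∃ t₀ : ℝ, 1 < t₀ ∧ ∀ t : ℝ, t₀ ≤ t → ∃ ε₀ : ℝ, 0 < ε₀ ∧ ∀ ε : ℝ, 0 < ε → ε < ε₀ →
      ∀ k : ℕ, 1 ≤ k →
        ConicBundle.IsExactSymplectic (fun x => c.eqn t (ConicBundle.coverMap k x))
          (c.X t k) (c.coverθ t ε k) ∧
        ∀ S : ConicBundle.SurgeryProfile,
          ∃ (M : Type) (_ : TopologicalSpace M)
            (_ : ChartedSpace (EuclideanSpace ℝ (Fin 3)) M) (j : M → ConicBundle.Amb),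
            ConicBundle.IsSumS1S2 (2 * k + 1) M ∧
            ConicBundle.IsExactLagrangianEmbedding (c.X t k) (c.coverθ t ε k) j ∧
            Set.range j = c.Q t ε S k := by
  obtain ⟨t₀, ht₀, hsym⟩ := c.exists_isExactSymplectic
  refine ⟨t₀, ht₀, fun t ht => ?_⟩
  obtain ⟨ε₀, hε₀, hsym⟩ := hsym t ht
  refine ⟨ε₀, hε₀, fun ε hε hε' k hk => ⟨hsym ε hε hε' k hk, fun S => ?_⟩⟩
  obtain ⟨M, rfl, rfl, rfl⟩ := ConicBundle.exists_model S (ht₀.trans_le ht) hk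
  obtain ⟨D, hsum, hgood, H, hH⟩ := ConicBundle.Model.exists_factorization c M
  let P : ConicBundle.Param :=
    ⟨c, M, D, H, ε, hε, hgood, fun Z hZ => (hH Z ((hgood Z).2 hZ)).1,
      fun Z hZ => (hH Z ((hgood Z).2 hZ)).2.1, fun Z hZ => (hH Z ((hgood Z).2 hZ)).2.2⟩
  exact ⟨D.Mfd, inferInstance, inferInstance, P.j, hsum, P.isExactLagrangianEmbedding_j, P.range_j⟩
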